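/- Let $G$ be a Lie group with Lie algebra $\mathfrak g$, and let $\Gamma\rightrightarrows\Gamma_0$ be a Lie groupoid with nerve $\Gamma_\bullet$ ($\Gamma_n$ is the manifold of composable $n$-tuples of arrows). Let $\Omega^k(\Gamma_n)$ be the $k$-forms on $\Gamma_n$ and let $\delta=(-1)^n d+\partial$ on $\Omega^k(\Gamma_n)$, where $d$ is the exterior derivative and $\partial=\sum_i(-1)^i\epsilon_i^*:\Omega^k(\Gamma_n)\to\Omega^k(\Gamma_{n+1})$ is the alternating sum of the pull-backs along the face maps. The total complex $\bigoplus_{n,k}\Omega^k(\Gamma_n)$, graded by $n+k$, is a differential graded algebra under the cup product $\alpha\vee\beta=(-1)^{kn}p_1^*\alpha\wedge p_2^*\beta\in\Omega^{k+l}(\Gamma_{m+n})$ for $\alpha\in\Omega^k(\Gamma_m)$, $\beta\in\Omega^l(\Gamma_n)$, where $p_1,p_2$ are the projections to the first $m$ and the last $n$ arrows. Denote its cocycles by $Z^*_{dR}(\Gamma_\bullet)$ and its cohomology by $H^*_{dR}(\Gamma_\bullet)$. A principal $G$-bundle over $\Gamma\rightrightarrows\Gamma_0$ is a (right) principal $G$-bundle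 $P\to\Gamma_0$ with a (left) action of $\Gamma$ on $P\to\Gamma_0$ that commutes with the action of $G$. Let $Q\rightrightarrows P$ be its transformation groupoid, with arrows the pairs $(\gamma,p)$ from $p$ to $\gamma p$, let $\pi:Q_\bullet\to\Gamma_\bullet$ be the projection, and let $p_0,\dots,p_n:Q_n\to P$ be the vertex maps. A pseudo-connection is a connection $1$-form $\theta\in\Omega^1(P)\otimes\mathfrak g$ of the principal bundle $P\to\Gamma_0$ (no compatibility with $\Gamma$ is required). Its total pseudo-curvature is $\partial\theta+\Omega$, with $\Omega=d\theta+\tfrac12[\theta,\theta]\in\Omega^2(P)\otimes\mathfrak g$ and with $\partial\theta\in\Omega^1(Q)\otimes\mathfrak g$ the difference of the pull-backs of $\theta$ along the source and the target map. On $\Delta_n\times Q_n$, where $\Delta_n$ is the standard simplex with barycentric coordinates $t_0,\dots,t_n$, let $\tilde\theta_n=\sum_{i=0}^n t_i\,p_i^*\theta$ and $\tilde\Omega_n=d\tilde\theta_n+\tfrac12[\tilde\theta_n,\tilde\theta_n]$. 1. For every pseudo-connection $\theta$ there is a unique linear map $$z_\theta:S(\mathfrak g^*)^G\to Z^*_{dR}(\Gamma_\bullet)$$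 such that, for all $f$ and $n$, the pull-back by $\pi$ to $Q_n$ of the component of $z_\theta(f)$ on $\Gamma_n$ is $\int_{\Delta_n}f(\tilde\Omega_n)$ (the integral over the simplex of the coefficient of $dt_1\wedge\dots\wedge dt_n$). The induced map $w_\theta:S(\mathfrak g^*)^G\to H^*_{dR}(\Gamma_\bullet)$ is a homomorphism of algebras, and it does not depend on $\theta$; it is denoted by $w_P$. Moreover $z_\theta$ is completely determined by the total pseudo-curvature: for every $f\in S(\mathfrak g^*)^G$ there is a non-commutative polynomial, depending only on $G$ and $f$, not on $\Gamma$, $P$ or $\theta$, such that $\pi^*z_\theta(f)$ is the value of this polynomial, with respect to the cup product on $Q_\bullet$, at the forms $\xi_1(\partial\theta)\wedge\dots\wedge\xi_k(\partial\theta)\in\Omega^k(Q_1)$ and $\xi(\Omega)\in\Omega^2(Q_0)$, with $\xi,\xi_1,\dots,\xi_k\in\mathfrak g^*$. 2. If $\phi$ is a strict homomorphism (smooth functor) from $\Gamma'\rightrightarrows\Gamma'_0$ to $\Gamma\rightrightarrows\Gamma_0$, and $\phi^*P$ and $\phi^*\theta$ are the pull-backs of the bundle and of the pseudo-connection, then $$z_{\phi^*\theta}=\phi^*\circ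 z_\theta\qquad\text{and}\qquad w_{\phi^*P}=\phi^*\circ w_P .$$ -/

import Mathlib

open scoped Manifold ContDiff DirectSum TensorProduct

universe u

noncomputable section

namespace ChernWeil
open Diffeology

section Wedge
variable {V W : Type*} [NormedAddCommGroup V] [NormedSpace ℝ V]
  [NormedAddCommGroup W] [NormedSpace ℝ W] {k l j : ℕ}

/-- The tensor product of two multilinear forms. -/
def tens (a : V [×k]→L[ℝ] ℝ) (b : V [×l]→L[ℝ] ℝ) : V [×(k + l)]→L[ℝ] ℝ where
  toMultilinearMap := ((LinearMap.mul' ℝ ℝ).compMultilinearMap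
    (a.toMultilinearMap.domCoprod b.toMultilinearMap)).domDomCongr finSumFinEquiv
  cont := by
    have : Continuous fun v : Fin (k + l) → V ↦
        a (fun i ↦ v (Fin.castAdd l i)) * b (fun i ↦ v (Fin.natAdd k i)) :=
      Continuous.mul (a.cont.comp (by fun_prop)) (b.cont.comp (by fun_prop))
    exact this

theorem tens_apply (a : V [×k]→L[ℝ] ℝ) (b : V [×l]→L[ℝ] ℝ) (v : Fin (k + l) → V) :
    tens a b v = a (fun i ↦ v (Fin.castAdd l i)) * b (fun i ↦ v (Fin.natAdd k i)) := rfl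

/-- The exterior product of alternating forms, normalised by
`(a ∧ b)(v) = 1 / (k! l!) ∑_σ sgn σ a(v_σ(1), …, v_σ(k)) b(v_σ(k+1), …, v_σ(k+l))`. -/
def wedge (a : V [⋀^Fin k]→L[ℝ] ℝ) (b : V [⋀^Fin l]→L[ℝ] ℝ) : V [⋀^Fin (k + l)]→L[ℝ] ℝ :=
  ((k.factorial * l.factorial : ℝ)⁻¹) •
    ContinuousMultilinearMap.alternatization
      (tens a.toContinuousMultilinearMap b.toContinuousMultilinearMap)

theorem wedge_apply (a : V [⋀^Fin k]→L[ℝ] ℝ) (b : V [⋀^Fin l]→L[ℝ] ℝ) (v : Fin (k + l) → V) :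
    wedge a b v = ((k.factorial * l.factorial : ℝ)⁻¹) * ∑ σ : Equiv.Perm (Fin (k + l)),
      ((Equiv.Perm.sign σ : ℤ) : ℝ) *
      (a (fun i ↦ v (σ (Fin.castAdd l i))) * b (fun i ↦ v (σ (Fin.natAdd k i)))) := by
  simp only [wedge, ContinuousAlternatingMap.smul_apply,
    ContinuousMultilinearMap.alternatization_apply_apply, smul_eq_mul, tens_apply]
  congr 1
  refine Finset.sum_congr rfl fun σ _ ↦ ?_
  rw [Units.smul_def, zsmul_eq_mul]
  rfl

theorem wedge_add_left (a a' : V [⋀^Fin k]→L[ℝ] ℝ) (b : V [⋀^Fin l]→L[ℝ] ℝ) :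
    wedge (a + a') b = wedge a b + wedge a' b := by
  ext v
  simp only [wedge_apply, ContinuousAlternatingMap.add_apply, add_mul, mul_add,
    Finset.sum_add_distrib]

theorem wedge_add_right (a : V [⋀^Fin k]→L[ℝ] ℝ) (b b' : V [⋀^Fin l]→L[ℝ] ℝ) :
    wedge a (b + b') = wedge a b + wedge a b' := by
  ext v
  simp only [wedge_apply, ContinuousAlternatingMap.add_apply, mul_add,
    Finset.sum_add_distrib]

theorem wedge_smul_left (c : ℝ) (a : V [⋀^Fin k]→L[ℝ] ℝ) (b : V [⋀^Fin l]→L[ℝ] ℝ) :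
    wedge (c • a) b = c • wedge a b := by
  ext v
  simp only [wedge_apply, ContinuousAlternatingMap.smul_apply, smul_eq_mul, Finset.mul_sum]
  exact Finset.sum_congr rfl fun _ _ ↦ by ring

theorem wedge_smul_right (c : ℝ) (a : V [⋀^Fin k]→L[ℝ] ℝ) (b : V [⋀^Fin l]→L[ℝ] ℝ) :
    wedge a (c • b) = c • wedge a b := by
  ext v
  simp only [wedge_apply, ContinuousAlternatingMap.smul_apply, smul_eq_mul, Finset.mul_sum]
  exact Finset.sum_congr rfl fun _ _ ↦ by ring

theorem wedge_comp (a : V [⋀^Fin k]→L[ℝ] ℝ) (b : V [⋀^Fin l]→L[ℝ] ℝ) (f : W →L[ℝ] V) :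
    (wedge a b).compContinuousLinearMap f =
      wedge (a.compContinuousLinearMap f) (b.compContinuousLinearMap f) := by
  ext v
  simp only [wedge_apply, ContinuousAlternatingMap.compContinuousLinearMap_apply,
    Function.comp_def]

theorem wedge_one (a : V [⋀^Fin k]→L[ℝ] ℝ) :
    wedge a (ContinuousAlternatingMap.constOfIsEmpty ℝ V (Fin 0) 1) = a := by
  ext v
  rw [wedge_apply]
  have : ∀ σ : Equiv.Perm (Fin (k + 0)), ((Equiv.Perm.sign σ : ℤ) : ℝ) *
      (a (fun i ↦ v (σ (Fin.castAdd 0 i))) *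
        (ContinuousAlternatingMap.constOfIsEmpty ℝ V (Fin 0) (1 : ℝ))
          (fun i ↦ v (σ (Fin.natAdd k i)))) = a v := by
    intro σ
    have h := a.toAlternatingMap.map_perm v σ
    have h1 : a (fun i ↦ v (σ (Fin.castAdd 0 i))) = Equiv.Perm.sign σ • a v := h
    rw [h1, Units.smul_def, zsmul_eq_mul]
    rcases Int.units_eq_one_or (Equiv.Perm.sign σ) with h | h <;> simp [h]
  rw [Finset.sum_congr rfl fun σ _ ↦ this σ]
  simp [Fintype.card_perm]
  field_simp


theorem alternatization_apply_real (A : V [×k]→L[ℝ] ℝ) (v : Fin k → V) :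
    ContinuousMultilinearMap.alternatization A v =
      ∑ σ : Equiv.Perm (Fin k), ((Equiv.Perm.sign σ : ℤ) : ℝ) * A (v ∘ σ) := by
  rw [ContinuousMultilinearMap.alternatization_apply_apply]
  refine Finset.sum_congr rfl fun σ _ ↦ ?_
  rw [Units.smul_def, zsmul_eq_mul]

/-- Permutation of the first block. -/
def extL (l : ℕ) (τ : Equiv.Perm (Fin k)) : Equiv.Perm (Fin (k + l)) :=
  finSumFinEquiv.permCongr (Equiv.Perm.sumCongr τ 1)

/-- Permutation of the second block. -/
def extR (k : ℕ) (τ : Equiv.Perm (Fin l)) : Equiv.Perm (Fin (k + l)) :=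
  finSumFinEquiv.permCongr (Equiv.Perm.sumCongr 1 τ)

theorem sign_extL (τ : Equiv.Perm (Fin k)) :
    Equiv.Perm.sign (extL l τ) = Equiv.Perm.sign τ := by
  simp [extL, Equiv.Perm.sign_permCongr]

theorem sign_extR (τ : Equiv.Perm (Fin l)) :
    Equiv.Perm.sign (extR k τ) = Equiv.Perm.sign τ := by
  simp [extR, Equiv.Perm.sign_permCongr]

theorem sum_sign_mul_right {n : ℕ} (τ : Equiv.Perm (Fin n)) (F : Equiv.Perm (Fin n) → ℝ) :
    ∑ σ : Equiv.Perm (Fin n), ((Equiv.Perm.sign σ : ℤ) : ℝ) * F (σ * τ) =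
      ((Equiv.Perm.sign τ : ℤ) : ℝ) *
        ∑ σ : Equiv.Perm (Fin n), ((Equiv.Perm.sign σ : ℤ) : ℝ) * F σ := by
  rw [Finset.mul_sum]
  rw [← Equiv.sum_comp (Equiv.mulRight τ) fun σ ↦ ((Equiv.Perm.sign τ : ℤ) : ℝ) * _]
  refine Finset.sum_congr rfl fun σ _ ↦ ?_
  have h : ((Equiv.Perm.sign τ : ℤ) : ℝ) * ((Equiv.Perm.sign τ : ℤ) : ℝ) = 1 := by
    rcases Int.units_eq_one_or (Equiv.Perm.sign τ) with h | h <;> simp [h]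
  simp only [Equiv.coe_mulRight, Equiv.Perm.sign_mul, Units.val_mul, Int.cast_mul]
  linear_combination (-((Equiv.Perm.sign σ : ℤ) : ℝ) * F (σ * τ)) * h

theorem sign_sq_real {n : ℕ} (τ : Equiv.Perm (Fin n)) :
    ((Equiv.Perm.sign τ : ℤ) : ℝ) * ((Equiv.Perm.sign τ : ℤ) : ℝ) = 1 := by
  rcases Int.units_eq_one_or (Equiv.Perm.sign τ) with h | h <;> simp [h]

theorem alt_tens_alt_left (A : V [×k]→L[ℝ] ℝ) (B : V [×l]→L[ℝ] ℝ) :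
    ContinuousMultilinearMap.alternatization
      (tens (ContinuousMultilinearMap.alternatization A).toContinuousMultilinearMap B) =
    (k.factorial : ℝ) • ContinuousMultilinearMap.alternatization (tens A B) := by
  ext v
  rw [alternatization_apply_real, ContinuousAlternatingMap.smul_apply, alternatization_apply_real]
  have h : ∀ σ : Equiv.Perm (Fin (k + l)),
      tens (ContinuousMultilinearMap.alternatization A).toContinuousMultilinearMap B (v ∘ σ) =
      ∑ τ : Equiv.Perm (Fin k), ((Equiv.Perm.sign τ : ℤ) : ℝ) *
        tens A B (v ∘ ⇑(σ * extL l τ)) := by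
    intro σ
    have h0 := alternatization_apply_real A (fun i ↦ v (σ (Fin.castAdd l i)))
    rw [tens_apply]
    refine (congrArg (· * _) h0).trans ?_
    rw [Finset.sum_mul]
    refine Finset.sum_congr rfl fun τ _ ↦ ?_
    rw [tens_apply, mul_assoc]
    simp [extL, Function.comp_def, Equiv.permCongr_apply]
  simp only [h, Finset.mul_sum]
  rw [Finset.sum_comm]
  have h2 : ∀ τ : Equiv.Perm (Fin k), ∑ σ : Equiv.Perm (Fin (k + l)),
      ((Equiv.Perm.sign σ : ℤ) : ℝ) * (((Equiv.Perm.sign τ : ℤ) : ℝ) *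
        tens A B (v ∘ ⇑(σ * extL l τ))) = ∑ σ : Equiv.Perm (Fin (k + l)),
      ((Equiv.Perm.sign σ : ℤ) : ℝ) * tens A B (v ∘ σ) := by
    intro τ
    have := sum_sign_mul_right (extL l τ) (fun σ ↦ tens A B (v ∘ σ))
    rw [sign_extL] at this
    simp only [mul_left_comm _ ((Equiv.Perm.sign τ : ℤ) : ℝ)]
    rw [← Finset.mul_sum, this, ← mul_assoc, sign_sq_real, one_mul]
  rw [Finset.sum_congr rfl fun τ _ ↦ h2 τ]
  simp [Fintype.card_perm, Finset.mul_sum]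

theorem alt_tens_alt_right (A : V [×k]→L[ℝ] ℝ) (B : V [×l]→L[ℝ] ℝ) :
    ContinuousMultilinearMap.alternatization
      (tens A (ContinuousMultilinearMap.alternatization B).toContinuousMultilinearMap) =
    (l.factorial : ℝ) • ContinuousMultilinearMap.alternatization (tens A B) := by
  ext v
  rw [alternatization_apply_real, ContinuousAlternatingMap.smul_apply, alternatization_apply_real]
  have h : ∀ σ : Equiv.Perm (Fin (k + l)),
      tens A (ContinuousMultilinearMap.alternatization B).toContinuousMultilinearMap (v ∘ σ) =
      ∑ τ : Equiv.Perm (Fin l), ((Equiv.Perm.sign τ : ℤ) : ℝ) *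
        tens A B (v ∘ ⇑(σ * extR k τ)) := by
    intro σ
    have h0 := alternatization_apply_real B (fun i ↦ v (σ (Fin.natAdd k i)))
    rw [tens_apply]
    refine (congrArg (_ * ·) h0).trans ?_
    rw [Finset.mul_sum]
    refine Finset.sum_congr rfl fun τ _ ↦ ?_
    rw [tens_apply, mul_left_comm]
    simp [extR, Function.comp_def, Equiv.permCongr_apply]
  simp only [h, Finset.mul_sum]
  rw [Finset.sum_comm]
  have h2 : ∀ τ : Equiv.Perm (Fin l), ∑ σ : Equiv.Perm (Fin (k + l)),
      ((Equiv.Perm.sign σ : ℤ) : ℝ) * (((Equiv.Perm.sign τ : ℤ) : ℝ) *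
        tens A B (v ∘ ⇑(σ * extR k τ))) = ∑ σ : Equiv.Perm (Fin (k + l)),
      ((Equiv.Perm.sign σ : ℤ) : ℝ) * tens A B (v ∘ σ) := by
    intro τ
    have := sum_sign_mul_right (extR k τ) (fun σ ↦ tens A B (v ∘ σ))
    rw [sign_extR] at this
    simp only [mul_left_comm _ ((Equiv.Perm.sign τ : ℤ) : ℝ)]
    rw [← Finset.mul_sum, this, ← mul_assoc, sign_sq_real, one_mul]
  rw [Finset.sum_congr rfl fun τ _ ↦ h2 τ]
  simp [Fintype.card_perm, Finset.mul_sum]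

theorem tens_smul_left (c : ℝ) (a : V [×k]→L[ℝ] ℝ) (b : V [×l]→L[ℝ] ℝ) :
    tens (c • a) b = c • tens a b := by
  ext v; simp [tens_apply, mul_assoc]

theorem tens_smul_right (c : ℝ) (a : V [×k]→L[ℝ] ℝ) (b : V [×l]→L[ℝ] ℝ) :
    tens a (c • b) = c • tens a b := by
  ext v; simp [tens_apply]; ring

theorem alternatization_smul (c : ℝ) (a : V [×k]→L[ℝ] ℝ) :
    ContinuousMultilinearMap.alternatization (c • a) =
      c • ContinuousMultilinearMap.alternatization a := by
  ext v
  simp only [alternatization_apply_real, ContinuousAlternatingMap.smul_apply,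
    smul_apply, smul_eq_mul, Finset.mul_sum]
  exact Finset.sum_congr rfl fun _ _ ↦ by ring

theorem wedge_assoc (a : V [⋀^Fin k]→L[ℝ] ℝ) (b : V [⋀^Fin l]→L[ℝ] ℝ) (c : V [⋀^Fin j]→L[ℝ] ℝ)
    (v : Fin (k + l + j) → V) :
    wedge (wedge a b) c v = wedge a (wedge b c) (v ∘ Fin.cast (add_assoc k l j).symm) := by
  have h1 : wedge (wedge a b) c = ((k.factorial * l.factorial * j.factorial : ℝ)⁻¹) •
      ContinuousMultilinearMap.alternatization (tens (tens a.toContinuousMultilinearMap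
        b.toContinuousMultilinearMap) c.toContinuousMultilinearMap) := by
    have e : (wedge a b).toContinuousMultilinearMap =
      ((k.factorial * l.factorial : ℝ)⁻¹) • (ContinuousMultilinearMap.alternatization
      (tens a.toContinuousMultilinearMap b.toContinuousMultilinearMap)).toContinuousMultilinearMap
      := rfl
    rw [wedge, e, tens_smul_left, alternatization_smul, alt_tens_alt_left, smul_smul, smul_smul]
    congr 1
    have := Nat.cast_ne_zero (R := ℝ).2 (Nat.factorial_ne_zero (k + l))
    field_simp
  have h2 : wedge a (wedge b c) = ((k.factorial * l.factorial * j.factorial : ℝ)⁻¹) •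
      ContinuousMultilinearMap.alternatization (tens a.toContinuousMultilinearMap
        (tens b.toContinuousMultilinearMap c.toContinuousMultilinearMap)) := by
    have e : (wedge b c).toContinuousMultilinearMap =
      ((l.factorial * j.factorial : ℝ)⁻¹) • (ContinuousMultilinearMap.alternatization
      (tens b.toContinuousMultilinearMap c.toContinuousMultilinearMap)).toContinuousMultilinearMap
      := rfl
    rw [wedge, e, tens_smul_right, alternatization_smul, alt_tens_alt_right, smul_smul, smul_smul]
    congr 1
    have := Nat.cast_ne_zero (R := ℝ).2 (Nat.factorial_ne_zero (l + j))
    field_simp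
  rw [h1, h2, ContinuousAlternatingMap.smul_apply, ContinuousAlternatingMap.smul_apply,
    alternatization_apply_real, alternatization_apply_real]
  congr 1
  rw [← (finCongr (add_assoc k l j)).permCongr.sum_comp]
  refine Finset.sum_congr rfl fun σ _ ↦ ?_
  rw [Equiv.Perm.sign_permCongr]
  congr 1
  simp only [tens_apply, Function.comp_def, Equiv.permCongr_apply]
  rw [mul_assoc]
  refine congrArg₂ _ rfl (congrArg₂ _ ?_ ?_)
  · refine congrArg _ (funext fun i ↦ congrArg v (Fin.ext ?_))
    have : Fin.castAdd j (Fin.natAdd k i) =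
      (finCongr (add_assoc k l j)).symm (Fin.natAdd k (Fin.castAdd j i)) := Fin.ext rfl
    rw [this]; rfl
  · refine congrArg _ (funext fun i ↦ congrArg v (Fin.ext ?_))
    have : Fin.natAdd (k + l) i =
      (finCongr (add_assoc k l j)).symm (Fin.natAdd k (Fin.natAdd l i)) :=
        Fin.ext (by simp [add_assoc])
    rw [this]; rfl

theorem sign_finAddFlip (k l : ℕ) :
    Equiv.Perm.sign (finAddFlip.trans (finCongr (add_comm l k)) : Equiv.Perm (Fin (k + l))) =
      (-1) ^ (k * l) := by
  have h : (finAddFlip.trans (finCongr (add_comm l k)) : Equiv.Perm (Fin (k + l))) =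
      finRotate (k + l) ^ l := by
    ext i
    have key : ∀ n : ℕ, ((finRotate (k + l) ^ n) i : ℕ) = (i + n) % (k + l) := by
      intro n
      induction n with
      | zero => simp [Nat.mod_eq_of_lt i.2]
      | succ n ih =>
        rw [pow_succ', Equiv.Perm.mul_apply]
        have : NeZero (k + l) := i.neZero
        rw [finRotate_apply, Fin.val_add, ih]
        rcases Nat.lt_or_ge 1 (k + l) with h | h
        · rw [Fin.val_one', Nat.mod_eq_of_lt h, Nat.mod_add_mod, add_assoc]
        · have : k + l = 1 := by have := i.pos; omega
          simp [this, Nat.mod_one]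
    rw [key]
    refine Fin.addCases (fun i ↦ ?_) (fun i ↦ ?_) i
    · simp only [Equiv.trans_apply, finAddFlip_apply_castAdd, finCongr_apply, Fin.val_cast,
        Fin.val_natAdd, Fin.val_castAdd]
      rw [Nat.mod_eq_of_lt (by omega)]; omega
    · simp only [Equiv.trans_apply, finAddFlip_apply_natAdd, finCongr_apply, Fin.val_cast,
        Fin.val_natAdd, Fin.val_castAdd]
      rw [show k + (i : ℕ) + l = i + (k + l) by omega, Nat.add_mod_right,
        Nat.mod_eq_of_lt (by omega)]
  rw [h, map_pow, sign_finRotate, ← pow_mul]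
  rcases Nat.eq_zero_or_pos l with rfl | hl
  · simp
  · obtain ⟨l, rfl⟩ : ∃ m, l = m + 1 := ⟨l - 1, by omega⟩
    rw [show k + (l + 1) - 1 = k + l by omega, add_mul, pow_add]
    have : Even (l * (l + 1)) := Nat.even_mul_succ_self l
    rw [this.neg_one_pow, mul_one]

theorem wedge_comm (a : V [⋀^Fin k]→L[ℝ] ℝ) (b : V [⋀^Fin l]→L[ℝ] ℝ) (v : Fin (k + l) → V) :
    wedge a b v = (-1) ^ (k * l) * wedge b a (v ∘ Fin.cast (add_comm l k)) := by
  rw [wedge_apply, wedge_apply]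
  set ρ : Equiv.Perm (Fin (k + l)) := finAddFlip.trans (finCongr (add_comm l k)) with hρ
  rw [← (finCongr (add_comm k l)).permCongr.sum_comp]
  have h := sum_sign_mul_right ρ (fun σ ↦ (a (fun i ↦ v (σ (Fin.castAdd l i))) *
    b (fun i ↦ v (σ (Fin.natAdd k i)))))
  rw [sign_finAddFlip] at h
  have hs : (((((-1 : ℤˣ) ^ (k * l) : ℤˣ) : ℤ)) : ℝ) = (-1) ^ (k * l) := by push_cast; rfl
  rw [hs] at h
  have h' : ∑ σ : Equiv.Perm (Fin (k + l)), ((Equiv.Perm.sign σ : ℤ) : ℝ) *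
      (a (fun i ↦ v (σ (Fin.castAdd l i))) * b (fun i ↦ v (σ (Fin.natAdd k i)))) =
      (-1) ^ (k * l) * ∑ σ : Equiv.Perm (Fin (k + l)), ((Equiv.Perm.sign σ : ℤ) : ℝ) *
      (a (fun i ↦ v ((σ * ρ) (Fin.castAdd l i))) *
        b (fun i ↦ v ((σ * ρ) (Fin.natAdd k i)))) := by
    rw [h, ← mul_assoc, ← pow_add, ← two_mul, pow_mul]; simp
  rw [h']
  rw [mul_left_comm, mul_comm (k.factorial : ℝ)]
  congr 2
  refine Finset.sum_congr rfl fun σ _ ↦ ?_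
  rw [Equiv.Perm.sign_permCongr]
  congr 1
  rw [mul_comm]
  congr 2
  · funext i
    simp [hρ, Equiv.permCongr_apply]
  · funext i
    simp [hρ, Equiv.permCongr_apply]


theorem sign_mul_alternatization_comp (A : V [×k]→L[ℝ] ℝ) (τ : Equiv.Perm (Fin k))
    (v : Fin k → V) :
    ∑ σ : Equiv.Perm (Fin k), ((Equiv.Perm.sign σ : ℤ) : ℝ) * A (v ∘ ⇑(σ * τ)) =
      ((Equiv.Perm.sign τ : ℤ) : ℝ) * ContinuousMultilinearMap.alternatization A v := by
  rw [sum_sign_mul_right τ (fun σ ↦ A (v ∘ σ)), alternatization_apply_real]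

theorem alternatization_coe (a : V [⋀^Fin k]→L[ℝ] ℝ) (v : Fin k → V) :
    ContinuousMultilinearMap.alternatization a.toContinuousMultilinearMap v =
      k.factorial * a v := by
  rw [alternatization_apply_real]
  have : ∀ σ : Equiv.Perm (Fin k), ((Equiv.Perm.sign σ : ℤ) : ℝ) *
      a.toContinuousMultilinearMap (v ∘ σ) = a v := by
    intro σ
    have h1 : a.toContinuousMultilinearMap (v ∘ σ) = Equiv.Perm.sign σ • a v :=
      a.toAlternatingMap.map_perm v σ
    rw [h1, Units.smul_def, zsmul_eq_mul, ← mul_assoc, sign_sq_real, one_mul]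
  rw [Finset.sum_congr rfl fun σ _ ↦ this σ]
  simp [Fintype.card_perm]

theorem alternatizeUncurryFin_smulRight (ξ : V →L[ℝ] ℝ) (a : V [⋀^Fin k]→L[ℝ] ℝ) :
    ContinuousAlternatingMap.alternatizeUncurryFin (ξ.smulRight a) =
      (-1 : ℝ) ^ k • wedge a (ContinuousAlternatingMap.ofSubsingleton ℝ V ℝ (0 : Fin 1) ξ) := by
  ext v
  set L := ContinuousAlternatingMap.alternatizeUncurryFin (ξ.smulRight a)
  set T := tens a.toContinuousMultilinearMap
    (ContinuousAlternatingMap.ofSubsingleton ℝ V ℝ (0 : Fin 1) ξ).toContinuousMultilinearMap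
  have hT : ∀ w : Fin (k + 1) → V, T w = a (fun i ↦ w i.castSucc) * ξ (w (Fin.last k)) := by
    intro w; rfl
  have hL : ∀ w, L w = ∑ i : Fin (k + 1), (-1 : ℝ) ^ (i : ℕ) * (T (w ∘ ⇑((i.cycleRange⁻¹ :
      Equiv.Perm (Fin (k + 1))) * finRotate (k + 1)))) := by
    intro w
    rw [ContinuousAlternatingMap.alternatizeUncurryFin_apply]
    refine Finset.sum_congr rfl fun i _ ↦ ?_
    rw [hT]
    have e1 : ∀ s : Fin k, (i.cycleRange⁻¹ * finRotate (k + 1) : Equiv.Perm (Fin (k + 1)))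
        s.castSucc = i.succAbove s := by
      intro s
      rw [Equiv.Perm.mul_apply, finRotate_apply, Fin.coeSucc_eq_succ]
      exact Fin.cycleRange_symm_succ i s
    have e2 : (i.cycleRange⁻¹ * finRotate (k + 1) : Equiv.Perm (Fin (k + 1)))
        (Fin.last k) = i := by
      rw [Equiv.Perm.mul_apply, finRotate_last]
      exact Fin.cycleRange_symm_zero i
    simp only [Function.comp_def, e1, e2]
    simp only [ContinuousLinearMap.smulRight_apply, ContinuousAlternatingMap.smul_apply,
      smul_eq_mul, zsmul_eq_mul, Int.cast_pow, Int.cast_neg, Int.cast_one]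
    rw [mul_comm (ξ _)]
    rfl
  have h1 := alternatization_coe L v
  rw [alternatization_apply_real] at h1
  have h2 : ∀ σ : Equiv.Perm (Fin (k + 1)), L.toContinuousMultilinearMap (v ∘ σ) =
      ∑ i : Fin (k + 1), (-1 : ℝ) ^ (i : ℕ) * (T (v ∘ ⇑(σ * (i.cycleRange⁻¹ * finRotate (k + 1)))))
      := fun σ ↦ hL (v ∘ σ)
  simp only [h2, Finset.mul_sum] at h1
  rw [Finset.sum_comm] at h1
  simp only [mul_left_comm _ ((-1 : ℝ) ^ _)] at h1
  simp only [← Finset.mul_sum, sign_mul_alternatization_comp] at h1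
  have h3 : ∀ i : Fin (k + 1), (-1 : ℝ) ^ (i : ℕ) *
      (((Equiv.Perm.sign (i.cycleRange⁻¹ * finRotate (k + 1)) : ℤ) : ℝ) *
      ContinuousMultilinearMap.alternatization T v) =
      (-1) ^ k * ContinuousMultilinearMap.alternatization T v := by
    intro i
    simp only [Equiv.Perm.sign_mul, Equiv.Perm.sign_inv, Fin.sign_cycleRange, sign_finRotate]
    push_cast
    rw [← mul_assoc, ← mul_assoc, ← mul_pow]
    simp
  rw [Finset.sum_congr rfl fun i _ ↦ h3 i] at h1
  have hw : wedge a (ContinuousAlternatingMap.ofSubsingleton ℝ V ℝ (0 : Fin 1) ξ) v =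
      (k.factorial : ℝ)⁻¹ * ContinuousMultilinearMap.alternatization T v := by
    simp [wedge, T]
  rw [ContinuousAlternatingMap.smul_apply, hw]
  simp only [Finset.sum_const, Finset.card_univ, Fintype.card_fin, nsmul_eq_mul,
    Nat.factorial_succ, smul_eq_mul] at h1 ⊢
  have := Nat.cast_ne_zero (R := ℝ).2 (Nat.factorial_ne_zero k)
  have h5 : ((k + 1 : ℕ) : ℝ) ≠ 0 := Nat.cast_ne_zero.2 (by omega)
  field_simp
  push_cast at h1 h5
  apply mul_left_cancel₀ h5
  linear_combination -h1


theorem neg_one_pow_sq (n : ℕ) : (-1 : ℝ) ^ n * (-1) ^ n = 1 := by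
  rw [← mul_pow]; simp

theorem auf_add (f g : V →L[ℝ] V [⋀^Fin k]→L[ℝ] ℝ) :
    ContinuousAlternatingMap.alternatizeUncurryFin (f + g) =
    ContinuousAlternatingMap.alternatizeUncurryFin f +
    ContinuousAlternatingMap.alternatizeUncurryFin g :=
  ContinuousAlternatingMap.alternatizeUncurryFin_add f g

/-- The exterior product as a bilinear map. -/
def wedgeₗ (V : Type*) [NormedAddCommGroup V] [NormedSpace ℝ V] (k l : ℕ) :
    (V [⋀^Fin k]→L[ℝ] ℝ) →ₗ[ℝ] (V [⋀^Fin l]→L[ℝ] ℝ) →ₗ[ℝ] V [⋀^Fin (k + l)]→L[ℝ] ℝ :=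
  LinearMap.mk₂ ℝ wedge wedge_add_left wedge_smul_left wedge_add_right wedge_smul_right

theorem norm_wedge_le (a : V [⋀^Fin k]→L[ℝ] ℝ) (b : V [⋀^Fin l]→L[ℝ] ℝ) :
    ‖wedge a b‖ ≤ ((k.factorial * l.factorial : ℝ)⁻¹ * (k + l).factorial) * ‖a‖ * ‖b‖ := by
  refine ContinuousAlternatingMap.opNorm_le_bound _ (by positivity) fun v ↦ ?_
  rw [wedge_apply, norm_mul, Real.norm_of_nonneg (by positivity), mul_assoc, mul_assoc, mul_assoc]
  refine mul_le_mul_of_nonneg_left ?_ (by positivity)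
  refine (norm_sum_le_of_le (f := _) Finset.univ (n := fun _ ↦ ‖a‖ * ‖b‖ * ∏ i, ‖v i‖)
    fun σ _ ↦ ?_).trans ?_
  · have hs : ‖((Equiv.Perm.sign σ : ℤ) : ℝ)‖ = 1 := by
      rcases Int.units_eq_one_or (Equiv.Perm.sign σ) with h | h <;> simp [h]
    rw [norm_mul, hs, one_mul, norm_mul, ← Equiv.prod_comp σ (fun i ↦ ‖v i‖), Fin.prod_univ_add]
    calc _ ≤ (‖a‖ * ∏ i, ‖v (σ (Fin.castAdd l i))‖) * (‖b‖ * ∏ i, ‖v (σ (Fin.natAdd k i))‖) :=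
          mul_le_mul (a.le_opNorm _) (b.le_opNorm _) (norm_nonneg _) (by positivity)
      _ = _ := by ring
  · simp [Fintype.card_perm, mul_assoc]

/-- The exterior product as a continuous bilinear map. -/
def wedgeL (V : Type*) [NormedAddCommGroup V] [NormedSpace ℝ V] (k l : ℕ) :
    (V [⋀^Fin k]→L[ℝ] ℝ) →L[ℝ] (V [⋀^Fin l]→L[ℝ] ℝ) →L[ℝ] V [⋀^Fin (k + l)]→L[ℝ] ℝ :=
  LinearMap.mkContinuous₂ (wedgeₗ V k l) _ norm_wedge_le

theorem wedgeL_apply (a : V [⋀^Fin k]→L[ℝ] ℝ) (b : V [⋀^Fin l]→L[ℝ] ℝ) :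
    wedgeL V k l a b = wedge a b := rfl

theorem contDiff_wedge {E : Type*} [NormedAddCommGroup E] [NormedSpace ℝ E]
    {f : E → V [⋀^Fin k]→L[ℝ] ℝ} {g : E → V [⋀^Fin l]→L[ℝ] ℝ} (hf : ContDiff ℝ ∞ f)
    (hg : ContDiff ℝ ∞ g) : ContDiff ℝ ∞ fun x ↦ wedge (f x) (g x) := by
  change ContDiff ℝ ∞ fun x ↦ wedgeL V k l (f x) (g x)
  fun_prop

/-- Transport of a form along an equality of degrees. -/
def castDeg {p q : ℕ} (h : p = q) (a : V [⋀^Fin p]→L[ℝ] ℝ) : V [⋀^Fin q]→L[ℝ] ℝ := h ▸ a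

theorem castDeg_apply {p q : ℕ} (h : p = q) (a : V [⋀^Fin p]→L[ℝ] ℝ) (v : Fin q → V) :
    castDeg h a v = a (v ∘ Fin.cast h) := by subst h; rfl

theorem clm_eq_sum [FiniteDimensional ℝ V] {F : Type*} [NormedAddCommGroup F] [NormedSpace ℝ F]
    (D : V →L[ℝ] F) : D = ∑ i, (LinearMap.toContinuousLinearMap
      ((Module.finBasis ℝ V).coord i)).smulRight (D (Module.finBasis ℝ V i)) := by
  ext v
  have h := congrArg D ((Module.finBasis ℝ V).sum_repr v)
  rw [map_sum] at h
  rw [← h, sum_apply]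
  exact Finset.sum_congr rfl fun i _ ↦ by rw [map_smul]; rfl

theorem auf_wedge_left [FiniteDimensional ℝ V] (D : V →L[ℝ] V [⋀^Fin k]→L[ℝ] ℝ)
    (b : V [⋀^Fin l]→L[ℝ] ℝ) (v : Fin (k + l + 1) → V) :
    ContinuousAlternatingMap.alternatizeUncurryFin (((wedgeL V k l).flip b).comp D) v =
      wedge (ContinuousAlternatingMap.alternatizeUncurryFin D) b
        (v ∘ Fin.cast (by omega : k + 1 + l = k + l + 1)) := by
  have key : ∀ (ξ : V →L[ℝ] ℝ) (a : V [⋀^Fin k]→L[ℝ] ℝ),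
      ContinuousAlternatingMap.alternatizeUncurryFin
        (((wedgeL V k l).flip b).comp (ξ.smulRight a)) v =
      wedge (ContinuousAlternatingMap.alternatizeUncurryFin (ξ.smulRight a)) b
        (v ∘ Fin.cast (by omega : k + 1 + l = k + l + 1)) := by
    intro ξ a
    have e : ((wedgeL V k l).flip b).comp (ξ.smulRight a) = ξ.smulRight (wedge a b) := by
      ext1 w
      simp [wedgeL_apply]
    set x := ContinuousAlternatingMap.ofSubsingleton ℝ V ℝ (0 : Fin 1) ξ
    rw [e, alternatizeUncurryFin_smulRight, alternatizeUncurryFin_smulRight, wedge_smul_left,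
      ContinuousAlternatingMap.smul_apply, ContinuousAlternatingMap.smul_apply, wedge_assoc,
      wedge_assoc]
    have hbx : wedge b x = (-1 : ℝ) ^ l • castDeg (add_comm 1 l) (wedge x b) := by
      ext w
      rw [wedge_comm, ContinuousAlternatingMap.smul_apply, castDeg_apply, mul_one, smul_eq_mul]
    rw [hbx, wedge_smul_right, ContinuousAlternatingMap.smul_apply, smul_smul, pow_add, mul_assoc,
      neg_one_pow_sq, mul_one]
    congr 1
    have : ∀ {p q : ℕ} (h : p = q) (c : V [⋀^Fin p]→L[ℝ] ℝ) (w : Fin (k + q) → V),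
        wedge a (castDeg h c) w = wedge a c (w ∘ Fin.cast (by omega)) := by
      intro p q h c w; subst h; rfl
    rw [this]
    rfl
  rw [clm_eq_sum D]
  set ξ := fun i ↦ LinearMap.toContinuousLinearMap ((Module.finBasis ℝ V).coord i)
  have h1 := map_sum (ContinuousAlternatingMap.alternatizeUncurryFinCLM ℝ V ℝ)
    (fun i ↦ (ξ i).smulRight (D (Module.finBasis ℝ V i))) Finset.univ
  have h2 := map_sum (ContinuousAlternatingMap.alternatizeUncurryFinCLM ℝ V ℝ)
    (fun i ↦ ((wedgeL V k l).flip b).comp ((ξ i).smulRight (D (Module.finBasis ℝ V i)))) Finset.univ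
  simp only [ContinuousAlternatingMap.alternatizeUncurryFinCLM_apply] at h1 h2
  have h3 : ((wedgeL V k l).flip b).comp (∑ i, (ξ i).smulRight (D (Module.finBasis ℝ V i))) =
    ∑ i, ((wedgeL V k l).flip b).comp ((ξ i).smulRight (D (Module.finBasis ℝ V i))) := by
    ext1 w; simp [sum_apply]
  rw [h3, h2, h1, ← wedgeL_apply, map_sum, ContinuousAlternatingMap.sum_apply]
  have h4 : ∀ (F : Fin (Module.finrank ℝ V) → (V [⋀^Fin l]→L[ℝ] ℝ) →L[ℝ]
      V [⋀^Fin (k + 1 + l)]→L[ℝ] ℝ), (∑ i, F i) b = ∑ i, F i b := fun F ↦ by simp [sum_apply]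
  rw [h4, ContinuousAlternatingMap.sum_apply]
  exact Finset.sum_congr rfl fun i _ ↦ key _ _

theorem auf_wedge_right [FiniteDimensional ℝ V] (a : V [⋀^Fin k]→L[ℝ] ℝ)
    (D : V →L[ℝ] V [⋀^Fin l]→L[ℝ] ℝ) :
    ContinuousAlternatingMap.alternatizeUncurryFin ((wedgeL V k l a).comp D) =
      (-1 : ℝ) ^ k • wedge a (ContinuousAlternatingMap.alternatizeUncurryFin D) := by
  have key : ∀ (ξ : V →L[ℝ] ℝ) (b : V [⋀^Fin l]→L[ℝ] ℝ),
      ContinuousAlternatingMap.alternatizeUncurryFin ((wedgeL V k l a).comp (ξ.smulRight b)) =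
      (-1 : ℝ) ^ k • wedge a (ContinuousAlternatingMap.alternatizeUncurryFin (ξ.smulRight b)) := by
    intro ξ b
    have e : (wedgeL V k l a).comp (ξ.smulRight b) = ξ.smulRight (wedge a b) := by
      ext1 w
      simp [wedgeL_apply]
    ext v
    rw [e, alternatizeUncurryFin_smulRight, alternatizeUncurryFin_smulRight, wedge_smul_right,
      smul_smul, ← pow_add, ContinuousAlternatingMap.smul_apply,
      ContinuousAlternatingMap.smul_apply, wedge_assoc]
    rfl
  rw [clm_eq_sum D]
  set ξ := fun i ↦ LinearMap.toContinuousLinearMap ((Module.finBasis ℝ V).coord i)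
  have h1 := map_sum (ContinuousAlternatingMap.alternatizeUncurryFinCLM ℝ V ℝ)
    (fun i ↦ (ξ i).smulRight (D (Module.finBasis ℝ V i))) Finset.univ
  have h2 := map_sum (ContinuousAlternatingMap.alternatizeUncurryFinCLM ℝ V ℝ)
    (fun i ↦ (wedgeL V k l a).comp ((ξ i).smulRight (D (Module.finBasis ℝ V i)))) Finset.univ
  simp only [ContinuousAlternatingMap.alternatizeUncurryFinCLM_apply] at h1 h2
  have h3 : (wedgeL V k l a).comp (∑ i, (ξ i).smulRight (D (Module.finBasis ℝ V i))) =
    ∑ i, (wedgeL V k l a).comp ((ξ i).smulRight (D (Module.finBasis ℝ V i))) := by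
    ext1 w; simp [sum_apply]
  rw [h3, h2, h1, ← wedgeL_apply, map_sum, Finset.smul_sum]
  exact Finset.sum_congr rfl fun i _ ↦ key _ _

/-- The graded Leibniz rule for the exterior derivative. -/
theorem extDeriv_wedge [FiniteDimensional ℝ V] {w : V → V [⋀^Fin k]→L[ℝ] ℝ}
    {η : V → V [⋀^Fin l]→L[ℝ] ℝ} {x : V} (ha : DifferentiableAt ℝ w x)
    (hη : DifferentiableAt ℝ η x) (v : Fin (k + l + 1) → V) :
    extDeriv (fun y ↦ wedge (w y) (η y)) x v =
      wedge (extDeriv w x) (η x) (v ∘ Fin.cast (by omega : k + 1 + l = k + l + 1)) +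
      (-1 : ℝ) ^ k * wedge (w x) (extDeriv η x) v := by
  have h := (wedgeL V k l).hasFDerivAt_of_bilinear ha.hasFDerivAt hη.hasFDerivAt
  have h' : fderiv ℝ (fun y ↦ wedge (w y) (η y)) x =
      (wedgeL V k l (w x)).comp (fderiv ℝ η x) + ((wedgeL V k l).flip (η x)).comp (fderiv ℝ w x) := by
    exact HasFDerivAt.fderiv h
  rw [extDeriv, h', auf_add, ContinuousAlternatingMap.add_apply, auf_wedge_left, auf_wedge_right,
    ContinuousAlternatingMap.smul_apply, smul_eq_mul, add_comm]
  rfl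

end Wedge

/-- Euclidean `n`-space. -/
abbrev Eu (n : ℕ) := EuclideanSpace ℝ (Fin n)

section Forms
variable {X Y Z : Type*} [DiffeologicalSpace X] [DiffeologicalSpace Y] [DiffeologicalSpace Z]
  {k l j m n : ℕ}

variable (X m) in
/-- The plots of dimension `m`. -/
abbrev Plot := {p : Eu m → X // IsPlot p}

/-- Reparametrisation of a plot. -/
def Plot.reparam (p : Plot X m) (f : Eu n → Eu m) (hf : ContDiff ℝ ∞ f) : Plot X n :=
  ⟨p.1 ∘ f, isPlot_reparam p.2 hf⟩

/-- The image of a plot under a smooth map. -/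
def Plot.map (f : X → Y) (hf : DSmooth f) (p : Plot X m) : Plot Y m := ⟨f ∘ p.1, hf m p.1 p.2⟩

variable (X k) in
/-- Families of alternating forms, one for each plot and each point of its domain. -/
abbrev RawForm := ∀ (m : ℕ), Plot X m → Eu m → Eu m [⋀^Fin k]→L[ℝ] ℝ

variable (X k) in
/-- The smooth differential `k`-forms on a diffeological space: smooth forms on the domains of all
plots, compatible with smooth reparametrisations. On a manifold (with the smooth maps as plots)
these are the usual differential forms, given by all their pull-backs to Euclidean spaces. -/
def formSubmodule : Submodule ℝ (RawForm X k) where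
  carrier := {a | (∀ m p, ContDiff ℝ ∞ (a m p)) ∧
    ∀ m n (p : Plot X m) (f : Eu n → Eu m) (hf : ContDiff ℝ ∞ f) (u : Eu n),
      a n (p.reparam f hf) u = (a m p (f u)).compContinuousLinearMap (fderiv ℝ f u)}
  zero_mem' := ⟨fun _ _ ↦ contDiff_const, fun _ _ _ _ _ _ ↦ by ext; rfl⟩
  add_mem' := by
    rintro a b ⟨h1, h2⟩ ⟨h3, h4⟩
    refine ⟨fun m p ↦ (h1 m p).add (h3 m p), fun m n p f hf u ↦ ?_⟩
    simp only [Pi.add_apply]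
    rw [h2 m n p f hf, h4 m n p f hf]
    rfl
  smul_mem' := by
    rintro c a ⟨h1, h2⟩
    refine ⟨fun m p ↦ (h1 m p).const_smul c, fun m n p f hf u ↦ ?_⟩
    simp only [Pi.smul_apply]
    rw [h2 m n p f hf]
    rfl

variable (X k) in
/-- The space of differential `k`-forms on `X`. -/
def Form := ↥(formSubmodule X k)

instance : AddCommGroup (Form X k) := inferInstanceAs (AddCommGroup ↥(formSubmodule X k))
instance : Module ℝ (Form X k) := inferInstanceAs (Module ℝ ↥(formSubmodule X k))

namespace Form

/-- The pull-back of a form along a plot, at a point. -/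
def val (a : Form X k) (p : Plot X m) (u : Eu m) : Eu m [⋀^Fin k]→L[ℝ] ℝ := a.1 m p u

@[ext] theorem ext {a b : Form X k}
    (h : ∀ (m : ℕ) (p : Plot X m) u, a.val p u = b.val p u) : a = b :=
  Subtype.ext (funext fun m ↦ funext fun p ↦ funext fun u ↦ h m p u)

theorem contDiff_val (a : Form X k) (p : Plot X m) : ContDiff ℝ ∞ (a.val p) := a.2.1 m p

theorem val_reparam (a : Form X k) (p : Plot X m) {f : Eu n → Eu m}
    (hf : ContDiff ℝ ∞ f) (u : Eu n) : a.val (p.reparam f hf) u =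
      (a.val p (f u)).compContinuousLinearMap (fderiv ℝ f u) := a.2.2 m n p f hf u

theorem add_val (a b : Form X k) (p : Plot X m) (u) :
    (a + b).val p u = a.val p u + b.val p u := rfl
theorem smul_val (c : ℝ) (a : Form X k) (p : Plot X m) (u) : (c • a).val p u = c • a.val p u := rfl

/-- Evaluation of a form along a plot at a point and at tangent vectors. -/
def eval (p : Plot X m) (u : Eu m) (v : Fin k → Eu m) : Form X k →ₗ[ℝ] ℝ where
  toFun a := a.val p u v
  map_add' _ _ := rfl
  map_smul' _ _ := rfl

/-- Pull-back of forms along a smooth map. -/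
def pullback (f : X → Y) (hf : DSmooth f) : Form Y k →ₗ[ℝ] Form X k where
  toFun a := ⟨fun _ p ↦ a.val (p.map f hf), fun _ p ↦ a.contDiff_val (p.map f hf),
    fun _ _ p _ hg u ↦ a.val_reparam (p.map f hf) hg u⟩
  map_add' _ _ := rfl
  map_smul' _ _ := rfl

theorem pullback_congr {f g : X → Y} (h : f = g) (hf : DSmooth f) (hg : DSmooth g) (a : Form Y k) :
    pullback f hf a = pullback g hg a := by subst h; rfl

theorem pullback_pullback {f : X → Y} {g : Y → Z} (hf : DSmooth f) (hg : DSmooth g)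
    (a : Form Z k) : pullback f hf (pullback g hg a) = pullback (g ∘ f) (hg.comp hf) a := rfl

/-- The exterior derivative. -/
def d : Form X k →ₗ[ℝ] Form X (k + 1) where
  toFun a := ⟨fun _ p ↦ extDeriv (a.val p), fun m p ↦ by
      have h := (a.contDiff_val p).fderiv_right (m := ∞) le_rfl
      exact (ContinuousAlternatingMap.alternatizeUncurryFinCLM ℝ (Eu m) ℝ).contDiff.comp h, by
      intro m n p f hf u
      have h : a.val (p.reparam f hf) = fun u ↦
        (a.val p (f u)).compContinuousLinearMap (fderiv ℝ f u) :=
          funext fun u ↦ a.val_reparam p hf u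
      beta_reduce
      rw [h]
      exact extDeriv_pullback (r := ∞) ((a.contDiff_val p).differentiable (by simp) _)
        hf.contDiffAt (by simpa using ENat.LEInfty.out)⟩
  map_add' a b := by
    refine Form.ext fun m p u ↦ ?_
    exact extDeriv_fun_add ((a.contDiff_val p).differentiable (by simp) _)
      ((b.contDiff_val p).differentiable (by simp) _)
  map_smul' c a := by
    refine Form.ext fun m p u ↦ ?_
    exact extDeriv_fun_smul c _

theorem d_pullback (f : X → Y) (hf : DSmooth f) (a : Form Y k) :
    d (pullback f hf a) = pullback f hf (d a) := rfl

/-- The exterior product of forms. -/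
def wedge (a : Form X k) (b : Form X l) : Form X (k + l) :=
  ⟨fun _ p u ↦ ChernWeil.wedge (a.val p u) (b.val p u),
    fun m p ↦ contDiff_wedge (a.contDiff_val p) (b.contDiff_val p),
    fun _ _ p _ hf u ↦ by
      beta_reduce
      rw [a.val_reparam p hf, b.val_reparam p hf]
      exact (wedge_comp _ _ _).symm⟩

theorem wedge_val (a : Form X k) (b : Form X l) (p : Plot X m) (u) :
    (wedge a b).val p u = ChernWeil.wedge (a.val p u) (b.val p u) := rfl

theorem wedge_pullback (f : X → Y) (hf : DSmooth f) (a : Form Y k) (b : Form Y l) :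
    pullback f hf (wedge a b) = wedge (pullback f hf a) (pullback f hf b) := rfl

variable (X k l) in
/-- The exterior product as a bilinear map. -/
def wedgeₗ : Form X k →ₗ[ℝ] Form X l →ₗ[ℝ] Form X (k + l) :=
  LinearMap.mk₂ ℝ wedge (fun _ _ _ ↦ Form.ext fun _ _ _ ↦ wedge_add_left _ _ _)
    (fun _ _ _ ↦ Form.ext fun _ _ _ ↦ wedge_smul_left _ _ _)
    (fun _ _ _ ↦ Form.ext fun _ _ _ ↦ wedge_add_right _ _ _)
    (fun _ _ _ ↦ Form.ext fun _ _ _ ↦ wedge_smul_right _ _ _)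

/-- A smooth function as a `0`-form. -/
def ofFun (f : X → ℝ) (hf : ∀ m (p : Plot X m), ContDiff ℝ ∞ (f ∘ p.1)) : Form X 0 :=
  ⟨fun _ p u ↦ ContinuousAlternatingMap.constOfIsEmpty ℝ _ (Fin 0) (f (p.1 u)),
    fun m p ↦ (ContinuousAlternatingMap.constOfIsEmptyLIE ℝ (Eu m) ℝ (Fin 0)).contDiff.comp
      (hf m p),
    fun _ _ _ _ _ _ ↦ by ext; rfl⟩

variable (X) in
/-- The constant functions. -/
def const : ℝ →ₗ[ℝ] Form X 0 where
  toFun c := ofFun (fun _ ↦ c) fun _ _ ↦ contDiff_const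
  map_add' _ _ := by ext; rfl
  map_smul' _ _ := by ext; rfl

theorem d_const (c : ℝ) : d (const X c) = 0 := by
  refine Form.ext fun m p u ↦ ?_
  refine (extDeriv_constOfIsEmpty _ _).trans ?_
  ext v
  simp [ContinuousAlternatingMap.ofSubsingleton]
  rfl

theorem pullback_const (f : X → Y) (hf : DSmooth f) (c : ℝ) :
    pullback f hf (const Y c) = const X c := rfl

/-- Transport along an equality of degrees. -/
def cast {k l : ℕ} (h : k = l) (a : Form X k) : Form X l := h ▸ a

theorem cast_val_apply {k l : ℕ} (h : k = l) (a : Form X k) (p : Plot X m) (u v) :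
    (a.cast h).val p u v = a.val p u (v ∘ Fin.cast h) := by subst h; rfl

theorem wedge_assoc (a : Form X k) (b : Form X l) (c : Form X j) :
    wedge (wedge a b) c = (wedge a (wedge b c)).cast (add_assoc k l j).symm := by
  ext m p u v
  rw [cast_val_apply]
  exact ChernWeil.wedge_assoc _ _ _ v

theorem wedge_comm (a : Form X k) (b : Form X l) :
    wedge a b = (-1 : ℝ) ^ (k * l) • (wedge b a).cast (add_comm l k) := by
  ext m p u v
  rw [smul_val, ContinuousAlternatingMap.smul_apply, cast_val_apply]
  exact ChernWeil.wedge_comm _ _ v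

theorem wedge_one (a : Form X k) : wedge a (const X 1) = a := by
  ext m p u v
  rw [wedge_val]
  exact congrArg (· v) (ChernWeil.wedge_one (a.val p u))

theorem one_wedge (a : Form X k) : wedge (const X 1) a = a.cast (zero_add k).symm := by
  rw [wedge_comm, wedge_one]
  simp

/-- The graded Leibniz rule. -/
theorem d_wedge (a : Form X k) (b : Form X l) :
    d (wedge a b) = (wedge (d a) b).cast (by omega) + (-1 : ℝ) ^ k • wedge a (d b) := by
  ext m p u v
  rw [add_val, ContinuousAlternatingMap.add_apply, cast_val_apply]
  exact extDeriv_wedge ((a.contDiff_val p).differentiable (by simp) _)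
    ((b.contDiff_val p).differentiable (by simp) _) v

end Form
end Forms

section Diffeologies

/-- The diffeology induced by a map: plots are the maps whose composite is a plot. -/
@[reducible]
def inducedDiffeology {X Y : Type*} [DiffeologicalSpace Y] (f : X → Y) : DiffeologicalSpace X where
  plots _ := {p | IsPlot (f ∘ p)}
  constant_plots _ := isPlot_const
  plot_reparam hp hf := isPlot_reparam hp hf
  locality hp := DiffeologicalSpace.locality hp

/-- The product diffeology. -/
instance {X Y : Type*} [DiffeologicalSpace X] [DiffeologicalSpace Y] :
    DiffeologicalSpace (X × Y) where
  plots _ := {p | IsPlot (Prod.fst ∘ p) ∧ IsPlot (Prod.snd ∘ p)}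
  constant_plots _ := ⟨isPlot_const, isPlot_const⟩
  plot_reparam hp hf := ⟨isPlot_reparam hp.1 hf, isPlot_reparam hp.2 hf⟩
  locality hp := by
    refine ⟨DiffeologicalSpace.locality fun x ↦ ?_, DiffeologicalSpace.locality fun x ↦ ?_⟩
    · obtain ⟨u, hu, hx, h⟩ := hp x
      exact ⟨u, hu, hx, fun hf hf' ↦ (h hf hf').1⟩
    · obtain ⟨u, hu, hx, h⟩ := hp x
      exact ⟨u, hu, hx, fun hf hf' ↦ (h hf hf').2⟩

/-- The product diffeology. -/
instance {ι : Type*} {X : ι → Type*} [∀ i, DiffeologicalSpace (X i)] :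
    DiffeologicalSpace (∀ i, X i) where
  plots _ := {p | ∀ i, IsPlot fun u ↦ p u i}
  constant_plots _ := fun _ ↦ isPlot_const
  plot_reparam hp hf := fun i ↦ isPlot_reparam (hp i) hf
  locality hp := fun i ↦ DiffeologicalSpace.locality fun x ↦ by
    obtain ⟨u, hu, hx, h⟩ := hp x
    exact ⟨u, hu, hx, fun hf hf' ↦ h hf hf' i⟩

/-- The subset diffeology. -/
instance {X : Type*} [DiffeologicalSpace X] {s : X → Prop} :
    DiffeologicalSpace {x // s x} := inducedDiffeology Subtype.val

/-- The plots of a manifold are the smooth maps from Euclidean spaces. -/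
@[reducible]
def manifoldDiffeology (N : ℕ) (M : Type*) [TopologicalSpace M] [ChartedSpace (Eu N) M] :
    DiffeologicalSpace M :=
  DiffeologicalSpace.ofCorePlotsOn {
    isPlotOn := fun {n} {u} _ p ↦ ContMDiffOn (𝓡 n) (𝓡 N) ∞ p u
    isPlotOn_congr := fun _ _ _ h ↦ ⟨fun h' ↦ h'.congr fun x hx ↦ (h hx).symm,
      fun h' ↦ h'.congr h⟩
    isPlot := fun {n} p ↦ ContMDiff (𝓡 n) (𝓡 N) ∞ p
    isPlotOn_univ := contMDiffOn_univ
    isPlot_const := fun _ ↦ contMDiff_const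
    isPlotOn_reparam := fun _ _ _ h hp hf ↦ hp.comp hf.contMDiffOn h
    locality := fun _ p hp x hx ↦ by
      obtain ⟨v, hv, hxv, h⟩ := hp x hx
      exact ((h x hxv).contMDiffAt (hv.mem_nhds hxv)).contMDiffWithinAt }

theorem isPlot_manifold {N n : ℕ} {M : Type*} [TopologicalSpace M] [ChartedSpace (Eu N) M]
    {p : Eu n → M} : @IsPlot M (manifoldDiffeology N M) n p ↔ ContMDiff (𝓡 n) (𝓡 N) ∞ p := Iff.rfl

end Diffeologies

section FormAlgebra
variable {X Y : Type*} [DiffeologicalSpace X] [DiffeologicalSpace Y]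

theorem Form.mk_cast {k l : ℕ} (h : k = l) (a : Form X k) :
    GradedMonoid.mk (A := Form X) l (a.cast h) = GradedMonoid.mk k a := by subst h; rfl

instance : GradedMonoid.GMul (Form X) where
  mul a b := a.wedge b

instance : GradedMonoid.GOne (Form X) where
  one := Form.const X 1

/-- The graded algebra of differential forms, with the exterior product. -/
instance : DirectSum.GRing (Form X) where
  mul_zero a := (Form.wedgeₗ X _ _ a).map_zero
  zero_mul b := (Form.wedgeₗ X _ _).map_zero₂ b
  mul_add a b c := (Form.wedgeₗ X _ _ a).map_add b c
  add_mul a b c := (Form.wedgeₗ X _ _).map_add₂ a b c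
  one_mul := fun ⟨k, a⟩ ↦ (congrArg (GradedMonoid.mk (A := Form X) (0 + k)) a.one_wedge).trans
    (Form.mk_cast _ a)
  mul_one := fun ⟨k, a⟩ ↦ congrArg (GradedMonoid.mk (A := Form X) k) a.wedge_one
  mul_assoc := fun ⟨k, a⟩ ⟨l, b⟩ ⟨j, c⟩ ↦
    (congrArg (GradedMonoid.mk (A := Form X) (k + l + j)) (Form.wedge_assoc a b c)).trans
      (Form.mk_cast _ _)
  natCast n := Form.const X n
  natCast_zero := by simp
  natCast_succ n := by rw [Nat.cast_succ, map_add]; rfl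
  intCast n := Form.const X n
  intCast_ofNat n := by simp
  intCast_negSucc_ofNat n := by simp

theorem Form.const_wedge {k : ℕ} (c : ℝ) (a : Form X k) :
    (Form.const X c).wedge a = (c • a).cast (zero_add k).symm := by
  have : Form.const X c = c • Form.const X 1 := by rw [← map_smul]; simp
  rw [this, ← (show c • a.cast (zero_add k).symm = (c • a).cast (zero_add k).symm by
    refine Form.ext fun m p u ↦ ?_
    ext v
    rw [Form.cast_val_apply, Form.smul_val, ContinuousAlternatingMap.smul_apply,
      Form.cast_val_apply]
    rfl), ← Form.one_wedge]
  exact (Form.wedgeₗ X 0 k).map_smul₂ c _ a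

theorem Form.wedge_const {k : ℕ} (c : ℝ) (a : Form X k) :
    a.wedge (Form.const X c) = c • a := by
  have : Form.const X c = c • Form.const X 1 := by rw [← map_smul]; simp
  rw [this]
  exact ((Form.wedgeₗ X k 0 a).map_smul c _).trans (congrArg _ a.wedge_one)

instance : DirectSum.GAlgebra ℝ (Form X) where
  toFun := (Form.const X).toAddMonoidHom
  map_one := rfl
  map_mul r s := congrArg (GradedMonoid.mk (A := Form X) 0) <| by
    refine Eq.trans ?_ (Form.wedge_const s (Form.const X r)).symm
    rw [← map_smul, smul_eq_mul, mul_comm]; rfl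
  commutes := fun r ⟨k, a⟩ ↦
    ((congrArg (GradedMonoid.mk (A := Form X) (0 + k)) (Form.const_wedge r a)).trans
    (Form.mk_cast _ _)).trans
      (congrArg (GradedMonoid.mk (A := Form X) k) (Form.wedge_const r a)).symm
  smul_def := fun r ⟨k, a⟩ ↦
    ((congrArg (GradedMonoid.mk (A := Form X) (0 + k)) (Form.const_wedge r a)).trans
    (Form.mk_cast _ _)).symm

variable (X) in
/-- The algebra of all differential forms. -/
abbrev Forms := ⨁ k, Form X k

theorem Form.commute_two (a b : Form X 2) : Commute
    (DirectSum.of (Form X) 2 a) (DirectSum.of (Form X) 2 b) := by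
  rw [Commute, SemiconjBy, DirectSum.of_mul_of, DirectSum.of_mul_of]
  refine DFinsupp.single_eq_of_sigma_eq (congrArg (GradedMonoid.mk (A := Form X) 4) ?_)
  refine (Form.wedge_comm a b).trans ?_
  norm_num
  rfl

end FormAlgebra

/-- The algebraic structure of a groupoid with objects `Ob` and arrows `Ar`; the product `a * b`
is defined if the source of `a` is the target of `b`. -/
structure AlgGroupoid (Ob Ar : Type*) where
  src : Ar → Ob
  tgt : Ar → Ob
  unit : Ob → Ar
  inv : Ar → Ar
  mul : ∀ a b : Ar, src a = tgt b → Ar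
  src_unit : ∀ x, src (unit x) = x
  tgt_unit : ∀ x, tgt (unit x) = x
  src_inv : ∀ a, src (inv a) = tgt a
  tgt_inv : ∀ a, tgt (inv a) = src a
  src_mul : ∀ a b h, src (mul a b h) = src b
  tgt_mul : ∀ a b h, tgt (mul a b h) = tgt a
  unit_mul : ∀ a, mul (unit (tgt a)) a (src_unit _) = a
  mul_unit : ∀ a, mul a (unit (src a)) (tgt_unit _).symm = a
  mul_inv : ∀ a, mul a (inv a) (tgt_inv a).symm = unit (tgt a)
  inv_mul : ∀ a, mul (inv a) a (src_inv a) = unit (src a)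
  mul_assoc : ∀ a b c (h : src a = tgt b) (h' : src b = tgt c),
    mul (mul a b h) c ((src_mul a b h).trans h') = mul a (mul b c h') (h.trans (tgt_mul b c h').symm)

/-- A groupoid whose sets of objects and arrows are diffeological spaces and whose structure maps
are smooth. -/
structure DiffGroupoid where
  Ob : Type u
  Ar : Type u
  [diffOb : DiffeologicalSpace Ob]
  [diffAr : DiffeologicalSpace Ar]
  str : AlgGroupoid Ob Ar
  smooth_src : DSmooth str.src
  smooth_tgt : DSmooth str.tgt
  smooth_unit : DSmooth str.unit
  smooth_inv : DSmooth str.inv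
  smooth_mul : DSmooth fun x : {x : Ar × Ar // str.src x.1 = str.tgt x.2} ↦ str.mul x.1.1 x.1.2 x.2

attribute [instance] DiffGroupoid.diffOb DiffGroupoid.diffAr

section Nerve
variable (𝒢 : DiffGroupoid.{u}) {m n k l : ℕ}

/-- An `n`-simplex of the nerve: vertices `x 0, …, x n` and arrows `g i j` from `x j` to `x i`
with `g i i = 1` and `g i j * g j k = g i k`. It is the same as a string of `n` composable arrows
`γ_1, …, γ_n` with `src γ_i = tgt γ_(i+1)`, where `γ_i = g (i - 1) i`. -/
def IsSimplex (n : ℕ) (s : (Fin (n + 1) → 𝒢.Ob) × (Fin (n + 1) → Fin (n + 1) → 𝒢.Ar)) : Prop :=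
  (∀ i j, 𝒢.str.tgt (s.2 i j) = s.1 i ∧ 𝒢.str.src (s.2 i j) = s.1 j) ∧
  (∀ i, s.2 i i = 𝒢.str.unit (s.1 i)) ∧
  ∀ i j k (h : 𝒢.str.src (s.2 i j) = 𝒢.str.tgt (s.2 j k)), 𝒢.str.mul (s.2 i j) (s.2 j k) h = s.2 i k

/-- The space of `n`-simplices of the nerve of a groupoid. -/
def Nerve (n : ℕ) := {s // IsSimplex 𝒢 n s}

instance : DiffeologicalSpace (Nerve 𝒢 n) := inferInstanceAs (DiffeologicalSpace (Subtype _))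

namespace Nerve
variable {𝒢}

/-- The `i`-th vertex. -/
def vertex (i : Fin (n + 1)) (s : Nerve 𝒢 n) : 𝒢.Ob := s.1.1 i

/-- The arrow from the `j`-th to the `i`-th vertex. -/
def arrow (i j : Fin (n + 1)) (s : Nerve 𝒢 n) : 𝒢.Ar := s.1.2 i j

/-- The simplicial structure: re-indexing of the vertices. -/
def reindex (f : Fin (m + 1) → Fin (n + 1)) (s : Nerve 𝒢 n) : Nerve 𝒢 m :=
  ⟨(fun i ↦ s.1.1 (f i), fun i j ↦ s.1.2 (f i) (f j)),
    fun _ _ ↦ s.2.1 _ _, fun _ ↦ s.2.2.1 _, fun _ _ _ ↦ s.2.2.2 _ _ _⟩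

theorem isPlot_iff {p : Eu m → Nerve 𝒢 n} : IsPlot p ↔
    (∀ i, IsPlot fun u ↦ vertex i (p u)) ∧ ∀ i j, IsPlot fun u ↦ arrow i j (p u) := Iff.rfl

theorem smooth_vertex (i : Fin (n + 1)) : DSmooth (vertex (𝒢 := 𝒢) i) := fun _ _ hp ↦ hp.1 i

theorem smooth_arrow (i j : Fin (n + 1)) : DSmooth (arrow (𝒢 := 𝒢) i j) := fun _ _ hp ↦ hp.2 i j

theorem smooth_reindex (f : Fin (m + 1) → Fin (n + 1)) : DSmooth (reindex (𝒢 := 𝒢) f) :=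
  fun _ _ hp ↦ ⟨fun i ↦ hp.1 (f i), fun i j ↦ hp.2 (f i) (f j)⟩

end Nerve

/-- The increasing map that omits `i`. -/
def face (n i : ℕ) (j : Fin (n + 1)) : Fin (n + 1 + 1) := if (j : ℕ) < i then j.castSucc else j.succ

/-- The inclusion of the first `m + 1` vertices. -/
def front (m n : ℕ) (j : Fin (m + 1)) : Fin (m + n + 1) := ⟨j, by omega⟩

/-- The inclusion of the last `n + 1` vertices. -/
def back (m n : ℕ) (j : Fin (n + 1)) : Fin (m + n + 1) := ⟨m + j, by omega⟩

theorem val_face (n i : ℕ) (j : Fin (n + 1)) :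
    ((j : ℕ) < i ∧ (face n i j : ℕ) = j) ∨ (i ≤ (j : ℕ) ∧ (face n i j : ℕ) = j + 1) := by
  unfold face
  split_ifs with h
  · exact Or.inl ⟨h, rfl⟩
  · exact Or.inr ⟨not_lt.1 h, rfl⟩

theorem val_front (m n : ℕ) (j : Fin (m + 1)) : (front m n j : ℕ) = j := rfl

theorem val_back (m n : ℕ) (j : Fin (n + 1)) : (back m n j : ℕ) = m + j := rfl

/-- The cochains of bidegree `(n, k)`: the `k`-forms on the `n`-simplices. -/
def Cochain (i : ℕ × ℕ) := Form (Nerve 𝒢 i.1) i.2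

instance (i : ℕ × ℕ) : AddCommGroup (Cochain 𝒢 i) :=
  inferInstanceAs (AddCommGroup (Form (Nerve 𝒢 i.1) i.2))
instance (i : ℕ × ℕ) : Module ℝ (Cochain 𝒢 i) :=
  inferInstanceAs (Module ℝ (Form (Nerve 𝒢 i.1) i.2))

namespace Cochain
variable {𝒢}

/-- Restriction of forms along a re-indexing of vertices. -/
def res (f : Fin (m + 1) → Fin (n + 1)) : Form (Nerve 𝒢 m) k →ₗ[ℝ] Form (Nerve 𝒢 n) k :=
  Form.pullback (Nerve.reindex f) (Nerve.smooth_reindex f)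

/-- The cup product `(-1)^(k n) p₁^* a ∧ p₂^* b` of a `k`-form `a` on the `m`-simplices and
an `l`-form `b` on the `n`-simplices, where `p₁` and `p₂` are the projections to the first `m` and
the last `n` arrows. -/
def cup (a : Form (Nerve 𝒢 m) k) (b : Form (Nerve 𝒢 n) l) : Form (Nerve 𝒢 (m + n)) (k + l) :=
  (-1 : ℝ) ^ (k * n) • (res (front m n) a).wedge (res (back m n) b)

/-- The simplicial differential `∑ (-1)^i ε_i^*`. -/
def faceSum (n k : ℕ) : Form (Nerve 𝒢 n) k →ₗ[ℝ] Form (Nerve 𝒢 (n + 1)) k :=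
  ∑ i ∈ Finset.range (n + 2), (-1 : ℝ) ^ i • res (face n i)

theorem mk_eq {m m' k k' : ℕ} (hm : m = m') (hk : k = k') {a : Form (Nerve 𝒢 m) k}
    {b : Form (Nerve 𝒢 m') k'}
    (h : b = res (fun i ↦ ⟨i, by omega⟩) (a.cast hk)) :
    GradedMonoid.mk (A := Cochain 𝒢) (m, k) a = GradedMonoid.mk (A := Cochain 𝒢) (m', k') b := by
  subst hm; subst hk; subst h; rfl

instance : GradedMonoid.GMul (Cochain 𝒢) where
  mul a b := cup a b

instance : GradedMonoid.GOne (Cochain 𝒢) where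
  one := Form.const _ 1

theorem cup_add {m n k l : ℕ} (a : Form (Nerve 𝒢 m) k) (b c : Form (Nerve 𝒢 n) l) :
    cup a (b + c) = cup a b + cup a c := by
  rw [cup, cup, cup, map_add, ← smul_add]
  exact congrArg _ ((Form.wedgeₗ _ _ _ _).map_add _ _)

theorem add_cup {m n k l : ℕ} (a b : Form (Nerve 𝒢 m) k) (c : Form (Nerve 𝒢 n) l) :
    cup (a + b) c = cup a c + cup b c := by
  rw [cup, cup, cup, map_add, ← smul_add]
  exact congrArg _ ((Form.wedgeₗ _ _ _).map_add₂ _ _ _)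

theorem cup_zero {m n k l : ℕ} (a : Form (Nerve 𝒢 m) k) :
    cup a (0 : Form (Nerve 𝒢 n) l) = 0 := by
  simpa using cup_add a 0 (0 : Form (Nerve 𝒢 n) l)

theorem zero_cup {m n k l : ℕ} (a : Form (Nerve 𝒢 m) k) :
    cup (0 : Form (Nerve 𝒢 n) l) a = 0 := by
  simpa using add_cup 0 (0 : Form (Nerve 𝒢 n) l) a

theorem smul_cup {m n k l : ℕ} (r : ℝ) (a : Form (Nerve 𝒢 m) k) (b : Form (Nerve 𝒢 n) l) :
    cup (r • a) b = r • cup a b := by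
  rw [cup, cup, map_smul, smul_comm]
  exact congrArg _ ((Form.wedgeₗ _ _ _).map_smul₂ _ _ _)

theorem cup_smul {m n k l : ℕ} (r : ℝ) (a : Form (Nerve 𝒢 m) k) (b : Form (Nerve 𝒢 n) l) :
    cup a (r • b) = r • cup a b := by
  rw [cup, cup, map_smul, smul_comm]
  exact congrArg _ ((Form.wedgeₗ _ _ _ _).map_smul _ _)

theorem res_wedge (f : Fin (m + 1) → Fin (n + 1)) (a : Form (Nerve 𝒢 m) k)
    (b : Form (Nerve 𝒢 m) l) : res f (a.wedge b) = (res f a).wedge (res f b) := rfl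

theorem res_res {j : ℕ} (f : Fin (m + 1) → Fin (n + 1)) (g : Fin (n + 1) → Fin (j + 1))
    (a : Form (Nerve 𝒢 m) k) : res g (res f a) = res (g ∘ f) a := rfl

theorem res_congr {f g : Fin (m + 1) → Fin (n + 1)} (h : ∀ i, (f i : ℕ) = g i)
    (a : Form (Nerve 𝒢 m) k) : res f a = res g a := by
  rw [show f = g from funext fun i ↦ Fin.ext (h i)]

theorem cast_smul {X : Type*} [DiffeologicalSpace X] {k l : ℕ} (h : k = l) (c : ℝ) (a : Form X k) :
    (c • a).cast h = c • a.cast h := by subst h; rfl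

theorem res_cast (f : Fin (m + 1) → Fin (n + 1)) {k l : ℕ} (h : k = l) (a : Form (Nerve 𝒢 m) k) :
    res f (a.cast h) = (res f a).cast h := by subst h; rfl

theorem one_cup {n l : ℕ} (b : Form (Nerve 𝒢 n) l) :
    GradedMonoid.mk (A := Cochain 𝒢) ((0, 0) + (n, l)) (cup (Form.const (Nerve 𝒢 0) 1) b) =
      GradedMonoid.mk (A := Cochain 𝒢) (n, l) b := by
  refine (mk_eq (zero_add n).symm (zero_add l).symm ?_).symm
  rw [cup, zero_mul, pow_zero, one_smul]
  refine (Form.one_wedge _).trans ?_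
  rw [res_cast]
  exact congrArg _ (res_congr (fun i ↦ by simp [back]) b)

theorem cup_one {n l : ℕ} (b : Form (Nerve 𝒢 n) l) :
    GradedMonoid.mk (A := Cochain 𝒢) ((n, l) + (0, 0)) (cup b (Form.const (Nerve 𝒢 0) 1)) =
      GradedMonoid.mk (A := Cochain 𝒢) (n, l) b := by
  refine congrArg (GradedMonoid.mk (A := Cochain 𝒢) (n, l)) ?_
  rw [cup, mul_zero, pow_zero, one_smul]
  exact Form.wedge_one _

theorem wedge_smul {X : Type*} [DiffeologicalSpace X] {k l : ℕ} (c : ℝ) (a : Form X k)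
    (b : Form X l) : a.wedge (c • b) = c • a.wedge b := (Form.wedgeₗ _ _ _ a).map_smul c b

theorem smul_wedge {X : Type*} [DiffeologicalSpace X] {k l : ℕ} (c : ℝ) (a : Form X k)
    (b : Form X l) : (c • a).wedge b = c • a.wedge b := (Form.wedgeₗ _ _ _).map_smul₂ c a b

theorem cup_assoc_aux {p q r a b c : ℕ} (x : Form (Nerve 𝒢 p) a) (y : Form (Nerve 𝒢 q) b)
    (z : Form (Nerve 𝒢 r) c) : cup (cup x y) z =
      res (fun i ↦ ⟨i, by omega⟩) ((cup x (cup y z)).cast (add_assoc a b c).symm) := by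
  simp only [cup, map_smul, cast_smul, res_wedge, res_res, wedge_smul, smul_wedge, smul_smul,
    ← pow_add, res_cast]
  rw [Form.wedge_assoc]
  have e1 : a * q + (a + b) * r = b * r + a * (q + r) := by ring
  refine congrArg₂ (fun (c' : ℝ) w ↦ c' • w) (by rw [add_comm, e1]; ring) (congrArg _ ?_)
  refine congrArg₂ Form.wedge (res_congr (fun i ↦ ?_) x) (congrArg₂ Form.wedge
    (res_congr (fun i ↦ ?_) y) (res_congr (fun i ↦ ?_) z)) <;> simp [front, back, add_assoc]

theorem cup_assoc {p q r a b c : ℕ} (x : Form (Nerve 𝒢 p) a) (y : Form (Nerve 𝒢 q) b)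
    (z : Form (Nerve 𝒢 r) c) :
    GradedMonoid.mk (A := Cochain 𝒢) ((p, a) + (q, b) + (r, c)) (cup (cup x y) z) =
      GradedMonoid.mk (A := Cochain 𝒢) ((p, a) + ((q, b) + (r, c))) (cup x (cup y z)) :=
  (mk_eq (add_assoc p q r).symm (add_assoc a b c).symm (cup_assoc_aux x y z)).symm

/-- The total complex with the cup product is a graded algebra. -/
instance : DirectSum.GRing (Cochain 𝒢) where
  mul_zero a := cup_zero a
  zero_mul b := zero_cup b
  mul_add := cup_add
  add_mul := add_cup
  one_mul := fun ⟨_, a⟩ ↦ one_cup a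
  mul_one := fun ⟨_, a⟩ ↦ cup_one a
  mul_assoc := fun ⟨_, a⟩ ⟨_, b⟩ ⟨_, c⟩ ↦ cup_assoc a b c
  natCast n := Form.const _ n
  natCast_zero := by
    rw [Nat.cast_zero, map_zero]; rfl
  natCast_succ n := by rw [Nat.cast_succ, map_add]; rfl
  intCast n := Form.const _ n
  intCast_ofNat n := congrArg _ (Int.cast_natCast n)
  intCast_negSucc_ofNat n := by
    rw [Int.cast_negSucc, map_neg]; rfl

end Cochain
end Nerve

section Complex
variable {𝒢 : DiffGroupoid.{u}} {m n k l : ℕ}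
namespace Cochain

theorem const_cup (c : ℝ) (a : Form (Nerve 𝒢 n) k) :
    GradedMonoid.mk (A := Cochain 𝒢) ((0, 0) + (n, k)) (cup (Form.const (Nerve 𝒢 0) c) a) =
      GradedMonoid.mk (A := Cochain 𝒢) (n, k) (c • a) := by
  have h : Form.const (Nerve 𝒢 0) c = c • Form.const (Nerve 𝒢 0) 1 := by rw [← map_smul]; simp
  rw [h, smul_cup, ← cup_smul]
  exact one_cup _

theorem cup_const (c : ℝ) (a : Form (Nerve 𝒢 n) k) :
    GradedMonoid.mk (A := Cochain 𝒢) ((n, k) + (0, 0)) (cup a (Form.const (Nerve 𝒢 0) c)) =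
      GradedMonoid.mk (A := Cochain 𝒢) (n, k) (c • a) := by
  have h : Form.const (Nerve 𝒢 0) c = c • Form.const (Nerve 𝒢 0) 1 := by rw [← map_smul]; simp
  rw [h, cup_smul, ← smul_cup]
  exact cup_one _

instance : DirectSum.GAlgebra ℝ (Cochain 𝒢) where
  toFun := (Form.const (Nerve 𝒢 0)).toAddMonoidHom
  map_one := rfl
  map_mul r s := by
    refine Eq.trans ?_ (const_cup r (Form.const (Nerve 𝒢 0) s)).symm
    refine congrArg (GradedMonoid.mk (A := Cochain 𝒢) (0, 0)) ?_
    exact (Form.const (Nerve 𝒢 0)).map_smul r s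
  commutes := fun r ⟨_, a⟩ ↦ (const_cup r a).trans (cup_const r a).symm
  smul_def := fun r ⟨_, a⟩ ↦ (const_cup r a).symm

end Cochain

variable (𝒢) in
/-- The total complex of forms on the nerve of a groupoid, an algebra under the cup product. -/
abbrev Total := ⨁ i, Cochain 𝒢 i

namespace Total

/-- The inclusion of the cochains of bidegree `(n, k)`. -/
def of (n k : ℕ) : Form (Nerve 𝒢 n) k →ₗ[ℝ] Total 𝒢 := DirectSum.lof ℝ (ℕ × ℕ) (Cochain 𝒢) (n, k)

/-- The component of bidegree `(n, k)`. -/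
def comp (n k : ℕ) : Total 𝒢 →ₗ[ℝ] Form (Nerve 𝒢 n) k :=
  DirectSum.component ℝ (ℕ × ℕ) (Cochain 𝒢) (n, k)

/-- Linear maps out of the total complex, given in each bidegree. -/
def lift {E : Type*} [AddCommGroup E] [Module ℝ E] (f : ∀ n k, Form (Nerve 𝒢 n) k →ₗ[ℝ] E) :
    Total 𝒢 →ₗ[ℝ] E := DirectSum.toModule ℝ (ℕ × ℕ) E fun i ↦ f i.1 i.2

@[simp] theorem lift_of {E : Type*} [AddCommGroup E] [Module ℝ E]
    (f : ∀ n k, Form (Nerve 𝒢 n) k →ₗ[ℝ] E) (n k : ℕ) (a : Form (Nerve 𝒢 n) k) :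
    lift f (of n k a) = f n k a :=
  DirectSum.toModule_lof (M := Cochain 𝒢) ℝ (φ := fun i ↦ f i.1 i.2) (n, k) a

theorem induction {motive : Total 𝒢 → Prop} (x : Total 𝒢) (zero : motive 0)
    (of : ∀ n k a, motive (of n k a)) (add : ∀ x y, motive x → motive y → motive (x + y)) :
    motive x := DirectSum.induction_on x zero (fun i a ↦ of i.1 i.2 a) add

theorem hom_ext {E : Type*} [AddCommGroup E] [Module ℝ E] {f g : Total 𝒢 →ₗ[ℝ] E}
    (h : ∀ n k a, f (of n k a) = g (of n k a)) : f = g :=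
  DirectSum.linearMap_ext ℝ fun i ↦ LinearMap.ext fun a ↦ h i.1 i.2 a

theorem of_mul_of (a : Form (Nerve 𝒢 m) k) (b : Form (Nerve 𝒢 n) l) :
    of m k a * of n l b = of (m + n) (k + l) (Cochain.cup a b) := DirectSum.of_mul_of _ _

theorem one_def : (1 : Total 𝒢) = of 0 0 (Form.const (Nerve 𝒢 0) 1) := rfl

theorem of_eq {m m' k k' : ℕ} (hm : m = m') (hk : k = k') {a : Form (Nerve 𝒢 m) k}
    {b : Form (Nerve 𝒢 m') k'}
    (h : b = Cochain.res (fun i ↦ ⟨i, by omega⟩) (a.cast hk)) : of m k a = of m' k' b :=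
  DFinsupp.single_eq_of_sigma_eq (Cochain.mk_eq hm hk h)

/-- The total differential: `(-1)^n d + ∂` on forms on the `n`-simplices. -/
def delta : Total 𝒢 →ₗ[ℝ] Total 𝒢 :=
  lift fun n k ↦ (-1 : ℝ) ^ n • of n (k + 1) ∘ₗ Form.d + of (n + 1) k ∘ₗ Cochain.faceSum n k

theorem delta_of (a : Form (Nerve 𝒢 n) k) : delta (of n k a) =
    (-1 : ℝ) ^ n • of n (k + 1) (Form.d a) + of (n + 1) k (Cochain.faceSum n k a) := by
  simp [delta]

/-- The sign of the total degree. -/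
def sgn : Total 𝒢 →ₗ[ℝ] Total 𝒢 := lift fun n k ↦ (-1 : ℝ) ^ (n + k) • of n k

theorem sgn_of (a : Form (Nerve 𝒢 n) k) : sgn (of n k a) = (-1 : ℝ) ^ (n + k) • of n k a := by
  simp [sgn]

theorem sgn_sgn (x : Total 𝒢) : sgn (sgn x) = x := by
  induction x using induction with
  | zero => simp
  | of n k a => rw [sgn_of, map_smul, sgn_of, smul_smul, neg_one_pow_sq, one_smul]
  | add x y hx hy => rw [map_add, map_add, hx, hy]

theorem delta_sgn (x : Total 𝒢) : delta (sgn x) = -sgn (delta x) := by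
  induction x using induction with
  | zero => simp
  | of n k a =>
    rw [sgn_of, map_smul, delta_of, map_add, map_smul, sgn_of, sgn_of, smul_add, smul_smul,
      smul_smul, neg_add, ← neg_smul, ← neg_smul]
    congr 2 <;> ring
  | add x y hx hy => simp only [map_add, hx, hy, neg_add]

/-- The pairing of two forms pulled back along re-indexings. -/
def pair (N : ℕ) (f : Fin (m + 1) → Fin (N + 1)) (g : Fin (n + 1) → Fin (N + 1))
    (a : Form (Nerve 𝒢 m) k) (b : Form (Nerve 𝒢 n) l) : Total 𝒢 :=
  of N (k + l) ((Cochain.res f a).wedge (Cochain.res g b))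

theorem pair_congr {N N' : ℕ} (hN : N = N') {f : Fin (m + 1) → Fin (N + 1)}
    {f' : Fin (m + 1) → Fin (N' + 1)} {g : Fin (n + 1) → Fin (N + 1)}
    {g' : Fin (n + 1) → Fin (N' + 1)} (hf : ∀ i, (f i : ℕ) = f' i) (hg : ∀ i, (g i : ℕ) = g' i)
    (a : Form (Nerve 𝒢 m) k) (b : Form (Nerve 𝒢 n) l) : pair N f g a b = pair N' f' g' a b := by
  subst hN
  rw [pair, pair, Cochain.res_congr hf, Cochain.res_congr hg]

theorem cup_eq_pair (a : Form (Nerve 𝒢 m) k) (b : Form (Nerve 𝒢 n) l) :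
    of (m + n) (k + l) (Cochain.cup a b) =
      (-1 : ℝ) ^ (k * n) • pair (m + n) (front m n) (back m n) a b := by
  rw [Cochain.cup, map_smul]; rfl

theorem simp_mul (a : Form (Nerve 𝒢 m) k) (b : Form (Nerve 𝒢 n) l) :
    of (m + 1) k (Cochain.faceSum m k a) * of n l b = ∑ i ∈ Finset.range (m + 2),
      (-1 : ℝ) ^ (i + k * n) • pair (m + 1 + n) (front (m + 1) n ∘ face m i) (back (m + 1) n) a b := by
  have h : Cochain.faceSum m k a = ∑ i ∈ Finset.range (m + 2),
      (-1 : ℝ) ^ i • Cochain.res (face m i) a := by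
    simp [Cochain.faceSum, LinearMap.sum_apply]
  rw [h, map_sum, Finset.sum_mul]
  refine Finset.sum_congr rfl fun i _ ↦ ?_
  rw [map_smul, smul_mul_assoc, of_mul_of, cup_eq_pair, smul_smul, ← pow_add]
  rfl

theorem mul_simp (a : Form (Nerve 𝒢 m) k) (b : Form (Nerve 𝒢 n) l) :
    of m k a * of (n + 1) l (Cochain.faceSum n l b) = ∑ i ∈ Finset.range (n + 2),
      (-1 : ℝ) ^ (i + k * (n + 1)) •
        pair (m + (n + 1)) (front m (n + 1)) (back m (n + 1) ∘ face n i) a b := by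
  have h : Cochain.faceSum n l b = ∑ i ∈ Finset.range (n + 2),
      (-1 : ℝ) ^ i • Cochain.res (face n i) b := by
    simp [Cochain.faceSum, LinearMap.sum_apply]
  rw [h, map_sum, Finset.mul_sum]
  refine Finset.sum_congr rfl fun i _ ↦ ?_
  rw [map_smul, mul_smul_comm, of_mul_of, cup_eq_pair, smul_smul, ← pow_add]
  rfl

theorem simp_cup (a : Form (Nerve 𝒢 m) k) (b : Form (Nerve 𝒢 n) l) :
    of (m + n + 1) (k + l) (Cochain.faceSum (m + n) (k + l) (Cochain.cup a b)) =
      ∑ i ∈ Finset.range (m + n + 2), (-1 : ℝ) ^ (i + k * n) •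
        pair (m + n + 1) (face (m + n) i ∘ front m n) (face (m + n) i ∘ back m n) a b := by
  simp only [Cochain.faceSum, LinearMap.sum_apply, map_sum, LinearMap.smul_apply, map_smul,
    Cochain.cup, Finset.smul_sum, smul_smul]
  refine Finset.sum_congr rfl fun i _ ↦ ?_
  rw [← pow_add, add_comm (k * n)]
  rfl

theorem simp_leibniz (a : Form (Nerve 𝒢 m) k) (b : Form (Nerve 𝒢 n) l) :
    of (m + n + 1) (k + l) (Cochain.faceSum (m + n) (k + l) (Cochain.cup a b)) =
      of (m + 1) k (Cochain.faceSum m k a) * of n l b +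
        (-1 : ℝ) ^ (m + k) • (of m k a * of (n + 1) l (Cochain.faceSum n l b)) := by
  have hs := Finset.sum_range_add (fun i ↦ (-1 : ℝ) ^ (i + k * n) •
    pair (m + n + 1) (face (m + n) i ∘ front m n) (face (m + n) i ∘ back m n) a b) (m + 1) (n + 1)
  rw [show m + 1 + (n + 1) = m + n + 2 by omega] at hs
  rw [simp_cup, simp_mul, mul_simp, hs, Finset.sum_range_succ _ (m + 1), Finset.sum_range_succ' _ (n + 1),
    smul_add, Finset.smul_sum, smul_smul]
  have h1 : ∀ i ∈ Finset.range (m + 1), (-1 : ℝ) ^ (i + k * n) •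
      pair (m + n + 1) (face (m + n) i ∘ front m n) (face (m + n) i ∘ back m n) a b =
      (-1 : ℝ) ^ (i + k * n) •
        pair (m + 1 + n) (front (m + 1) n ∘ face m i) (back (m + 1) n) a b := by
    intro i hi
    rw [Finset.mem_range] at hi
    refine congrArg _ (pair_congr (by omega) (fun j ↦ ?_) (fun j ↦ ?_) a b)
    · have h1 := val_face (m + n) i (front m n j)
      have h2 := val_face m i j
      have h3 := val_front m n j
      have h4 := val_front (m + 1) n (face m i j)
      simp only [Function.comp]
      omega
    · have h1 := val_face (m + n) i (back m n j)
      have h3 := val_back m n j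
      have h4 := val_back (m + 1) n j
      simp only [Function.comp]
      omega
  have h2 : ∀ i ∈ Finset.range (n + 1), (-1 : ℝ) ^ (m + 1 + i + k * n) •
      pair (m + n + 1) (face (m + n) (m + 1 + i) ∘ front m n)
        (face (m + n) (m + 1 + i) ∘ back m n) a b =
      (-1 : ℝ) ^ (m + k) • (-1 : ℝ) ^ (i + 1 + k * (n + 1)) •
        pair (m + (n + 1)) (front m (n + 1)) (back m (n + 1) ∘ face n (i + 1)) a b := by
    intro i hi
    rw [smul_smul, ← pow_add]
    refine congrArg₂ (fun (c : ℝ) w ↦ c • w) ?_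
      (pair_congr (by omega) (fun j ↦ ?_) (fun j ↦ ?_) a b)
    · rw [show m + k + (i + 1 + k * (n + 1)) = m + 1 + i + k * n + 2 * k by ring,
        pow_add _ _ (2 * k), pow_mul]
      norm_num
    · have h1 := val_face (m + n) (m + 1 + i) (front m n j)
      have h3 := val_front m n j
      have h4 := val_front m (n + 1) j
      simp only [Function.comp]
      omega
    · have h1 := val_face (m + n) (m + 1 + i) (back m n j)
      have h2 := val_face n (i + 1) j
      have h3 := val_back m n j
      have h4 := val_back m (n + 1) (face n (i + 1) j)
      simp only [Function.comp]
      omega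
  have h3 : (-1 : ℝ) ^ (m + 1 + k * n) •
        pair (m + 1 + n) (front (m + 1) n ∘ face m (m + 1)) (back (m + 1) n) a b +
      ((-1 : ℝ) ^ (m + k) * (-1 : ℝ) ^ (0 + k * (n + 1))) •
        pair (m + (n + 1)) (front m (n + 1)) (back m (n + 1) ∘ face n 0) a b = 0 := by
    have e : pair (m + 1 + n) (front (m + 1) n ∘ face m (m + 1)) (back (m + 1) n) a b =
        pair (m + (n + 1)) (front m (n + 1)) (back m (n + 1) ∘ face n 0) a b := by
      refine pair_congr (by omega) (fun j ↦ ?_) (fun j ↦ ?_) a b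
      · have h2 := val_face m (m + 1) j
        have h3 := val_front (m + 1) n (face m (m + 1) j)
        have h4 := val_front m (n + 1) j
        simp only [Function.comp]
        omega
      · have h2 := val_face n 0 j
        have h3 := val_back (m + 1) n j
        have h4 := val_back m (n + 1) (face n 0 j)
        simp only [Function.comp]
        omega
    rw [e, ← add_smul, ← pow_add, show m + k + (0 + k * (n + 1)) = m + k * n + 2 * k by ring,
      pow_add _ _ (2 * k), pow_mul, show m + 1 + k * n = m + k * n + 1 by ring, pow_succ]
    norm_num
  rw [Finset.sum_congr rfl h1, Finset.sum_congr rfl h2]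
  have fin : ∀ A B P Q : Total 𝒢, P + Q = 0 → A + B = A + P + (B + Q) := by
    intro A B P Q h
    rw [add_add_add_comm, h, add_zero]
  exact fin _ _ _ _ h3

theorem d_leibniz (a : Form (Nerve 𝒢 m) k) (b : Form (Nerve 𝒢 n) l) :
    (-1 : ℝ) ^ (m + n) • of (m + n) (k + l + 1) (Form.d (Cochain.cup a b)) =
      (-1 : ℝ) ^ m • (of m (k + 1) (Form.d a) * of n l b) +
        (-1 : ℝ) ^ (m + k) • (-1 : ℝ) ^ n • (of m k a * of n (l + 1) (Form.d b)) := by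
  have hc : ∀ {N K K' : ℕ} (h : K = K') (x : Form (Nerve 𝒢 N) K),
      of N K' (x.cast h) = of N K x := by
    intro N K K' h x; subst h; rfl
  rw [of_mul_of, of_mul_of]
  simp only [Cochain.cup, map_smul, Form.d_wedge, map_add, smul_add, smul_smul, ← pow_add, hc]
  refine congrArg₂ (· + ·) ?_ ?_
  · refine congrArg₂ (fun (c : ℝ) w ↦ c • w) ?_ rfl
    ring
  · refine congrArg₂ (fun (c : ℝ) w ↦ c • w) ?_ rfl
    ring

theorem delta_mul (x y : Total 𝒢) : delta (x * y) = delta x * y + sgn x * delta y := by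
  induction x using induction with
  | zero => simp
  | add x x' hx hx' => simp only [add_mul, map_add, hx, hx']; abel
  | of m k a =>
    induction y using induction with
    | zero => simp
    | add y y' hy hy' => simp only [mul_add, map_add, hy, hy']; abel
    | of n l b =>
      rw [of_mul_of, delta_of, delta_of, delta_of, sgn_of, d_leibniz, simp_leibniz]
      simp only [add_mul, mul_add, smul_mul_assoc, mul_smul_comm]
      generalize (-1 : ℝ) ^ (m + k) = c1
      generalize (-1 : ℝ) ^ m = c2
      generalize (-1 : ℝ) ^ n = c3
      module

theorem delta_one : delta (1 : Total 𝒢) = 0 := by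
  rw [one_def, delta_of, Form.d_const, map_zero, smul_zero, zero_add]
  simp only [Cochain.faceSum, Finset.sum_range_succ, Finset.sum_range_zero]
  have h : ∀ i, Cochain.res (face 0 i) (Form.const (Nerve 𝒢 0) 1) = Form.const (Nerve 𝒢 1) 1 :=
    fun _ ↦ rfl
  simp [h]

end Total

variable (𝒢) in
/-- The algebra of closed elements of the total complex. -/
def Cocycle : Subalgebra ℝ (Total 𝒢) where
  carrier := {x | Total.delta x = 0}
  add_mem' {x y} hx hy := by
    change Total.delta _ = 0 at *
    rw [map_add, hx, hy, add_zero]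
  mul_mem' {x y} hx hy := by
    change Total.delta _ = 0 at *
    rw [Total.delta_mul, hx, hy, zero_mul, mul_zero, add_zero]
  algebraMap_mem' r := by
    change Total.delta _ = 0
    rw [Algebra.algebraMap_eq_smul_one, map_smul, Total.delta_one, smul_zero]

variable (𝒢) in
/-- The ideal of exact elements in the algebra of closed elements. -/
def coboundary : Ideal (Cocycle 𝒢) where
  carrier := {z | ∃ x, Total.delta x = z.1}
  add_mem' := by
    rintro _ _ ⟨x, hx⟩ ⟨y, hy⟩
    exact ⟨x + y, by rw [map_add, hx, hy]; rfl⟩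
  zero_mem' := ⟨0, map_zero _⟩
  smul_mem' := by
    rintro c _ ⟨x, hx⟩
    refine ⟨Total.sgn c.1 * x, ?_⟩
    rw [Total.delta_mul, Total.delta_sgn, show Total.delta c.1 = 0 from c.2, map_zero, neg_zero,
      zero_mul, zero_add, Total.sgn_sgn, hx]
    rfl

instance : (coboundary 𝒢).IsTwoSided where
  mul_mem_of_left := by
    rintro _ c ⟨x, hx⟩
    refine ⟨x * c.1, ?_⟩
    rw [Total.delta_mul, show Total.delta c.1 = 0 from c.2, mul_zero, add_zero, hx]
    rfl

variable (𝒢) in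
/-- The de Rham cohomology algebra of a groupoid. -/
abbrev Cohomology := Cocycle 𝒢 ⧸ coboundary 𝒢

/-- The cohomology class of a closed element. -/
abbrev cls (z : Cocycle 𝒢) : Cohomology 𝒢 := Ideal.Quotient.mk (coboundary 𝒢) z

/-- A strict homomorphism of groupoids: a smooth functor. -/
structure StrictHom (𝒢 ℋ : DiffGroupoid.{u}) where
  onOb : 𝒢.Ob → ℋ.Ob
  onAr : 𝒢.Ar → ℋ.Ar
  smooth_onOb : DSmooth onOb
  smooth_onAr : DSmooth onAr
  src_map : ∀ a, ℋ.str.src (onAr a) = onOb (𝒢.str.src a)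
  tgt_map : ∀ a, ℋ.str.tgt (onAr a) = onOb (𝒢.str.tgt a)
  unit_map : ∀ x, onAr (𝒢.str.unit x) = ℋ.str.unit (onOb x)
  mul_map : ∀ a b (h : 𝒢.str.src a = 𝒢.str.tgt b), onAr (𝒢.str.mul a b h) =
    ℋ.str.mul (onAr a) (onAr b) ((src_map a).trans ((congrArg onOb h).trans (tgt_map b).symm))

namespace StrictHom
variable {ℋ : DiffGroupoid.{u}} (φ : StrictHom 𝒢 ℋ)

/-- The induced map of nerves. -/
def nerve (n : ℕ) (s : Nerve 𝒢 n) : Nerve ℋ n :=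
  ⟨(fun i ↦ φ.onOb (s.1.1 i), fun i j ↦ φ.onAr (s.1.2 i j)), by
    obtain ⟨h1, h2, h3⟩ := s.2
    refine ⟨fun i j ↦ ⟨?_, ?_⟩, fun i ↦ ?_, fun i j k _ ↦ ?_⟩ <;> dsimp only
    · rw [φ.tgt_map, (h1 i j).1]
    · rw [φ.src_map, (h1 i j).2]
    · rw [h2, φ.unit_map]
    · rw [← h3 i j k ((h1 i j).2.trans (h1 j k).1.symm), φ.mul_map]⟩

theorem smooth_nerve (n : ℕ) : DSmooth (φ.nerve n) := fun _ _ hp ↦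
  ⟨fun i ↦ φ.smooth_onOb _ _ (hp.1 i), fun i j ↦ φ.smooth_onAr _ _ (hp.2 i j)⟩

/-- Pull-back of cochains. -/
def pull : Total ℋ →ₗ[ℝ] Total 𝒢 :=
  Total.lift fun n k ↦ Total.of n k ∘ₗ Form.pullback (φ.nerve n) (φ.smooth_nerve n)

theorem pull_of {n k : ℕ} (a : Form (Nerve ℋ n) k) : φ.pull (Total.of n k a) =
    Total.of n k (Form.pullback (φ.nerve n) (φ.smooth_nerve n) a) := by simp [pull]

theorem pull_delta (x : Total ℋ) : φ.pull (Total.delta x) = Total.delta (φ.pull x) := by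
  induction x using Total.induction with
  | zero => simp
  | add x y hx hy => simp only [map_add, hx, hy]
  | of n k a =>
    rw [Total.delta_of, pull_of, Total.delta_of, map_add, map_smul, pull_of, pull_of]
    refine congrArg₂ (· + ·) rfl (congrArg _ ?_)
    simp only [Cochain.faceSum, LinearMap.sum_apply, LinearMap.smul_apply, map_sum, map_smul]
    rfl

theorem pull_mul (x y : Total ℋ) : φ.pull (x * y) = φ.pull x * φ.pull y := by
  induction x using Total.induction with
  | zero => simp
  | add x x' hx hx' => simp only [add_mul, map_add, hx, hx']
  | of m k a =>
    induction y using Total.induction with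
    | zero => simp
    | add y y' hy hy' => simp only [mul_add, map_add, hy, hy']
    | of n l b =>
      rw [Total.of_mul_of, pull_of, pull_of, pull_of, Total.of_mul_of, Cochain.cup, map_smul]
      rfl

/-- Pull-back of cochains as an algebra homomorphism. -/
def pullAlg : Total ℋ →ₐ[ℝ] Total 𝒢 := AlgHom.ofLinearMap φ.pull (φ.pull_of _) φ.pull_mul

/-- Pull-back of closed elements. -/
def pullCocycle : Cocycle ℋ →ₐ[ℝ] Cocycle 𝒢 :=
  (φ.pullAlg.comp (Cocycle ℋ).val).codRestrict (Cocycle 𝒢) fun z ↦ by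
    change Total.delta (φ.pull z.1) = 0
    rw [← pull_delta, show Total.delta z.1 = 0 from z.2, map_zero]

/-- Pull-back in cohomology. -/
def pullCohomology : Cohomology ℋ →ₐ[ℝ] Cohomology 𝒢 :=
  Ideal.Quotient.liftₐ (coboundary ℋ) ((Ideal.Quotient.mkₐ ℝ (coboundary 𝒢)).comp φ.pullCocycle) <| by
    rintro z ⟨x, hx⟩
    refine Ideal.Quotient.eq_zero_iff_mem.2 ⟨φ.pull x, ?_⟩
    rw [← pull_delta, hx]
    rfl

end StrictHom
end Complex

section LieAlgebra
variable (d : ℕ) (G : Type u) [TopologicalSpace G] [ChartedSpace (Eu d) G] [Group G]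

/-- The Lie algebra of a Lie group `G`: the tangent space at `1`. -/
abbrev LieAlg := GroupLieAlgebra (𝓡 d) G

variable [LieGroup (𝓡 d) ∞ G]

instance : LieGroup (𝓡 d) (minSmoothness ℝ 3) G :=
  LieGroup.of_le (n := ∞) (by simpa using ENat.LEInfty.out)

variable {G} in
/-- The adjoint action of a Lie group: the derivative at `1` of `h ↦ g h g⁻¹`. -/
def Ad (g : G) : LieAlg d G →ₗ[ℝ] LieAlg d G where
  toFun x := mfderiv (𝓡 d) (𝓡 d) (fun h : G ↦ g * h * g⁻¹) 1 x
  map_add' := map_add (mfderiv (𝓡 d) (𝓡 d) (fun h : G ↦ g * h * g⁻¹) 1)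
  map_smul' := map_smul (mfderiv (𝓡 d) (𝓡 d) (fun h : G ↦ g * h * g⁻¹) 1)

/-- The polynomials on the Lie algebra that are invariant under the (co)adjoint action. -/
def InvPoly : Subalgebra ℝ (SymmetricAlgebra ℝ (Module.Dual ℝ (LieAlg d G))) where
  carrier := {f | ∀ g : G,
    SymmetricAlgebra.lift (SymmetricAlgebra.ι ℝ _ ∘ₗ (Ad d g).dualMap) f = f}
  mul_mem' hx hy g := by rw [map_mul, hx g, hy g]
  add_mem' hx hy g := by rw [map_add, hx g, hy g]
  algebraMap_mem' r g := by rw [AlgHom.commutes]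

end LieAlgebra

section VectorValued
variable {X Y : Type*} [DiffeologicalSpace X] [DiffeologicalSpace Y] {k l m : ℕ}
  {L : Type*} [LieRing L] [LieAlgebra ℝ L]

/-- The product `a ⊗ x, b ⊗ y ↦ (a ∧ b) ⊗ [x, y]` of forms with values in a Lie algebra. -/
def bracket : Form X k ⊗[ℝ] L →ₗ[ℝ] Form X l ⊗[ℝ] L →ₗ[ℝ] Form X (k + l) ⊗[ℝ] L :=
  TensorProduct.map₂ (Form.wedgeₗ X k l) (LieModule.toEnd ℝ L L : L →ₗ[ℝ] Module.End ℝ L)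

/-- The curvature `dθ + 1/2 [θ, θ]`. -/
def curvature (θ : Form X 1 ⊗[ℝ] L) : Form X 2 ⊗[ℝ] L :=
  Form.d.rTensor L θ + (1 / 2 : ℝ) • bracket θ θ

/-- The pairing with a linear form. -/
def pairing (ξ : Module.Dual ℝ L) : Form X k ⊗[ℝ] L →ₗ[ℝ] Form X k :=
  (TensorProduct.rid ℝ (Form X k)).toLinearMap ∘ₗ ξ.lTensor (Form X k)

/-- Pull-back of forms with values in a vector space. -/
def vpull (f : X → Y) (hf : DSmooth f) : Form Y k ⊗[ℝ] L →ₗ[ℝ] Form X k ⊗[ℝ] L :=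
  (Form.pullback f hf).rTensor L

/-- Evaluation of a vector-valued form along a plot. -/
def veval (p : Plot X m) (u : Eu m) (w : Fin k → Eu m) : Form X k ⊗[ℝ] L →ₗ[ℝ] L :=
  (TensorProduct.lid ℝ L).toLinearMap ∘ₗ (Form.eval p u w).rTensor L

/-- The commutative algebra generated by pairwise commuting elements. -/
@[reducible]
def adjoinCommRing {M A : Type*} [AddCommGroup M] [Module ℝ M] [Ring A] [Algebra ℝ A]
    (c : M →ₗ[ℝ] A) (hc : ∀ x y, Commute (c x) (c y)) :
    CommRing (Algebra.adjoin ℝ (Set.range c)) where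
  __ := (inferInstance : Ring (Algebra.adjoin ℝ (Set.range c)))
  mul_comm := (Algebra.isMulCommutative_adjoin ℝ (by
    rintro _ ⟨x, rfl⟩ _ ⟨y, rfl⟩
    exact hc x y)).is_comm.comm

/-- The algebra homomorphism from a symmetric algebra to an arbitrary algebra which extends a
linear map with pairwise commuting values. -/
def symLift {M A : Type*} [AddCommGroup M] [Module ℝ M] [Ring A] [Algebra ℝ A] (c : M →ₗ[ℝ] A)
    (hc : ∀ x y, Commute (c x) (c y)) : SymmetricAlgebra ℝ M →ₐ[ℝ] A :=
  letI := adjoinCommRing c hc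
  (Algebra.adjoin ℝ (Set.range c)).val.comp (SymmetricAlgebra.lift
    (c.codRestrict (Subalgebra.toSubmodule (Algebra.adjoin ℝ (Set.range c)))
      fun x ↦ Algebra.subset_adjoin ⟨x, rfl⟩))

theorem symLift_ι {M A : Type*} [AddCommGroup M] [Module ℝ M] [Ring A] [Algebra ℝ A]
    (c : M →ₗ[ℝ] A) (hc : ∀ x y, Commute (c x) (c y)) (x : M) :
    symLift c hc (SymmetricAlgebra.ι ℝ M x) = c x := by
  let := adjoinCommRing c hc
  exact congrArg Subtype.val (SymmetricAlgebra.lift_ι_apply (A := Algebra.adjoin ℝ (Set.range c))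
    (c.codRestrict (Subalgebra.toSubmodule (Algebra.adjoin ℝ (Set.range c)))
      fun x ↦ Algebra.subset_adjoin ⟨x, rfl⟩) x)

/-- Evaluation `f ↦ f(Ω)` of polynomials on a Lie algebra at a 2-form `Ω` with values in it. -/
def polyEval (Ω : Form X 2 ⊗[ℝ] L) : SymmetricAlgebra ℝ (Module.Dual ℝ L) →ₐ[ℝ] Forms X :=
  symLift (DirectSum.lof ℝ ℕ (Form X) 2 ∘ₗ
      LinearMap.mk (⟨fun ξ ↦ pairing ξ Ω, fun ξ η ↦ by
        simp [pairing, LinearMap.lTensor_add]⟩) fun c ξ ↦ by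
        simp [pairing, LinearMap.lTensor_smul])
    fun _ _ ↦ Form.commute_two _ _

/-- The iterated exterior product of the components `ξ(ω)`, for `ξ` in a list. -/
def wedgeList (β : Form X 1 ⊗[ℝ] L) : ∀ S : List (Module.Dual ℝ L), Form X S.length
  | [] => Form.const X 1
  | ξ :: S => (wedgeList β S).wedge (pairing ξ β)

end VectorValued

/-- A Lie groupoid `Ar ⇉ Ob`. The space of composable pairs is a submanifold of `Ar × Ar`, so
smoothness of the product is smoothness along all smooth families of composable pairs. -/
structure LieGroupoid where
  dimOb : ℕ
  dimAr : ℕ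
  Ob : Type u
  Ar : Type u
  [topOb : TopologicalSpace Ob]
  [topAr : TopologicalSpace Ar]
  [chartOb : ChartedSpace (Eu dimOb) Ob]
  [chartAr : ChartedSpace (Eu dimAr) Ar]
  [manifoldOb : IsManifold (𝓡 dimOb) ∞ Ob]
  [manifoldAr : IsManifold (𝓡 dimAr) ∞ Ar]
  str : AlgGroupoid Ob Ar
  submersion_src : Manifold.IsSubmersion (𝓡 dimAr) (𝓡 dimOb) ∞ str.src
  submersion_tgt : Manifold.IsSubmersion (𝓡 dimAr) (𝓡 dimOb) ∞ str.tgt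
  smooth_unit : ContMDiff (𝓡 dimOb) (𝓡 dimAr) ∞ str.unit
  smooth_inv : ContMDiff (𝓡 dimAr) (𝓡 dimAr) ∞ str.inv
  smooth_mul : ∀ (m : ℕ) (a b : Eu m → Ar) (h : ∀ x, str.src (a x) = str.tgt (b x)),
    ContMDiff (𝓡 m) (𝓡 dimAr) ∞ a → ContMDiff (𝓡 m) (𝓡 dimAr) ∞ b →
      ContMDiff (𝓡 m) (𝓡 dimAr) ∞ fun x ↦ str.mul (a x) (b x) (h x)

namespace LieGroupoid
attribute [instance] topOb topAr chartOb chartAr manifoldOb manifoldAr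

instance (Γ : LieGroupoid.{u}) : DiffeologicalSpace Γ.Ob := manifoldDiffeology Γ.dimOb Γ.Ob
instance (Γ : LieGroupoid.{u}) : DiffeologicalSpace Γ.Ar := manifoldDiffeology Γ.dimAr Γ.Ar

/-- The underlying diffeological groupoid of a Lie groupoid. -/
def toDiff (Γ : LieGroupoid.{u}) : DiffGroupoid.{u} where
  Ob := Γ.Ob
  Ar := Γ.Ar
  str := Γ.str
  smooth_src := fun _ _ hp ↦ Γ.submersion_src.contMDiff.comp hp
  smooth_tgt := fun _ _ hp ↦ Γ.submersion_tgt.contMDiff.comp hp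
  smooth_unit := fun _ _ hp ↦ Γ.smooth_unit.comp hp
  smooth_inv := fun _ _ hp ↦ Γ.smooth_inv.comp hp
  smooth_mul := fun m p hp ↦ Γ.smooth_mul m (fun x ↦ (p x).1.1) (fun x ↦ (p x).1.2)
    (fun x ↦ (p x).2) hp.1 hp.2

/-- A strict homomorphism of Lie groupoids: a smooth functor. -/
structure Hom (Γ' Γ : LieGroupoid.{u}) where
  onOb : Γ'.Ob → Γ.Ob
  onAr : Γ'.Ar → Γ.Ar
  smooth_onOb : ContMDiff (𝓡 Γ'.dimOb) (𝓡 Γ.dimOb) ∞ onOb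
  smooth_onAr : ContMDiff (𝓡 Γ'.dimAr) (𝓡 Γ.dimAr) ∞ onAr
  src_map : ∀ a, Γ.str.src (onAr a) = onOb (Γ'.str.src a)
  tgt_map : ∀ a, Γ.str.tgt (onAr a) = onOb (Γ'.str.tgt a)
  unit_map : ∀ x, onAr (Γ'.str.unit x) = Γ.str.unit (onOb x)
  mul_map : ∀ a b (h : Γ'.str.src a = Γ'.str.tgt b), onAr (Γ'.str.mul a b h) =
    Γ.str.mul (onAr a) (onAr b) ((src_map a).trans ((congrArg onOb h).trans (tgt_map b).symm))

/-- The underlying smooth functor of diffeological groupoids. -/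
def Hom.toStrict {Γ' Γ : LieGroupoid.{u}} (φ : Hom Γ' Γ) : StrictHom Γ'.toDiff Γ.toDiff where
  onOb := φ.onOb
  onAr := φ.onAr
  smooth_onOb := fun _ _ hp ↦ φ.smooth_onOb.comp hp
  smooth_onAr := fun _ _ hp ↦ φ.smooth_onAr.comp hp
  src_map := φ.src_map
  tgt_map := φ.tgt_map
  unit_map := φ.unit_map
  mul_map := φ.mul_map

end LieGroupoid

variable (d : ℕ) (G : Type u) [TopologicalSpace G] [ChartedSpace (Eu d) G] [Group G]
  [LieGroup (𝓡 d) ∞ G]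

/-- A principal `G`-bundle over a Lie groupoid `Γ`: a (right) principal `G`-bundle over the
manifold of objects with a (left) action of `Γ` that commutes with the action of `G`. The total
space carries its smooth structure as a diffeology; since the bundle is locally isomorphic to
`U × G` with `U` open in `Γ.Ob`, this is the same as the structure of a manifold for which the
local trivialisations are diffeomorphisms. -/
structure PrincipalBundle (Γ : LieGroupoid.{u}) where
  P : Type u
  [diff : DiffeologicalSpace P]
  proj : P → Γ.Ob
  act : P → G → P
  lact : ∀ (γ : Γ.Ar) (p : P), Γ.str.src γ = proj p → P
  smooth_proj : DSmooth proj
  smooth_act : ∀ (m : ℕ) (p : Eu m → P) (g : Eu m → G), IsPlot p → ContMDiff (𝓡 m) (𝓡 d) ∞ g →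
    IsPlot fun x ↦ act (p x) (g x)
  act_one : ∀ p, act p 1 = p
  act_mul : ∀ p g h, act p (g * h) = act (act p g) h
  proj_act : ∀ p g, proj (act p g) = proj p
  locally_trivial : ∀ x : Γ.Ob, ∃ U : Set Γ.Ob, IsOpen U ∧ x ∈ U ∧
    ∃ (s : {y // y ∈ U} → P) (τ : {p // proj p ∈ U} → G), DSmooth s ∧
      (∀ (m : ℕ) (q : Eu m → {p // proj p ∈ U}), IsPlot q →
        ContMDiff (𝓡 m) (𝓡 d) ∞ fun x ↦ τ (q x)) ∧
      (∀ y, proj (s y) = y.1) ∧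
      (∀ p, act (s ⟨proj p.1, p.2⟩) (τ p) = p.1) ∧
      ∀ p g (h : proj (act p.1 g) ∈ U), τ ⟨act p.1 g, h⟩ = τ p * g
  smooth_lact : DSmooth fun x : {x : Γ.Ar × P // Γ.str.src x.1 = proj x.2} ↦ lact x.1.1 x.1.2 x.2
  proj_lact : ∀ γ p h, proj (lact γ p h) = Γ.str.tgt γ
  lact_unit : ∀ p, lact (Γ.str.unit (proj p)) p (Γ.str.src_unit _) = p
  lact_mul : ∀ γ γ' p (h : Γ.str.src γ = Γ.str.tgt γ') (h' : Γ.str.src γ' = proj p),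
    lact (Γ.str.mul γ γ' h) p ((Γ.str.src_mul γ γ' h).trans h') =
      lact γ (lact γ' p h') (h.trans (proj_lact γ' p h').symm)
  lact_act : ∀ γ p g (h : Γ.str.src γ = proj p),
    lact γ (act p g) (h.trans (proj_act p g).symm) = act (lact γ p h) g

namespace PrincipalBundle
attribute [instance] PrincipalBundle.diff
variable {d G} {Γ Γ' : LieGroupoid.{u}} (B : PrincipalBundle d G Γ)

theorem smooth_act_const (g : G) : DSmooth fun p ↦ B.act p g :=
  fun m p hp ↦ B.smooth_act m p (fun _ ↦ g) hp contMDiff_const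

theorem lact_congr {γ γ' : Γ.Ar} {p p' : B.P} (hγ : γ = γ') (hp : p = p')
    (h : Γ.str.src γ = B.proj p) (h' : Γ.str.src γ' = B.proj p') :
    B.lact γ p h = B.lact γ' p' h' := by subst hγ hp; rfl

/-- The transformation groupoid `Γ × P ⇉ P`, with arrows `(γ, p)` from `p` to `γ p`. -/
def transformation : DiffGroupoid.{u} where
  Ob := B.P
  Ar := {x : Γ.Ar × B.P // Γ.str.src x.1 = B.proj x.2}
  diffOb := B.diff
  diffAr := inferInstance
  str :=
    { src := fun a ↦ a.1.2
      tgt := fun a ↦ B.lact a.1.1 a.1.2 a.2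
      unit := fun p ↦ ⟨(Γ.str.unit (B.proj p), p), Γ.str.src_unit _⟩
      inv := fun a ↦ ⟨(Γ.str.inv a.1.1, B.lact a.1.1 a.1.2 a.2),
        (Γ.str.src_inv _).trans (B.proj_lact _ _ _).symm⟩
      mul := fun a b h ↦ ⟨(Γ.str.mul a.1.1 b.1.1
          (a.2.trans ((congrArg B.proj h).trans (B.proj_lact _ _ _))), b.1.2),
        (Γ.str.src_mul _ _ _).trans b.2⟩
      src_unit := fun _ ↦ rfl
      tgt_unit := B.lact_unit
      src_inv := fun _ ↦ rfl
      tgt_inv := fun a ↦ by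
        have e := Γ.str.inv_mul a.1.1
        rw [← B.lact_mul _ _ _ (Γ.str.src_inv _) a.2]
        exact (B.lact_congr (e.trans (congrArg _ a.2)) rfl _ _).trans (B.lact_unit _)
      src_mul := fun _ _ _ ↦ rfl
      tgt_mul := fun a b h ↦ by
        rw [B.lact_mul]
        exact B.lact_congr rfl h.symm _ _
      unit_mul := fun a ↦ Subtype.ext (Prod.ext (by
        have e : ∀ x (hx : x = Γ.str.tgt a.1.1), Γ.str.mul (Γ.str.unit x) a.1.1
            ((Γ.str.src_unit x).trans hx) = a.1.1 := by
          rintro _ rfl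
          exact Γ.str.unit_mul _
        exact e _ (B.proj_lact _ _ _)) rfl)
      mul_unit := fun a ↦ Subtype.ext (Prod.ext (by
        have e : ∀ x (hx : Γ.str.src a.1.1 = x), Γ.str.mul a.1.1 (Γ.str.unit x)
            (hx.trans (Γ.str.tgt_unit x).symm) = a.1.1 := by
          rintro _ rfl
          exact Γ.str.mul_unit _
        exact e _ a.2) rfl)
      mul_inv := fun a ↦ Subtype.ext (Prod.ext ((Γ.str.mul_inv _).trans
        (congrArg _ (B.proj_lact _ _ _).symm)) rfl)
      inv_mul := fun a ↦ Subtype.ext (Prod.ext ((Γ.str.inv_mul _).trans (congrArg _ a.2)) rfl)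
      mul_assoc := fun a b c h h' ↦ Subtype.ext (Prod.ext (Γ.str.mul_assoc _ _ _ _ _) rfl) }
  smooth_src := fun _ _ hp ↦ hp.2
  smooth_tgt := B.smooth_lact
  smooth_unit := fun _ p hp ↦ ⟨Γ.toDiff.smooth_unit _ _ (B.smooth_proj _ p hp), hp⟩
  smooth_inv := fun _ _ hp ↦ ⟨Γ.toDiff.smooth_inv _ _ hp.1, B.smooth_lact _ _ hp⟩
  smooth_mul := fun m p hp ↦ ⟨Γ.smooth_mul m (fun x ↦ (p x).1.1.1.1) (fun x ↦ (p x).1.2.1.1) _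
    hp.1.1 hp.2.1, hp.2.2⟩

/-- The projection of the transformation groupoid to `Γ`. -/
def toBase : StrictHom B.transformation Γ.toDiff where
  onOb := B.proj
  onAr := fun a ↦ a.1.1
  smooth_onOb := B.smooth_proj
  smooth_onAr := fun _ _ hp ↦ hp.1
  src_map := fun a ↦ a.2
  tgt_map := fun _ ↦ (B.proj_lact _ _ _).symm
  unit_map := fun _ ↦ rfl
  mul_map := fun _ _ _ ↦ rfl

/-- The pull-back of a principal bundle along a strict homomorphism of Lie groupoids. -/
def pullback (φ : LieGroupoid.Hom Γ' Γ) : PrincipalBundle d G Γ' where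
  P := {x : Γ'.Ob × B.P // φ.onOb x.1 = B.proj x.2}
  diff := inferInstance
  proj := fun x ↦ x.1.1
  act := fun x g ↦ ⟨(x.1.1, B.act x.1.2 g), x.2.trans (B.proj_act _ _).symm⟩
  lact := fun γ x h ↦ ⟨(Γ'.str.tgt γ, B.lact (φ.onAr γ) x.1.2
      ((φ.src_map γ).trans ((congrArg _ h).trans x.2))),
    (φ.tgt_map γ).symm.trans (B.proj_lact _ _ _).symm⟩
  smooth_proj := fun _ _ hp ↦ hp.1
  smooth_act := fun m _ g hp hg ↦ ⟨hp.1, B.smooth_act m _ g hp.2 hg⟩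
  act_one := fun x ↦ Subtype.ext (Prod.ext rfl (B.act_one _))
  act_mul := fun x g h ↦ Subtype.ext (Prod.ext rfl (B.act_mul _ _ _))
  proj_act := fun _ _ ↦ rfl
  locally_trivial := fun x ↦ by
    obtain ⟨U, hU, hx, s, τ, h1, h2, h3, h4, h5⟩ := B.locally_trivial (φ.onOb x)
    refine ⟨φ.onOb ⁻¹' U, hU.preimage φ.smooth_onOb.continuous, hx,
      fun y ↦ ⟨(y.1, s ⟨φ.onOb y.1, y.2⟩), (h3 ⟨φ.onOb y.1, y.2⟩).symm⟩,
      fun q ↦ τ ⟨q.1.1.2, q.1.2 ▸ q.2⟩, fun m p hp ↦ ⟨hp, ?_⟩, fun m q hq ↦ ?_,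
      fun _ ↦ rfl, fun q ↦ ?_, fun q g h ↦ ?_⟩
    · exact h1 m (fun z ↦ ⟨φ.onOb (p z).1, (p z).2⟩) (φ.smooth_onOb.comp hp)
    · exact h2 m (fun z ↦ ⟨(q z).1.1.2, (q z).1.2 ▸ (q z).2⟩) hq.2
    · refine Subtype.ext (Prod.ext rfl ?_)
      have e : ∀ z (hz : z ∈ U) (hz' : z = B.proj q.1.1.2),
          B.act (s ⟨z, hz⟩) (τ ⟨q.1.1.2, hz' ▸ hz⟩) = q.1.1.2 := by
        rintro _ hz rfl
        exact h4 ⟨_, hz⟩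
      exact e _ q.2 q.1.2
    · exact h5 ⟨q.1.1.2, q.1.2 ▸ q.2⟩ g _
  smooth_lact := fun m p hp ↦ ⟨Γ'.toDiff.smooth_tgt _ _ hp.1, B.smooth_lact m
    (fun z ↦ ⟨(φ.onAr (p z).1.1, (p z).1.2.1.2),
      ((φ.src_map _).trans ((congrArg _ (p z).2).trans (p z).1.2.2))⟩)
    ⟨φ.smooth_onAr.comp hp.1, hp.2.2⟩⟩
  proj_lact := fun _ _ _ ↦ rfl
  lact_unit := fun x ↦ Subtype.ext (Prod.ext (Γ'.str.tgt_unit _) <|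
    (B.lact_congr ((φ.unit_map _).trans (congrArg _ x.2)) rfl _ _).trans (B.lact_unit _))
  lact_mul := fun γ γ' x h h' ↦ Subtype.ext (Prod.ext (Γ'.str.tgt_mul _ _ _) <|
    (B.lact_congr (φ.mul_map γ γ' h) rfl _ ((Γ.str.src_mul _ _ _).trans
      ((φ.src_map γ').trans ((congrArg _ h').trans x.2)))).trans (B.lact_mul _ _ _ _ _))
  lact_act := fun γ x g h ↦ Subtype.ext (Prod.ext rfl (B.lact_act _ _ _ _))

/-- The canonical map from the total space of a pull-back. -/
def fromPullback (φ : LieGroupoid.Hom Γ' Γ) (x : (B.pullback φ).P) : B.P := x.1.2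

theorem smooth_fromPullback (φ : LieGroupoid.Hom Γ' Γ) : DSmooth (B.fromPullback φ) :=
  fun _ _ hp ↦ hp.2

/-- A plot in a fibre of the bundle. -/
def orbitPlot {m : ℕ} (p : B.P) (g : Eu m → G) (hg : ContMDiff (𝓡 m) (𝓡 d) ∞ g) : Plot B.P m :=
  ⟨fun x ↦ B.act p (g x), B.smooth_act m (fun _ ↦ p) g isPlot_const hg⟩

end PrincipalBundle

variable {d G} {Γ Γ' : LieGroupoid.{u}}

/-- A pseudo-connection: a connection 1-form of the principal `G`-bundle `P → Γ.Ob`. It is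
equivariant, and its pull-back to every orbit of `G` is the left Maurer-Cartan form. -/
structure PseudoConnection (B : PrincipalBundle d G Γ) where
  form : Form B.P 1 ⊗[ℝ] LieAlg d G
  equivariant : ∀ g : G, vpull (fun p ↦ B.act p g) (B.smooth_act_const g) form =
    (Ad d g⁻¹).lTensor (Form B.P 1) form
  vertical : ∀ (p : B.P) (m : ℕ) (g : Eu m → G) (hg : ContMDiff (𝓡 m) (𝓡 d) ∞ g) (x w : Eu m),
    veval (B.orbitPlot p g hg) x (fun _ ↦ w) form =
      mfderiv (𝓡 d) (𝓡 d) (fun h : G ↦ (g x)⁻¹ * h) (g x) (mfderiv (𝓡 m) (𝓡 d) g x w)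

/-- The pull-back of a pseudo-connection along a strict homomorphism. -/
def PseudoConnection.pullback {B : PrincipalBundle d G Γ} (θ : PseudoConnection B)
    (φ : LieGroupoid.Hom Γ' Γ) : PseudoConnection (B.pullback φ) where
  form := vpull (B.fromPullback φ) (B.smooth_fromPullback φ) θ.form
  equivariant g := by
    have h1 : ∀ x : Form B.P 1 ⊗[ℝ] LieAlg d G,
        vpull (fun p ↦ (B.pullback φ).act p g) ((B.pullback φ).smooth_act_const g)
          (vpull (B.fromPullback φ) (B.smooth_fromPullback φ) x) =
        vpull (B.fromPullback φ) (B.smooth_fromPullback φ)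
          (vpull (fun p ↦ B.act p g) (B.smooth_act_const g) x) := by
      intro x
      induction x with
      | zero => simp
      | tmul a y => rfl
      | add x y hx hy => simp only [map_add, hx, hy]
    have h2 : ∀ x : Form B.P 1 ⊗[ℝ] LieAlg d G,
        vpull (B.fromPullback φ) (B.smooth_fromPullback φ) ((Ad d g⁻¹).lTensor _ x) =
        (Ad d g⁻¹).lTensor _ (vpull (B.fromPullback φ) (B.smooth_fromPullback φ) x) := by
      intro x
      induction x with
      | zero => simp
      | tmul a y => rfl
      | add x y hx hy => simp only [map_add, hx, hy]
    rw [h1, θ.equivariant, h2]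
  vertical p m g hg x w := by
    rw [← θ.vertical (B.fromPullback φ p) m g hg x w]
    generalize θ.form = y
    induction y with
    | zero => simp
    | tmul a y => rfl
    | add x y hx hy => simp only [map_add, hx, hy]

section Simplex
variable {Y : Type*} [DiffeologicalSpace Y] {n m : ℕ}

variable (n) in
/-- The standard simplex, with the coordinates `t_1, …, t_n`. -/
def simplex : Set (Eu n) := {t | (∀ i, 0 ≤ t i) ∧ ∑ i, t i ≤ 1}

/-- The barycentric coordinates, with `t_0 = 1 - t_1 - … - t_n`. -/
def bary (i : Fin (n + 1)) (t : Eu n) : ℝ := Fin.cases (1 - ∑ j, t j) (fun j ↦ t j) i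

theorem contDiff_bary (i : Fin (n + 1)) : ContDiff ℝ ∞ (bary i) := by
  refine Fin.cases ?_ (fun j ↦ ?_) i
  · change ContDiff ℝ ∞ fun t : Eu n ↦ 1 - ∑ j, t j
    fun_prop
  · change ContDiff ℝ ∞ fun t : Eu n ↦ t j
    fun_prop

/-- A barycentric coordinate as a function on `Δ × Y`, or rather on `ℝ^n × Y`. -/
def baryForm (Y : Type*) [DiffeologicalSpace Y] (i : Fin (n + 1)) : Form (Eu n × Y) 0 :=
  Form.ofFun (fun x ↦ bary i x.1) fun _ p ↦ (contDiff_bary i).comp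
    (isPlot_iff_contDiff.1 p.2.1)

theorem smooth_snd (X Y : Type*) [DiffeologicalSpace X] [DiffeologicalSpace Y] :
    DSmooth (Prod.snd : X × Y → Y) := fun _ _ hp ↦ hp.2

/-- Joining of vectors. -/
def join (t : Eu n) (x : Eu m) : Eu (n + m) := WithLp.toLp 2 (Fin.append t.ofLp x.ofLp)

/-- The product of the identity of `ℝ^n` with a plot. -/
def prodPlot (n : ℕ) (p : Plot Y m) : Plot (Eu n × Y) (n + m) :=
  ⟨fun w ↦ (WithLp.toLp 2 fun i ↦ w (Fin.castAdd m i), p.1 (WithLp.toLp 2 fun i ↦ w (Fin.natAdd n i))),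
    isPlot_iff_contDiff.2 (contDiff_euclidean.2 fun i ↦ by
      change ContDiff ℝ ∞ fun w : Eu (n + m) ↦ w (Fin.castAdd m i)
      fun_prop),
    isPlot_reparam p.2 (contDiff_euclidean.2 fun i ↦ by
      change ContDiff ℝ ∞ fun w : Eu (n + m) ↦ w (Fin.natAdd n i)
      fun_prop)⟩

/-- The integral over the simplex `Δ_n` of an `(n + k)`-form on `Δ_n × Y`: the coefficient of
`dt_1 ∧ … ∧ dt_n`, a `k`-form on `Y`, is integrated over the simplex. It is evaluated here along a
plot of `Y`, at a point and at `k` vectors. -/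
def fibreIntegral {k : ℕ} (a : Form (Eu n × Y) (n + k)) (p : Plot Y m) (x : Eu m)
    (w : Fin k → Eu m) : ℝ :=
  ∫ t in simplex n, a.val (prodPlot n p) (join t x)
    (Fin.append (fun i ↦ join (EuclideanSpace.single i 1) 0) fun j ↦ join 0 (w j))

end Simplex

namespace PseudoConnection
variable {B : PrincipalBundle d G Γ} (θ : PseudoConnection B)

/-- The connection 1-form `∑ t_i p_i^* θ` on `Δ_n × Q_n`, where `Q` is the transformation
groupoid and `p_i : Q_n → P` is the `i`-th vertex. -/
def extended (n : ℕ) : Form (Eu n × Nerve B.transformation n) 1 ⊗[ℝ] LieAlg d G :=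
  ∑ i : Fin (n + 1), ((Form.wedgeₗ _ 1 0).flip (baryForm _ i)).rTensor (LieAlg d G)
    (vpull Prod.snd (smooth_snd _ _) (vpull (Nerve.vertex i) (Nerve.smooth_vertex i) θ.form))

/-- The pseudo-curvature, as a form on the `0`-simplices of the transformation groupoid. -/
def pseudoCurvature : Form (Nerve B.transformation 0) 2 ⊗[ℝ] LieAlg d G :=
  vpull (Nerve.vertex 0) (Nerve.smooth_vertex 0) (curvature θ.form)

/-- The difference `∂θ = src^* θ - tgt^* θ`, as a form on the `1`-simplices. -/
def boundary : Form (Nerve B.transformation 1) 1 ⊗[ℝ] LieAlg d G :=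
  vpull (Nerve.vertex 1) (Nerve.smooth_vertex 1) θ.form -
    vpull (Nerve.vertex 0) (Nerve.smooth_vertex 0) θ.form

/-- Evaluation of non-commutative polynomials at the total pseudo-curvature `∂θ + Ω`, with the cup
product. A generator is either a list `ξ_1, …, ξ_k` of linear forms on the Lie algebra, which
stands for the exterior product of the `ξ_i(∂θ)`, or a single linear form `ξ`, which stands for
`ξ(Ω)`. -/
def evalTotal : FreeAlgebra ℝ (List (Module.Dual ℝ (LieAlg d G)) ⊕ Module.Dual ℝ (LieAlg d G))
    →ₐ[ℝ] Total B.transformation :=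
  FreeAlgebra.lift ℝ (Sum.elim
    (fun S ↦ Total.of 1 S.length (wedgeList θ.boundary S))
    (fun ξ ↦ Total.of 0 2 (pairing ξ θ.pseudoCurvature)))

/-- The Chern-Weil map on the cochain level: the pull-back of `z f` to `Q_n` is the integral over
the simplex `Δ_n` of `f(Ω)`, where `Ω` is the curvature of the form `∑ t_i p_i^* θ`. -/
def IsCochainMap (z : InvPoly d G →ₗ[ℝ] Cocycle Γ.toDiff) : Prop :=
  ∀ (f : InvPoly d G) (n k m : ℕ) (p : Plot (Nerve B.transformation n) m) (x : Eu m)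
    (w : Fin k → Eu m),
    (Total.comp n k (B.toBase.pull (z f).1)).val p x w =
      fibreIntegral (DirectSum.component ℝ ℕ (Form (Eu n × Nerve B.transformation n)) (n + k)
        (polyEval (curvature (θ.extended n)) f.1)) p x w

end PseudoConnection

/-- The Chern-Weil map in cohomology: it is induced by the cochain map of a pseudo-connection. -/
def IsChernWeilMap (B : PrincipalBundle d G Γ) (w : InvPoly d G →ₐ[ℝ] Cohomology Γ.toDiff) : Prop :=
  ∃ (θ : PseudoConnection B) (z : InvPoly d G →ₗ[ℝ] Cocycle Γ.toDiff),
    θ.IsCochainMap z ∧ ∀ f, w f = cls (z f)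

end ChernWeil

end

open ChernWeil

/-! The argument takes place on `Δ_n × Q_n`. Along a plot, a connection form is an ordinary Lie
algebra valued 1-form on a Euclidean space (`conn`). By local triviality, two plots over the same
plot of the base differ near every point by a smooth map `g` to `G`. Since the coefficients `t_i`
sum to 1, the form `∑ t_i p_i^* θ` then changes by the gauge transformation `Ad(g⁻¹) A + g⁻¹ dg`,
and its curvature is conjugated (`curvAt_gauge`). An invariant polynomial of the curvature therefore
does not depend on the lift (`IsGaugeForm.val_eq`) and descends to `Δ_n × Γ_n`
(`LocalLift.exists_pullback_eq`). For closedness, a gauge is chosen in which the connection form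
vanishes at the point in question (`gauge_zero_at`); there the differential of every curvature
component vanishes (`IsGaugeForm.d_polyEval`).

The descended forms are compatible with all affine maps of simplices, so they make up a closed
simplicial form in the sense of Dupont. Stokes' theorem for the integration over `Δ_n`
(`Forms.fibreInt_d`) turns `d` on simplicial forms into `δ` on their integrals
(`Family.delta_integral`), and the integral is a cocycle. It is unique because pull-back along `Q_n
→ Γ_n` is injective: plots of `Γ_n` lift locally. Two pseudo-connections are joined by interpolation
over an extra interval, and integration over this interval yields a cobounding cochain
(`exists_delta_eq_sub`).

The passage from `f` to the simplicial form is an algebra homomorphism, but integration is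
multiplicative only up to homotopy. The external product of two simplicial forms lives on `Δ_m × Δ_m
× Γ_m`. Its integral over the diagonal gives the integral of the product; its integral over the
Alexander–Whitney pieces `Δ_p × Δ_q` gives, by the projection formula, the cup product of the
integrals. Both integrals satisfy the same Stokes formula, so acyclic models, with the contraction
of `Δ_m × Δ_m` to a vertex, produce a natural homotopy between them (`homotopyInt_defect`,
`exists_delta_eq_integral_mul`).

The polynomial comes from the formula for the curvature of `∑ t_i θ_i`, namely `∑ t_i Ω_i - ∑ (θ_i -
θ_0) dt_i - 1/4 ∑ t_i t_j [θ_i - θ_j, θ_i - θ_j]` (`of_pairing_curvature_sum`). The differences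
telescope along the edges, where they are pull-backs of `∂θ`. Graded commutativity sorts every
product along the string vertex 0, edge 01, vertex 1, and so on; integration replaces the simplex
factor by a number; and a sorted product is, up to sign, a cup product of the generators
(`ordered_le_universal`). The computation is made for the families indexed by all bundles with
pseudo-connections at once (`NatForm`), so that one polynomial serves them all.

Naturality holds because each construction commutes with pull-back; the uniqueness of the cochain
map then identifies the two sides. -/

noncomputable section
namespace ChernWeil

open Diffeology Filter Topology VectorField MeasureTheory
set_option linter.unusedSectionVars false

/-! ### Lie groups in the chart at the identity: Maurer–Cartan, adjoint action, gauge
transformations -/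

section LieGroupChart
variable {d : ℕ} {G : Type u} [TopologicalSpace G] [ChartedSpace (Eu d) G] [Group G]
  [LieGroup (𝓡 d) ∞ G]
  {E : Type*} [NormedAddCommGroup E] [NormedSpace ℝ E]

variable (d G) in
/-- The chart at the identity. -/
abbrev chartOne : PartialEquiv G (Eu d) := extChartAt (𝓡 d) (1 : G)

variable (d G) in
/-- The coordinates of the identity. -/
abbrev coordOne : Eu d := chartOne d G 1

omit [LieGroup (𝓡 d) ∞ G] in
theorem chartOne_symm_coordOne : (chartOne d G).symm (coordOne d G) = 1 :=
  extChartAt_to_inv (I := 𝓡 d) (1 : G)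

omit [LieGroup (𝓡 d) ∞ G] in
theorem eventually_chartOne_symm {X : Type*} [TopologicalSpace X] {f : X → G} {x : X}
    (hf : ContinuousAt f x) (h : f x = 1) :
    ∀ᶠ y in 𝓝 x, (chartOne d G).symm (chartOne d G (f y)) = f y := by
  have : ∀ᶠ g in 𝓝 (f x), g ∈ (chartOne d G).source := by
    rw [h]; exact extChartAt_source_mem_nhds (I := 𝓡 d) (1 : G)
  filter_upwards [hf.eventually this] with y hy using (chartOne d G).left_inv hy

omit [LieGroup (𝓡 d) ∞ G] in
theorem eventually_chartOne_coord :
    ∀ᶠ a in 𝓝 (coordOne d G), chartOne d G ((chartOne d G).symm a) = a := by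
  filter_upwards [extChartAt_target_mem_nhds (I := 𝓡 d) (1 : G)] with a ha
    using (chartOne d G).right_inv ha

theorem contMDiffAt_chartOne_symm :
    ContMDiffAt (𝓡 d) (𝓡 d) ∞ (chartOne d G).symm (coordOne d G) :=
  (contMDiffOn_extChartAt_symm (I := 𝓡 d) (n := ∞) (1 : G)).contMDiffAt
    (extChartAt_target_mem_nhds (I := 𝓡 d) (1 : G))

theorem contMDiffAt_chartOne_symm_comp {f : E → Eu d} {x : E} (hf : ContDiffAt ℝ ∞ f x)
    (h : f x = coordOne d G) :
    ContMDiffAt 𝓘(ℝ, E) (𝓡 d) ∞ (fun y ↦ (chartOne d G).symm (f y)) x := by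
  have := contMDiffAt_chartOne_symm (d := d) (G := G)
  rw [← h] at this
  exact this.comp x hf.contMDiffAt

theorem contDiffAt_chartOne {f : E → G} {x : E} (hf : ContMDiffAt 𝓘(ℝ, E) (𝓡 d) ∞ f x)
    (h : f x = 1) : ContDiffAt ℝ ∞ (fun y ↦ chartOne d G (f y)) x := by
  rw [← contMDiffAt_iff_contDiffAt]
  have : ContMDiffAt (𝓡 d) 𝓘(ℝ, Eu d) ∞ (chartOne d G) (f x) := by
    rw [h]; exact contMDiffAt_extChartAt
  exact this.comp x hf

theorem fderiv_partial_right {E₁ E₂ F : Type*} [NormedAddCommGroup E₁] [NormedSpace ℝ E₁]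
    [NormedAddCommGroup E₂] [NormedSpace ℝ E₂] [NormedAddCommGroup F] [NormedSpace ℝ F]
    {f : E₁ × E₂ → F} {x : E₁} {y : E₂} (hf : DifferentiableAt ℝ f (x, y)) :
    HasFDerivAt (fun z ↦ f (x, z)) ((fderiv ℝ f (x, y)).comp (ContinuousLinearMap.inr ℝ E₁ E₂)) y :=
  hf.hasFDerivAt.comp y (hasFDerivAt_prodMk_right x y)

theorem fderiv_partial_left {E₁ E₂ F : Type*} [NormedAddCommGroup E₁] [NormedSpace ℝ E₁]
    [NormedAddCommGroup E₂] [NormedSpace ℝ E₂] [NormedAddCommGroup F] [NormedSpace ℝ F]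
    {f : E₁ × E₂ → F} {x : E₁} {y : E₂} (hf : DifferentiableAt ℝ f (x, y)) :
    HasFDerivAt (fun z ↦ f (z, y)) ((fderiv ℝ f (x, y)).comp (ContinuousLinearMap.inl ℝ E₁ E₂)) x :=
  hf.hasFDerivAt.comp x (hasFDerivAt_prodMk_left x y)

/-- The partial derivative along a smooth section is smooth. -/
theorem contDiffAt_partial_right {E₁ E₂ F : Type*} [NormedAddCommGroup E₁] [NormedSpace ℝ E₁]
    [NormedAddCommGroup E₂] [NormedSpace ℝ E₂] [NormedAddCommGroup F] [NormedSpace ℝ F]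
    {f : E₁ × E₂ → F} {φ : E₁ → E₂} {x : E₁} (hφ : ContDiffAt ℝ ∞ φ x)
    (hf : ContDiffAt ℝ ∞ f (x, φ x)) :
    ContDiffAt ℝ ∞ (fun y ↦ fderiv ℝ (fun z ↦ f (y, z)) (φ y)) x := by
  have h1 : ContDiffAt ℝ ∞ (fderiv ℝ f) (x, φ x) := hf.fderiv_right (by simp)
  have hc : ContDiffAt ℝ ∞ (fun y ↦ (y, φ y)) x := contDiffAt_id.prodMk hφ
  have h2 : ∀ᶠ y in 𝓝 x, DifferentiableAt ℝ f (y, φ y) := by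
    have h3 : ∀ᶠ q in 𝓝 (x, φ x), DifferentiableAt ℝ f q := by
      have := (hf.of_le (m := 1) (by simp)).eventually (by simp)
      filter_upwards [this] with q hq using hq.differentiableAt (by simp)
    exact hc.continuousAt.eventually h3
  have h4 : ContDiffAt ℝ ∞ (fun y ↦ (fderiv ℝ f (y, φ y)).comp
      (ContinuousLinearMap.inr ℝ E₁ E₂)) x :=
    (h1.comp x hc).clm_comp contDiffAt_const
  refine h4.congr_of_eventuallyEq ?_
  filter_upwards [h2] with y hy using (fderiv_partial_right hy).fderiv

variable (d G) in
/-- The product in the chart at the identity. -/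
def chartMul (q : Eu d × Eu d) : Eu d :=
  chartOne d G ((chartOne d G).symm q.1 * (chartOne d G).symm q.2)

theorem contDiffAt_chartMul :
    ContDiffAt ℝ ∞ (chartMul d G) (coordOne d G, coordOne d G) :=
  contDiffAt_chartOne ((contMDiffAt_chartOne_symm_comp contDiffAt_fst rfl).mul
    (contMDiffAt_chartOne_symm_comp contDiffAt_snd rfl)) (by
      simp only [chartOne_symm_coordOne, mul_one])

variable (d G) in
/-- The derivative at the identity of the left translations, in the chart at the identity. -/
def leftFrame (a : Eu d) : Eu d →L[ℝ] Eu d :=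
  fderiv ℝ (fun b ↦ chartMul d G (a, b)) (coordOne d G)

theorem contDiffAt_leftFrame : ContDiffAt ℝ ∞ (leftFrame d G) (coordOne d G) :=
  contDiffAt_partial_right (f := chartMul d G) (φ := fun _ ↦ coordOne d G) contDiffAt_const
    contDiffAt_chartMul

theorem leftFrame_one : leftFrame d G (coordOne d G) = ContinuousLinearMap.id ℝ _ := by
  have : (fun b ↦ chartMul d G (coordOne d G, b)) =ᶠ[𝓝 (coordOne d G)] id := by
    filter_upwards [eventually_chartOne_coord (d := d) (G := G)] with b hb
    simp only [chartMul, chartOne_symm_coordOne, one_mul, hb, id]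
  rw [leftFrame, this.fderiv_eq, fderiv_id]

/-- Left-invariant vector fields in the chart at the identity. -/
theorem mpullbackWithin_mulInvariantVectorField (v : LieAlg d G) :
    (mpullbackWithin 𝓘(ℝ, Eu d) (𝓡 d) (chartOne d G).symm (mulInvariantVectorField v)
      (Set.range (𝓡 d)) : Eu d → Eu d) =ᶠ[𝓝 (coordOne d G)] fun a ↦ leftFrame d G a v := by
  have hdiff : ∀ᶠ a in 𝓝 (coordOne d G), DifferentiableAt ℝ
      (fun b ↦ chartMul d G (a, b)) (coordOne d G) := by
    have := ((contDiffAt_chartMul (d := d) (G := G)).of_le (m := 1) (by simp)).eventually (by simp)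
    have hc : ContinuousAt (fun a : Eu d ↦ (a, coordOne d G)) (coordOne d G) := by fun_prop
    filter_upwards [hc.eventually this] with a ha
    exact (fderiv_partial_right (ha.differentiableAt (by simp))).differentiableAt
  filter_upwards [hdiff, extChartAt_target_mem_nhds (I := 𝓡 d) (1 : G)] with a ha hat
  set g : G := (chartOne d G).symm a with hg
  have hinv := isInvertible_mfderivWithin_extChartAt_symm (I := 𝓡 d) hat
  rw [mpullbackWithin_apply]
  -- Near the coordinates of the identity, `L_g ∘ chart⁻¹` and `chart⁻¹ ∘ chartMul (a, ·)` are the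
  -- same map. The chain rule applied to both factorisations compares the invariant field at `g`
  -- with the frame at `a`.
  have key : mfderivWithin 𝓘(ℝ, Eu d) (𝓡 d) (chartOne d G).symm (Set.range (𝓡 d)) a
      (leftFrame d G a v) = mulInvariantVectorField v g := by
    have h1 : HasMFDerivAt (𝓡 d) (𝓡 d) (fun h : G ↦ g * h) 1
        (mfderiv (𝓡 d) (𝓡 d) (fun h : G ↦ g * h) 1) :=
      ((contMDiff_mul_left (I := 𝓡 d) (n := ∞) (a := g)).mdifferentiableAt (by simp)).hasMFDerivAt
    have h2 : HasMFDerivAt 𝓘(ℝ, Eu d) (𝓡 d) (chartOne d G).symm (coordOne d G)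
        (ContinuousLinearMap.id ℝ (Eu d)) := by
      have h := (contMDiffAt_chartOne_symm (d := d) (G := G)).mdifferentiableAt (by simp)
      have h' := h.hasMFDerivAt
      rw [← mfderivWithin_univ, ← ModelWithCorners.range_eq_univ (𝓡 d)] at h'
      rwa [mfderivWithin_range_extChartAt_symm] at h'
    have h3 := HasMFDerivAt.comp (coordOne d G) (by rw [chartOne_symm_coordOne]; exact h1) h2
    have h4 : HasMFDerivAt 𝓘(ℝ, Eu d) 𝓘(ℝ, Eu d) (fun b ↦ chartMul d G (a, b)) (coordOne d G)
        (leftFrame d G a) := ha.hasFDerivAt.hasMFDerivAt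
    have h5 : HasMFDerivAt 𝓘(ℝ, Eu d) (𝓡 d) (chartOne d G).symm a
        (mfderivWithin 𝓘(ℝ, Eu d) (𝓡 d) (chartOne d G).symm (Set.range (𝓡 d)) a) := by
      rw [ModelWithCorners.range_eq_univ, mfderivWithin_univ]
      exact (((contMDiffOn_extChartAt_symm (I := 𝓡 d) (n := ∞) (1 : G)).contMDiffAt
        (extChartAt_target_mem_nhds' hat)).mdifferentiableAt (by simp)).hasMFDerivAt
    have ha1 : chartMul d G (a, coordOne d G) = a := by
      simp only [chartMul, chartOne_symm_coordOne, mul_one]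
      exact (chartOne d G).right_inv hat
    have h6 := HasMFDerivAt.comp (coordOne d G) (by rw [ha1]; exact h5) h4
    have heq : (chartOne d G).symm ∘ (fun b ↦ chartMul d G (a, b)) =ᶠ[𝓝 (coordOne d G)]
        (fun h : G ↦ g * h) ∘ (chartOne d G).symm := by
      have hc : ContinuousAt (fun b ↦ g * (chartOne d G).symm b) (coordOne d G) :=
        ((contMDiff_mul_left (I := 𝓡 d) (n := ∞) (a := g)).continuous.continuousAt).comp
          contMDiffAt_chartOne_symm.continuousAt
      have hs : ∀ᶠ g' in 𝓝 (g * (chartOne d G).symm (coordOne d G)), g' ∈ (chartOne d G).source := by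
        rw [chartOne_symm_coordOne, mul_one]
        exact extChartAt_source_mem_nhds' ((chartOne d G).map_target hat)
      filter_upwards [hc.eventually hs] with b hb
      exact (chartOne d G).left_inv hb
    have h7 := hasMFDerivAt_unique (h6.congr_of_eventuallyEq heq.symm) h3
    have h8 := DFunLike.congr_fun h7 v
    exact h8
  exact hinv.inverse_apply_eq.2 key.symm

/-- The bracket of the Lie algebra in terms of the left-invariant frame. -/
theorem lie_eq_leftFrame (v w : LieAlg d G) :
    ⁅v, w⁆ = fderiv ℝ (leftFrame d G) (coordOne d G) v w -
      fderiv ℝ (leftFrame d G) (coordOne d G) w v := by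
  rw [GroupLieAlgebra.bracket_def, mlieBracket, mlieBracketWithin_apply, mfderiv_extChartAt_self]
  change ContinuousLinearMap.inverse (ContinuousLinearMap.id ℝ (Eu d)) _ = _
  rw [show ContinuousLinearMap.inverse (ContinuousLinearMap.id ℝ (Eu d)) =
    ContinuousLinearMap.id ℝ (Eu d) from ContinuousLinearMap.inverse_id ..]
  have h : ∀ s : Set (Eu d), (mpullbackWithin 𝓘(ℝ, Eu d) (𝓡 d) (chartOne d G).symm
      (mulInvariantVectorField v) (Set.range (𝓡 d)) : Eu d → Eu d) =ᶠ[𝓝[s] (coordOne d G)]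
      fun a ↦ leftFrame d G a v := fun s ↦
    (mpullbackWithin_mulInvariantVectorField v).filter_mono nhdsWithin_le_nhds
  have h' : ∀ s : Set (Eu d), (mpullbackWithin 𝓘(ℝ, Eu d) (𝓡 d) (chartOne d G).symm
      (mulInvariantVectorField w) (Set.range (𝓡 d)) : Eu d → Eu d) =ᶠ[𝓝[s] (coordOne d G)]
      fun a ↦ leftFrame d G a w := fun s ↦
    (mpullbackWithin_mulInvariantVectorField w).filter_mono nhdsWithin_le_nhds
  have h1 := EventuallyEq.lieBracketWithin_vectorField_eq_of_mem (𝕜 := ℝ) (h Set.univ) (h' Set.univ)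
    (Set.mem_univ _)
  have hs : ((chartOne d G).symm ⁻¹' Set.univ ∩ Set.range (𝓡 d)) = Set.univ := by
    simp
  have hd : DifferentiableAt ℝ (leftFrame d G) (coordOne d G) :=
    contDiffAt_leftFrame.differentiableAt (by simp)
  have hf : ∀ u : Eu d, fderiv ℝ (fun a ↦ leftFrame d G a u) (coordOne d G) =
      (fderiv ℝ (leftFrame d G) (coordOne d G)).flip u := by
    intro u
    ext1 z
    rw [fderiv_clm_apply hd (differentiableAt_const u)]
    simp
  -- The frame is the identity at `coordOne`, so the bracket of the two fields there is the
  -- antisymmetrised derivative of the frame.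
  have h2 : lieBracketWithin ℝ (fun a ↦ leftFrame d G a v) (fun a ↦ leftFrame d G a w) Set.univ
      (coordOne d G) = fderiv ℝ (leftFrame d G) (coordOne d G) v w -
      fderiv ℝ (leftFrame d G) (coordOne d G) w v := by
    rw [lieBracketWithin_univ]
    change fderiv ℝ (fun a ↦ leftFrame d G a w) (coordOne d G) (leftFrame d G _ v) -
      fderiv ℝ (fun a ↦ leftFrame d G a v) (coordOne d G) (leftFrame d G _ w) = _
    rw [leftFrame_one, hf v, hf w]
    rfl
  rw [← h2, ← h1, hs]
  rfl

variable (G) in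
/-- The bracket of the Lie algebra, on the coordinate space. -/
def lieCoord (v w : Eu d) : Eu d := Bracket.bracket (L := LieAlg d G) (M := LieAlg d G) v w

theorem lieCoord_eq (v w : Eu d) : lieCoord G v w =
    fderiv ℝ (leftFrame d G) (coordOne d G) v w - fderiv ℝ (leftFrame d G) (coordOne d G) w v :=
  lie_eq_leftFrame (G := G) v w

/-- The Maurer-Cartan form pulled back along a map to the group. -/
def maurerCartan (h : E → G) (x : E) : E →L[ℝ] Eu d :=
  fderiv ℝ (fun y ↦ chartOne d G ((h x)⁻¹ * h y)) x

/-- The adjoint action in the chart at the identity. -/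
def adCoord (g : G) : Eu d →L[ℝ] Eu d :=
  fderiv ℝ (fun b ↦ chartOne d G (g * (chartOne d G).symm b * g⁻¹)) (coordOne d G)

/-- The constant cancels in `(g h x)⁻¹ (g h y)`. This left invariance allows a gauge transformation
to be normalised to `1` at a given point. -/
theorem maurerCartan_mul_left (g : G) (h : E → G) :
    maurerCartan (d := d) (fun x ↦ g * h x) = maurerCartan h := by
  funext x
  simp only [maurerCartan, mul_inv_rev, mul_assoc, inv_mul_cancel_left]

/-- The form at `x` is the derivative in the second variable, taken on the diagonal, of `(x, y) ↦ (h
x)⁻¹ h y` read in the chart, which is jointly smooth near the diagonal point. -/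
theorem contDiffAt_maurerCartan {h : E → G} {u : E} (hh : ContMDiffAt 𝓘(ℝ, E) (𝓡 d) ∞ h u) :
    ContDiffAt ℝ ∞ (maurerCartan (d := d) h) u := by
  have h1 : ContMDiffAt 𝓘(ℝ, E × E) (𝓡 d) ∞ (fun q : E × E ↦ (h q.1)⁻¹ * h q.2) (u, u) :=
    (ContMDiffAt.comp (u, u) (g := h) hh contDiffAt_fst.contMDiffAt).inv.mul
      (ContMDiffAt.comp (u, u) (g := h) hh contDiffAt_snd.contMDiffAt)
  have h2 := contDiffAt_chartOne h1 (by simp)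
  exact contDiffAt_partial_right (φ := id) contDiffAt_id h2

theorem contDiffAt_adCoord_inv {h : E → G} {u : E} (hh : ContMDiffAt 𝓘(ℝ, E) (𝓡 d) ∞ h u) :
    ContDiffAt ℝ ∞ (fun x ↦ adCoord (d := d) (h x)⁻¹) u := by
  have h1 : ContMDiffAt 𝓘(ℝ, E × Eu d) (𝓡 d) ∞
      (fun q : E × Eu d ↦ (h q.1)⁻¹ * (chartOne d G).symm q.2 * (h q.1)⁻¹⁻¹) (u, coordOne d G) := by
    have h0 : ContMDiffAt 𝓘(ℝ, E × Eu d) (𝓡 d) ∞ (fun q : E × Eu d ↦ (h q.1)⁻¹)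
        (u, coordOne d G) :=
      (ContMDiffAt.comp (u, coordOne d G) (g := h) hh contDiffAt_fst.contMDiffAt).inv
    exact (h0.mul (contMDiffAt_chartOne_symm_comp contDiffAt_snd rfl)).mul h0.inv
  have h2 := contDiffAt_chartOne h1 (by simp only [chartOne_symm_coordOne]; group)
  exact contDiffAt_partial_right (φ := fun _ ↦ coordOne d G) contDiffAt_const h2

theorem differentiableAt_chartOne {f : E → G} {x : E} (hf : ContMDiffAt 𝓘(ℝ, E) (𝓡 d) ∞ f x)
    (h : f x = 1) : DifferentiableAt ℝ (fun y ↦ chartOne d G (f y)) x :=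
  (contDiffAt_chartOne hf h).differentiableAt (by simp)

theorem eventually_differentiableAt_chartMul : ∀ᶠ q in 𝓝 (coordOne d G, coordOne d G),
    DifferentiableAt ℝ (chartMul d G) q := by
  have := ((contDiffAt_chartMul (d := d) (G := G)).of_le (m := 1) (by simp)).eventually (by simp)
  filter_upwards [this] with q hq using hq.differentiableAt (by simp)

/-- The left-invariant frame carries the Maurer-Cartan form to the derivative. -/
theorem leftFrame_maurerCartan {h : E → G} {u : E}
    (hh : ∀ᶠ x in 𝓝 u, ContMDiffAt 𝓘(ℝ, E) (𝓡 d) ∞ h x) (hu : h u = 1) :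
    (fun x ↦ (leftFrame d G (chartOne d G (h x))).comp (maurerCartan h x)) =ᶠ[𝓝 u]
      fderiv ℝ (fun x ↦ chartOne d G (h x)) := by
  have hc : ContinuousAt (fun x ↦ (chartOne d G (h x), coordOne d G)) u :=
    ((contDiffAt_chartOne hh.self_of_nhds hu).continuousAt).prodMk continuousAt_const
  have hd : ∀ᶠ x in 𝓝 u, DifferentiableAt ℝ (chartMul d G) (chartOne d G (h x), coordOne d G) := by
    refine hc.eventually ?_
    beta_reduce
    rw [hu]
    exact eventually_differentiableAt_chartMul
  filter_upwards [hh, hd, eventually_chartOne_symm (d := d) hh.self_of_nhds.continuousAt hu] with x hx hdx hex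
  have h0 : ContMDiffAt 𝓘(ℝ, E) (𝓡 d) ∞ (fun y ↦ (h x)⁻¹ * h y) x := contMDiffAt_const.mul hx
  have h1 : HasFDerivAt (fun y ↦ chartOne d G ((h x)⁻¹ * h y)) (maurerCartan h x) x :=
    (differentiableAt_chartOne h0 (by simp)).hasFDerivAt
  have e1 : chartOne d G ((h x)⁻¹ * h x) = coordOne d G := by rw [inv_mul_cancel]
  have h2 : HasFDerivAt (fun b ↦ chartMul d G (chartOne d G (h x), b))
      (leftFrame d G (chartOne d G (h x))) (chartOne d G ((h x)⁻¹ * h x)) := by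
    rw [e1]
    exact (fderiv_partial_right hdx).differentiableAt.hasFDerivAt
  -- Chain rule for `h y = h x * ((h x)⁻¹ * h y)`: the outer map is left translation by `h x`, the
  -- inner one has derivative `maurerCartan h x`.
  have h3 := h2.comp x h1
  refine (h3.congr_of_eventuallyEq ?_).fderiv.symm
  filter_upwards [eventually_chartOne_symm (d := d) h0.continuousAt (by simp)] with y hy
  simp only [Function.comp, chartMul, hex, hy, mul_inv_cancel_left]

/-- The Maurer-Cartan equation. -/
theorem fderiv_maurerCartan {h : E → G} {u : E}
    (hh : ∀ᶠ x in 𝓝 u, ContMDiffAt 𝓘(ℝ, E) (𝓡 d) ∞ h x) (hu : h u = 1) (v w : E) :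
    fderiv ℝ (maurerCartan (d := d) h) u v w - fderiv ℝ (maurerCartan (d := d) h) u w v =
      -lieCoord G (maurerCartan h u v) (maurerCartan h u w) := by
  set η : E → Eu d := fun x ↦ chartOne d G (h x) with hη
  have hηs : ContDiffAt ℝ ∞ η u := contDiffAt_chartOne hh.self_of_nhds hu
  have hfr : DifferentiableAt ℝ (leftFrame d G) (η u) := by
    simp only [hη, hu]; exact contDiffAt_leftFrame.differentiableAt (by simp)
  have hmc := (contDiffAt_maurerCartan (d := d) hh.self_of_nhds).differentiableAt (by simp)
  have hev := leftFrame_maurerCartan hh hu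
  have hηu : fderiv ℝ η u = maurerCartan h u := by
    rw [← hev.self_of_nhds]
    beta_reduce
    rw [hu, leftFrame_one, ContinuousLinearMap.id_comp]
  have hcomp : HasFDerivAt (fun x ↦ leftFrame d G (η x))
      ((fderiv ℝ (leftFrame d G) (η u)).comp (fderiv ℝ η u)) u :=
    hfr.hasFDerivAt.comp u (hηs.differentiableAt (by simp)).hasFDerivAt
  have h1 := hcomp.clm_comp hmc.hasFDerivAt
  -- Differentiate `F(η) ∘ μ = dη` at `u`, where the frame `F` is the identity. The second
  -- derivative of `η` is symmetric, so antisymmetrisation leaves `dμ` and, by `lieCoord_eq`, the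
  -- bracket.
  have h2 : ∀ v w, fderiv ℝ (fderiv ℝ η) u v w =
      fderiv ℝ (maurerCartan (d := d) h) u v w +
        fderiv ℝ (leftFrame d G) (coordOne d G) (maurerCartan h u v) (maurerCartan h u w) := by
    intro v w
    rw [← hev.fderiv_eq, h1.fderiv, hηu]
    have e : η u = coordOne d G := by simp only [hη, hu]
    rw [e, leftFrame_one]
    simp
  have h3 : fderiv ℝ (fderiv ℝ η) u v w = fderiv ℝ (fderiv ℝ η) u w v :=
    (hηs.isSymmSndFDerivAt (by simpa using ENat.LEInfty.out)).eq v w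
  rw [h2, h2] at h3
  rw [lieCoord_eq, neg_sub, sub_eq_sub_iff_add_eq_add, h3, add_comm]

theorem adCoord_one : adCoord (d := d) (1 : G) = ContinuousLinearMap.id ℝ _ := by
  have : (fun b ↦ chartOne d G (1 * (chartOne d G).symm b * 1⁻¹)) =ᶠ[𝓝 (coordOne d G)] id := by
    filter_upwards [eventually_chartOne_coord (d := d) (G := G)] with b hb
    simp only [one_mul, inv_one, mul_one, hb, id]
  rw [adCoord, this.fderiv_eq, fderiv_id]

/-- The derivative of the adjoint action is the bracket. -/
theorem fderiv_adCoord_inv {h : E → G} {u : E}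
    (hh : ∀ᶠ x in 𝓝 u, ContMDiffAt 𝓘(ℝ, E) (𝓡 d) ∞ h x) (hu : h u = 1) (v : E) (l : Eu d) :
    fderiv ℝ (fun x ↦ adCoord (d := d) (h x)⁻¹) u v l = -lieCoord G (maurerCartan h u v) l := by
  set η : E → Eu d := fun x ↦ chartOne d G (h x) with hη
  have hηu1 : η u = coordOne d G := by simp only [hη, hu]
  have hηs : ContDiffAt ℝ ∞ η u := contDiffAt_chartOne hh.self_of_nhds hu
  have hfr : DifferentiableAt ℝ (leftFrame d G) (η u) := by
    rw [hηu1]; exact contDiffAt_leftFrame.differentiableAt (by simp)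
  have hηu : fderiv ℝ η u = maurerCartan h u := by
    rw [← (leftFrame_maurerCartan hh hu).self_of_nhds]
    beta_reduce
    rw [hu, leftFrame_one, ContinuousLinearMap.id_comp]
  have had := (contDiffAt_adCoord_inv (d := d) hh.self_of_nhds).differentiableAt (by simp)
  set R : Eu d → Eu d →L[ℝ] Eu d := fun a ↦
    fderiv ℝ (fun b ↦ chartMul d G (b, a)) (coordOne d G) with hR
  have hD2 : DifferentiableAt ℝ (fderiv ℝ (chartMul d G)) (coordOne d G, coordOne d G) :=
    (contDiffAt_chartMul.fderiv_right (m := ∞) (by simp)).differentiableAt (by simp)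
  have hev : ∀ᶠ a in 𝓝 (coordOne d G),
      DifferentiableAt ℝ (chartMul d G) (a, coordOne d G) ∧
      DifferentiableAt ℝ (chartMul d G) (coordOne d G, a) := by
    have h1 : ContinuousAt (fun a : Eu d ↦ (a, coordOne d G)) (coordOne d G) := by fun_prop
    have h2 : ContinuousAt (fun a : Eu d ↦ (coordOne d G, a)) (coordOne d G) := by fun_prop
    exact (h1.eventually eventually_differentiableAt_chartMul).and
      (h2.eventually eventually_differentiableAt_chartMul)
  set D := fderiv ℝ (fderiv ℝ (chartMul d G)) (coordOne d G, coordOne d G) with hD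
  have hL' : ∀ a b, fderiv ℝ (leftFrame d G) (coordOne d G) a b = D (a, 0) (0, b) := by
    intro a b
    have h1 : leftFrame d G =ᶠ[𝓝 (coordOne d G)] fun a ↦ (fderiv ℝ (chartMul d G)
        (a, coordOne d G)).comp (ContinuousLinearMap.inr ℝ _ _) := by
      filter_upwards [hev] with a ha using (fderiv_partial_right ha.1).fderiv
    have h2 := (HasFDerivAt.comp (coordOne d G) (f := fun a ↦ (a, coordOne d G)) hD2.hasFDerivAt
      (hasFDerivAt_prodMk_left (coordOne d G) (coordOne d G))).clm_comp
        (hasFDerivAt_const (ContinuousLinearMap.inr ℝ (Eu d) (Eu d)) _)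
    rw [(h2.congr_of_eventuallyEq h1).fderiv]
    simp [hD]
  have hR' : HasFDerivAt R ((((ContinuousLinearMap.compL ℝ _ _ _).flip
      (ContinuousLinearMap.inl ℝ _ _)).comp D).comp (ContinuousLinearMap.inr ℝ _ _))
      (coordOne d G) := by
    have h1 : R =ᶠ[𝓝 (coordOne d G)] fun a ↦ (fderiv ℝ (chartMul d G)
        (coordOne d G, a)).comp (ContinuousLinearMap.inl ℝ _ _) := by
      filter_upwards [hev] with a ha using (fderiv_partial_left ha.2).fderiv
    have h2 := (hD2.hasFDerivAt.comp (coordOne d G)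
      (hasFDerivAt_prodMk_right (coordOne d G) (coordOne d G))).clm_comp
        (hasFDerivAt_const (ContinuousLinearMap.inl ℝ (Eu d) (Eu d)) _)
    refine (h2.congr_of_eventuallyEq h1).congr_fderiv ?_
    ext1 a
    ext1 b
    simp [hD]
  have hsymm : ∀ a b, D (0, a) (b, 0) = D (b, 0) (0, a) := fun a b ↦
    (contDiffAt_chartMul.isSymmSndFDerivAt (by simpa using ENat.LEInfty.out)).eq _ _
  -- Right translation by `h x` is conjugation by `(h x)⁻¹` followed by left translation by `h x`.
  -- Differentiation at `u` involves only the mixed second derivative `D` of the product; its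
  -- symmetry expresses the derivative of `R` through that of the left frame, and the bracket
  -- appears as the difference.
  have hkey : (fun x ↦ R (η x)) =ᶠ[𝓝 u] fun x ↦ (leftFrame d G (η x)).comp (adCoord (h x)⁻¹) := by
    have hc : Tendsto η (𝓝 u) (𝓝 (coordOne d G)) := by
      rw [← hηu1]; exact hηs.continuousAt
    filter_upwards [hh, hc.eventually hev,
      eventually_chartOne_symm (d := d) hh.self_of_nhds.continuousAt hu] with x hx hdx hex
    have h0 : ContMDiffAt 𝓘(ℝ, Eu d) (𝓡 d) ∞
        (fun b ↦ (h x)⁻¹ * (chartOne d G).symm b * (h x)⁻¹⁻¹) (coordOne d G) :=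
      (contMDiffAt_const.mul (contMDiffAt_chartOne_symm_comp contDiffAt_id rfl)).mul
        contMDiffAt_const
    have h01 : (h x)⁻¹ * (chartOne d G).symm (coordOne d G) * (h x)⁻¹⁻¹ = 1 := by
      rw [chartOne_symm_coordOne]; group
    have h1 : HasFDerivAt (fun b ↦ chartOne d G ((h x)⁻¹ * (chartOne d G).symm b * (h x)⁻¹⁻¹))
        (adCoord (h x)⁻¹) (coordOne d G) := (differentiableAt_chartOne h0 h01).hasFDerivAt
    have h2 : HasFDerivAt (fun b ↦ chartMul d G (η x, b))
      (leftFrame d G (η x)) (chartOne d G ((h x)⁻¹ * (chartOne d G).symm (coordOne d G) *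
        (h x)⁻¹⁻¹)) := by
      rw [h01]
      exact (fderiv_partial_right hdx.1).differentiableAt.hasFDerivAt
    refine ((h2.comp (coordOne d G) h1).congr_of_eventuallyEq ?_).fderiv
    filter_upwards [eventually_chartOne_symm (d := d) h0.continuousAt h01] with b hb
    simp only [Function.comp, chartMul, hη, hex, hb]
    congr 1
    group
  have h1 := (hR'.congr_of_eventuallyEq (EventuallyEq.refl _ _))
  rw [← hηu1] at h1
  have h2 := h1.comp u (hηs.differentiableAt (by simp)).hasFDerivAt
  have h3 := (hfr.hasFDerivAt.comp u (hηs.differentiableAt (by simp)).hasFDerivAt).clm_comp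
    had.hasFDerivAt
  have h4 := DFunLike.congr_fun (DFunLike.congr_fun
    ((h3.congr_of_eventuallyEq hkey).unique h2) v) l
  simp only [Function.comp_apply] at h4
  rw [hηu, hηu1, leftFrame_one, hu, inv_one, adCoord_one] at h4
  simp only [ContinuousLinearMap.comp_apply, add_apply, ContinuousLinearMap.compL_apply,
    ContinuousLinearMap.flip_apply, ContinuousLinearMap.inr_apply, ContinuousLinearMap.inl_apply,
    ContinuousLinearMap.id_apply, hsymm, ← hL'] at h4
  rw [lieCoord_eq, neg_sub, ← h4, add_sub_cancel_right]

theorem contMDiffAt_conj_symm (g : G) : ContMDiffAt 𝓘(ℝ, Eu d) (𝓡 d) ∞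
    (fun b ↦ g * (chartOne d G).symm b * g⁻¹) (coordOne d G) :=
  (contMDiffAt_const.mul (contMDiffAt_chartOne_symm_comp contDiffAt_id rfl)).mul contMDiffAt_const

theorem conj_symm_coordOne (g : G) : g * (chartOne d G).symm (coordOne d G) * g⁻¹ = 1 := by
  rw [chartOne_symm_coordOne]; group

theorem hasFDerivAt_conj (g : G) :
    HasFDerivAt (fun b ↦ chartOne d G (g * (chartOne d G).symm b * g⁻¹)) (adCoord g)
      (coordOne d G) :=
  (differentiableAt_chartOne (contMDiffAt_conj_symm g) (conj_symm_coordOne g)).hasFDerivAt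

theorem adCoord_mul (g h : G) : adCoord (d := d) (g * h) = (adCoord g).comp (adCoord h) := by
  have h1 := hasFDerivAt_conj (d := d) g
  have e : chartOne d G (h * (chartOne d G).symm (coordOne d G) * h⁻¹) = coordOne d G := by
    rw [conj_symm_coordOne]
  rw [← e] at h1
  have h2 := h1.comp (coordOne d G) (hasFDerivAt_conj (d := d) h)
  refine (h2.congr_of_eventuallyEq ?_).fderiv
  filter_upwards [eventually_chartOne_symm (d := d) (contMDiffAt_conj_symm h).continuousAt
    (conj_symm_coordOne h)] with b hb
  simp only [Function.comp, hb]
  congr 1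
  group

/-- The adjoint action preserves the bracket. -/
theorem adCoord_lie (g : G) (v w : Eu d) :
    adCoord g (lieCoord G v w) = lieCoord G (adCoord g v) (adCoord g w) := by
  set c : Eu d → Eu d := fun b ↦ chartOne d G (g * (chartOne d G).symm b * g⁻¹) with hc
  have hcs : ContDiffAt ℝ ∞ c (coordOne d G) :=
    contDiffAt_chartOne (contMDiffAt_conj_symm g) (conj_symm_coordOne g)
  have hc1 : c (coordOne d G) = coordOne d G := by simp only [hc, conj_symm_coordOne]
  have hcd : ∀ᶠ a in 𝓝 (coordOne d G), DifferentiableAt ℝ c a := by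
    filter_upwards [(hcs.of_le (m := 1) (by simp)).eventually (by simp)] with q hq
      using hq.differentiableAt (by simp)
  have hct : Tendsto c (𝓝 (coordOne d G)) (𝓝 (coordOne d G)) := by
    have := hcs.continuousAt
    rwa [ContinuousAt, hc1] at this
  have hmd : ∀ᶠ a in 𝓝 (coordOne d G), DifferentiableAt ℝ (chartMul d G) (a, coordOne d G) := by
    have h1 : ContinuousAt (fun a : Eu d ↦ (a, coordOne d G)) (coordOne d G) := by fun_prop
    exact h1.eventually eventually_differentiableAt_chartMul
  -- Conjugation is a homomorphism, `c (a b) = c a * c b`; this is its derivative in `b` at the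
  -- identity. After a further derivative in `a`, the symmetric second derivative of `c` drops out
  -- of the antisymmetrisation.
  have key : (fun a ↦ (fderiv ℝ c a).comp (leftFrame d G a)) =ᶠ[𝓝 (coordOne d G)]
      fun a ↦ (leftFrame d G (c a)).comp (adCoord g) := by
    filter_upwards [hcd, hmd, hct.eventually hmd, eventually_chartOne_coord (d := d) (G := G),
      eventually_chartOne_symm (d := d) (contMDiffAt_conj_symm g).continuousAt
        (conj_symm_coordOne g), extChartAt_target_mem_nhds (I := 𝓡 d) (1 : G)]
      with a ha1 ha2 ha3 ha4 ha5 ha6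
    have e1 : chartMul d G (a, coordOne d G) = a := by
      simp only [chartMul, chartOne_symm_coordOne, mul_one, ha4]
    have h1 : HasFDerivAt c (fderiv ℝ c a) (chartMul d G (a, coordOne d G)) := by
      rw [e1]; exact ha1.hasFDerivAt
    have h2 := h1.comp (coordOne d G) (fderiv_partial_right ha2).differentiableAt.hasFDerivAt
    have h3 : HasFDerivAt (fun b ↦ chartMul d G (c a, b)) (leftFrame d G (c a))
        (c (coordOne d G)) := by
      rw [hc1]; exact (fderiv_partial_right ha3).differentiableAt.hasFDerivAt
    have h4 := h3.comp (coordOne d G) (hasFDerivAt_conj (d := d) g)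
    refine h2.unique (h4.congr_of_eventuallyEq ?_)
    have hs : ContinuousAt (fun b ↦ (chartOne d G).symm a * (chartOne d G).symm b)
        (coordOne d G) :=
      ((contMDiff_mul_left (I := 𝓡 d) (n := ∞)
        (a := (chartOne d G).symm a)).continuous.continuousAt).comp
          contMDiffAt_chartOne_symm.continuousAt
    have hs' : ∀ᶠ g' in 𝓝 ((chartOne d G).symm a * (chartOne d G).symm (coordOne d G)),
        g' ∈ (chartOne d G).source := by
      rw [chartOne_symm_coordOne, mul_one]
      exact extChartAt_source_mem_nhds' ((chartOne d G).map_target ha6)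
    filter_upwards [hs.eventually hs', eventually_chartOne_symm (d := d)
      (contMDiffAt_conj_symm g).continuousAt (conj_symm_coordOne g)] with b hb1 hb2
    simp only [Function.comp, chartMul, hc, ha5, hb2, (chartOne d G).left_inv hb1]
    congr 1
    group
  have hfr : DifferentiableAt ℝ (leftFrame d G) (coordOne d G) :=
    contDiffAt_leftFrame.differentiableAt (by simp)
  have hfr' : HasFDerivAt (leftFrame d G) (fderiv ℝ (leftFrame d G) (coordOne d G))
      (c (coordOne d G)) := by rw [hc1]; exact hfr.hasFDerivAt
  have h1 := ((hcs.fderiv_right (m := ∞) (by simp)).differentiableAt (by simp)).hasFDerivAt.clm_comp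
    hfr.hasFDerivAt
  have h2 := (hfr'.comp _ (hasFDerivAt_conj (d := d) g)).clm_comp
    (hasFDerivAt_const (adCoord (d := d) g) _)
  have h3 := (h1.congr_of_eventuallyEq key.symm).unique h2
  have h4 : ∀ v w, fderiv ℝ (leftFrame d G) (coordOne d G) (adCoord g v) (adCoord g w) =
      adCoord g (fderiv ℝ (leftFrame d G) (coordOne d G) v w) +
        fderiv ℝ (fderiv ℝ c) (coordOne d G) v w := by
    intro v w
    have h5 := DFunLike.congr_fun (DFunLike.congr_fun h3 v) w
    rw [leftFrame_one, show fderiv ℝ c (coordOne d G) = adCoord g from rfl] at h5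
    simpa using h5.symm
  have h6 : fderiv ℝ (fderiv ℝ c) (coordOne d G) v w = fderiv ℝ (fderiv ℝ c) (coordOne d G) w v :=
    (hcs.isSymmSndFDerivAt (by simpa using ENat.LEInfty.out)).eq v w
  rw [lieCoord_eq, lieCoord_eq, h4, h4, h6, map_sub]
  abel

theorem lieCoord_add_left (a b c : Eu d) :
    lieCoord G (a + b) c = lieCoord G a c + lieCoord G b c :=
  add_lie (L := LieAlg d G) (M := LieAlg d G) a b c

theorem lieCoord_add_right (a b c : Eu d) :
    lieCoord G a (b + c) = lieCoord G a b + lieCoord G a c :=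
  lie_add (L := LieAlg d G) (M := LieAlg d G) a b c

theorem lieCoord_swap (a b : Eu d) : lieCoord G a b = -lieCoord G b a :=
  (lie_skew (L := LieAlg d G) a b).symm

variable (G) in
/-- The value of the curvature of a connection form on a domain. -/
def curvAt (A : E → E →L[ℝ] Eu d) (u v w : E) : Eu d :=
  fderiv ℝ A u v w - fderiv ℝ A u w v + lieCoord G (A u v) (A u w)

/-- The gauge transformation of a connection form. -/
def gauge (h : E → G) (A : E → E →L[ℝ] Eu d) (x : E) : E →L[ℝ] Eu d :=
  (adCoord (h x)⁻¹).comp (A x) + maurerCartan h x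

/-- At `u` the adjoint factor is the identity. Its derivative contributes `-[μ v, A w] + [μ w, A v]`
and the Maurer–Cartan equation contributes `-[μ v, μ w]`; these cancel the extra terms of `[A v + μ
v, A w + μ w]`. -/
theorem curvAt_gauge_of_one {h : E → G} {u : E}
    (hh : ∀ᶠ x in 𝓝 u, ContMDiffAt 𝓘(ℝ, E) (𝓡 d) ∞ h x) (hu : h u = 1)
    {A : E → E →L[ℝ] Eu d} (hA : DifferentiableAt ℝ A u) (v w : E) :
    curvAt G (gauge h A) u v w = curvAt G A u v w := by
  have had := (contDiffAt_adCoord_inv (d := d) hh.self_of_nhds).differentiableAt (by simp)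
  have hmc := (contDiffAt_maurerCartan (d := d) hh.self_of_nhds).differentiableAt (by simp)
  have h1 : HasFDerivAt (gauge h A) _ u :=
    (had.hasFDerivAt.clm_comp hA.hasFDerivAt).add hmc.hasFDerivAt
  have hone : adCoord (d := d) (h u)⁻¹ = ContinuousLinearMap.id ℝ _ := by
    rw [hu, inv_one, adCoord_one]
  have h2 := fderiv_maurerCartan hh hu v w
  have h3 := fderiv_adCoord_inv hh hu v (A u w)
  have h4 := fderiv_adCoord_inv hh hu w (A u v)
  rw [curvAt, h1.fderiv]
  simp only [gauge, hone, ContinuousLinearMap.comp_apply, add_apply,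
    ContinuousLinearMap.compL_apply, ContinuousLinearMap.flip_apply,
    ContinuousLinearMap.id_apply, h3, h4, lieCoord_add_left, lieCoord_add_right, curvAt]
  rw [sub_eq_iff_eq_add] at h2
  rw [h2, lieCoord_swap (A u v) (maurerCartan h u w)]
  abel

/-- The curvature of a gauge transform. -/
theorem curvAt_gauge {h : E → G} {u : E}
    (hh : ∀ᶠ x in 𝓝 u, ContMDiffAt 𝓘(ℝ, E) (𝓡 d) ∞ h x)
    {A : E → E →L[ℝ] Eu d} (hA : DifferentiableAt ℝ A u) (v w : E) :
    curvAt G (gauge h A) u v w = adCoord (h u)⁻¹ (curvAt G A u v w) := by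
  -- Split off the constant `h u`: the gauge transformation by `h` is the constant one followed by
  -- `k`, which is `1` at `u`. The constant one only applies `Ad`, which preserves brackets.
  set k : E → G := fun x ↦ (h u)⁻¹ * h x with hk
  set A₁ : E → E →L[ℝ] Eu d := fun x ↦ (adCoord (h u)⁻¹).comp (A x) with hA₁
  have e : gauge h A = gauge k A₁ := by
    funext x
    simp only [gauge, hk, hA₁, mul_inv_rev, inv_inv, adCoord_mul, maurerCartan_mul_left]
    congr 1
    rw [ContinuousLinearMap.comp_assoc, ← ContinuousLinearMap.comp_assoc _ _ (A x), ← adCoord_mul,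
      mul_inv_cancel, adCoord_one, ContinuousLinearMap.id_comp]
  have hd : HasFDerivAt A₁ _ u := (hasFDerivAt_const (adCoord (d := d) (h u)⁻¹) u).clm_comp
    hA.hasFDerivAt
  rw [e, curvAt_gauge_of_one (h := k) (hh.mono fun x hx ↦ contMDiffAt_const.mul hx) (by simp [hk])
    hd.differentiableAt, curvAt, hd.fderiv, curvAt]
  simp only [hA₁, map_add, map_sub, adCoord_lie]
  simp

end LieGroupChart

/-! ### The adjoint action and the Maurer–Cartan form as manifold derivatives -/

section LieGroupDerivatives
variable {d : ℕ} {G : Type u} [TopologicalSpace G] [ChartedSpace (Eu d) G] [Group G]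
  [LieGroup (𝓡 d) ∞ G] {m : ℕ}

theorem Ad_apply (g : G) (l : LieAlg d G) : Ad d g l = adCoord g l := by
  have h1 : ContMDiff (𝓡 d) (𝓡 d) ∞ (fun h : G ↦ g * h * g⁻¹) :=
    (contMDiff_const.mul contMDiff_id).mul contMDiff_const
  have h2 : MDifferentiableAt (𝓡 d) (𝓡 d) (fun h : G ↦ g * h * g⁻¹) 1 :=
    h1.mdifferentiableAt (by simp)
  have e : g * 1 * g⁻¹ = (1 : G) := by group
  change mfderiv (𝓡 d) (𝓡 d) (fun h : G ↦ g * h * g⁻¹) 1 l = _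
  refine (DFunLike.congr_fun h2.mfderiv l).trans ?_
  -- The derivative reads the target in the chart at `g * 1 * g⁻¹`, which equals `1` only
  -- propositionally; hence the generalisation over the base point `b`.
  have h : ∀ b, b = (1 : G) → ∀ f : G → G, (fderivWithin ℝ
      (fun z ↦ extChartAt (𝓡 d) b (f ((extChartAt (𝓡 d) (1 : G)).symm z))) (Set.range (𝓡 d))
      (extChartAt (𝓡 d) (1 : G) 1) : Eu d →L[ℝ] Eu d) =
      fderiv ℝ (fun z ↦ chartOne d G (f ((chartOne d G).symm z))) (coordOne d G) := by
    rintro b rfl f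
    rw [ModelWithCorners.range_eq_univ, fderivWithin_univ]
  exact DFunLike.congr_fun (h _ e fun k ↦ g * k * g⁻¹) l

theorem mfderiv_inv_mul_eq_maurerCartan {h : Eu m → G} (hh : ContMDiff (𝓡 m) (𝓡 d) ∞ h)
    (x w : Eu m) : (mfderiv (𝓡 d) (𝓡 d) (fun k : G ↦ (h x)⁻¹ * k) (h x)
      (mfderiv (𝓡 m) (𝓡 d) h x w) : Eu d) = maurerCartan h x w := by
  have h0 : MDifferentiableAt (𝓡 m) (𝓡 d) h x := hh.mdifferentiableAt (by simp)
  have h1 : MDifferentiableAt (𝓡 d) (𝓡 d) (fun k : G ↦ (h x)⁻¹ * k) (h x) :=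
    (contMDiff_mul_left (n := ∞)).mdifferentiableAt (by simp)
  have h2 := mfderiv_comp x h1 h0
  have h3 : MDifferentiableAt (𝓡 m) (𝓡 d) ((fun k : G ↦ (h x)⁻¹ * k) ∘ h) x := h1.comp x h0
  have h4 := DFunLike.congr_fun h2 w
  refine h4.symm.trans ?_
  have e : (h x)⁻¹ * h x = 1 := inv_mul_cancel _
  refine (DFunLike.congr_fun h3.mfderiv w).trans ?_
  have h' : ∀ b, b = (1 : G) → ∀ f : Eu m → G, (fderivWithin ℝ (fun z ↦ extChartAt (𝓡 d) b (f z))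
      (Set.range (𝓡 m)) x : Eu m →L[ℝ] Eu d) = fderiv ℝ (fun z ↦ chartOne d G (f z)) x := by
    rintro b rfl f
    rw [ModelWithCorners.range_eq_univ, fderivWithin_univ]
  exact DFunLike.congr_fun (h' _ e _) w

end LieGroupDerivatives

/-! ### Values of forms on vectors in low degree -/

section FormValues
variable {X : Type*} [DiffeologicalSpace X] {k m : ℕ}

theorem Form.contDiff_val_apply (a : Form X k) (p : Plot X m) (v : Fin k → Eu m) :
    ContDiff ℝ ∞ fun x ↦ a.val p x v :=
  (ContinuousAlternatingMap.apply ℝ (Eu m) ℝ v).contDiff.comp (a.contDiff_val p)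

theorem Form.d_val (a : Form X k) (p : Plot X m) (x : Eu m) (v : Fin (k + 1) → Eu m) :
    (Form.d a).val p x v = ∑ i : Fin (k + 1), (-1 : ℝ) ^ (i : ℕ) *
      fderiv ℝ (fun x ↦ a.val p x (i.removeNth v)) x (v i) := by
  refine (extDeriv_apply ((a.contDiff_val p).differentiable (by simp) x) v).trans ?_
  exact Finset.sum_congr rfl fun i _ ↦ by simp

theorem wedge_one_one_apply {V : Type*} [NormedAddCommGroup V] [NormedSpace ℝ V]
    (a b : V [⋀^Fin 1]→L[ℝ] ℝ) (v w : V) : wedge a b ![v, w] =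
      a (fun _ ↦ v) * b (fun _ ↦ w) - a (fun _ ↦ w) * b (fun _ ↦ v) := by
  rw [wedge_apply, show (Finset.univ : Finset (Equiv.Perm (Fin (1 + 1)))) =
    {1, Equiv.swap 0 1} from by decide, Finset.sum_pair (by decide)]
  have e : ∀ (c : V [⋀^Fin 1]→L[ℝ] ℝ) (f : Fin 1 → V), c f = c (fun _ ↦ f 0) := fun c f ↦
    congrArg c (funext fun i ↦ by rw [Subsingleton.elim i 0])
  rw [e a, e b, e a, e b]
  simp [Fin.castAdd, Fin.natAdd, Fin.castLE]
  ring

end FormValues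

/-! ### Lie algebra valued forms along plots -/

section ConnectionForm
variable {d : ℕ} {G : Type u} [TopologicalSpace G] [ChartedSpace (Eu d) G] [Group G]
  [LieGroup (𝓡 d) ∞ G] {X Y : Type*} [DiffeologicalSpace X] [DiffeologicalSpace Y] {m n : ℕ}

/-- The coordinates of an element of the Lie algebra. -/
def lieVec (l : LieAlg d G) : Eu d := l

/-- Evaluation of a Lie algebra valued form along a plot, in coordinates. -/
def vcoord {k : ℕ} (p : Plot X m) (u : Eu m) (w : Fin k → Eu m) :
    Form X k ⊗[ℝ] LieAlg d G →ₗ[ℝ] Eu d where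
  toFun Θ := veval (L := LieAlg d G) p u w Θ
  map_add' := map_add (veval (L := LieAlg d G) p u w)
  map_smul' := map_smul (veval (L := LieAlg d G) p u w)

theorem vcoord_tmul {k : ℕ} (p : Plot X m) (u : Eu m) (w : Fin k → Eu m) (a : Form X k)
    (l : LieAlg d G) : vcoord p u w (a ⊗ₜ[ℝ] l) = a.val p u w • lieVec l := rfl

theorem vcoord_vpull {k : ℕ} (f : X → Y) (hf : DSmooth f) (p : Plot X m) (u : Eu m)
    (w : Fin k → Eu m) (Θ : Form Y k ⊗[ℝ] LieAlg d G) :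
    vcoord p u w (vpull f hf Θ) = vcoord (p.map f hf) u w Θ := by
  induction Θ with
  | zero => simp only [map_zero]
  | tmul a l => rfl
  | add Θ Θ' h h' => simp only [map_add, h, h']

/-- A Lie algebra valued `1`-form along a plot. -/
def conn (Θ : Form X 1 ⊗[ℝ] LieAlg d G) (p : Plot X m) (x : Eu m) : Eu m →L[ℝ] Eu d :=
  LinearMap.toContinuousLinearMap
    { toFun := fun w ↦ vcoord p x (fun _ ↦ w) Θ
      map_add' := fun v w ↦ by
        induction Θ with
        | zero => simp only [map_zero, add_zero]
        | tmul a l =>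
          have h := (a.val p x).map_update_add (fun _ ↦ v) 0 v w
          have e : ∀ z : Eu m, Function.update (fun _ : Fin 1 ↦ v) 0 z = fun _ ↦ z := fun z ↦
            funext fun i ↦ by rw [Subsingleton.elim i 0, Function.update_self]
          rw [e, e, e] at h
          rw [vcoord_tmul, vcoord_tmul, vcoord_tmul, h, add_smul]
        | add Θ Θ' h h' =>
          simp only [map_add] at h h' ⊢
          rw [h, h']
          abel
      map_smul' := fun c w ↦ by
        induction Θ with
        | zero => simp only [map_zero, smul_zero]
        | tmul a l =>
          have h := (a.val p x).map_update_smul (fun _ ↦ w) 0 c w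
          have e : ∀ z : Eu m, Function.update (fun _ : Fin 1 ↦ w) 0 z = fun _ ↦ z := fun z ↦
            funext fun i ↦ by rw [Subsingleton.elim i 0, Function.update_self]
          rw [e, e] at h
          rw [vcoord_tmul, vcoord_tmul, h, smul_assoc]
          rfl
        | add Θ Θ' h h' =>
          simp only [map_add] at h h' ⊢
          rw [h, h', smul_add] }

theorem conn_apply (Θ : Form X 1 ⊗[ℝ] LieAlg d G) (p : Plot X m) (x w : Eu m) :
    conn Θ p x w = vcoord p x (fun _ ↦ w) Θ := rfl

theorem conn_add (Θ Θ' : Form X 1 ⊗[ℝ] LieAlg d G) (p : Plot X m) (x : Eu m) :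
    conn (Θ + Θ') p x = conn Θ p x + conn Θ' p x := by
  ext1 w
  exact map_add (vcoord p x fun _ ↦ w) Θ Θ'

theorem conn_tmul (a : Form X 1) (l : LieAlg d G) (p : Plot X m) (x w : Eu m) :
    conn (a ⊗ₜ[ℝ] l) p x w = a.val p x (fun _ ↦ w) • lieVec l := rfl

theorem conn_zero (p : Plot X m) (x : Eu m) :
    conn (0 : Form X 1 ⊗[ℝ] LieAlg d G) p x = 0 := by
  ext1 w
  exact map_zero (vcoord (d := d) (G := G) (k := 1) p x fun _ ↦ w)

theorem conn_vpull (f : X → Y) (hf : DSmooth f) (p : Plot X m)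
    (Θ : Form Y 1 ⊗[ℝ] LieAlg d G) : conn (vpull f hf Θ) p = conn Θ (p.map f hf) :=
  funext fun x ↦ ContinuousLinearMap.ext fun _ ↦ vcoord_vpull f hf p x _ Θ

theorem conn_reparam (Θ : Form X 1 ⊗[ℝ] LieAlg d G) (p : Plot X m) {f : Eu n → Eu m}
    (hf : ContDiff ℝ ∞ f) (x : Eu n) :
    conn Θ (p.reparam f hf) x = (conn Θ p (f x)).comp (fderiv ℝ f x) := by
  ext1 w
  induction Θ with
  | zero => rw [conn_zero, conn_zero]; rfl
  | tmul a l =>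
    rw [ContinuousLinearMap.comp_apply, conn_tmul, conn_tmul, a.val_reparam]
    rfl
  | add Θ Θ' h h' =>
    rw [conn_add, conn_add, ContinuousLinearMap.add_comp, add_apply, add_apply, h, h']

theorem contDiff_conn (Θ : Form X 1 ⊗[ℝ] LieAlg d G) (p : Plot X m) :
    ContDiff ℝ ∞ (conn Θ p) := by
  induction Θ with
  | zero => rw [show conn (0 : Form X 1 ⊗[ℝ] LieAlg d G) p = fun _ ↦ 0 from
      funext fun x ↦ conn_zero p x]; exact contDiff_const
  | tmul a l =>
    rw [contDiff_clm_apply_iff]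
    intro w
    simp only [conn_tmul]
    exact (a.contDiff_val_apply p _).smul contDiff_const
  | add Θ Θ' h h' =>
    rw [show conn (Θ + Θ') p = fun x ↦ conn Θ p x + conn Θ' p x from
      funext fun x ↦ conn_add Θ Θ' p x]
    exact h.add h'

theorem vcoord_d (Θ : Form X 1 ⊗[ℝ] LieAlg d G) (p : Plot X m) (x v w : Eu m) :
    vcoord p x ![v, w] (Form.d.rTensor (LieAlg d G) Θ) =
      fderiv ℝ (conn Θ p) x v w - fderiv ℝ (conn Θ p) x w v := by
  induction Θ with
  | zero =>
    rw [show conn (0 : Form X 1 ⊗[ℝ] LieAlg d G) p = fun _ ↦ 0 from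
      funext fun x ↦ conn_zero p x]
    simp only [map_zero, fderiv_fun_const]
    simp
  | tmul a l =>
    have h : ∀ v w : Eu m, fderiv ℝ (conn (a ⊗ₜ[ℝ] l) p) x v w =
        fderiv ℝ (fun x ↦ a.val p x (fun _ ↦ w)) x v • lieVec l := by
      intro v w
      have h1 := ((contDiff_conn (a ⊗ₜ[ℝ] l) p).differentiable (by simp) x).hasFDerivAt.clm_apply
        (hasFDerivAt_const w x)
      have h2 := HasFDerivAt.smul_const (𝕜 := ℝ) (F := Eu d)
        ((a.contDiff_val_apply p (fun _ ↦ w)).differentiable (by simp) x).hasFDerivAt (lieVec l)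
      have h3 := DFunLike.congr_fun (h1.unique h2) v
      simpa only [add_apply, ContinuousLinearMap.comp_zero, zero_add, add_zero,
        ContinuousLinearMap.flip_apply, zero_apply,
        ContinuousLinearMap.smulRight_apply] using h3
    rw [LinearMap.rTensor_tmul, vcoord_tmul, h, h, Form.d_val, Fin.sum_univ_two]
    have e0 : ∀ f : Fin 1 → Eu m, f = fun _ ↦ f 0 := fun f ↦
      funext fun i ↦ by rw [Subsingleton.elim i 0]
    have e1 : Fin.removeNth (0 : Fin 2) ![v, w] = fun _ ↦ w := e0 _
    have e2 : Fin.removeNth (1 : Fin 2) ![v, w] = fun _ ↦ v := e0 _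
    rw [e1, e2, ← sub_smul]
    congr 1
    simp
    ring
  | add Θ Θ' h h' =>
    rw [show conn (Θ + Θ') p = fun x ↦ conn Θ p x + conn Θ' p x from
      funext fun x ↦ conn_add Θ Θ' p x, map_add, map_add, h, h']
    rw [fderiv_fun_add ((contDiff_conn Θ p).differentiable (by simp) x)
      ((contDiff_conn Θ' p).differentiable (by simp) x)]
    simp only [add_apply]
    abel

theorem lieCoord_smul_smul (r s : ℝ) (a b : Eu d) :
    lieCoord G (r • a) (s • b) = (r * s) • lieCoord G a b := by
  have h : ∀ l l' : LieAlg d G, ⁅r • l, s • l'⁆ = (r * s) • ⁅l, l'⁆ := fun l l' ↦ by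
    rw [smul_lie, lie_smul, smul_smul]
  exact h a b

theorem lieCoord_zero_left (a : Eu d) : lieCoord G 0 a = 0 := by
  simpa using lieCoord_smul_smul (G := G) 0 1 0 a

theorem lieCoord_zero_right (a : Eu d) : lieCoord G a 0 = 0 := by
  rw [lieCoord_swap, lieCoord_zero_left, neg_zero]

theorem bracket_tmul {k l : ℕ} (a : Form X k) (b : Form X l) (x y : LieAlg d G) :
    bracket (a ⊗ₜ[ℝ] x) (b ⊗ₜ[ℝ] y) = a.wedge b ⊗ₜ[ℝ] ⁅x, y⁆ := rfl

theorem vcoord_bracket (Θ Θ' : Form X 1 ⊗[ℝ] LieAlg d G) (p : Plot X m) (x v w : Eu m) :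
    vcoord p x ![v, w] (bracket Θ Θ') =
      lieCoord G (conn Θ p x v) (conn Θ' p x w) - lieCoord G (conn Θ p x w) (conn Θ' p x v) := by
  induction Θ with
  | zero =>
    simp only [map_zero, LinearMap.zero_apply, conn_apply, lieCoord_zero_left, sub_zero]
  | add Θ₁ Θ₂ h h' =>
    simp only [map_add, LinearMap.add_apply, conn_add, add_apply, lieCoord_add_left, h, h']
    abel
  | tmul a l =>
    induction Θ' with
    | zero =>
      simp only [map_zero, conn_apply, lieCoord_zero_right, sub_zero]
    | add Θ₁ Θ₂ h h' =>
      simp only [map_add, conn_add, add_apply, lieCoord_add_right, h, h']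
      abel
    | tmul a' l' =>
      rw [bracket_tmul, vcoord_tmul]
      have e : (a.wedge a').val p x ![v, w] = a.val p x (fun _ ↦ v) *
          a'.val p x (fun _ ↦ w) - a.val p x (fun _ ↦ w) * a'.val p x (fun _ ↦ v) :=
        wedge_one_one_apply _ _ _ _
      rw [conn_tmul, conn_tmul, conn_tmul, conn_tmul, lieCoord_smul_smul, lieCoord_smul_smul,
        ← sub_smul, ← e]
      rfl

/-- The curvature along a plot. -/
theorem vcoord_curvature (Θ : Form X 1 ⊗[ℝ] LieAlg d G) (p : Plot X m) (x v w : Eu m) :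
    vcoord p x ![v, w] (curvature Θ) = curvAt G (conn Θ p) x v w := by
  -- The bracket of `Θ` with itself evaluates to twice `[A v, A w]`; this is what the factor `1 / 2`
  -- in `curvature` compensates.
  rw [curvature, map_add, map_smul, vcoord_d, vcoord_bracket, lieCoord_swap (conn Θ p x w), curvAt,
    sub_neg_eq_add, ← two_smul ℝ, smul_smul]
  norm_num

end ConnectionForm

/-! ### Coordinates on products of Euclidean spaces -/

section Join
variable {n m k : ℕ}

/-- Joining of vectors as a continuous linear map. -/
def joinL (n m : ℕ) : (Eu n × Eu m) →L[ℝ] Eu (n + m) :=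
  LinearMap.toContinuousLinearMap
    { toFun := fun x ↦ join x.1 x.2
      map_add' := fun x y ↦ by
        ext i
        refine Fin.addCases (fun i ↦ ?_) (fun i ↦ ?_) i <;> simp [join]
      map_smul' := fun c x ↦ by
        ext i
        refine Fin.addCases (fun i ↦ ?_) (fun i ↦ ?_) i <;> simp [join] }

/-- The first coordinates. -/
def fstL (n m : ℕ) : Eu (n + m) →L[ℝ] Eu n :=
  LinearMap.toContinuousLinearMap
    { toFun := fun w ↦ WithLp.toLp 2 fun i ↦ w (Fin.castAdd m i)
      map_add' := fun _ _ ↦ rfl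
      map_smul' := fun _ _ ↦ rfl }

/-- The last coordinates. -/
def sndL (n m : ℕ) : Eu (n + m) →L[ℝ] Eu m :=
  LinearMap.toContinuousLinearMap
    { toFun := fun w ↦ WithLp.toLp 2 fun i ↦ w (Fin.natAdd n i)
      map_add' := fun _ _ ↦ rfl
      map_smul' := fun _ _ ↦ rfl }

theorem joinL_apply (x : Eu n × Eu m) : joinL n m x = join x.1 x.2 := rfl

@[simp] theorem fstL_join (t : Eu n) (x : Eu m) : fstL n m (join t x) = t := by
  ext i
  exact Fin.append_left _ _ i

@[simp] theorem sndL_join (t : Eu n) (x : Eu m) : sndL n m (join t x) = x := by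
  ext i
  exact Fin.append_right _ _ i

@[simp] theorem join_fstL_sndL (w : Eu (n + m)) : join (fstL n m w) (sndL n m w) = w := by
  ext i
  refine Fin.addCases (fun i ↦ ?_) (fun i ↦ ?_) i
  · exact Fin.append_left _ _ i
  · exact Fin.append_right _ _ i

theorem join_add (t t' : Eu n) (x x' : Eu m) : join (t + t') (x + x') = join t x + join t' x' :=
  map_add (joinL n m) (t, x) (t', x')

theorem join_eq_add (t : Eu n) (x : Eu m) : join t x = join t 0 + join 0 x := by
  rw [← join_add, add_zero, zero_add]

theorem hasFDerivAt_join {E : Type*} [NormedAddCommGroup E] [NormedSpace ℝ E] {f : E → Eu n}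
    {g : E → Eu m} {f' : E →L[ℝ] Eu n} {g' : E →L[ℝ] Eu m} {x : E} (hf : HasFDerivAt f f' x)
    (hg : HasFDerivAt g g' x) :
    HasFDerivAt (fun x ↦ join (f x) (g x)) ((joinL n m).comp (f'.prod g')) x :=
  (joinL n m).hasFDerivAt.comp x (hf.prodMk hg)

theorem ContDiff.join {E : Type*} [NormedAddCommGroup E] [NormedSpace ℝ E] {f : E → Eu n}
    {g : E → Eu m} {r : WithTop ℕ∞} (hf : ContDiff ℝ r f) (hg : ContDiff ℝ r g) :
    ContDiff ℝ r fun x ↦ ChernWeil.join (f x) (g x) :=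
  (joinL n m).contDiff.comp (hf.prodMk hg)

end Join

/-! ### Locality and descent of differential forms -/

section Germs
variable {X Z : Type*} [DiffeologicalSpace X] [DiffeologicalSpace Z] {k m n : ℕ}

/-- Smooth maps with values in a given neighbourhood that are the identity near the point. -/
theorem exists_cutoff {u : Eu m} {s : Set (Eu m)} (hs : s ∈ 𝓝 u) :
    ∃ c : Eu m → Eu m, ContDiff ℝ ∞ c ∧ c =ᶠ[𝓝 u] id ∧ ∀ x, c x ∈ s := by
  obtain ⟨r, hr, hrs⟩ := Metric.mem_nhds_iff.1 hs
  let χ : ContDiffBump u := ⟨r / 2, r, by positivity, by linarith⟩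
  -- The displacement from `u` is damped by a bump function: the map is the identity on the inner
  -- ball, constantly `u` off the outer ball, and never leaves the ball of radius `r`.
  refine ⟨fun x ↦ u + χ x • (x - u), ?_, ?_, fun x ↦ hrs ?_⟩
  · exact contDiff_const.add (χ.contDiff.smul (contDiff_id.sub contDiff_const))
  · filter_upwards [χ.eventuallyEq_one] with x hx
    simp [hx]
  · rw [Metric.mem_ball, dist_eq_norm, add_sub_cancel_left, norm_smul,
      Real.norm_of_nonneg χ.nonneg]
    by_cases hx : x ∈ Metric.ball u r
    · rw [Metric.mem_ball, dist_eq_norm] at hx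
      exact (mul_le_of_le_one_left (norm_nonneg _) χ.le_one).trans_lt hx
    · have : χ x = 0 := χ.zero_of_le_dist (by simpa using hx)
      simpa [this] using hr

theorem Form.val_congr_plot (a : Form X k) {p p' : Plot X m} (h : ∀ x, p.1 x = p'.1 x) (u : Eu m) :
    a.val p u = a.val p' u := by
  rw [show p = p' from Subtype.ext (funext h)]

theorem Form.val_reparam_of_eventuallyEq_id (a : Form X k) (p : Plot X m) {c : Eu m → Eu m}
    (hc : ContDiff ℝ ∞ c) {u : Eu m} (h : c =ᶠ[𝓝 u] id) :
    a.val (p.reparam c hc) u = a.val p u := by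
  rw [a.val_reparam, h.eq_of_nhds, h.fderiv_eq, fderiv_id]
  ext v
  rfl

/-- A form sees only plots defined on all of `ℝ^m`, so its locality has to be derived.
Reparametrising both plots by a cut-off makes them equal everywhere, while the cut-off is the
identity near `u` and leaves the values there unchanged. -/
theorem Form.val_congr (a : Form X k) {p p' : Plot X m} {u : Eu m} (h : ∀ᶠ x in 𝓝 u, p.1 x = p'.1 x) :
    a.val p u = a.val p' u := by
  obtain ⟨c, hc, hc1, hc2⟩ := exists_cutoff h
  rw [← a.val_reparam_of_eventuallyEq_id p hc hc1, ← a.val_reparam_of_eventuallyEq_id p' hc hc1]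
  exact a.val_congr_plot hc2 u

/-- A map along which plots can be lifted locally. -/
def LocalLift (π : X → Z) : Prop :=
  ∀ (m : ℕ) (q : Plot Z m) (u : Eu m), ∃ p : Plot X m, ∀ᶠ x in 𝓝 u, π (p.1 x) = q.1 x

theorem LocalLift.pullback_injective {π : X → Z} (h : LocalLift π) (hπ : DSmooth π) :
    Function.Injective (Form.pullback (k := k) π hπ) := by
  intro a b hab
  refine Form.ext fun m q u ↦ ?_
  obtain ⟨p, hp⟩ := h m q u
  have h1 : a.val (p.map π hπ) u = b.val (p.map π hπ) u :=
    congrArg (fun c : Form X k ↦ c.val p u) hab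
  rwa [a.val_congr hp, b.val_congr hp] at h1

/-- Descent of differential forms. -/
theorem LocalLift.exists_pullback_eq {π : X → Z} (h : LocalLift π) (hπ : DSmooth π) (a : Form X k)
    (ha : ∀ (m : ℕ) (p p' : Plot X m) (u : Eu m), (∀ x, π (p.1 x) = π (p'.1 x)) →
      a.val p u = a.val p' u) : ∃ b : Form Z k, Form.pullback π hπ b = a := by
  have ha' : ∀ (m : ℕ) (p p' : Plot X m) (u : Eu m), (∀ᶠ x in 𝓝 u, π (p.1 x) = π (p'.1 x)) →
      a.val p u = a.val p' u := by
    intro m p p' u hu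
    obtain ⟨c, hc, hc1, hc2⟩ := exists_cutoff hu
    rw [← a.val_reparam_of_eventuallyEq_id p hc hc1, ← a.val_reparam_of_eventuallyEq_id p' hc hc1]
    exact ha m _ _ u hc2
  choose l hl using h
  -- The value of the descended form is read off along a chosen lift. Independence of this choice
  -- gives smoothness, since one lift serves all nearby points, and also compatibility with
  -- reparametrisations.
  have key : ∀ (m : ℕ) (q : Plot Z m) (u : Eu m) (p : Plot X m),
      (∀ᶠ x in 𝓝 u, π (p.1 x) = q.1 x) → a.val (l m q u) u = a.val p u := by
    intro m q u p hp
    refine ha' m _ _ u ?_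
    filter_upwards [hp, hl m q u] with x h1 h2
    rw [h1, h2]
  refine ⟨⟨fun m q u ↦ a.val (l m q u) u, fun m q ↦ contDiff_iff_contDiffAt.2 fun u ↦ ?_,
    fun m n q f hf u ↦ ?_⟩, Form.ext fun m p u ↦ ?_⟩
  · refine ((a.contDiff_val (l m q u)).contDiffAt).congr_of_eventuallyEq ?_
    filter_upwards [(hl m q u).eventually_nhds] with x hx
    exact key m q x _ hx
  · beta_reduce
    rw [key n (q.reparam f hf) u ((l m q (f u)).reparam f hf)
      (hf.continuous.continuousAt.eventually (hl m q (f u))), a.val_reparam]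
  · exact key m (p.map π hπ) u p (Eventually.of_forall fun _ ↦ rfl)

variable {T : Type*} [DiffeologicalSpace T]

theorem LocalLift.prodMap {π : X → Z} (h : LocalLift π) : LocalLift (Prod.map (id : T → T) π) := by
  intro m q u
  obtain ⟨p, hp⟩ := h m (q.map Prod.snd (smooth_snd T Z)) u
  refine ⟨⟨fun x ↦ ((q.1 x).1, p.1 x), q.2.1, p.2⟩, ?_⟩
  filter_upwards [hp] with x hx
  exact Prod.ext rfl hx

theorem smooth_prodMap {π : X → Z} (hπ : DSmooth π) : DSmooth (Prod.map (id : T → T) π) :=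
  fun m _ hp ↦ ⟨hp.1, hπ m _ hp.2⟩

end Germs

/-! ### Smooth families of alternating forms -/

section SmoothFamilies

/-- The values on tuples of basis vectors embed the alternating forms in a finite-dimensional space
of functions; a linear left inverse recovers `f` smoothly from these coordinates. -/
theorem contDiff_alternating {V E : Type*} [NormedAddCommGroup V] [NormedSpace ℝ V]
    [FiniteDimensional ℝ V] [NormedAddCommGroup E] [NormedSpace ℝ E] {k : ℕ}
    {f : E → V [⋀^Fin k]→L[ℝ] ℝ} {r : WithTop ℕ∞} (h : ∀ v, ContDiff ℝ r fun x ↦ f x v) :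
    ContDiff ℝ r f := by
  let b := Module.finBasis ℝ V
  let ev : (V [⋀^Fin k]→L[ℝ] ℝ) →ₗ[ℝ] (Fin k → Fin (Module.finrank ℝ V)) → ℝ :=
    { toFun := fun a s ↦ a fun i ↦ b (s i)
      map_add' := fun _ _ ↦ rfl
      map_smul' := fun _ _ ↦ rfl }
  have inj : Function.Injective ev := by
    intro a a' haa
    ext v
    refine DFunLike.congr_fun (Module.Basis.ext_multilinear
      (f := a.toMultilinearMap) (g := a'.toMultilinearMap) (fun _ ↦ b) fun s ↦ ?_) v
    exact congrFun haa s
  have fd : FiniteDimensional ℝ (V [⋀^Fin k]→L[ℝ] ℝ) := FiniteDimensional.of_injective ev inj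
  obtain ⟨g, hg⟩ := LinearMap.exists_leftInverse_of_injective ev (LinearMap.ker_eq_bot.2 inj)
  have e : f = fun x ↦ LinearMap.toContinuousLinearMap g (ev (f x)) :=
    funext fun x ↦ (DFunLike.congr_fun hg (f x)).symm
  rw [e]
  exact (LinearMap.toContinuousLinearMap g).contDiff.comp (contDiff_pi.2 fun s ↦ h _)

theorem contDiff_alternating_apply {V E : Type*} [NormedAddCommGroup V] [NormedSpace ℝ V]
    [FiniteDimensional ℝ V] [NormedAddCommGroup E] [NormedSpace ℝ E] {k : ℕ}
    {f : E → V [⋀^Fin k]→L[ℝ] ℝ} {v : Fin k → E → V} {r : WithTop ℕ∞} (hf : ContDiff ℝ r f)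
    (hv : ∀ i, ContDiff ℝ r (v i)) : ContDiff ℝ r fun x ↦ f x fun i ↦ v i x := by
  let b := Module.finBasis ℝ V
  have e : (fun x ↦ f x fun i ↦ v i x) = fun x ↦ ∑ s : Fin k → Fin (Module.finrank ℝ V),
      (∏ i, LinearMap.toContinuousLinearMap (b.coord (s i)) (v i x)) * f x fun i ↦ b (s i) := by
    funext x
    have h1 : (fun i ↦ v i x) = fun i ↦ ∑ j, b.coord j (v i x) • b j :=
      funext fun i ↦ (b.sum_repr (v i x)).symm
    have h2 := (f x).toMultilinearMap.map_sum (fun i j ↦ b.coord j (v i x) • b j)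
    refine (congrArg (f x) h1).trans (h2.trans (Finset.sum_congr rfl fun s _ ↦ ?_))
    exact (f x).toMultilinearMap.map_smul_univ _ _
  rw [e]
  refine ContDiff.sum fun s _ ↦ ContDiff.mul ?_ ?_
  · exact contDiff_prod fun i _ ↦ (ContinuousLinearMap.contDiff _).comp (hv i)
  · exact (ContinuousAlternatingMap.apply ℝ V ℝ fun i ↦ b (s i)).contDiff.comp hf

end SmoothFamilies

/-! ### The algebra of forms, and its reduction to constant coefficients at a point -/

section FormsAlgebra
variable {X Y Z : Type*} [DiffeologicalSpace X] [DiffeologicalSpace Y] [DiffeologicalSpace Z]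
  {k l m n : ℕ}

namespace Forms

/-- The inclusion of the forms of degree `k`. -/
def of (k : ℕ) : Form X k →ₗ[ℝ] Forms X := DirectSum.lof ℝ ℕ (Form X) k

/-- The component of degree `k`. -/
def comp (k : ℕ) : Forms X →ₗ[ℝ] Form X k := DirectSum.component ℝ ℕ (Form X) k

theorem of_mul_of (a : Form X k) (b : Form X l) : of k a * of l b = of (k + l) (a.wedge b) :=
  DirectSum.of_mul_of _ _

theorem comp_of_same (a : Form X k) : comp k (of k a) = a := DirectSum.component.lof_self ..

theorem comp_of_ne {k l : ℕ} (h : k ≠ l) (a : Form X k) : comp l (of k a) = 0 :=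
  (DirectSum.component.of ..).trans (by simp [h])

theorem induction {motive : Forms X → Prop} (x : Forms X) (zero : motive 0)
    (of : ∀ k a, motive (of k a)) (add : ∀ x y, motive x → motive y → motive (x + y)) :
    motive x := DirectSum.induction_on x zero of add

theorem ext_comp {a b : Forms X} (h : ∀ k, comp k a = comp k b) : a = b :=
  DFinsupp.ext h

/-- Linear maps out of the algebra of forms, given in each degree. -/
def lift {E : Type*} [AddCommMonoid E] [Module ℝ E] (f : ∀ k, Form X k →ₗ[ℝ] E) :
    Forms X →ₗ[ℝ] E := DirectSum.toModule ℝ ℕ E f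

@[simp] theorem lift_of {E : Type*} [AddCommMonoid E] [Module ℝ E] (f : ∀ k, Form X k →ₗ[ℝ] E)
    (a : Form X k) : lift f (of k a) = f k a := DirectSum.toModule_lof ℝ k a

/-- Algebra homomorphisms given in each degree. -/
def algHom (f : ∀ k, Form X k →ₗ[ℝ] Form Y k) (h1 : f 0 (Form.const X 1) = Form.const Y 1)
    (h2 : ∀ k l (a : Form X k) (b : Form X l), f (k + l) (a.wedge b) = (f k a).wedge (f l b)) :
    Forms X →ₐ[ℝ] Forms Y :=
  DirectSum.toAlgebra ℝ (Form X) (fun k ↦ of k ∘ₗ f k) (congrArg (of 0) h1) fun {i j} a b ↦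
    (congrArg (of (i + j)) (h2 i j a b)).trans (of_mul_of _ _).symm

theorem algHom_of (f : ∀ k, Form X k →ₗ[ℝ] Form Y k) (h1 : f 0 (Form.const X 1) = Form.const Y 1)
    (h2 : ∀ k l (a : Form X k) (b : Form X l), f (k + l) (a.wedge b) = (f k a).wedge (f l b))
    (a : Form X k) : algHom f h1 h2 (of k a) = of k (f k a) :=
  DirectSum.toAddMonoid_of (fun k ↦ (of k ∘ₗ f k).toAddMonoidHom) k a

theorem comp_algHom (f : ∀ k, Form X k →ₗ[ℝ] Form Y k)
    (h1 : f 0 (Form.const X 1) = Form.const Y 1)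
    (h2 : ∀ k l (a : Form X k) (b : Form X l), f (k + l) (a.wedge b) = (f k a).wedge (f l b))
    (a : Forms X) : comp k (algHom f h1 h2 a) = f k (comp k a) := by
  induction a using induction with
  | zero => simp only [map_zero]
  | add x y hx hy => simp only [map_add, hx, hy]
  | of l a =>
    rw [algHom_of]
    by_cases h : l = k
    · subst h; rw [comp_of_same, comp_of_same]
    · rw [comp_of_ne h, comp_of_ne h, map_zero]

/-- Pull-back of forms along a smooth map. -/
def pullback (f : X → Y) (hf : DSmooth f) : Forms Y →ₐ[ℝ] Forms X :=
  algHom (fun _ ↦ Form.pullback f hf) rfl fun _ _ _ _ ↦ rfl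

theorem pullback_of (f : X → Y) (hf : DSmooth f) (a : Form Y k) :
    pullback f hf (of k a) = of k (Form.pullback f hf a) := algHom_of _ _ _ a

theorem comp_pullback (f : X → Y) (hf : DSmooth f) (a : Forms Y) :
    comp k (pullback f hf a) = Form.pullback f hf (comp k a) := comp_algHom _ _ _ a

theorem pullback_pullback {f : X → Y} {g : Y → Z} (hf : DSmooth f) (hg : DSmooth g)
    (a : Forms Z) : pullback f hf (pullback g hg a) = pullback (g ∘ f) (hg.comp hf) a := by
  refine ext_comp fun k ↦ ?_
  rw [comp_pullback, comp_pullback, comp_pullback, Form.pullback_pullback]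

/-- The exterior derivative. -/
def d : Forms X →ₗ[ℝ] Forms X := lift fun k ↦ of (k + 1) ∘ₗ Form.d

theorem d_of (a : Form X k) : d (of k a) = of (k + 1) (Form.d a) := lift_of _ a

theorem d_pullback (f : X → Y) (hf : DSmooth f) (a : Forms Y) :
    d (pullback f hf a) = pullback f hf (d a) := by
  induction a using induction with
  | zero => simp only [map_zero]
  | add x y hx hy => simp only [map_add, hx, hy]
  | of l a => rw [pullback_of, d_of, d_of, pullback_of]; rfl

theorem comp_zero_d (a : Forms X) : comp 0 (d a) = 0 := by
  induction a using induction with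
  | zero => simp only [map_zero]
  | add x y hx hy => simp only [map_add, hx, hy, add_zero]
  | of l a => rw [d_of, comp_of_ne (by simp)]

theorem comp_succ_d (a : Forms X) : comp (k + 1) (d a) = Form.d (comp k a) := by
  induction a using induction with
  | zero => simp only [map_zero]
  | add x y hx hy => simp only [map_add, hx, hy]
  | of l a =>
    rw [d_of]
    by_cases h : l = k
    · subst h; rw [comp_of_same, comp_of_same]
    · rw [comp_of_ne h, comp_of_ne (by omega), map_zero]

theorem of_cast {k l : ℕ} (h : k = l) (a : Form X k) : of l (a.cast h) = of k a := by
  subst h; rfl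

/-- The sign of the degree. -/
def sgn : Forms X →ₗ[ℝ] Forms X := lift fun k ↦ (-1 : ℝ) ^ k • of k

theorem sgn_of (a : Form X k) : sgn (of k a) = (-1 : ℝ) ^ k • of k a := lift_of _ a

theorem d_mul (a b : Forms X) : d (a * b) = d a * b + sgn a * d b := by
  induction a using induction with
  | zero => simp only [map_zero, zero_mul, add_zero]
  | add x y hx hy => simp only [add_mul, map_add, hx, hy]; abel
  | of k a =>
    induction b using induction with
    | zero => simp only [map_zero, mul_zero, add_zero]
    | add x y hx hy => simp only [mul_add, map_add, hx, hy]; abel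
    | of l b =>
      rw [of_mul_of, d_of, d_of, d_of, Form.d_wedge, sgn_of, smul_mul_assoc, of_mul_of, of_mul_of,
        map_add, of_cast, map_smul]
      rfl

end Forms

/-- The form with constant coefficients that agrees with `a` at a point of a plot. -/
def Form.freeze (p : Plot X m) (u : Eu m) : Form X k →ₗ[ℝ] Form (Eu m) k where
  toFun a := ⟨fun _ q x ↦ (a.val p u).compContinuousLinearMap (fderiv ℝ q.1 x), fun n q ↦
      contDiff_alternating fun v ↦ contDiff_alternating_apply (f := fun _ ↦ a.val p u)
        (v := fun i x ↦ fderiv ℝ q.1 x (v i)) contDiff_const fun i ↦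
          ((isPlot_iff_contDiff.1 q.2).fderiv_right (m := ∞) le_rfl).clm_apply contDiff_const, by
      intro n n' q f hf x
      have h : fderiv ℝ (q.1 ∘ f) x = _ := fderiv_comp x
        ((isPlot_iff_contDiff.1 q.2).differentiable (by simp) _) (hf.differentiable (by simp) _)
      change (a.val p u).compContinuousLinearMap (fderiv ℝ (q.1 ∘ f) x) = _
      rw [h]
      rfl⟩
  map_add' _ _ := rfl
  map_smul' _ _ := rfl

theorem Form.freeze_val (p : Plot X m) (u : Eu m) (a : Form X k) :
    (Form.freeze p u a).val ⟨id, isPlot_iff_contDiff.2 contDiff_id⟩ 0 = a.val p u := by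
  change (a.val p u).compContinuousLinearMap (fderiv ℝ id 0) = _
  rw [fderiv_id]
  rfl

theorem Form.freeze_const (p : Plot X m) (u : Eu m) (c : ℝ) :
    Form.freeze p u (Form.const X c) = Form.const (Eu m) c := rfl

theorem Form.freeze_wedge (p : Plot X m) (u : Eu m) (a : Form X k) (b : Form X l) :
    Form.freeze p u (a.wedge b) = (Form.freeze p u a).wedge (Form.freeze p u b) :=
  Form.ext fun _ q x ↦ wedge_comp (a.val p u) (b.val p u) (fderiv ℝ q.1 x)

/-- The algebra homomorphism that replaces forms by forms with constant coefficients. -/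
def Forms.freeze (p : Plot X m) (u : Eu m) : Forms X →ₐ[ℝ] Forms (Eu m) :=
  Forms.algHom (fun _ ↦ Form.freeze p u) (Form.freeze_const p u 1)
    fun _ _ ↦ Form.freeze_wedge p u

theorem Forms.freeze_of (p : Plot X m) (u : Eu m) (a : Form X k) :
    Forms.freeze p u (of k a) = of k (Form.freeze p u a) := Forms.algHom_of _ _ _ a

theorem Forms.comp_freeze (p : Plot X m) (u : Eu m) (a : Forms X) :
    comp k (Forms.freeze p u a) = Form.freeze p u (comp k a) := Forms.comp_algHom _ _ _ a

/-- Freezing is an algebra homomorphism to the fixed algebra `Forms (Eu m)` and loses nothing at the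
point. Comparisons of the values of polynomials in forms at a point can therefore be made on
generators. -/
theorem Forms.val_eq_of_freeze_eq {p : Plot X m} {u : Eu m} {p' : Plot Y m} {u' : Eu m}
    {a : Forms X} {b : Forms Y} (h : Forms.freeze p u a = Forms.freeze p' u' b) (k : ℕ) :
    (Forms.comp k a).val p u = (Forms.comp k b).val p' u' := by
  have h1 := congrArg (Forms.comp k) h
  rw [Forms.comp_freeze, Forms.comp_freeze] at h1
  rw [← Form.freeze_val, h1, Form.freeze_val]

end FormsAlgebra

/-! ### Evaluation of invariant polynomials at curvatures -/

section PolynomialEvaluation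
variable {M A : Type*} [AddCommGroup M] [Module ℝ M] [Ring A] [Algebra ℝ A]
  {X Y : Type*} [DiffeologicalSpace X] [DiffeologicalSpace Y] {k m : ℕ}

/-- The target may be non-commutative, as `Forms X` is, so the universal property among commutative
algebras does not decide this; induction on polynomials does. -/
theorem algHom_symm_ext {f g : SymmetricAlgebra ℝ M →ₐ[ℝ] A}
    (h : ∀ x, f (SymmetricAlgebra.ι ℝ M x) = g (SymmetricAlgebra.ι ℝ M x)) (x) : f x = g x := by
  induction x using SymmetricAlgebra.induction with
  | algebraMap r => rw [AlgHom.commutes, AlgHom.commutes]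
  | ι x => exact h x
  | mul a b ha hb => rw [map_mul, map_mul, ha, hb]
  | add a b ha hb => rw [map_add, map_add, ha, hb]

section
variable {L : Type*} [LieRing L] [LieAlgebra ℝ L]

theorem pairing_tmul (ξ : Module.Dual ℝ L) (a : Form X k) (l : L) :
    pairing ξ (a ⊗ₜ[ℝ] l) = ξ l • a := by
  simp [pairing]

theorem pairing_val (ξ : Module.Dual ℝ L) (Ω : Form X k ⊗[ℝ] L) (p : Plot X m) (u : Eu m)
    (w : Fin k → Eu m) : (pairing ξ Ω).val p u w = ξ (veval p u w Ω) := by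
  induction Ω with
  | zero => rw [map_zero, map_zero, map_zero]; rfl
  | tmul a l =>
    rw [pairing_tmul, Form.smul_val]
    simp [veval, Form.eval, mul_comm]
    exact Or.inl rfl
  | add x y hx hy =>
    rw [map_add, map_add, map_add, Form.add_val, ContinuousAlternatingMap.add_apply, hx, hy]

theorem pairing_vpull (ξ : Module.Dual ℝ L) (f : X → Y) (hf : DSmooth f) (Ω : Form Y k ⊗[ℝ] L) :
    pairing ξ (vpull f hf Ω) = Form.pullback f hf (pairing ξ Ω) := by
  induction Ω with
  | zero => simp only [map_zero]
  | tmul a l => rw [pairing_tmul, map_smul, ← pairing_tmul]; rfl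
  | add x y hx hy => simp only [map_add, hx, hy]

theorem polyEval_ι (Ω : Form X 2 ⊗[ℝ] L) (ξ : Module.Dual ℝ L) :
    polyEval Ω (SymmetricAlgebra.ι ℝ _ ξ) = Forms.of 2 (pairing ξ Ω) := symLift_ι _ _ ξ

theorem pullback_polyEval (f : X → Y) (hf : DSmooth f) (Ω : Form Y 2 ⊗[ℝ] L)
    (F : SymmetricAlgebra ℝ (Module.Dual ℝ L)) :
    Forms.pullback f hf (polyEval Ω F) = polyEval (vpull f hf Ω) F := by
  refine algHom_symm_ext (f := (Forms.pullback f hf).comp (polyEval Ω)) (fun ξ ↦ ?_) F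
  rw [AlgHom.comp_apply, polyEval_ι, polyEval_ι, Forms.pullback_of, pairing_vpull]

theorem vpull_curvature (f : X → Y) (hf : DSmooth f) (Θ : Form Y 1 ⊗[ℝ] L) :
    vpull f hf (curvature Θ) = curvature (vpull f hf Θ) := by
  have h1 : vpull f hf (Form.d.rTensor L Θ) = Form.d.rTensor L (vpull f hf Θ) := by
    induction Θ with
    | zero => simp only [map_zero]
    | tmul a l => rfl
    | add x y hx hy => simp only [map_add, hx, hy]
  have h2 : ∀ Θ' : Form Y 1 ⊗[ℝ] L, vpull f hf (bracket Θ Θ') = bracket (vpull f hf Θ) (vpull f hf Θ') := by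
    clear h1
    intro Θ'
    induction Θ with
    | zero => simp only [map_zero, LinearMap.zero_apply]
    | add x y hx hy => simp only [map_add, LinearMap.add_apply] at *; rw [hx, hy]
    | tmul a l =>
      induction Θ' with
      | zero => simp only [map_zero]
      | add x y hx hy => simp only [map_add, hx, hy]
      | tmul a' l' => rfl
  rw [curvature, curvature, map_add, map_smul, h1, h2]

end

variable {d : ℕ} {G : Type u} [TopologicalSpace G] [ChartedSpace (Eu d) G] [Group G]
  [LieGroup (𝓡 d) ∞ G]

/-- Invariant polynomials take the same values at conjugate curvatures. -/
theorem polyEval_val_eq_of_conj {Ω : Form X 2 ⊗[ℝ] LieAlg d G} {Ω' : Form Y 2 ⊗[ℝ] LieAlg d G}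
    {p : Plot X m} {u : Eu m} {p' : Plot Y m} {u' : Eu m} (g : G)
    (h : ∀ v w, vcoord p' u' ![v, w] Ω' = adCoord g (vcoord p u ![v, w] Ω)) (f : InvPoly d G)
    (k : ℕ) : (Forms.comp k (polyEval Ω' f.1)).val p' u' =
      (Forms.comp k (polyEval Ω f.1)).val p u := by
  refine Forms.val_eq_of_freeze_eq ?_ k
  -- Both sides are algebra homomorphisms in the polynomial. They agree on linear forms when the
  -- right one is preceded by the coadjoint action of `g`, and that action fixes `f`.
  have key := algHom_symm_ext (f := (Forms.freeze p' u').comp (polyEval Ω'))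
    (g := ((Forms.freeze p u).comp (polyEval Ω)).comp
      (SymmetricAlgebra.lift (SymmetricAlgebra.ι ℝ _ ∘ₗ (Ad d g).dualMap))) (fun ξ ↦ ?_) f.1
  · rw [AlgHom.comp_apply, AlgHom.comp_apply, f.2 g] at key
    exact key
  · rw [AlgHom.comp_apply, AlgHom.comp_apply, AlgHom.comp_apply, SymmetricAlgebra.lift_ι_apply,
      LinearMap.comp_apply, polyEval_ι, polyEval_ι, Forms.freeze_of, Forms.freeze_of]
    congr 1
    have e : (pairing ξ Ω').val p' u' = (pairing ((Ad d g).dualMap ξ) Ω).val p u := by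
      ext v
      have hv : v = ![v 0, v 1] := by
        funext i
        fin_cases i <;> rfl
      rw [hv, pairing_val, pairing_val]
      have h1 : veval (L := LieAlg d G) p' u' ![v 0, v 1] Ω' =
        Ad d g (veval (L := LieAlg d G) p u ![v 0, v 1] Ω) :=
          (h _ _).trans (Ad_apply g (veval (L := LieAlg d G) p u ![v 0, v 1] Ω)).symm
      rw [h1]
      rfl
    refine Form.ext fun n q x ↦ ?_
    change ((pairing ξ Ω').val p' u').compContinuousLinearMap _ = _
    rw [e]
    rfl

end PolynomialEvaluation

/-! ### Plots of the bundle and of the nerve of the transformation groupoid -/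

section BundlePlots
variable {d : ℕ} {G : Type u} [TopologicalSpace G] [ChartedSpace (Eu d) G] [Group G]
  [LieGroup (𝓡 d) ∞ G] {Γ : LieGroupoid.{u}} (B : PrincipalBundle d G Γ) {n m : ℕ}

namespace PrincipalBundle

/-- Two families of points over the same family in the base locally differ by a smooth family of
group elements. -/
theorem exists_smooth_quotient (p p' : Plot B.P m) (h : ∀ x, B.proj (p.1 x) = B.proj (p'.1 x))
    (u : Eu m) : ∃ (c : Eu m → Eu m) (g : Eu m → G), ContDiff ℝ ∞ c ∧ c =ᶠ[𝓝 u] id ∧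
      ContMDiff (𝓡 m) (𝓡 d) ∞ g ∧ ∀ x, p'.1 (c x) = B.act (p.1 (c x)) (g x) := by
  obtain ⟨U, hU, hu, s, τ, _, h2, _, h4, h5⟩ := B.locally_trivial (B.proj (p.1 u))
  have hc : Continuous fun x ↦ B.proj (p.1 x) :=
    (show ContMDiff (𝓡 m) (𝓡 Γ.dimOb) ∞ _ from B.smooth_proj m _ p.2).continuous
  obtain ⟨c, hc1, hc2, hc3⟩ := exists_cutoff (hc.continuousAt.preimage_mem_nhds (hU.mem_nhds hu))
  let a : Eu m → {p // B.proj p ∈ U} := fun x ↦ ⟨p.1 (c x), hc3 x⟩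
  let a' : Eu m → {p // B.proj p ∈ U} := fun x ↦ ⟨p'.1 (c x), h (c x) ▸ hc3 x⟩
  have sa : ContMDiff (𝓡 m) (𝓡 d) ∞ fun x ↦ τ (a x) := h2 m a (isPlot_reparam p.2 hc1)
  have sa' : ContMDiff (𝓡 m) (𝓡 d) ∞ fun x ↦ τ (a' x) := h2 m a' (isPlot_reparam p'.2 hc1)
  -- Over the trivialising set, kept by means of the cut-off `c`, both points are translates of the
  -- same section value `s`, by `τ (a x)` and `τ (a' x)`; the quotient of the two translates one to
  -- the other.
  refine ⟨c, fun x ↦ (τ (a x))⁻¹ * τ (a' x), hc1, hc2, sa.inv.mul sa', fun x ↦ ?_⟩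
  have e1 := h4 (a x)
  have e2 := h4 (a' x)
  have e3 : (⟨B.proj (a x).1, (a x).2⟩ : {y // y ∈ U}) = ⟨B.proj (a' x).1, (a' x).2⟩ :=
    Subtype.ext (h (c x))
  rw [e3] at e1
  change (a' x).1 = B.act (a x).1 _
  rw [← e1, ← B.act_mul, mul_inv_cancel_left, e2]

/-- Right translation of the simplices of the transformation groupoid. -/
def translate (s : Nerve B.transformation n) (g : G) : Nerve B.transformation n :=
  ⟨(fun i ↦ B.act (s.1.1 i) g, fun i j ↦ ⟨((s.1.2 i j).1.1, B.act (s.1.2 i j).1.2 g),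
    (s.1.2 i j).2.trans (B.proj_act _ _).symm⟩), by
    obtain ⟨h1, h2, h3⟩ := s.2
    refine ⟨fun i j ↦ ⟨?_, ?_⟩, fun i ↦ ?_, fun i j k h ↦ ?_⟩
    · change B.lact (s.1.2 i j).1.1 (B.act (s.1.2 i j).1.2 g) _ = B.act (s.1.1 i) g
      exact (B.lact_act _ _ _ (s.1.2 i j).2).trans (congrArg (B.act · g) (h1 i j).1)
    · exact congrArg (B.act · g) (h1 i j).2
    · have e := h2 i
      refine Subtype.ext (Prod.ext ?_ ?_)
      · refine (congrArg (fun a ↦ a.1.1) e).trans ?_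
        exact congrArg Γ.str.unit (B.proj_act _ _).symm
      · exact congrArg (fun a ↦ B.act a.1.2 g) e
    · have e := h3 i j k ((h1 i j).2.trans (h1 j k).1.symm)
      refine Subtype.ext (Prod.ext ?_ ?_)
      · exact congrArg (fun a ↦ a.1.1) e
      · exact congrArg (fun a ↦ B.act a.1.2 g) e⟩

theorem nerve_translate (s : Nerve B.transformation n) (g : G) :
    B.toBase.nerve n (B.translate s g) = B.toBase.nerve n s :=
  Subtype.ext (Prod.ext (funext fun _ ↦ B.proj_act _ _) rfl)

theorem isPlot_translate {p : Eu m → Nerve B.transformation n} (hp : IsPlot p) {g : Eu m → G}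
    (hg : ContMDiff (𝓡 m) (𝓡 d) ∞ g) : IsPlot fun x ↦ B.translate (p x) (g x) :=
  ⟨fun i ↦ B.smooth_act m _ g (hp.1 i) hg,
    fun i j ↦ ⟨(hp.2 i j).1, B.smooth_act m _ g (hp.2 i j).2 hg⟩⟩

/-- An arrow of the transformation groupoid is an arrow of `Γ` with a source, and the arrow from
vertex 0 to vertex `i` moves the one point to the other. The projected simplex and vertex 0 thus
determine everything. -/
theorem nerve_ext {s s' : Nerve B.transformation n}
    (h : B.toBase.nerve n s = B.toBase.nerve n s') (h0 : Nerve.vertex 0 s = Nerve.vertex 0 s') :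
    s = s' := by
  have ha : ∀ i j, (s.1.2 i j).1.1 = (s'.1.2 i j).1.1 := fun i j ↦
    congrFun (congrFun (congrArg (fun z ↦ z.1.2) h) i) j
  have hv : ∀ i, s.1.1 i = s'.1.1 i := by
    intro i
    rw [← (s.2.1 i 0).1, ← (s'.2.1 i 0).1]
    exact B.lact_congr (ha i 0) (((s.2.1 i 0).2.trans h0).trans (s'.2.1 i 0).2.symm) _ _
  refine Subtype.ext (Prod.ext (funext hv) (funext fun i ↦ funext fun j ↦
    Subtype.ext (Prod.ext (ha i j) ?_)))
  exact ((s.2.1 i j).2.trans (hv j)).trans (s'.2.1 i j).2.symm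

/-- By `nerve_ext` the translation by `g` has to be checked at vertex 0 only; the action of `Γ`
commutes with that of `G`, so it propagates to the other vertices. -/
theorem eq_translate {s s' : Nerve B.transformation n} {g : G}
    (h : B.toBase.nerve n s = B.toBase.nerve n s')
    (h0 : Nerve.vertex 0 s' = B.act (Nerve.vertex 0 s) g) : s' = B.translate s g :=
  B.nerve_ext (h.symm.trans (B.nerve_translate s g).symm) h0

/-- The simplex of the transformation groupoid over a simplex of the base with a given first
vertex. -/
def liftNerve (s : Nerve Γ.toDiff n) (p : B.P) (h : Nerve.vertex 0 s = B.proj p) :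
    Nerve B.transformation n :=
  ⟨(fun i ↦ B.lact (s.1.2 i 0) p ((s.2.1 i 0).2.trans h), fun i j ↦ ⟨(s.1.2 i j,
      B.lact (s.1.2 j 0) p ((s.2.1 j 0).2.trans h)),
      ((s.2.1 i j).2.trans (s.2.1 j 0).1.symm).trans (B.proj_lact _ _ _).symm⟩), by
    have key0 : ∀ i j, B.lact (s.1.2 i j) (B.lact (s.1.2 j 0) p ((s.2.1 j 0).2.trans h))
        (((s.2.1 i j).2.trans (s.2.1 j 0).1.symm).trans (B.proj_lact _ _ _).symm) =
        B.lact (s.1.2 i 0) p ((s.2.1 i 0).2.trans h) := by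
      intro i j
      exact (B.lact_mul _ _ _ ((s.2.1 i j).2.trans (s.2.1 j 0).1.symm) _).symm.trans
        (B.lact_congr (s.2.2.2 i j 0 _) rfl _ _)
    refine ⟨fun i j ↦ ⟨key0 i j, rfl⟩, fun i ↦ ?_, fun i j k h' ↦ ?_⟩
    · refine Subtype.ext (Prod.ext ((s.2.2.1 i).trans ?_) rfl)
      exact congrArg Γ.str.unit ((s.2.1 i 0).1.symm.trans (B.proj_lact _ _ _).symm)
    · exact Subtype.ext (Prod.ext (s.2.2.2 i j k _) rfl)⟩

theorem nerve_liftNerve (s : Nerve Γ.toDiff n) (p : B.P) (h : Nerve.vertex 0 s = B.proj p) :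
    B.toBase.nerve n (B.liftNerve s p h) = s :=
  Subtype.ext (Prod.ext (funext fun i ↦ (B.proj_lact _ _ _).trans (s.2.1 i 0).1) rfl)

/-- A local section of the bundle lifts vertex 0, and the arrows from vertex 0 transport the lift to
the other vertices. -/
theorem localLift_nerve : LocalLift (B.toBase.nerve n) := by
  intro m q u
  let v : Eu m → Γ.Ob := fun x ↦ Nerve.vertex 0 (q.1 x)
  obtain ⟨U, hU, hu, s, _, h1, _, h3, _, _⟩ := B.locally_trivial (v u)
  have hc : Continuous v := (show ContMDiff (𝓡 m) (𝓡 Γ.dimOb) ∞ v from q.2.1 0).continuous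
  obtain ⟨c, hc1, hc2, hc3⟩ := exists_cutoff (hc.continuousAt.preimage_mem_nhds (hU.mem_nhds hu))
  let b : Eu m → {y // y ∈ U} := fun x ↦ ⟨v (c x), hc3 x⟩
  have hb : IsPlot fun x ↦ s (b x) := h1 m b (isPlot_reparam (q.2.1 0) hc1)
  have hl : ∀ i, IsPlot fun x ↦ B.lact ((q.1 (c x)).1.2 i 0) (s (b x))
      (((q.1 (c x)).2.1 i 0).2.trans (h3 (b x)).symm) := fun i ↦
    B.smooth_lact m (fun x ↦ ⟨((q.1 (c x)).1.2 i 0, s (b x)),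
      ((q.1 (c x)).2.1 i 0).2.trans (h3 (b x)).symm⟩) ⟨isPlot_reparam (q.2.2 i 0) hc1, hb⟩
  refine ⟨⟨fun x ↦ B.liftNerve (q.1 (c x)) (s (b x)) (h3 (b x)).symm, hl,
    fun i j ↦ ⟨isPlot_reparam (q.2.2 i j) hc1, hl j⟩⟩, ?_⟩
  filter_upwards [hc2] with x hx
  refine (B.nerve_liftNerve _ _ _).trans ?_
  rw [hx, id]

end PrincipalBundle
end BundlePlots

/-! ### Forms determined up to gauge: basic and closed characteristic forms -/

section GaugeForms
variable {d : ℕ} {G : Type u} [TopologicalSpace G] [ChartedSpace (Eu d) G] [Group G]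
  [LieGroup (𝓡 d) ∞ G] {X Z : Type*} [DiffeologicalSpace X] [DiffeologicalSpace Z] {k m : ℕ}

instance : FiniteDimensional ℝ (LieAlg d G) := inferInstanceAs (FiniteDimensional ℝ (Eu d))

theorem vcoord_Ad (g : G) (p : Plot X m) (u : Eu m) (w : Fin k → Eu m)
    (Θ : Form X k ⊗[ℝ] LieAlg d G) :
    vcoord p u w ((Ad d g).lTensor (Form X k) Θ) = adCoord g (vcoord p u w Θ) := by
  induction Θ with
  | zero => simp only [map_zero]
  | tmul a l =>
    rw [LinearMap.lTensor_tmul, vcoord_tmul, vcoord_tmul, map_smul]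
    exact congrArg (a.val p u w • ·) (Ad_apply g l)
  | add Θ Θ' h h' => simp only [map_add, h, h']

/-- Take `g` with coordinates `coordOne - A u (x - u)` near `u`. Then `g u = 1` and the
Maurer–Cartan form of `g` at `u` is `-A u`, which cancels the connection form. The cut-off only
makes `g` globally defined. -/
theorem gauge_zero_at (A : Eu m → Eu m →L[ℝ] Eu d) (u : Eu m) :
    ∃ g : Eu m → G, ContMDiff (𝓡 m) (𝓡 d) ∞ g ∧ gauge g A u = 0 := by
  let f : Eu m → Eu d := fun x ↦ coordOne d G - A u (x - u)
  have hf : ContDiff ℝ ∞ f := contDiff_const.sub ((A u).contDiff.comp (contDiff_id.sub contDiff_const))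
  have fu : f u = coordOne d G := by simp [f]
  have ht : f ⁻¹' (chartOne d G).target ∈ 𝓝 u := hf.continuous.continuousAt.preimage_mem_nhds (by
    rw [fu]; exact extChartAt_target_mem_nhds (I := 𝓡 d) (1 : G))
  obtain ⟨c, hc1, hc2, hc3⟩ := exists_cutoff ht
  let g : Eu m → G := fun x ↦ (chartOne d G).symm (f (c x))
  have gu : g u = 1 := by
    change (chartOne d G).symm (f (c u)) = 1
    rw [hc2.eq_of_nhds, id, fu, chartOne_symm_coordOne]
  refine ⟨g, fun x ↦ ?_, ?_⟩
  · have h1 : ContMDiffAt (𝓡 d) (𝓡 d) ∞ (chartOne d G).symm (f (c x)) :=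
      (contMDiffOn_extChartAt_symm (I := 𝓡 d) (n := ∞) (1 : G)).contMDiffAt
        ((isOpen_extChartAt_target (I := 𝓡 d) (1 : G)).mem_nhds (hc3 x))
    exact h1.comp x (hf.comp hc1).contDiffAt.contMDiffAt
  · have h2 : (fun y ↦ chartOne d G ((g u)⁻¹ * g y)) =ᶠ[𝓝 u] f := by
      filter_upwards [hc2] with y hy
      rw [gu, inv_one, one_mul]
      change chartOne d G ((chartOne d G).symm (f (c y))) = f y
      rw [(chartOne d G).right_inv (hc3 y), hy, id]
    have h3 : HasFDerivAt f (-(A u)) u := by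
      have h := HasFDerivAt.comp (f := fun x ↦ x - u) u (A u).hasFDerivAt
        ((hasFDerivAt_id u).sub_const u)
      rw [ContinuousLinearMap.comp_id] at h
      exact h.const_sub (coordOne d G)
    rw [gauge, maurerCartan, h2.fderiv_eq, h3.fderiv, gu, inv_one, adCoord_one]
    exact add_neg_cancel (A u)

theorem Form.d_d (a : Form X k) : Form.d (Form.d a) = 0 := by
  refine Form.ext fun m p u ↦ ?_
  exact congrFun (extDeriv_extDeriv (a.contDiff_val p) (by simpa using ENat.LEInfty.out)) u

section
variable {L : Type*} [LieRing L] [LieAlgebra ℝ L]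

theorem sum_pairing_tmul {ι : Type*} [Fintype ι] (b : Module.Basis ι ℝ L) (Θ : Form X k ⊗[ℝ] L) :
    ∑ i, pairing (b.coord i) Θ ⊗ₜ[ℝ] b i = Θ := by
  induction Θ with
  | zero => simp only [map_zero, TensorProduct.zero_tmul, Finset.sum_const_zero]
  | tmul a l =>
    simp only [pairing_tmul, TensorProduct.smul_tmul, ← TensorProduct.tmul_sum]
    exact congrArg _ (b.sum_repr l)
  | add x y hx hy => simp only [map_add, TensorProduct.add_tmul, Finset.sum_add_distrib, hx, hy]

theorem pairing_d (ξ : Module.Dual ℝ L) (Θ : Form X k ⊗[ℝ] L) :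
    pairing ξ (Form.d.rTensor L Θ) = Form.d (pairing ξ Θ) := by
  induction Θ with
  | zero => simp only [map_zero]
  | tmul a l => rw [LinearMap.rTensor_tmul, pairing_tmul, pairing_tmul, map_smul]
  | add x y hx hy => simp only [map_add, hx, hy]

/-- The product of two `1`-forms. -/
def wedgeOne (a b : Form X 1) : Form X 2 := a.wedge b

theorem of_wedgeOne (a b : Form X 1) : Forms.of 2 (wedgeOne a b) = Forms.of 1 a * Forms.of 1 b :=
  (Forms.of_mul_of a b).symm

theorem pairing_bracket_tmul (ξ : Module.Dual ℝ L) (a b : Form X 1) (x y : L) :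
    pairing ξ (bracket (a ⊗ₜ[ℝ] x) (b ⊗ₜ[ℝ] y) : Form X 2 ⊗[ℝ] L) = ξ ⁅x, y⁆ • wedgeOne a b :=
  pairing_tmul ξ _ _

theorem pairing_bracket {ι : Type*} [Fintype ι] (b : Module.Basis ι ℝ L) (ξ : Module.Dual ℝ L)
    (Θ Θ' : Form X 1 ⊗[ℝ] L) : pairing ξ (bracket Θ Θ' : Form X 2 ⊗[ℝ] L) =
      ∑ i, ∑ j, ξ ⁅b i, b j⁆ • wedgeOne (pairing (b.coord i) Θ) (pairing (b.coord j) Θ') := by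
  conv_lhs => rw [← sum_pairing_tmul b Θ, ← sum_pairing_tmul b Θ']
  simp only [map_sum, LinearMap.sum_apply]
  rw [Finset.sum_comm]
  exact Finset.sum_congr rfl fun i _ ↦ Finset.sum_congr rfl fun j _ ↦ pairing_bracket_tmul _ _ _ _ _

theorem pairing_curvature {ι : Type*} [Fintype ι] (b : Module.Basis ι ℝ L) (ξ : Module.Dual ℝ L)
    (Θ : Form X 1 ⊗[ℝ] L) : pairing ξ (curvature Θ) = Form.d (pairing ξ Θ) + (1 / 2 : ℝ) •
      ∑ i, ∑ j, ξ ⁅b i, b j⁆ • wedgeOne (pairing (b.coord i) Θ) (pairing (b.coord j) Θ) := by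
  rw [curvature, map_add, map_smul, pairing_d]
  exact congrArg (fun z : Form X 2 ↦ Form.d (pairing ξ Θ) + (1 / 2 : ℝ) • z) (pairing_bracket b ξ Θ Θ)

end

/-- The Bianchi identity at a point where the connection form vanishes: the differential of a
curvature component is the differential of a quadratic expression in the connection components, and
each of its terms keeps an undifferentiated factor, zero at `u`. The Leibniz rule extends this to
all polynomials. -/
theorem freeze_d_polyEval {Θ : Form X 1 ⊗[ℝ] LieAlg d G} {p : Plot X m} {u : Eu m}
    (h : conn Θ p u = 0) (F : SymmetricAlgebra ℝ (Module.Dual ℝ (LieAlg d G))) :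
    Forms.freeze p u (Forms.d (polyEval (curvature Θ) F)) = 0 := by
  induction F using SymmetricAlgebra.induction with
  | algebraMap r =>
    rw [AlgHom.commutes]
    have e : algebraMap ℝ (Forms X) r = Forms.of 0 (Form.const X r) := rfl
    rw [e, Forms.d_of, Form.d_const, map_zero, map_zero]
  | add a b ha hb => simp only [map_add, ha, hb, add_zero]
  | mul a b ha hb => rw [map_mul, Forms.d_mul, map_add, map_mul, map_mul, ha, hb, zero_mul, mul_zero,
      add_zero]
  | ι ξ =>
    let b := Module.finBasis ℝ (LieAlg d G)
    have ha : ∀ ξ : Module.Dual ℝ (LieAlg d G),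
        Forms.freeze p u (Forms.of 1 (pairing ξ Θ)) = 0 := by
      intro ξ
      rw [Forms.freeze_of]
      have e : (pairing ξ Θ).val p u = 0 := by
        ext w
        have hw : w = fun _ ↦ w 0 := funext fun i ↦ by rw [Subsingleton.elim i 0]
        rw [hw, pairing_val]
        exact (congrArg ξ (DFunLike.congr_fun h (w 0))).trans (map_zero ξ)
      rw [show Form.freeze p u (pairing ξ Θ) = 0 from Form.ext fun n q x ↦ by
        change ((pairing ξ Θ).val p u).compContinuousLinearMap _ = _
        rw [e]; rfl, map_zero]
    rw [polyEval_ι, pairing_curvature b, map_add, map_add, map_add, Forms.d_of, Form.d_d]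
    simp only [map_smul, map_sum, map_zero, of_wedgeOne, Forms.d_mul, map_add,
      map_mul, Forms.sgn_of, ha, smul_zero, zero_mul, mul_zero, add_zero, Finset.sum_const_zero]

/-- A connection form on the total space of a map which is determined by the base up to gauge
transformations, all of which are realised. -/
structure IsGaugeForm (π : X → Z) (Θ : Form X 1 ⊗[ℝ] LieAlg d G) : Prop where
  compare : ∀ (m : ℕ) (p p' : Plot X m), (∀ x, π (p.1 x) = π (p'.1 x)) → ∀ u : Eu m,
    ∃ (c : Eu m → Eu m) (hc : ContDiff ℝ ∞ c) (g : Eu m → G), c =ᶠ[𝓝 u] id ∧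
      ContMDiff (𝓡 m) (𝓡 d) ∞ g ∧
      ∀ x, conn Θ (p'.reparam c hc) x = gauge g (conn Θ (p.reparam c hc)) x
  translate : ∀ (m : ℕ) (p : Plot X m) (g : Eu m → G), ContMDiff (𝓡 m) (𝓡 d) ∞ g →
    ∃ p' : Plot X m, (∀ x, π (p'.1 x) = π (p.1 x)) ∧ ∀ x, conn Θ p' x = gauge g (conn Θ p) x

namespace IsGaugeForm
variable {π : X → Z} {Θ : Form X 1 ⊗[ℝ] LieAlg d G}

/-- After reparametrisation by `c`, which is the identity near `u`, the two plots differ by a gauge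
transformation. Their curvatures at `u` are then conjugate and the invariance of `f` applies. -/
theorem val_eq (h : IsGaugeForm π Θ) (f : InvPoly d G) (p p' : Plot X m)
    (hp : ∀ x, π (p.1 x) = π (p'.1 x)) (u : Eu m) :
    (Forms.comp k (polyEval (curvature Θ) f.1)).val p u =
      (Forms.comp k (polyEval (curvature Θ) f.1)).val p' u := by
  obtain ⟨c, hc, g, hc1, hg, hcg⟩ := h.compare m p p' hp u
  rw [← Form.val_reparam_of_eventuallyEq_id _ p hc hc1,
    ← Form.val_reparam_of_eventuallyEq_id _ p' hc hc1]
  refine (polyEval_val_eq_of_conj (g u)⁻¹ (fun v w ↦ ?_) f k).symm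
  rw [vcoord_curvature, vcoord_curvature, show conn Θ (p'.reparam c hc) = _ from funext hcg]
  exact curvAt_gauge (Eventually.of_forall fun x ↦ hg x)
    ((contDiff_conn Θ _).differentiable (by simp) u) v w

/-- The form takes the same values along every plot with the same projection. It may therefore be
computed along the plot whose connection form has been gauged to zero at `u`, where
`freeze_d_polyEval` applies. -/
theorem d_polyEval (h : IsGaugeForm π Θ) (f : InvPoly d G) :
    Forms.d (polyEval (curvature Θ) f.1) = 0 := by
  refine Forms.ext_comp fun k ↦ ?_
  obtain _ | k := k
  · rw [Forms.comp_zero_d, map_zero]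
  rw [Forms.comp_succ_d, map_zero]
  refine Form.ext fun m p u ↦ ?_
  obtain ⟨g, hg, hg0⟩ := gauge_zero_at (G := G) (conn Θ p) u
  obtain ⟨p', hp', hc⟩ := h.translate m p g hg
  have e : (Forms.comp k (polyEval (curvature Θ) f.1)).val p =
      (Forms.comp k (polyEval (curvature Θ) f.1)).val p' :=
    funext fun x ↦ h.val_eq f p p' (fun x ↦ (hp' x).symm) x
  change extDeriv ((Forms.comp k (polyEval (curvature Θ) f.1)).val p) u = 0
  rw [e]
  have h0 := freeze_d_polyEval (p := p') (u := u) (by rw [hc, hg0]) f.1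
  have h1 := Forms.val_eq_of_freeze_eq (p := p') (u := u) (p' := p') (u' := u) (b := 0)
    (by rw [h0, map_zero]) (k + 1)
  rw [Forms.comp_succ_d, map_zero] at h1
  exact h1

end IsGaugeForm
end GaugeForms

/-! ### Convex combinations of pseudo-connections -/

section Interpolation
variable {d : ℕ} {G : Type u} [TopologicalSpace G] [ChartedSpace (Eu d) G] [Group G]
  [LieGroup (𝓡 d) ∞ G] {Γ : LieGroupoid.{u}} {B : PrincipalBundle d G Γ} {n m : ℕ}

/-- The plot `x ↦ p(x) g(x)` is the diagonal of the two-variable plot `R : (x, y) ↦ p(x) g(y)`.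
Linearity splits its derivative into a part with `g` fixed, evaluated by equivariance, and a part
with `p` fixed, evaluated by the condition on vertical vectors. -/
theorem PseudoConnection.conn_act (θ : PseudoConnection B) (p p' : Plot B.P m) {g : Eu m → G}
    (hg : ContMDiff (𝓡 m) (𝓡 d) ∞ g) (h : ∀ x, p'.1 x = B.act (p.1 x) (g x)) (x : Eu m) :
    conn θ.form p' x = gauge g (conn θ.form p) x := by
  let R : Plot B.P (m + m) := ⟨fun w ↦ B.act (p.1 (fstL m m w)) (g (sndL m m w)),
    B.smooth_act (m + m) _ _ (isPlot_reparam p.2 (fstL m m).contDiff)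
      (hg.comp (sndL m m).contDiff.contMDiff)⟩
  have hR : ∀ {a b : Eu m → Eu m} (ha : ContDiff ℝ ∞ a) (hb : ContDiff ℝ ∞ b) (q : Plot B.P m)
      (hq : ∀ y, q.1 y = B.act (p.1 (a y)) (g (b y))) (w : Eu m), conn θ.form q x w =
        conn θ.form R (join (a x) (b x)) (join (fderiv ℝ a x w) (fderiv ℝ b x w)) := by
    intro a b ha hb q hq w
    have e : q = R.reparam (fun y ↦ join (a y) (b y)) (ha.join hb) := by
      refine Subtype.ext (funext fun y ↦ (hq y).trans ?_)
      change _ = B.act (p.1 (fstL m m (join (a y) (b y)))) (g (sndL m m (join (a y) (b y))))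
      rw [fstL_join, sndL_join]
    have h1 := hasFDerivAt_join (ha.differentiable (by simp) x).hasFDerivAt
      (hb.differentiable (by simp) x).hasFDerivAt
    rw [e, conn_reparam, h1.fderiv]
    rfl
  ext1 w
  have h1 := hR contDiff_id contDiff_id p' h w
  have h2 := hR contDiff_id contDiff_const (p.map _ (B.smooth_act_const (g x))) (fun _ ↦ rfl) w
  have h3 := hR contDiff_const contDiff_id (B.orbitPlot (p.1 x) g hg) (fun _ ↦ rfl) w
  have h4 : conn θ.form (p.map _ (B.smooth_act_const (g x))) x w =
      adCoord (g x)⁻¹ (conn θ.form p x w) := by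
    rw [← conn_vpull, θ.equivariant]
    exact vcoord_Ad _ _ _ _ _
  have h5 : conn θ.form (B.orbitPlot (p.1 x) g hg) x w = maurerCartan g x w :=
    (θ.vertical (p.1 x) m g hg x w).trans (mfderiv_inv_mul_eq_maurerCartan hg x w)
  rw [h1, gauge, add_apply, ContinuousLinearMap.comp_apply, ← h4, ← h5, h2, h3]
  simp only [fderiv_id, fderiv_fun_const, Pi.zero_apply, zero_apply, ContinuousLinearMap.id_apply,
    id_eq]
  rw [join_eq_add w w, map_add]

variable {T X : Type*} [DiffeologicalSpace T] [DiffeologicalSpace X] {ι : Type*} [Fintype ι]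

theorem Form.wedge_ofFun_val {k : ℕ} (a : Form X k) {f : X → ℝ}
    (hf : ∀ m (p : Plot X m), ContDiff ℝ ∞ (f ∘ p.1)) (p : Plot X m) (u : Eu m) :
    (a.wedge (Form.ofFun f hf)).val p u = f (p.1 u) • a.val p u := by
  change ChernWeil.wedge (a.val p u) (ContinuousAlternatingMap.constOfIsEmpty ℝ _ (Fin 0) _) = _
  have e : ContinuousAlternatingMap.constOfIsEmpty ℝ (Eu m) (Fin 0) (f (p.1 u)) =
      f (p.1 u) • ContinuousAlternatingMap.constOfIsEmpty ℝ (Eu m) (Fin 0) (1 : ℝ) := by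
    ext v
    simp
  rw [e, wedge_smul_right, ChernWeil.wedge_one]

/-- The pull-back of a pseudo-connection to the simplices. -/
def PseudoConnection.onVertex (θ : PseudoConnection B) (i : Fin (n + 1)) :
    Form (Nerve B.transformation n) 1 ⊗[ℝ] LieAlg d G :=
  vpull (Nerve.vertex i) (Nerve.smooth_vertex i) θ.form

theorem conn_vpull_vertex {𝒢 : DiffGroupoid.{u}} (Θ : Form 𝒢.Ob 1 ⊗[ℝ] LieAlg d G)
    (i : Fin (n + 1)) (p : Plot (Nerve 𝒢 n) m) :
    conn (vpull (Nerve.vertex i) (Nerve.smooth_vertex i) Θ) p =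
      conn Θ (p.map (Nerve.vertex i) (Nerve.smooth_vertex i)) :=
  conn_vpull (Nerve.vertex i) (Nerve.smooth_vertex i) p Θ

theorem PseudoConnection.conn_onVertex (θ : PseudoConnection B) (i : Fin (n + 1))
    (p : Plot (Nerve B.transformation n) m) :
    conn (θ.onVertex i) p = conn θ.form ⟨fun x ↦ Nerve.vertex i (p.1 x), p.2.1 i⟩ :=
  conn_vpull_vertex (𝒢 := B.transformation) θ.form i p

/-- A convex combination of the pull-backs of pseudo-connections along vertices. -/
def interpolate (c : ι → T → ℝ)
    (hc : ∀ i m (p : Plot (T × Nerve B.transformation n) m), ContDiff ℝ ∞ ((fun x ↦ c i x.1) ∘ p.1))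
    (v : ι → Fin (n + 1)) (θ : ι → PseudoConnection B) :
    Form (T × Nerve B.transformation n) 1 ⊗[ℝ] LieAlg d G :=
  ∑ i, ((Form.wedgeₗ _ 1 0).flip (Form.ofFun (fun x ↦ c i x.1) (hc i))).rTensor (LieAlg d G)
    (vpull Prod.snd (smooth_snd _ _) ((θ i).onVertex (v i)))

variable {c : ι → T → ℝ}
    {hc : ∀ i m (p : Plot (T × Nerve B.transformation n) m), ContDiff ℝ ∞ ((fun x ↦ c i x.1) ∘ p.1)}
    {v : ι → Fin (n + 1)} {θ : ι → PseudoConnection B}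

theorem conn_wedge_ofFun {f : X → ℝ} (hf : ∀ m (p : Plot X m), ContDiff ℝ ∞ (f ∘ p.1))
    (Θ : Form X 1 ⊗[ℝ] LieAlg d G) (p : Plot X m) (x : Eu m) :
    conn (((Form.wedgeₗ _ 1 0).flip (Form.ofFun f hf)).rTensor (LieAlg d G) Θ) p x =
      f (p.1 x) • conn Θ p x := by
  induction Θ with
  | zero =>
    rw [map_zero, conn_zero]
    ext1 w
    rw [smul_apply, zero_apply, smul_zero]
  | tmul a l =>
    ext1 w
    rw [LinearMap.rTensor_tmul, smul_apply, conn_tmul, conn_tmul, smul_smul]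
    congr 1
    exact congrArg (fun z : Eu m [⋀^Fin 1]→L[ℝ] ℝ ↦ z fun _ ↦ w) (Form.wedge_ofFun_val a hf p x)
  | add x y hx hy => rw [map_add, conn_add, conn_add, hx, hy, smul_add]

theorem conn_sum (s : Finset ι) (Θ : ι → Form X 1 ⊗[ℝ] LieAlg d G) (p : Plot X m) (x : Eu m) :
    conn (∑ i ∈ s, Θ i) p x = ∑ i ∈ s, conn (Θ i) p x := by
  classical
  induction s using Finset.induction with
  | empty => rw [Finset.sum_empty, Finset.sum_empty, conn_zero]
  | insert i s hi h => rw [Finset.sum_insert hi, Finset.sum_insert hi, conn_add, h]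

theorem conn_interpolate (p : Plot (T × Nerve B.transformation n) m) (x : Eu m) :
    conn (interpolate c hc v θ) p x = ∑ i, c i (p.1 x).1 • conn (θ i).form
      ⟨fun y ↦ Nerve.vertex (v i) (p.1 y).2, p.2.2.1 (v i)⟩ x := by
  rw [interpolate, conn_sum]
  refine Finset.sum_congr rfl fun i _ ↦ ?_
  rw [conn_wedge_ofFun, conn_vpull, (θ i).conn_onVertex]
  rfl

/-- Gauge transformations are affine in the connection. With coefficients of sum 1, the
inhomogeneous Maurer–Cartan term comes out exactly once. -/
theorem conn_interpolate_gauge (h1 : ∀ t, ∑ i, c i t = 1)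
    (p p' : Plot (T × Nerve B.transformation n) m) {g : Eu m → G}
    (hg : ContMDiff (𝓡 m) (𝓡 d) ∞ g) (hf : ∀ x, (p'.1 x).1 = (p.1 x).1)
    (hs : ∀ x, (p'.1 x).2 = B.translate (p.1 x).2 (g x)) (x : Eu m) :
    conn (interpolate c hc v θ) p' x = gauge g (conn (interpolate c hc v θ) p) x := by
  have e : ∀ i, conn (θ i).form ⟨fun y ↦ Nerve.vertex (v i) (p'.1 y).2, p'.2.2.1 (v i)⟩ x =
      gauge g (conn (θ i).form ⟨fun y ↦ Nerve.vertex (v i) (p.1 y).2, p.2.2.1 (v i)⟩) x :=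
    fun i ↦ (θ i).conn_act _ _ hg (fun y ↦ congrArg (Nerve.vertex (v i)) (hs y)) x
  rw [gauge, conn_interpolate, conn_interpolate]
  simp only [e, hf, gauge, smul_add, Finset.sum_add_distrib, ← Finset.sum_smul, h1, one_smul]
  congr 1
  ext1 w
  simp [map_sum]

/-- Interpolations of pseudo-connections are gauge forms. -/
theorem isGaugeForm_interpolate (h1 : ∀ t, ∑ i, c i t = 1) :
    IsGaugeForm (Prod.map (id : T → T) (B.toBase.nerve n)) (interpolate c hc v θ) where
  compare m p p' hp u := by
    -- Only the plots of vertex 0 are compared; `eq_translate` extends the translation by `g` to the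
    -- whole simplex.
    obtain ⟨c, g, hc, hc1, hg, h⟩ := B.exists_smooth_quotient
      ((p.map _ (smooth_snd _ _)).map _ (Nerve.smooth_vertex 0))
      ((p'.map _ (smooth_snd _ _)).map _ (Nerve.smooth_vertex 0))
      (fun x ↦ congrArg (fun z ↦ z.2.1.1 0) (hp x)) u
    refine ⟨c, hc, g, hc1, hg, fun x ↦ conn_interpolate_gauge h1
      (p.reparam c hc) (p'.reparam c hc) hg (fun y ↦ (congrArg Prod.fst (hp (c y))).symm)
      (fun y ↦ B.eq_translate (s := (p.1 (c y)).2) (congrArg Prod.snd (hp (c y))) (h y)) x⟩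
  translate m p g hg := by
    let p' : Plot (T × Nerve B.transformation n) m :=
      ⟨fun x ↦ ((p.1 x).1, B.translate (p.1 x).2 (g x)), p.2.1, B.isPlot_translate p.2.2 hg⟩
    exact ⟨p', fun x ↦ Prod.ext rfl (B.nerve_translate _ _),
      fun x ↦ conn_interpolate_gauge h1 p p' hg (fun _ ↦ rfl) (fun _ ↦ rfl) x⟩

end Interpolation

/-! ### Calculus on the standard simplex -/

section Simplices
variable {n m k : ℕ}

/-- The vertices of the standard simplex. -/
def vert (i : Fin (n + 1)) : Eu n := Fin.cases 0 (fun j ↦ EuclideanSpace.single j 1) i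

@[simp] theorem vert_zero : vert (0 : Fin (n + 1)) = 0 := rfl
@[simp] theorem vert_succ (j : Fin n) : vert j.succ = EuclideanSpace.single j 1 := rfl

/-- The linear part of an affine map of simplices. -/
def simplexLin (f : Fin (m + 1) → Fin (n + 1)) : Eu m →L[ℝ] Eu n :=
  ∑ j : Fin m, (EuclideanSpace.proj j : Eu m →L[ℝ] ℝ).smulRight (vert (f j.succ) - vert (f 0))

theorem simplexLin_apply (f : Fin (m + 1) → Fin (n + 1)) (t : Eu m) :
    simplexLin f t = ∑ j : Fin m, t j • (vert (f j.succ) - vert (f 0)) := by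
  simp [simplexLin, sum_apply]

theorem simplexLin_single (f : Fin (m + 1) → Fin (n + 1)) (j : Fin m) :
    simplexLin f (EuclideanSpace.single j 1) = vert (f j.succ) - vert (f 0) := by
  simp [simplexLin_apply, PiLp.single_apply]

theorem simplexLin_vert (f : Fin (m + 1) → Fin (n + 1)) (i : Fin (m + 1)) :
    simplexLin f (vert i) = vert (f i) - vert (f 0) := by
  refine Fin.cases ?_ (fun j ↦ ?_) i
  · rw [vert_zero, map_zero, sub_self]
  · exact simplexLin_single f j

theorem eu_ext {F : Type*} [AddCommGroup F] [Module ℝ F] [TopologicalSpace F] {a b : Eu m →L[ℝ] F}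
    (h : ∀ j, a (EuclideanSpace.single j 1) = b (EuclideanSpace.single j 1)) : a = b := by
  have h1 : (a : Eu m →ₗ[ℝ] F) = b :=
    (EuclideanSpace.basisFun (Fin m) ℝ).toBasis.ext fun j ↦ by simpa using h j
  exact ContinuousLinearMap.coe_injective h1

theorem simplexLin_comp (f : Fin (m + 1) → Fin (n + 1)) (g : Fin (k + 1) → Fin (m + 1)) :
    simplexLin (f ∘ g) = (simplexLin f).comp (simplexLin g) := by
  refine eu_ext fun j ↦ ?_
  rw [ContinuousLinearMap.comp_apply, simplexLin_single, simplexLin_single, map_sub,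
    simplexLin_vert, simplexLin_vert]
  simp

theorem simplexLin_id : simplexLin (id : Fin (n + 1) → Fin (n + 1)) = ContinuousLinearMap.id ℝ _ := by
  refine eu_ext fun j ↦ ?_
  rw [simplexLin_single]
  simp

/-- The affine map of simplices with given values on the vertices. -/
def simplexMap (f : Fin (m + 1) → Fin (n + 1)) (t : Eu m) : Eu n := vert (f 0) + simplexLin f t

theorem simplexMap_comp (f : Fin (m + 1) → Fin (n + 1)) (g : Fin (k + 1) → Fin (m + 1)) (t : Eu k) :
    simplexMap (f ∘ g) t = simplexMap f (simplexMap g t) := by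
  rw [simplexMap, simplexMap, simplexMap, simplexLin_comp, map_add, simplexLin_vert,
    ContinuousLinearMap.comp_apply, Function.comp]
  abel

theorem simplexMap_id (t : Eu n) : simplexMap id t = t := by
  rw [simplexMap, simplexLin_id]
  simp

theorem contDiff_simplexMap (f : Fin (m + 1) → Fin (n + 1)) : ContDiff ℝ ∞ (simplexMap f) :=
  contDiff_const.add (simplexLin f).contDiff

theorem hasFDerivAt_simplexMap (f : Fin (m + 1) → Fin (n + 1)) (t : Eu m) :
    HasFDerivAt (simplexMap f) (simplexLin f) t :=
  (simplexLin f).hasFDerivAt.const_add _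

theorem sum_bary (t : Eu n) : ∑ i, bary i t = 1 := by
  rw [Fin.sum_univ_succ]
  simp [bary]

theorem bary_affine {ι : Type*} (s : Finset ι) (i : Fin (n + 1)) (a b : Eu n) (c : ι → ℝ) (v : ι → Eu n) :
    bary i (a + ∑ j ∈ s, c j • (v j - b)) = bary i a + ∑ j ∈ s, c j * (bary i (v j) - bary i b) := by
  refine Fin.cases ?_ (fun l ↦ ?_) i
  · simp only [bary, Fin.cases_zero, PiLp.add_apply]
    have : ∀ l, (∑ j ∈ s, c j • (v j - b)).ofLp l = ∑ j ∈ s, c j * (v j l - b l) := fun l ↦ by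
      simp
    simp only [this, Finset.sum_add_distrib]
    rw [Finset.sum_comm]
    simp only [← Finset.mul_sum, Finset.sum_sub_distrib]
    rw [← sub_sub, sub_eq_add_neg (1 - _), ← Finset.sum_neg_distrib]
    congr 1
    refine Finset.sum_congr rfl fun j _ ↦ ?_
    ring
  · simp [bary]

theorem bary_simplexMap (f : Fin (m + 1) → Fin (n + 1)) (i : Fin (n + 1)) (t : Eu m) :
    bary i (simplexMap f t) = ∑ j, bary j t * bary i (vert (f j)) := by
  rw [simplexMap, simplexLin_apply, bary_affine, Fin.sum_univ_succ]
  simp only [bary, Fin.cases_zero, Fin.cases_succ, mul_sub, Finset.sum_sub_distrib, ← Finset.sum_mul]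
  ring

theorem bary_vert (i j : Fin (n + 1)) : bary i (vert j) = if i = j then 1 else 0 := by
  refine Fin.cases ?_ (fun i ↦ ?_) i <;> refine Fin.cases ?_ (fun j ↦ ?_) j
  · simp [bary]
  · simp [bary, PiLp.single_apply, (Fin.succ_ne_zero _).symm]
  · simp [bary]
  · simp [bary, PiLp.single_apply]

theorem mem_simplex_iff {t : Eu n} : t ∈ simplex n ↔ ∀ i, 0 ≤ bary i t := by
  rw [Fin.forall_fin_succ, and_comm]
  simp [simplex, bary]

theorem simplexMap_mem (f : Fin (m + 1) → Fin (n + 1)) {t : Eu m} (ht : t ∈ simplex m) :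
    simplexMap f t ∈ simplex n := by
  rw [mem_simplex_iff] at ht ⊢
  intro i
  rw [bary_simplexMap]
  refine Finset.sum_nonneg fun j _ ↦ mul_nonneg (ht j) ?_
  rw [bary_vert]
  positivity

theorem isClosed_simplex (n : ℕ) : IsClosed (simplex n) := by
  have : simplex n = ⋂ i, {t | 0 ≤ bary i t} := by
    ext t
    rw [mem_simplex_iff]
    simp
  rw [this]
  exact isClosed_iInter fun i ↦ isClosed_le continuous_const (contDiff_bary i).continuous

theorem isCompact_simplex (n : ℕ) : IsCompact (simplex n) := by
  refine (isCompact_closedBall (0 : Eu n) (Real.sqrt n)).of_isClosed_subset (isClosed_simplex n)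
    fun t ht ↦ ?_
  rw [mem_closedBall_zero_iff, EuclideanSpace.norm_eq]
  refine Real.sqrt_le_sqrt ?_
  have h1 : ∀ i, t i ≤ 1 := fun i ↦
    (Finset.single_le_sum (fun j _ ↦ ht.1 j) (Finset.mem_univ i)).trans ht.2
  calc ∑ i, ‖t i‖ ^ 2 ≤ ∑ _i : Fin n, (1 : ℝ) := Finset.sum_le_sum fun i _ ↦ by
        rw [Real.norm_of_nonneg (ht.1 i)]
        exact pow_le_one₀ (ht.1 i) (h1 i)
    _ = n := by simp

/-- The determinant is multiplicative in the permutation, and a permutation has finite order; so the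
determinant is a real root of unity. -/
theorem det_simplexLin_perm (τ : Equiv.Perm (Fin (n + 1))) : |(simplexLin τ).det| = 1 := by
  have h : ∀ j : ℕ, (simplexLin ⇑(τ ^ j)).det = (simplexLin τ).det ^ j := by
    intro j
    induction j with
    | zero =>
      rw [pow_zero, pow_zero, Equiv.Perm.coe_one, simplexLin_id]
      exact LinearMap.det_id
    | succ j ih =>
      rw [pow_succ, Equiv.Perm.coe_mul, simplexLin_comp, pow_succ, ← ih]
      exact LinearMap.det_comp _ _
  have h1 := h (orderOf τ)
  rw [pow_orderOf_eq_one, Equiv.Perm.coe_one, simplexLin_id] at h1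
  have h2 : (1 : ℝ) = (simplexLin τ).det ^ orderOf τ := by
    rw [← h1]
    exact LinearMap.det_id.symm
  exact (pow_eq_one_iff_of_nonneg (abs_nonneg _) (orderOf_pos τ).ne').1 (by
    rw [← abs_pow, ← h2, abs_one])

theorem integral_simplexMap_perm (τ : Equiv.Perm (Fin (n + 1))) (g : Eu n → ℝ) :
    ∫ t in simplex n, g (simplexMap τ t) = ∫ t in simplex n, g t := by
  have inv : ∀ (τ : Equiv.Perm (Fin (n + 1))) t, simplexMap ⇑τ⁻¹ (simplexMap τ t) = t := by
    intro τ t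
    rw [← simplexMap_comp, ← Equiv.Perm.coe_mul, inv_mul_cancel, Equiv.Perm.coe_one, simplexMap_id]
  have im : simplexMap τ '' simplex n = simplex n := by
    refine Set.Subset.antisymm (Set.image_subset_iff.2 fun t ht ↦ simplexMap_mem _ ht) fun t ht ↦ ?_
    exact ⟨simplexMap ⇑τ⁻¹ t, simplexMap_mem _ ht, by simpa using inv τ⁻¹ t⟩
  have h := integral_image_eq_integral_abs_det_fderiv_smul volume (isClosed_simplex n).measurableSet
    (fun t _ ↦ (hasFDerivAt_simplexMap τ t).hasFDerivWithinAt)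
    (Function.LeftInverse.injective (inv τ)).injOn g
  rw [im] at h
  rw [h]
  simp only [det_simplexLin_perm, one_smul]

theorem integrableOn_simplex {F : Type*} [NormedAddCommGroup F] {g : Eu n → F} (hg : Continuous g) :
    IntegrableOn g (simplex n) := hg.continuousOn.integrableOn_compact (isCompact_simplex n)

theorem contDiff_integral_simplex {E : Type*} [NormedAddCommGroup E] [NormedSpace ℝ E]
    {g : Eu n × E → ℝ} (hg : ContDiff ℝ ∞ g) :
    ContDiff ℝ ∞ fun x ↦ ∫ t in simplex n, g (t, x) := by
  obtain ⟨R, hR⟩ := (isCompact_simplex n).isBounded.subset_closedBall (0 : Eu n)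
  let χ : ContDiffBump (0 : Eu n) := ⟨max R 1, max R 1 + 1, by positivity, by linarith⟩
  -- The integral is the value at `0` of a convolution depending on the parameter `x`: the indicator
  -- function of the simplex against `y ↦ g (-y, x)`, cut off by a bump function equal to 1 on a
  -- ball containing the simplex. Smoothness of such convolutions gives the claim.
  have h := contDiffOn_convolution_right_with_param_comp (n := ⊤) (μ := volume)
    (ContinuousLinearMap.mul ℝ ℝ) (v := fun _ : E ↦ (0 : Eu n)) (s := Set.univ)
    (f := (simplex n).indicator fun _ ↦ (1 : ℝ)) (g := fun x y ↦ χ y * g (-y, x))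
    (k := Metric.closedBall 0 (max R 1 + 1)) contDiffOn_const isOpen_univ
    (isCompact_closedBall _ _) (fun x y _ hy ↦ by
      rw [χ.zero_of_le_dist (by simpa using (not_le.1 (by simpa using hy)).le), zero_mul])
    (((integrableOn_simplex continuous_const).integrable_indicator
      (isClosed_simplex n).measurableSet).locallyIntegrable)
    (ContDiff.contDiffOn ((χ.contDiff.comp contDiff_snd).mul
      (hg.comp (contDiff_snd.neg.prodMk contDiff_fst))))
  convert contDiffOn_univ.1 h using 1
  funext x
  rw [convolution, ← integral_indicator (isClosed_simplex n).measurableSet]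
  congr 1
  funext t
  by_cases ht : t ∈ simplex n
  · have : χ (-t) = 1 := χ.one_of_mem_closedBall (by
      have := hR ht
      rw [mem_closedBall_zero_iff] at this ⊢
      rw [norm_neg]
      exact this.trans (le_max_left _ _))
    simp [ht, this]
  · simp [ht]

theorem hasFDerivAt_integral_simplex {E : Type*} [NormedAddCommGroup E] [NormedSpace ℝ E]
    [FiniteDimensional ℝ E]
    {g : Eu n × E → ℝ} (hg : ContDiff ℝ ∞ g) (x : E) :
    HasFDerivAt (fun x ↦ ∫ t in simplex n, g (t, x))
      (∫ t in simplex n, (fderiv ℝ g (t, x)).comp (ContinuousLinearMap.inr ℝ _ _)) x := by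
  have hc : Continuous fun z : Eu n × E ↦ (fderiv ℝ g z).comp (ContinuousLinearMap.inr ℝ (Eu n) E) :=
    (hg.continuous_fderiv (by simp)).clm_comp continuous_const
  obtain ⟨C, hC⟩ := ((isCompact_simplex n).prod (isCompact_closedBall x 1)).exists_bound_of_continuousOn
    hc.continuousOn
  refine hasFDerivAt_integral_of_dominated_of_fderiv_le (bound := fun _ ↦ C)
    (F' := fun x t ↦ (fderiv ℝ g (t, x)).comp (ContinuousLinearMap.inr ℝ (Eu n) E))
    (s := Metric.closedBall x 1) (Metric.closedBall_mem_nhds x one_pos) ?_ ?_ ?_ ?_ ?_ ?_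
  · exact Eventually.of_forall fun y ↦ (hg.continuous.comp (by fun_prop)).aestronglyMeasurable
  · exact integrableOn_simplex (hg.continuous.comp (by fun_prop))
  · exact (hc.comp (by fun_prop : Continuous fun t : Eu n ↦ (t, x))).aestronglyMeasurable
  · exact (ae_restrict_iff' (isClosed_simplex n).measurableSet).2
      (Eventually.of_forall fun t ht y hy ↦ hC (t, y) ⟨ht, hy⟩)
  · exact integrableOn_simplex continuous_const
  · refine Eventually.of_forall fun t y _ ↦ ?_
    exact (hg.differentiable (by simp) (t, y)).hasFDerivAt.comp y
      ((hasFDerivAt_const t y).prodMk (hasFDerivAt_id y))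

theorem fderiv_integral_simplex {E : Type*} [NormedAddCommGroup E] [NormedSpace ℝ E]
    [FiniteDimensional ℝ E] {g : Eu n × E → ℝ} (hg : ContDiff ℝ ∞ g) (x w : E) :
    fderiv ℝ (fun x ↦ ∫ t in simplex n, g (t, x)) x w =
      ∫ t in simplex n, fderiv ℝ g (t, x) (0, w) := by
  have hc : Continuous fun t : Eu n ↦
      (fderiv ℝ g (t, x)).comp (ContinuousLinearMap.inr ℝ (Eu n) E) :=
    ((hg.continuous_fderiv (by simp)).comp (by fun_prop)).clm_comp continuous_const
  rw [(hasFDerivAt_integral_simplex hg x).fderiv, ContinuousLinearMap.integral_apply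
    (integrableOn_simplex hc)]
  rfl

/-- Insertion of a coordinate. -/
def insertCoord (i : Fin (m + 1)) (s : ℝ) (t : Eu m) : Eu (m + 1) :=
  WithLp.toLp 2 (i.insertNth s t.ofLp)

theorem insertCoord_self (i : Fin (m + 1)) (s : ℝ) (t : Eu m) : insertCoord i s t i = s := by
  simp [insertCoord]

theorem insertCoord_succAbove (i : Fin (m + 1)) (s : ℝ) (t : Eu m) (j : Fin m) :
    insertCoord i s t (i.succAbove j) = t j := by
  simp [insertCoord]

theorem sum_insertCoord (i : Fin (m + 1)) (s : ℝ) (t : Eu m) :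
    ∑ j, insertCoord i s t j = s + ∑ j, t j := by
  rw [Fin.sum_univ_succAbove _ i, insertCoord_self]
  simp only [insertCoord_succAbove]

theorem insertCoord_eq (i : Fin (m + 1)) (s : ℝ) (t : Eu m) : insertCoord i s t =
    insertCoord i 0 t + s • EuclideanSpace.single i 1 := by
  ext j
  refine Fin.succAboveCases i ?_ (fun j ↦ ?_) j
  · simp [insertCoord_self]
  · simp [insertCoord_succAbove, Fin.succAbove_ne]

theorem insertCoord_mem_iff (i : Fin (m + 1)) (s : ℝ) (t : Eu m) :
    insertCoord i s t ∈ simplex (m + 1) ↔ t ∈ simplex m ∧ 0 ≤ s ∧ s ≤ 1 - ∑ j, t j := by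
  simp only [simplex, Set.mem_ofPred_eq, sum_insertCoord, Fin.forall_iff_succAbove i,
    insertCoord_self, insertCoord_succAbove]
  constructor
  · rintro ⟨⟨h1, h2⟩, h3⟩
    exact ⟨⟨h2, by linarith⟩, h1, by linarith⟩
  · rintro ⟨⟨h1, h2⟩, h3, h4⟩
    exact ⟨⟨h3, h1⟩, by linarith⟩

theorem insertCoord_zero (i : Fin (m + 1)) (t : Eu m) :
    insertCoord i 0 t = simplexMap i.succ.succAbove t := by
  have h0 : i.succ.succAbove 0 = 0 := Fin.succ_succAbove_zero i
  have h1 : ∀ j : Fin m, i.succ.succAbove j.succ = (i.succAbove j).succ := Fin.succ_succAbove_succ i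
  rw [simplexMap, simplexLin_apply, h0]
  simp only [h1, vert_zero, vert_succ, sub_zero, zero_add]
  ext j
  refine Fin.succAboveCases i ?_ (fun j ↦ ?_) j
  · simp [insertCoord_self, (Fin.succAbove_ne _ _).symm]
  · simp [insertCoord_succAbove, Pi.single_apply]

/-- The upper end of the segment in direction `i` lies on the facet opposite to vertex 0, but its
vertices come in another order: `t = 0` is sent to vertex `i + 1`. The cyclic permutation records
this. -/
theorem insertCoord_one_sub (i : Fin (m + 1)) (t : Eu m) : insertCoord i (1 - ∑ j, t j) t =
    simplexMap Fin.succ (simplexMap ⇑i.cycleRange.symm t) := by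
  rw [← simplexMap_comp, simplexMap, simplexLin_apply, insertCoord_eq, insertCoord_zero, simplexMap,
    simplexLin_apply]
  simp only [Function.comp, Fin.cycleRange_symm_zero, Fin.cycleRange_symm_succ, vert_succ,
    Fin.succ_succAbove_zero, Fin.succ_succAbove_succ, vert_zero, sub_zero, zero_add, smul_sub,
    Finset.sum_sub_distrib, ← Finset.sum_smul, sub_smul, one_smul]
  abel

theorem continuous_insertCoord (i : Fin (m + 1)) :
    Continuous fun z : ℝ × Eu m ↦ insertCoord i z.1 z.2 := by
  have : (fun z : ℝ × Eu m ↦ insertCoord i z.1 z.2) = fun z ↦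
      (z.1 • EuclideanSpace.single i (1 : ℝ)) + simplexMap i.succ.succAbove z.2 := by
    funext z
    rw [insertCoord_eq, insertCoord_zero]
    exact add_comm _ _
  rw [this]
  have := (contDiff_simplexMap i.succ.succAbove).continuous
  fun_prop

/-- Fubini's theorem: the part of the simplex over `t` in direction `i` is the segment from `0` to
`1 - ∑ t_j`, and it is empty unless `t` lies in the smaller simplex. -/
theorem integral_simplex_succ (i : Fin (m + 1)) {g : Eu (m + 1) → ℝ} (hg : Continuous g) :
    ∫ t in simplex (m + 1), g t =
      ∫ t in simplex m, ∫ s in (0 : ℝ)..(1 - ∑ j, t j), g (insertCoord i s t) := by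
  have e1 : MeasurePreserving (fun z : ℝ × Eu m ↦ insertCoord i z.1 z.2)
      (volume.prod volume) volume := by
    have h1 := (PiLp.volume_preserving_toLp (Fin (m + 1))).comp
      ((volume_preserving_piFinSuccAbove (fun _ : Fin (m + 1) ↦ ℝ) i).symm _)
    exact h1.comp ((MeasurePreserving.id volume).prod (PiLp.volume_preserving_ofLp (Fin m)))
  have hmeas := (isClosed_simplex (m + 1)).measurableSet
  have emb : MeasurableEmbedding fun z : ℝ × Eu m ↦ insertCoord i z.1 z.2 := by
    refine (continuous_insertCoord i).measurableEmbedding fun z z' h ↦ ?_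
    refine Prod.ext ?_ ?_
    · have := congrArg (fun w : Eu (m + 1) ↦ w i) h
      simpa [insertCoord_self] using this
    · ext j
      have := congrArg (fun w : Eu (m + 1) ↦ w (i.succAbove j)) h
      simpa [insertCoord_succAbove] using this
  have e2 := e1.integral_comp emb ((simplex (m + 1)).indicator g)
  rw [integral_indicator hmeas] at e2
  rw [← e2, integral_prod_symm]
  · rw [← integral_indicator (isClosed_simplex m).measurableSet]
    congr 1
    funext t
    by_cases ht : t ∈ simplex m
    · have h0 : (0 : ℝ) ≤ 1 - ∑ j, t j := by linarith [ht.2]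
      rw [Set.indicator_of_mem ht, intervalIntegral.integral_of_le h0,
        ← integral_Icc_eq_integral_Ioc, ← integral_indicator measurableSet_Icc]
      congr 1
      funext s
      by_cases hs : s ∈ Set.Icc 0 (1 - ∑ j, t j)
      · rw [Set.indicator_of_mem hs, Set.indicator_of_mem
          ((insertCoord_mem_iff i s t).2 ⟨ht, hs.1, hs.2⟩)]
      · rw [Set.indicator_of_notMem hs, Set.indicator_of_notMem]
        exact fun h ↦ hs (((insertCoord_mem_iff i s t).1 h).2)
    · rw [Set.indicator_of_notMem ht]
      refine integral_eq_zero_of_ae (Eventually.of_forall fun s ↦ ?_)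
      exact Set.indicator_of_notMem (fun h ↦ ht ((insertCoord_mem_iff i s t).1 h).1) _
  · exact (e1.integrable_comp_emb emb).2
      ((integrableOn_simplex hg).integrable_indicator hmeas)

/-- The fundamental theorem of calculus on a simplex. -/
theorem integral_simplex_fderiv (i : Fin (m + 1)) {g : Eu (m + 1) → ℝ} (hg : ContDiff ℝ ∞ g) :
    ∫ t in simplex (m + 1), fderiv ℝ g t (EuclideanSpace.single i 1) =
      (∫ t in simplex m, g (simplexMap Fin.succ t)) -
        ∫ t in simplex m, g (simplexMap i.succ.succAbove t) := by
  have hc : Continuous fun t ↦ fderiv ℝ g t (EuclideanSpace.single i 1) :=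
    (hg.continuous_fderiv (by simp)).clm_apply continuous_const
  -- The upper endpoint parametrises its facet only up to a permutation of the vertices. Integration
  -- over the simplex does not see such a permutation, so it can be inserted beforehand.
  rw [integral_simplex_succ i hc, ← integral_simplexMap_perm i.cycleRange.symm
    (fun t ↦ g (simplexMap Fin.succ t)), ← integral_sub]
  · refine setIntegral_congr_fun (isClosed_simplex m).measurableSet fun t _ ↦ ?_
    beta_reduce
    rw [← insertCoord_one_sub, ← insertCoord_zero]
    refine intervalIntegral.integral_eq_sub_of_hasDerivAt (f := fun s ↦ g (insertCoord i s t))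
      (fun s _ ↦ ?_) (Continuous.intervalIntegrable ?_ _ _)
    · have h1 : HasDerivAt (fun s ↦ insertCoord i s t) (EuclideanSpace.single i 1) s := by
        have : (fun s ↦ insertCoord i s t) = fun s ↦ insertCoord i 0 t +
            s • EuclideanSpace.single i (1 : ℝ) := funext fun s ↦ insertCoord_eq i s t
        rw [this]
        simpa using ((hasDerivAt_id s).smul_const (EuclideanSpace.single i (1 : ℝ))).const_add
          (insertCoord i 0 t)
      exact (hg.differentiable (by simp) _).hasFDerivAt.comp_hasDerivAt s h1
    · exact hc.comp ((continuous_insertCoord i).comp (by fun_prop : Continuous fun s ↦ (s, t)))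
  · exact integrableOn_simplex (hg.continuous.comp ((contDiff_simplexMap _).continuous.comp
      (contDiff_simplexMap _).continuous))
  · exact integrableOn_simplex (hg.continuous.comp (contDiff_simplexMap _).continuous)

end Simplices

/-! ### Contraction of exterior products with vectors -/

section Contraction
variable {V : Type*} [NormedAddCommGroup V] [NormedSpace ℝ V] {k l m n : ℕ}

/-- Up to the order of the arguments, `alternatizeUncurryFin (ξ.smulRight a)` is `ξ ∧ a`; the sign
is that of moving `ξ` past `b`. -/
theorem wedge_alternatizeUncurryFin (b : V [⋀^Fin l]→L[ℝ] ℝ) (ξ : V →L[ℝ] ℝ) (a : V [⋀^Fin k]→L[ℝ] ℝ) :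
    wedge b (ContinuousAlternatingMap.alternatizeUncurryFin (ξ.smulRight a)) =
      (-1 : ℝ) ^ l • ContinuousAlternatingMap.alternatizeUncurryFin (ξ.smulRight (wedge b a)) := by
  ext v
  rw [alternatizeUncurryFin_smulRight, alternatizeUncurryFin_smulRight, wedge_smul_right, smul_smul,
    ContinuousAlternatingMap.smul_apply, ContinuousAlternatingMap.smul_apply, wedge_assoc, pow_add,
    ← mul_assoc, neg_one_pow_sq, one_mul]
  rfl

theorem alternatizeUncurryFin_cons (ξ : V →L[ℝ] ℝ) (a : V [⋀^Fin k]→L[ℝ] ℝ) (e : V)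
    (w : Fin k → V) :
    ContinuousAlternatingMap.alternatizeUncurryFin (ξ.smulRight a) (Fin.cons e w : Fin (k + 1) → V) =
      ξ e * a w - ∑ i : Fin k, (-1 : ℝ) ^ (i : ℕ) *
        (ξ (w i) * a (i.succ.removeNth (Fin.cons e w : Fin (k + 1) → V))) := by
  rw [ContinuousAlternatingMap.alternatizeUncurryFin_apply, Fin.sum_univ_succ, sub_eq_add_neg,
    ← Finset.sum_neg_distrib]
  congr 1
  · simp
  · refine Finset.sum_congr rfl fun i _ ↦ ?_
    simp [pow_succ]

theorem removeNth_succ_cons (i : Fin (k + 1)) (e : V) (w : Fin (k + 1) → V) :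
    i.succ.removeNth (Fin.cons e w : Fin (k + 2) → V) = Fin.cons e (i.removeNth w) := by
  funext j
  refine Fin.cases ?_ (fun j ↦ ?_) j
  · simp [Fin.removeNth]
  · simp [Fin.removeNth]

theorem wedge_zero_right (b : V [⋀^Fin l]→L[ℝ] ℝ) (a : V [⋀^Fin 0]→L[ℝ] ℝ) :
    wedge b a = (a Fin.elim0) • b := by
  have h : a = (a Fin.elim0) • ContinuousAlternatingMap.constOfIsEmpty ℝ V (Fin 0) (1 : ℝ) := by
    ext v
    rw [Subsingleton.elim v Fin.elim0]
    simp
  conv_lhs => rw [h, wedge_smul_right]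
  rw [show wedge b (ContinuousAlternatingMap.constOfIsEmpty ℝ V (Fin 0) (1 : ℝ)) = b from wedge_one b]

/-- Forms of positive degree are spanned by the products `ξ ∧ a`: antisymmetrising `a.curryLeft`
returns `(k + 1) a`, and `a.curryLeft` expands in a basis of the dual space. -/
theorem alternating_induction [FiniteDimensional ℝ V] {motive : (V [⋀^Fin (k + 1)]→L[ℝ] ℝ) → Prop}
    (zero : motive 0) (add : ∀ a b, motive a → motive b → motive (a + b))
    (smul : ∀ (c : ℝ) a, motive a → motive (c • a))
    (ext : ∀ (ξ : V →L[ℝ] ℝ) (a : V [⋀^Fin k]→L[ℝ] ℝ),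
      motive (ContinuousAlternatingMap.alternatizeUncurryFin (ξ.smulRight a)))
    (a : V [⋀^Fin (k + 1)]→L[ℝ] ℝ) : motive a := by
  have h : a = ((k + 1 : ℕ) : ℝ)⁻¹ • ContinuousAlternatingMap.alternatizeUncurryFin a.curryLeft := by
    have h1 : ContinuousAlternatingMap.alternatizeUncurryFin a.curryLeft = ((k + 1 : ℕ) : ℝ) • a := by
      rw [ContinuousAlternatingMap.alternatizeUncurryFin_curryLeft, Nat.cast_smul_eq_nsmul]
    rw [h1, smul_smul, inv_mul_cancel₀ (by positivity), one_smul]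
  have h2 := map_sum (ContinuousAlternatingMap.alternatizeUncurryFinCLM ℝ V ℝ)
    (fun i ↦ (LinearMap.toContinuousLinearMap ((Module.finBasis ℝ V).coord i)).smulRight
      (a.curryLeft (Module.finBasis ℝ V i))) Finset.univ
  rw [← clm_eq_sum] at h2
  simp only [ContinuousAlternatingMap.alternatizeUncurryFinCLM_apply] at h2
  rw [h, h2]
  exact smul _ _ (Finset.sum_induction _ motive add zero fun i _ ↦ ext _ _)

/-- Contraction is an antiderivation, here for a product with a linear form. The zeroth summand
gives `ξ e • a`; the remaining ones keep `e` as first argument of `a`. -/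
theorem curryLeft_alternatizeUncurryFin_succ (ξ : V →L[ℝ] ℝ) (a : V [⋀^Fin (k + 1)]→L[ℝ] ℝ) (e : V) :
    (ContinuousAlternatingMap.alternatizeUncurryFin (ξ.smulRight a)).curryLeft e =
      ξ e • a - ContinuousAlternatingMap.alternatizeUncurryFin (ξ.smulRight (a.curryLeft e)) := by
  ext w
  refine (alternatizeUncurryFin_cons ξ a e w).trans ?_
  rw [ContinuousAlternatingMap.sub_apply, ContinuousAlternatingMap.smul_apply,
    ContinuousAlternatingMap.alternatizeUncurryFin_apply, smul_eq_mul]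
  congr 1
  refine Finset.sum_congr rfl fun i _ ↦ ?_
  rw [removeNth_succ_cons, ContinuousLinearMap.smulRight_apply]
  simp only [zsmul_eq_mul, Int.cast_pow, Int.cast_neg, Int.cast_one]
  rfl

/-- Contraction of an exterior product with a vector that annihilates the first factor. -/
theorem wedge_cons [FiniteDimensional ℝ V] {b : V [⋀^Fin l]→L[ℝ] ℝ} {e : V}
    (hb : ∀ u i, u i = e → b u = 0) :
    ∀ (k : ℕ) (a : V [⋀^Fin (k + 1)]→L[ℝ] ℝ) (w : Fin (l + k) → V),
      wedge b a (Fin.cons e w : Fin (l + k + 1) → V) = (-1) ^ l * wedge b (a.curryLeft e) w := by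
  intro k
  -- Induction on the degree of the second factor, which may be taken to be `ξ ∧ a`. Expanding along
  -- `ξ`, the summand with `ξ e` already has the desired shape. The others contain `e` among the
  -- arguments of `b ∧ a`, with `a` of smaller degree: they vanish by `hb` in degree 0 and are given
  -- by `ih` otherwise.
  induction k with
  | zero =>
    intro a
    induction a using alternating_induction with
    | zero =>
      intro w
      simp [← wedgeL_apply]
    | add a a' h h' =>
      intro w
      rw [wedge_add_right, ContinuousAlternatingMap.add_apply, h, h',
        ContinuousAlternatingMap.curryLeft_add, add_apply, wedge_add_right,
        ContinuousAlternatingMap.add_apply, mul_add]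
    | smul c a h =>
      intro w
      rw [wedge_smul_right, ContinuousAlternatingMap.smul_apply, h,
        ContinuousAlternatingMap.curryLeft_smul, smul_apply, wedge_smul_right,
        ContinuousAlternatingMap.smul_apply, smul_eq_mul, smul_eq_mul, mul_left_comm]
    | ext ξ a =>
      intro w
      have h1 : (ContinuousAlternatingMap.alternatizeUncurryFin (ξ.smulRight a)).curryLeft e =
          ξ e • a := by
        ext v
        refine (alternatizeUncurryFin_cons ξ a e v).trans ?_
        simp
      rw [wedge_alternatizeUncurryFin, h1, wedge_smul_right, ContinuousAlternatingMap.smul_apply,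
        alternatizeUncurryFin_cons, Finset.sum_eq_zero fun i _ ↦ ?_]
      · simp
      · rw [wedge_zero_right, ContinuousAlternatingMap.smul_apply, hb _ ⟨0, i.pos⟩, smul_zero, mul_zero,
          mul_zero]
        simp [Fin.removeNth, Fin.succAbove, Fin.lt_def]
  | succ k ih =>
    intro a
    induction a using alternating_induction with
    | zero =>
      intro w
      simp [← wedgeL_apply]
    | add a a' h h' =>
      intro w
      rw [wedge_add_right, ContinuousAlternatingMap.add_apply, h, h',
        ContinuousAlternatingMap.curryLeft_add, add_apply, wedge_add_right,
        ContinuousAlternatingMap.add_apply, mul_add]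
    | smul c a h =>
      intro w
      rw [wedge_smul_right, ContinuousAlternatingMap.smul_apply, h,
        ContinuousAlternatingMap.curryLeft_smul, smul_apply, wedge_smul_right,
        ContinuousAlternatingMap.smul_apply, smul_eq_mul, smul_eq_mul, mul_left_comm]
    | ext ξ a =>
      intro w
      rw [wedge_alternatizeUncurryFin, curryLeft_alternatizeUncurryFin_succ, sub_eq_add_neg,
        wedge_add_right, ← neg_one_smul ℝ (ContinuousAlternatingMap.alternatizeUncurryFin _),
        wedge_smul_right, wedge_smul_right, wedge_alternatizeUncurryFin]
      simp only [ContinuousAlternatingMap.add_apply, ContinuousAlternatingMap.smul_apply,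
        smul_eq_mul]
      rw [alternatizeUncurryFin_cons, ContinuousAlternatingMap.alternatizeUncurryFin_apply,
        sub_eq_add_neg, neg_one_mul]
      congr 3
      rw [Finset.mul_sum]
      refine Finset.sum_congr rfl fun i _ ↦ ?_
      have := ih a (Fin.removeNth (n := l + k) i w)
      rw [show i.succ.removeNth (Fin.cons e w : Fin (l + (k + 1) + 1) → V) =
        Fin.cons e (Fin.removeNth (n := l + k) i w) from removeNth_succ_cons (k := l + k) i e w]
      refine (congrArg (fun x ↦ (-1 : ℝ) ^ (i : ℕ) * (ξ (w i) * x)) this).trans ?_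
      simp only [ContinuousLinearMap.smulRight_apply, ContinuousAlternatingMap.smul_apply, smul_eq_mul]
      ring

theorem append_update_right {n k : ℕ} (e : Fin n → V) (w : Fin k → V) (i : Fin k) (z : V) :
    Fin.append e (Function.update w i z) = Function.update (Fin.append e w) (Fin.natAdd n i) z := by
  funext j
  refine Fin.addCases (fun j ↦ ?_) (fun j ↦ ?_) j
  · rw [Function.update_of_ne (by simp [Fin.ext_iff]; omega)]
    simp
  · by_cases hj : j = i
    · subst hj; simp
    · rw [Function.update_of_ne (by simpa using hj)]
      simp [hj]

variable {K : ℕ}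

/-- Insertion of vectors in the first arguments. -/
def contract (h : K = n + k) (a : V [⋀^Fin K]→L[ℝ] ℝ) (e : Fin n → V) : V [⋀^Fin k]→L[ℝ] ℝ where
  toFun w := a (Fin.append e w ∘ Fin.cast h)
  map_update_add' w i x y := by
    rename_i inst
    obtain rfl : inst = instDecidableEqFin k := Subsingleton.elim _ _
    subst h
    change a (Fin.append _ _) = a (Fin.append _ _) + a (Fin.append _ _)
    rw [append_update_right, append_update_right, append_update_right]
    exact a.map_update_add (Fin.append e w) (Fin.natAdd n i) x y
  map_update_smul' w i c x := by
    rename_i inst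
    obtain rfl : inst = instDecidableEqFin k := Subsingleton.elim _ _
    subst h
    change a (Fin.append _ _) = c • a (Fin.append _ _)
    rw [append_update_right, append_update_right]
    exact a.map_update_smul (Fin.append e w) (Fin.natAdd n i) c x
  map_eq_zero_of_eq' w i j hw hij := by
    subst h
    refine a.map_eq_zero_of_eq _ (i := Fin.natAdd n i) (j := Fin.natAdd n j) ?_
      fun h ↦ hij (by simpa using h)
    simpa using hw
  cont := by
    refine a.cont.comp (continuous_pi fun i ↦ ?_)
    subst h
    refine Fin.addCases (fun j ↦ ?_) (fun j ↦ ?_) i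
    · simpa using continuous_const
    · simpa using continuous_apply j

theorem append_eq_cons (e : Fin (n + 1) → V) (w : Fin k → V) (i : Fin (n + 1 + k)) :
    Fin.append e w i = (Fin.cons (e 0) (Fin.append (Fin.tail e) w) : Fin (n + k + 1) → V)
      (Fin.cast (by omega) i) := by
  conv_lhs => rw [← Fin.cons_self_tail e, Fin.append_cons]
  rfl

/-- `wedge_cons` is applied once for each of the `n` vectors; each passage through `b` costs
`(-1)^l`. This is the pointwise form of the projection formula. -/
theorem wedge_append [FiniteDimensional ℝ V] {b : V [⋀^Fin l]→L[ℝ] ℝ} :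
    ∀ {n K : ℕ} (h : K = n + k) (a : V [⋀^Fin K]→L[ℝ] ℝ) (e : Fin n → V) (w : Fin (l + k) → V)
      (v : Fin (l + K) → V), (∀ j u i, u i = e j → b u = 0) →
      (∀ i, v i = Fin.append e w (Fin.cast (by omega) i)) →
      wedge b a v = (-1) ^ (l * n) * wedge b (contract h a e) w := by
  intro n
  induction n with
  | zero =>
    intro K h a e w v hb hv
    obtain rfl : K = k := by omega
    have h1 : contract h a e = a := by
      ext u
      refine congrArg a (funext fun i ↦ ?_)
      have := Fin.append_right e u i
      rwa [show Fin.natAdd 0 i = Fin.cast h i from Fin.ext (by simp)] at this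
    rw [h1, mul_zero, pow_zero, one_mul]
    refine congrArg _ (funext fun i ↦ (hv i).trans ?_)
    have := Fin.append_right e w i
    rwa [show Fin.natAdd 0 i = Fin.cast _ i from Fin.ext (by simp)] at this
  | succ n ih =>
    intro K h a e w v hb hv
    obtain rfl : K = n + k + 1 := by omega
    have h1 : v = Fin.cons (e 0) (Fin.append (Fin.tail e) w ∘ Fin.cast (by omega) :
        Fin (l + (n + k)) → V) := by
      funext i
      refine (hv i).trans ?_
      rw [append_eq_cons]
      refine Fin.cases rfl (fun i ↦ rfl) (i : Fin (l + (n + k) + 1))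
    rw [h1]
    refine (wedge_cons (fun u i ↦ hb 0 u i) (n + k) a _).trans ?_
    have h2 := ih rfl (a.curryLeft (e 0)) (Fin.tail e) w (Fin.append (Fin.tail e) w ∘ Fin.cast (by omega))
      (fun j u i ↦ hb j.succ u i) fun _ ↦ rfl
    have h3 : contract rfl (a.curryLeft (e 0)) (Fin.tail e) = contract h a e := by
      ext u
      refine congrArg a (funext fun i ↦ ?_)
      rw [Function.comp_apply, append_eq_cons]
      rfl
    refine (congrArg ((-1 : ℝ) ^ l * ·) h2).trans ?_
    rw [h3, ← mul_assoc, ← pow_add, mul_add, mul_one, add_comm]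

/-- After `K` contractions the second factor has degree 0, and a further vector `e j` must be
inserted in `b`, which annihilates it. -/
theorem wedge_append_eq_zero [FiniteDimensional ℝ V] {b : V [⋀^Fin l]→L[ℝ] ℝ} :
    ∀ {n K : ℕ} (_ : K < n) (a : V [⋀^Fin K]→L[ℝ] ℝ) (e : Fin n → V)
      (v : Fin (l + K) → V) , (∀ j u i, u i = e j → b u = 0) →
      (∀ j : Fin n, ∀ hj : (j : ℕ) < l + K, v ⟨j, hj⟩ = e j) → n ≤ l + K →
      wedge b a v = 0 := by
  intro n
  induction n with
  | zero => intro K h; omega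
  | succ n ih =>
    intro K h a e v hb hv hn
    cases K with
    | zero =>
      rw [wedge_zero_right, ContinuousAlternatingMap.smul_apply,
        hb 0 v ⟨0, by omega⟩ (hv 0 (by rw [Fin.val_zero]; omega)), smul_zero]
    | succ K =>
      have h1 : v = Fin.cons (e 0) (Fin.tail (n := l + K) v) := by
        rw [← hv 0 (by rw [Fin.val_zero]; omega)]
        exact (Fin.cons_self_tail (n := l + K) v).symm
      rw [h1]
      refine (wedge_cons (fun u i ↦ hb 0 u i) K a _).trans ?_
      rw [ih (by omega) (a.curryLeft (e 0)) (Fin.tail e) _ (fun j u i ↦ hb j.succ u i)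
        (fun j hj ↦ hv j.succ (by simpa [← add_assoc] using hj)) (by omega), mul_zero]

end Contraction

/-! ### Integration of forms over the simplex -/

section FibreIntegration
variable {X Y Z : Type*} [DiffeologicalSpace X] [DiffeologicalSpace Y] [DiffeologicalSpace Z]
  {k l m n r : ℕ}

namespace Forms

/-- The value of a form along a plot, at a point and at a tuple of vectors. -/
def ev (a : Forms X) (p : Plot X m) (x : Eu m) (v : Fin k → Eu m) : ℝ := (comp k a).val p x v

theorem ev_add (a b : Forms X) (p : Plot X m) (x : Eu m) (v : Fin k → Eu m) :
    (a + b).ev p x v = a.ev p x v + b.ev p x v := by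
  rw [ev, map_add]
  rfl

theorem ev_smul (c : ℝ) (a : Forms X) (p : Plot X m) (x : Eu m) (v : Fin k → Eu m) :
    (c • a).ev p x v = c * a.ev p x v := by
  rw [ev, map_smul]
  rfl

theorem ev_zero (p : Plot X m) (x : Eu m) (v : Fin k → Eu m) : (0 : Forms X).ev p x v = 0 := by
  rw [ev, map_zero]
  rfl

theorem ev_sum {ι : Type*} (s : Finset ι) (a : ι → Forms X) (p : Plot X m) (x : Eu m)
    (v : Fin k → Eu m) : (∑ i ∈ s, a i).ev p x v = ∑ i ∈ s, (a i).ev p x v := by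
  classical
  induction s using Finset.induction_on with
  | empty => simp [ev_zero]
  | insert i s hi ih => rw [Finset.sum_insert hi, Finset.sum_insert hi, ev_add, ih]

theorem ext_ev {a b : Forms X}
    (h : ∀ (k m : ℕ) (p : Plot X m) (x : Eu m) (v : Fin k → Eu m), a.ev p x v = b.ev p x v) : a = b :=
  ext_comp fun k ↦ Form.ext fun m p x ↦ ContinuousAlternatingMap.ext fun v ↦ h k m p x v

/-- `ev` takes the component whose degree is the length of the tuple. An equality of degrees thus
becomes a re-indexing of the vectors, and no form has to be transported. -/
theorem ev_congr (a : Forms X) {p p' : Plot X m} (x : Eu m) {v : Fin k → Eu m} {v' : Fin l → Eu m}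
    (hp : ∀ x, p.1 x = p'.1 x) (h : k = l) (hv : ∀ i, v i = v' (Fin.cast h i)) :
    a.ev p x v = a.ev p' x v' := by
  subst h
  obtain rfl : p = p' := Subtype.ext (funext hp)
  rw [show v = v' from funext hv]

theorem ev_pullback (f : X → Y) (hf : DSmooth f) (a : Forms Y) (p : Plot X m) (x : Eu m)
    (v : Fin k → Eu m) : (pullback f hf a).ev p x v = a.ev (p.map f hf) x v := by
  rw [ev, comp_pullback]
  rfl

theorem ev_reparam (a : Forms X) (p : Plot X m) {f : Eu n → Eu m} (hf : ContDiff ℝ ∞ f) (x : Eu n)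
    (v : Fin k → Eu n) : a.ev (p.reparam f hf) x v = a.ev p (f x) fun i ↦ fderiv ℝ f x (v i) := by
  rw [ev, Form.val_reparam]
  rfl

theorem ev_reparam_of_eq (a : Forms X) {q : Plot X n} (p : Plot X m) {f : Eu n → Eu m}
    {f' : Eu n →L[ℝ] Eu m} {x : Eu n} (hf : ContDiff ℝ ∞ f) (hf' : HasFDerivAt f f' x)
    (hq : ∀ x, q.1 x = p.1 (f x)) (v : Fin k → Eu n) :
    a.ev q x v = a.ev p (f x) fun i ↦ f' (v i) := by
  rw [show q = p.reparam f hf from Subtype.ext (funext hq), ev_reparam, hf'.fderiv]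

theorem contDiff_ev (a : Forms X) (p : Plot X m) {E : Type*} [NormedAddCommGroup E] [NormedSpace ℝ E]
    {x : E → Eu m} {v : Fin k → E → Eu m} (hx : ContDiff ℝ ∞ x) (hv : ∀ i, ContDiff ℝ ∞ (v i)) :
    ContDiff ℝ ∞ fun y ↦ a.ev p (x y) fun i ↦ v i y :=
  contDiff_alternating_apply (((comp k a).contDiff_val p).comp hx) hv

theorem ev_d (a : Forms X) (p : Plot X m) (x : Eu m) (v : Fin (k + 1) → Eu m) :
    (d a).ev p x v = ∑ i : Fin (k + 1), (-1 : ℝ) ^ (i : ℕ) *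
      fderiv ℝ (fun x ↦ a.ev p x (i.removeNth v)) x (v i) := by
  rw [ev, comp_succ_d, Form.d_val]
  rfl

theorem ev_d_zero (a : Forms X) (p : Plot X m) (x : Eu m) (v : Fin 0 → Eu m) : (d a).ev p x v = 0 := by
  rw [ev, comp_zero_d]
  rfl

end Forms

/-- The vectors tangent to the factor `ℝ^n`, followed by vectors tangent to the other factor. -/
def frame (n : ℕ) (w : Fin k → Eu m) : Fin (n + k) → Eu (n + m) :=
  Fin.append (fun i ↦ join (EuclideanSpace.single i 1) 0) fun j ↦ join 0 (w j)

@[simp] theorem frame_castAdd (w : Fin k → Eu m) (i : Fin n) :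
    frame n w (Fin.castAdd k i) = join (EuclideanSpace.single i 1) 0 := Fin.append_left _ _ i

@[simp] theorem frame_natAdd (w : Fin k → Eu m) (i : Fin k) :
    frame n w (Fin.natAdd n i) = join 0 (w i) := Fin.append_right _ _ i

theorem Forms.ev_of (a : Form X k) (p : Plot X m) (x : Eu m) (v : Fin k → Eu m) :
    (Forms.of k a).ev p x v = a.val p x v := by
  rw [Forms.ev, Forms.comp_of_same]

theorem Forms.ev_of_ne {k l : ℕ} (h : k ≠ l) (a : Form X k) (p : Plot X m) (x : Eu m) (v : Fin l → Eu m) :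
    (Forms.of k a).ev p x v = 0 := by
  rw [Forms.ev, Forms.comp_of_ne h]
  rfl

theorem hasFDerivAt_fstL (n m : ℕ) (z : Eu (n + m)) : HasFDerivAt (fstL n m) (fstL n m) z :=
  (fstL n m).hasFDerivAt

theorem hasFDerivAt_sndL (n m : ℕ) (z : Eu (n + m)) : HasFDerivAt (sndL n m) (sndL n m) z :=
  (sndL n m).hasFDerivAt

/-- Values of forms along maps of products. -/
theorem Forms.ev_prodPlot_reparam (a : Forms (Eu n × Y)) {q : Plot (Eu n × Y) (l + r)} (p : Plot Y m)
    {f : Eu l → Eu n} {g : Eu r → Eu m} {f' : Eu l →L[ℝ] Eu n} {g' : Eu r →L[ℝ] Eu m}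
    {t : Eu l} {x : Eu r} (hf : ContDiff ℝ ∞ f) (hg : ContDiff ℝ ∞ g) (hf' : HasFDerivAt f f' t)
    (hg' : HasFDerivAt g g' x) (hq : ∀ t x, q.1 (join t x) = (f t, p.1 (g x)))
    (w : Fin k → Eu r) :
    a.ev q (join t x) (frame l w) = a.ev (prodPlot n p) (join (f t) (g x))
      (Fin.append (fun i ↦ join (f' (EuclideanSpace.single i 1)) 0) fun j ↦ join 0 (g' (w j))) := by
  have h1 : HasFDerivAt (fun z : Eu (l + r) ↦ join (f (fstL l r z)) (g (sndL l r z)))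
      ((joinL n m).comp ((f'.comp (fstL l r)).prod (g'.comp (sndL l r)))) (join t x) := by
    refine hasFDerivAt_join ?_ ?_
    · refine HasFDerivAt.comp (join t x) ?_ (hasFDerivAt_fstL l r _)
      rwa [fstL_join]
    · refine HasFDerivAt.comp (join t x) ?_ (hasFDerivAt_sndL l r _)
      rwa [sndL_join]
  rw [a.ev_reparam_of_eq (prodPlot n p)
    ((hf.comp (fstL l r).contDiff).join (hg.comp (sndL l r).contDiff)) h1 fun z ↦ ?_]
  · rw [Function.comp_apply, Function.comp_apply, fstL_join, sndL_join]
    congr 1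
    funext i
    refine Fin.addCases (fun i ↦ ?_) (fun i ↦ ?_) i
    · simp [joinL_apply]
    · simp [joinL_apply]
  · conv_lhs => rw [← join_fstL_sndL z, hq]
    refine Prod.ext ?_ ?_
    · exact (fstL_join _ _).symm
    · exact congrArg p.1 (sndL_join _ _).symm

theorem Forms.contDiff_ev_join (a : Forms (Eu n × Y)) (p : Plot Y m) (v : Fin k → Eu (n + m)) :
    ContDiff ℝ ∞ fun z : Eu n × Eu m ↦ a.ev (prodPlot n p) (join z.1 z.2) v :=
  a.contDiff_ev _ (joinL n m).contDiff fun _ ↦ contDiff_const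

/-- The coefficient of `dt_1 ∧ … ∧ dt_n`. -/
def Form.coefficient (a : Form (Eu n × Y) (n + k)) (p : Plot Y m) (z : Eu n × Eu m) :
    Eu m [⋀^Fin k]→L[ℝ] ℝ :=
  (contract rfl (a.val (prodPlot n p) (join z.1 z.2))
    fun i ↦ join (EuclideanSpace.single i 1) 0).compContinuousLinearMap
      ((joinL n m).comp (ContinuousLinearMap.inr ℝ (Eu n) (Eu m)))

theorem Form.contDiff_coefficient (a : Form (Eu n × Y) (n + k)) (p : Plot Y m) :
    ContDiff ℝ ∞ (a.coefficient p) := by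
  refine contDiff_alternating fun w ↦ ?_
  have h := (Forms.of (n + k) a).contDiff_ev_join p (frame n w)
  simp only [Forms.ev_of] at h
  exact h

/-- Evaluation at `w` is a continuous linear map on alternating forms and commutes with the
integral. This makes the number-valued `fibreIntegral` the evaluation of an integrated form. -/
theorem integral_coefficient_apply (a : Form (Eu n × Y) (n + k)) (p : Plot Y m) (x : Eu m)
    (w : Fin k → Eu m) :
    (∫ t in simplex n, a.coefficient p (t, x)) w = fibreIntegral a p x w := by
  refine ((ContinuousAlternatingMap.apply ℝ (Eu m) ℝ w).integral_comp_comm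
    (integrableOn_simplex ?_)).symm
  exact (a.contDiff_coefficient p).continuous.comp (by fun_prop)

theorem fibreIntegral_eq_ev (a : Form (Eu n × Y) (n + k)) (p : Plot Y m) (x : Eu m) (w : Fin k → Eu m) :
    fibreIntegral a p x w =
      ∫ t in simplex n, (Forms.of (n + k) a).ev (prodPlot n p) (join t x) (frame n w) := by
  simp only [Forms.ev_of]
  rfl

/-- Integration over the simplex, in a fixed degree. -/
def Form.fibreInt (n k : ℕ) : Form (Eu n × Y) (n + k) →ₗ[ℝ] Form Y k where
  toFun a := ⟨fun m p x ↦ ∫ t in simplex n, a.coefficient p (t, x), fun m p ↦ by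
      refine contDiff_alternating fun w ↦ ?_
      simp only [integral_coefficient_apply, fibreIntegral_eq_ev]
      exact contDiff_integral_simplex ((Forms.of (n + k) a).contDiff_ev_join p (frame n w)), by
      intro m r p f hf u
      ext w
      rw [ContinuousAlternatingMap.compContinuousLinearMap_apply, integral_coefficient_apply,
        integral_coefficient_apply, fibreIntegral_eq_ev, fibreIntegral_eq_ev]
      refine integral_congr_ae (Eventually.of_forall fun t ↦ ?_)
      exact (Forms.of (n + k) a).ev_prodPlot_reparam p contDiff_id hf (hasFDerivAt_id t)
        (hf.differentiable (by simp) u).hasFDerivAt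
        (fun t x ↦ Prod.ext (fstL_join t x) (congrArg (fun x ↦ p.1 (f x)) (sndL_join t x))) w⟩
  map_add' a b := by
    refine Form.ext fun m p x ↦ ContinuousAlternatingMap.ext fun w ↦ ?_
    refine (integral_coefficient_apply _ _ _ _).trans ?_
    refine Eq.trans ?_ (congrArg₂ (· + ·) (integral_coefficient_apply a p x w)
      (integral_coefficient_apply b p x w)).symm
    rw [fibreIntegral_eq_ev, fibreIntegral_eq_ev, fibreIntegral_eq_ev, ← integral_add]
    · simp only [map_add, Forms.ev_add]
    · exact integrableOn_simplex (((Forms.of (n + k) a).contDiff_ev_join p _).continuous.comp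
        (by fun_prop : Continuous fun t : Eu n ↦ (t, x)))
    · exact integrableOn_simplex (((Forms.of (n + k) b).contDiff_ev_join p _).continuous.comp
        (by fun_prop : Continuous fun t : Eu n ↦ (t, x)))
  map_smul' c a := by
    refine Form.ext fun m p x ↦ ContinuousAlternatingMap.ext fun w ↦ ?_
    refine (integral_coefficient_apply _ _ _ _).trans ?_
    refine Eq.trans ?_ (congrArg (c • ·) (integral_coefficient_apply a p x w)).symm
    rw [fibreIntegral_eq_ev, fibreIntegral_eq_ev, smul_eq_mul, ← integral_const_mul]
    simp only [map_smul, Forms.ev_smul]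

theorem Form.fibreInt_val (a : Form (Eu n × Y) (n + k)) (p : Plot Y m) (x : Eu m) (w : Fin k → Eu m) :
    (Form.fibreInt n k a).val p x w = fibreIntegral a p x w := integral_coefficient_apply a p x w

namespace Forms

/-- Integration over the simplex. -/
def fibreInt (n : ℕ) : Forms (Eu n × Y) →ₗ[ℝ] Forms Y :=
  -- The composite `comp (n + (j - n)) ∘ of j` is the transport along `j = n + (j - n)`. In degrees
  -- below `n` there is no coefficient of `dt_1 ∧ … ∧ dt_n`, and the integral is zero.
  lift fun j ↦ if n ≤ j then
    of (j - n) ∘ₗ Form.fibreInt n (j - n) ∘ₗ comp (n + (j - n)) ∘ₗ of j else 0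

theorem fibreInt_of (a : Form (Eu n × Y) (n + k)) :
    fibreInt n (of (n + k) a) = of k (Form.fibreInt n k a) := by
  have h : ∀ i, i = k → of i (Form.fibreInt n i (comp (n + i) (of (n + k) a))) =
      of k (Form.fibreInt n k a) := by
    rintro _ rfl
    rw [comp_of_same]
  rw [fibreInt, lift_of, if_pos (Nat.le_add_right n k)]
  exact h _ (Nat.add_sub_cancel_left n k)

theorem fibreInt_of_lt (h : k < n) (a : Form (Eu n × Y) k) : fibreInt n (of k a) = 0 := by
  rw [fibreInt, lift_of, if_neg (by omega)]
  rfl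

theorem comp_fibreInt (a : Forms (Eu n × Y)) :
    comp k (fibreInt n a) = Form.fibreInt n k (comp (n + k) a) := by
  induction a using induction with
  | zero => simp only [map_zero]
  | add x y hx hy => simp only [map_add, hx, hy]
  | of j a =>
    by_cases h : n ≤ j
    · obtain ⟨i, rfl⟩ := Nat.exists_eq_add_of_le h
      rw [fibreInt_of]
      by_cases hik : i = k
      · subst hik; rw [comp_of_same, comp_of_same]
      · rw [comp_of_ne hik, comp_of_ne (by omega), map_zero]
    · rw [fibreInt_of_lt (by omega), comp_of_ne (by omega), map_zero, map_zero]

theorem ev_fibreInt (a : Forms (Eu n × Y)) (p : Plot Y m) (x : Eu m) (w : Fin k → Eu m) :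
    (fibreInt n a).ev p x w = ∫ t in simplex n, a.ev (prodPlot n p) (join t x) (frame n w) := by
  rw [ev, comp_fibreInt, Form.fibreInt_val]
  rfl

end Forms
end FibreIntegration

/-! ### Stokes' theorem over the simplex -/

section Stokes
variable {X Y Z : Type*} [DiffeologicalSpace X] [DiffeologicalSpace Y] [DiffeologicalSpace Z]
  {k l m n r : ℕ}

/-- The coordinate formula for `d`, with the sum over the omitted vector split according to the two
blocks. The casts come from `n + k + 1` against `n + 1 + k`. -/
theorem Forms.ev_d_append_aux (a : Forms X) (p : Plot X m) (x : Eu m) (e : Fin (n + 1) → Eu m)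
    (w : Fin k → Eu m) : (Forms.d a).ev p x (Fin.append e w) =
      (∑ i : Fin (n + 1), (-1 : ℝ) ^ (i : ℕ) *
        fderiv ℝ (fun x ↦ a.ev p x (Fin.append (i.removeNth e) w)) x (e i)) +
      ∑ j : Fin k, (-1 : ℝ) ^ (n + 1 + (j : ℕ)) *
        fderiv ℝ (fun x ↦ a.ev p x (Fin.removeNth (n := n + k) ⟨n + 1 + j, by omega⟩ fun i ↦
          Fin.append e w (Fin.cast (by omega) i))) x (w j) := by
  have h : n + k + 1 = n + 1 + k := by omega
  have h0 : (Forms.d a).ev p x (Fin.append e w) =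
      (Forms.d a).ev p x fun i : Fin (n + k + 1) ↦ Fin.append e w (Fin.cast h i) :=
    Forms.ev_congr _ x (fun _ ↦ rfl) h.symm fun _ ↦ rfl
  rw [h0, Forms.ev_d, ← (finCongr h.symm).sum_comp, Fin.sum_univ_add]
  congr 1
  · refine Finset.sum_congr rfl fun i _ ↦ ?_
    have h1 : Fin.append e w (Fin.cast h (finCongr h.symm (Fin.castAdd k i))) = e i :=
      Fin.append_left e w i
    rw [h1]
    refine congrArg (fun f ↦ (-1 : ℝ) ^ (i : ℕ) * fderiv ℝ f x (e i)) (funext fun x ↦ ?_)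
    refine a.ev_congr (p' := p) x (fun _ ↦ rfl) rfl fun s ↦ ?_
    refine Fin.addCases (fun s ↦ ?_) (fun s ↦ ?_) s
    · rw [show Fin.cast _ (Fin.castAdd k s) = Fin.castAdd k s from rfl, Fin.append_left]
      refine Eq.trans ?_ (Fin.append_left e w (i.succAbove s))
      simp only [Fin.removeNth]
      congr 1
      simp only [Fin.ext_iff, Fin.succAbove, Fin.lt_def]
      simp only [finCongr_apply, Fin.val_cast, Fin.val_castAdd, Fin.val_castSucc]
      split <;> simp
    · rw [show Fin.cast _ (Fin.natAdd n s) = Fin.natAdd n s from rfl, Fin.append_right]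
      refine Eq.trans ?_ (Fin.append_right e w s)
      simp only [Fin.removeNth]
      congr 1
      simp only [Fin.ext_iff, Fin.succAbove, Fin.lt_def]
      simp only [finCongr_apply, Fin.val_cast, Fin.val_castAdd, Fin.val_castSucc, Fin.val_natAdd]
      rw [if_neg (by omega)]
      simp
      omega
  · refine Finset.sum_congr rfl fun j _ ↦ ?_
    have h1 : Fin.append e w (Fin.cast h (finCongr h.symm (Fin.natAdd (n + 1) j))) = w j :=
      Fin.append_right e w j
    rw [h1]
    rfl

theorem Forms.ev_d_append_zero (a : Forms X) (p : Plot X m) (x : Eu m) (e : Fin (n + 1) → Eu m)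
    (w : Fin 0 → Eu m) : (Forms.d a).ev p x (Fin.append e w) =
      ∑ i : Fin (n + 1), (-1 : ℝ) ^ (i : ℕ) *
        fderiv ℝ (fun x ↦ a.ev p x (Fin.append (i.removeNth e) w)) x (e i) := by
  rw [Forms.ev_d_append_aux, Fin.sum_univ_zero, add_zero]

/-- The exterior derivative on a tuple of vectors in two groups. -/
theorem Forms.ev_d_append (a : Forms X) (p : Plot X m) (x : Eu m) (e : Fin (n + 1) → Eu m)
    (w : Fin (k + 1) → Eu m) : (Forms.d a).ev p x (Fin.append e w) =
      (∑ i : Fin (n + 1), (-1 : ℝ) ^ (i : ℕ) *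
        fderiv ℝ (fun x ↦ a.ev p x (Fin.append (i.removeNth e) w)) x (e i)) +
      (-1 : ℝ) ^ (n + 1) * ∑ j : Fin (k + 1), (-1 : ℝ) ^ (j : ℕ) *
        fderiv ℝ (fun x ↦ a.ev p x (Fin.append e (j.removeNth w))) x (w j) := by
  rw [Forms.ev_d_append_aux, Finset.mul_sum]
  congr 1
  refine Finset.sum_congr rfl fun j _ ↦ ?_
  rw [pow_add, mul_assoc]
  congr 4
  funext x
  have h : n + (k + 1) = n + 1 + k := by omega
  refine a.ev_congr (p' := p) x (fun _ ↦ rfl) h fun s ↦ ?_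
  obtain ⟨s, rfl⟩ : ∃ s', s = Fin.cast h.symm s' := ⟨Fin.cast h s, rfl⟩
  refine Fin.addCases (fun s ↦ ?_) (fun s ↦ ?_) s
  · rw [show Fin.cast h (Fin.cast h.symm (Fin.castAdd k s)) = Fin.castAdd k s from rfl, Fin.append_left]
    refine Eq.trans ?_ (Fin.append_left e w s)
    simp only [Fin.removeNth]
    congr 1
    simp only [Fin.ext_iff, Fin.succAbove, Fin.lt_def]
    simp only [Fin.val_cast, Fin.val_castAdd, Fin.val_castSucc]
    rw [if_pos (by omega)]
    simp
  · rw [show Fin.cast h (Fin.cast h.symm (Fin.natAdd (n + 1) s)) = Fin.natAdd (n + 1) s from rfl,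
      Fin.append_right]
    refine Eq.trans ?_ (Fin.append_right e w (j.succAbove s))
    simp only [Fin.removeNth]
    congr 1
    simp only [Fin.ext_iff, Fin.succAbove, Fin.lt_def]
    simp only [Fin.val_cast, Fin.val_castSucc, Fin.val_natAdd]
    by_cases hs : (s : ℕ) < j
    · rw [if_pos (by omega), if_pos hs]
      simp
    · rw [if_neg (by omega), if_neg hs]
      simp
      omega

/-- A determinant identity: the alternating sum over the facets of a simplex. -/
theorem alternating_sub_first {V : Type*} [NormedAddCommGroup V] [NormedSpace ℝ V]
    (a : V [⋀^Fin n]→L[ℝ] ℝ) (L : Eu (n + 1) →L[ℝ] V) :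
    a (fun j ↦ L (EuclideanSpace.single j.succ 1 - EuclideanSpace.single 0 1)) =
      ∑ i : Fin (n + 1), (-1 : ℝ) ^ (i : ℕ) *
        a fun j ↦ L (EuclideanSpace.single (i.succAbove j) 1) := by
  set b := EuclideanSpace.basisFun (Fin (n + 1)) ℝ
  set φ : Eu (n + 1) →L[ℝ] ℝ := ∑ i, EuclideanSpace.proj i
  -- Here `c = φ ∧ (a ∘ L)`, where `φ` is the sum of the coordinates. On `e_0, e_1 - e_0, …` only `φ
  -- e_0 = 1` is non-zero, which gives the left side; on the standard basis every `φ e_i` is 1,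
  -- which gives the alternating sum. The two tuples differ by a matrix of determinant 1.
  set c := ContinuousAlternatingMap.alternatizeUncurryFin
    (φ.smulRight (a.compContinuousLinearMap L))
  have h1 : ∀ i, φ (EuclideanSpace.single i 1) = 1 := fun i ↦ by simp [φ, sum_apply, PiLp.single_apply]
  have h2 := c.toAlternatingMap.eq_smul_basis_det b.toBasis
  set v : Fin (n + 1) → Eu (n + 1) := Fin.cons (EuclideanSpace.single 0 1)
    fun j ↦ EuclideanSpace.single j.succ 1 - EuclideanSpace.single 0 1
  have h3 : b.toBasis.det v = 1 := by
    rw [← b.toBasis.det_self, Module.Basis.det_apply, Module.Basis.det_apply, ← Matrix.det_transpose,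
      ← Matrix.det_transpose (b.toBasis.toMatrix _)]
    refine Matrix.det_eq_of_forall_row_eq_smul_add_const (Fin.cons 0 fun _ ↦ -1) 0 rfl ?_
    intro i j
    refine Fin.cases ?_ (fun i ↦ ?_) i
    · simp [v, Module.Basis.toMatrix_apply, b]
    · simp [v, Module.Basis.toMatrix_apply, b]
      split_ifs <;> simp
  have h4 : c v = c fun i ↦ EuclideanSpace.single i 1 := by
    have h5 := DFunLike.congr_fun h2 v
    rw [AlternatingMap.smul_apply, h3] at h5
    refine h5.trans ?_
    rw [smul_eq_mul, mul_one]
    refine congrArg c (funext fun i ↦ ?_)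
    simp [b]
  have h6 : c v = a (fun j ↦ L (EuclideanSpace.single j.succ 1 - EuclideanSpace.single 0 1)) := by
    refine (alternatizeUncurryFin_cons _ _ _ _).trans ?_
    rw [Finset.sum_eq_zero fun i _ ↦ ?_]
    · rw [h1]
      simp [Function.comp_def]
    · rw [map_sub, h1, h1]
      simp
  rw [← h6, h4, ContinuousAlternatingMap.alternatizeUncurryFin_apply]
  refine Finset.sum_congr rfl fun i _ ↦ ?_
  rw [ContinuousLinearMap.smulRight_apply, h1, one_smul, zsmul_eq_mul]
  simp [Function.comp_def, Fin.removeNth]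

namespace Forms

theorem smooth_simplexMap (Y : Type*) [DiffeologicalSpace Y] (f : Fin (m + 1) → Fin (n + 1)) :
    DSmooth (Prod.map (simplexMap f) (id : Y → Y)) := fun _ _ hp ↦
  ⟨isPlot_iff_contDiff.2 ((contDiff_simplexMap f).comp (isPlot_iff_contDiff.1 hp.1)), hp.2⟩

/-- The pull-back along an affine map of simplices. -/
def simplexPull (f : Fin (m + 1) → Fin (n + 1)) : Forms (Eu n × Y) →ₐ[ℝ] Forms (Eu m × Y) :=
  pullback (Prod.map (simplexMap f) id) (smooth_simplexMap Y f)

theorem ev_simplexPull (f : Fin (m + 1) → Fin (n + 1)) (a : Forms (Eu n × Y)) (p : Plot Y r)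
    (t : Eu m) (x : Eu r) (w : Fin k → Eu r) :
    (simplexPull f a).ev (prodPlot m p) (join t x) (frame m w) =
      a.ev (prodPlot n p) (join (simplexMap f t) x)
        (Fin.append (fun j ↦ join (vert (f j.succ) - vert (f 0)) 0) fun j ↦ join 0 (w j)) := by
  rw [simplexPull, ev_pullback]
  refine (a.ev_prodPlot_reparam p (contDiff_simplexMap f) contDiff_id (hasFDerivAt_simplexMap f t)
    (hasFDerivAt_id x) (fun t x ↦ ?_) w).trans ?_
  · exact Prod.ext (congrArg (simplexMap f) (fstL_join t x)) (congrArg p.1 (sndL_join t x))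
  · simp only [simplexLin_single]
    rfl

theorem fderiv_comp_join {F : Eu (n + m) → ℝ} (hF : ContDiff ℝ ∞ F) (t e : Eu n) (x w : Eu m) :
    fderiv ℝ (fun z : Eu n × Eu m ↦ F (join z.1 z.2)) (t, x) (e, w) =
      fderiv ℝ F (join t x) (join e w) := by
  have h := ((hF.differentiable (by simp) (join t x)).hasFDerivAt).comp (t, x)
    (joinL n m).hasFDerivAt
  exact DFunLike.congr_fun h.fderiv (e, w)

theorem fderiv_comp_join_left {F : Eu (n + m) → ℝ} (hF : ContDiff ℝ ∞ F) (t e : Eu n) (x : Eu m) :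
    fderiv ℝ (fun t ↦ F (join t x)) t e = fderiv ℝ F (join t x) (join e 0) := by
  have h := ((hF.differentiable (by simp) (join t x)).hasFDerivAt).comp t
    (hasFDerivAt_join (hasFDerivAt_id t) (hasFDerivAt_const x t))
  exact DFunLike.congr_fun h.fderiv e

theorem continuous_fderiv_join {F : Eu (n + m) → ℝ} (hF : ContDiff ℝ ∞ F) (x : Eu m) (v : Eu (n + m)) :
    Continuous fun t ↦ fderiv ℝ F (join t x) v :=
  ((hF.continuous_fderiv (by simp)).comp ((joinL n m).continuous.comp
    (by fun_prop : Continuous fun t : Eu n ↦ (t, x)))).clm_apply continuous_const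

/-- With the last block fixed, the value is alternating in the first. Since `contract` inserts
vectors in front, the blocks are exchanged first, and the sign of this exchange goes into `c`. -/
theorem exists_append_eq_contract (a : Forms X) (p : Plot X r) (z : Eu r) (w : Fin k → Eu r) :
    ∃ c : Eu r [⋀^Fin n]→L[ℝ] ℝ, ∀ v, a.ev p z (Fin.append v w) = c v := by
  let σ : Equiv.Perm (Fin (n + k)) := finAddFlip.trans (finCongr (add_comm k n))
  refine ⟨((Equiv.Perm.sign σ : ℤ) : ℝ) • contract (add_comm n k) ((comp (n + k) a).val p z) w,
    fun v ↦ ?_⟩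
  have h := ((comp (n + k) a).val p z).toAlternatingMap.map_perm
    (Fin.append w v ∘ Fin.cast (add_comm n k)) σ
  rw [Units.smul_def, ← Int.cast_smul_eq_zsmul ℝ] at h
  refine Eq.trans (congrArg ((comp (n + k) a).val p z) (funext fun i ↦ ?_)) h
  refine Fin.addCases (fun i ↦ ?_) (fun i ↦ ?_) i
  · simp [σ]
  · simp [σ]

/-- Stokes' theorem for the integration over the fibre. -/
theorem fibreInt_d (a : Forms (Eu (n + 1) × Y)) :
    fibreInt (n + 1) (d a) = (-1 : ℝ) ^ (n + 1) • d (fibreInt (n + 1) a) +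
      ∑ i : Fin (n + 2), (-1 : ℝ) ^ (i : ℕ) • fibreInt n (simplexPull i.succAbove a) := by
  refine ext_ev fun k m p x w ↦ ?_
  -- Derivatives in a simplex direction integrate to a difference of facets: the one opposite to
  -- vertex 0 minus the one opposite to vertex `i + 1`.
  have hb : ∀ (i : Fin (n + 1)), ∫ t in simplex (n + 1), (-1 : ℝ) ^ (i : ℕ) *
      fderiv ℝ (fun z ↦ a.ev (prodPlot (n + 1) p) z (Fin.append (i.removeNth fun i ↦
        join (EuclideanSpace.single i 1) 0) fun j ↦ join 0 (w j))) (join t x)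
          (join (EuclideanSpace.single i 1) 0) = 
      (-1 : ℝ) ^ (i : ℕ) * ((∫ t in simplex n, a.ev (prodPlot (n + 1) p) (join (simplexMap Fin.succ t) x)
        (Fin.append (i.removeNth fun i ↦ join (EuclideanSpace.single i 1) 0) fun j ↦ join 0 (w j))) -
        (fibreInt n (simplexPull i.succ.succAbove a)).ev p x w) := by
    intro i
    set V := Fin.append (i.removeNth fun i ↦ join (EuclideanSpace.single i (1 : ℝ)) (0 : Eu m))
      fun j ↦ join 0 (w j)
    have hF : ContDiff ℝ ∞ fun z ↦ a.ev (prodPlot (n + 1) p) z V :=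
      a.contDiff_ev _ contDiff_id fun _ ↦ contDiff_const
    have hg : ContDiff ℝ ∞ fun t ↦ a.ev (prodPlot (n + 1) p) (join t x) V :=
      hF.comp (contDiff_id.join contDiff_const)
    rw [integral_const_mul]
    simp only [← fderiv_comp_join_left hF]
    rw [integral_simplex_fderiv i hg, ev_fibreInt]
    simp only [ev_simplexPull, Fin.succ_succAbove_zero, Fin.succ_succAbove_succ, vert_succ, vert_zero,
      sub_zero]
    rfl
  -- The edges of the facet opposite to vertex 0 are the vectors `e_(j+1) - e_0`. By
  -- `alternating_sub_first` its integral is the alternating sum of the first terms found in `hb`.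
  have h0 : (fibreInt n (simplexPull (Fin.succAbove 0) a)).ev p x w =
      ∑ i : Fin (n + 1), (-1 : ℝ) ^ (i : ℕ) *
       (∫ t in simplex n, a.ev (prodPlot (n + 1) p) (join (simplexMap Fin.succ t) x)
        (Fin.append (i.removeNth fun i ↦ join (EuclideanSpace.single i 1) 0) fun j ↦ join 0 (w j))) := by
    rw [ev_fibreInt, Fin.succAbove_zero]
    simp only [← integral_const_mul]
    rw [← integral_finsetSum]
    · refine integral_congr_ae (Eventually.of_forall fun t ↦ ?_)
      beta_reduce
      rw [ev_simplexPull]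
      obtain ⟨c, hc⟩ := a.exists_append_eq_contract (n := n) (prodPlot (n + 1) p)
        (join (simplexMap Fin.succ t) x) fun j ↦ join 0 (w j)
      simp only [hc]
      exact alternating_sub_first c ((joinL (n + 1) m).comp (ContinuousLinearMap.inl ℝ _ _))
    · intro i _
      refine Integrable.const_mul ?_ _
      refine integrableOn_simplex ?_
      exact (a.contDiff_ev _ ((contDiff_simplexMap Fin.succ).join contDiff_const)
        fun _ ↦ contDiff_const).continuous
  rw [ev_add, ev_smul, ev_sum, Fin.sum_univ_succ]
  simp only [ev_smul]
  rw [Fin.val_zero, pow_zero, one_mul, h0, ev_fibreInt]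
  have hI : ∀ (i : Fin (n + 1)), IntegrableOn (fun t ↦ (-1 : ℝ) ^ (i : ℕ) *
      fderiv ℝ (fun z ↦ a.ev (prodPlot (n + 1) p) z (Fin.append (i.removeNth fun i ↦
        join (EuclideanSpace.single i 1) 0) fun j ↦ join 0 (w j))) (join t x)
          (join (EuclideanSpace.single i 1) 0)) (simplex (n + 1)) := fun i ↦
    (integrableOn_simplex (continuous_fderiv_join (a.contDiff_ev _ contDiff_id
      fun _ ↦ contDiff_const) _ _)).const_mul _
  have hS : (∑ i : Fin (n + 1), (-1 : ℝ) ^ (i : ℕ) *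
       (∫ t in simplex n, a.ev (prodPlot (n + 1) p) (join (simplexMap Fin.succ t) x)
        (Fin.append (i.removeNth fun i ↦ join (EuclideanSpace.single i 1) 0) fun j ↦ join 0 (w j)))) + 
      ∑ i : Fin (n + 1), (-1 : ℝ) ^ (i.succ : ℕ) *
        (fibreInt n (simplexPull i.succ.succAbove a)).ev p x w =
      ∫ t in simplex (n + 1), ∑ i : Fin (n + 1), (-1 : ℝ) ^ (i : ℕ) *
      fderiv ℝ (fun z ↦ a.ev (prodPlot (n + 1) p) z (Fin.append (i.removeNth fun i ↦
        join (EuclideanSpace.single i 1) 0) fun j ↦ join 0 (w j))) (join t x)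
          (join (EuclideanSpace.single i 1) 0) := by
    rw [integral_finsetSum _ fun i _ ↦ hI i, ← Finset.sum_add_distrib]
    refine Finset.sum_congr rfl fun i _ ↦ ?_
    rw [hb, Fin.val_succ, pow_succ]
    ring
  rw [hS]
  cases k with
  | zero =>
    rw [ev_d_zero, mul_zero, zero_add]
    refine integral_congr_ae (Eventually.of_forall fun t ↦ ?_)
    exact ev_d_append_zero _ _ _ _ _
  | succ k =>
    rw [ev_d]
    -- Derivatives along `Y` pass under the integral. Moving them past the `n + 1` simplex vectors
    -- produces the sign in front of `d (fibreInt (n + 1) a)`.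
    have hd : ∀ j : Fin (k + 1), fderiv ℝ (fun x ↦ (fibreInt (n + 1) a).ev p x (j.removeNth w)) x (w j) =
      ∫ t in simplex (n + 1), fderiv ℝ (fun z ↦ a.ev (prodPlot (n + 1) p) z
        (frame (n + 1) (j.removeNth w))) (join t x) (join 0 (w j)) := by
      intro j
      have hF : ContDiff ℝ ∞ fun z ↦ a.ev (prodPlot (n + 1) p) z (frame (n + 1) (j.removeNth w)) :=
        a.contDiff_ev _ contDiff_id fun _ ↦ contDiff_const
      simp only [ev_fibreInt]
      rw [fderiv_integral_simplex (a.contDiff_ev_join p (frame (n + 1) (j.removeNth w)))]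
      simp only [fderiv_comp_join hF]
    have hJ : ∀ j : Fin (k + 1), IntegrableOn (fun t ↦ fderiv ℝ (fun z ↦ a.ev (prodPlot (n + 1) p) z
        (frame (n + 1) (j.removeNth w))) (join t x) (join 0 (w j))) (simplex (n + 1)) := fun j ↦
      integrableOn_simplex (continuous_fderiv_join (a.contDiff_ev _ contDiff_id
        fun _ ↦ contDiff_const) _ _)
    simp only [hd]
    simp only [← integral_const_mul]
    rw [← integral_finsetSum _ fun j _ ↦ (hJ j).const_mul _, ← integral_const_mul, ← integral_add]
    · refine integral_congr_ae (Eventually.of_forall fun t ↦ ?_)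
      refine (ev_d_append a _ _ _ _).trans ((add_comm _ _).trans ?_)
      rfl
    · exact (integrable_finsetSum _ fun j _ ↦ (hJ j).const_mul _).const_mul _
    · exact integrable_finsetSum _ fun i _ ↦ hI i

theorem smooth_zero_prod (n : ℕ) (Y : Type*) [DiffeologicalSpace Y] :
    DSmooth fun y : Y ↦ ((0 : Eu n), y) := fun _ _ hp ↦ ⟨isPlot_const, hp⟩

/-- `Δ_0` is the single point of `ℝ^0`, of volume 1. -/
theorem fibreInt_zero (a : Forms (Eu 0 × Y)) :
    fibreInt 0 a = pullback (fun y ↦ (0, y)) (smooth_zero_prod 0 Y) a := by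
  refine ext_ev fun k m p x w ↦ ?_
  rw [ev_fibreInt, ev_pullback]
  have h : simplex 0 = {(0 : Eu 0)} := by
    ext t
    simp [simplex, Subsingleton.elim t 0]
  have h1 : volume.real {(0 : Eu 0)} = 1 := by
    rw [Measure.real, volume_euclideanSpace_eq_dirac, Measure.dirac_apply_of_mem (Set.mem_singleton _)]
    rfl
  rw [h, integral_singleton, h1, one_smul]
  refine Eq.symm ((a.ev_reparam_of_eq (prodPlot 0 p) (f := fun x ↦ join 0 x)
    (contDiff_const.join contDiff_id) (hasFDerivAt_join (hasFDerivAt_const (0 : Eu 0) x) (hasFDerivAt_id x))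
    (fun y ↦ Prod.ext (fstL_join (0 : Eu 0) y).symm (congrArg p.1 (sndL_join (0 : Eu 0) y).symm)) w).trans ?_)
  refine a.ev_congr _ (fun _ ↦ rfl) (zero_add k).symm fun i ↦ ?_
  exact (frame_natAdd (n := 0) w i).symm.trans (congrArg (frame 0 w) (Fin.ext (by simp)))

theorem fibreInt_zero_d (a : Forms (Eu 0 × Y)) : fibreInt 0 (d a) = d (fibreInt 0 a) := by
  rw [fibreInt_zero, fibreInt_zero, d_pullback]

end Forms
end Stokes

/-! ### Naturality of fibre integration and the projection formula -/

section ProjectionFormula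
variable {X Y Z : Type*} [DiffeologicalSpace X] [DiffeologicalSpace Y] [DiffeologicalSpace Z]
  {k l m n r i j : ℕ}

namespace Forms

theorem fibreInt_pullback (g : Y → Z) (hg : DSmooth g) (a : Forms (Eu n × Z)) :
    fibreInt n (pullback (Prod.map id g) (smooth_prodMap hg) a) = pullback g hg (fibreInt n a) := by
  refine ext_ev fun k m p x w ↦ ?_
  rw [ev_fibreInt, ev_pullback, ev_fibreInt]
  refine integral_congr_ae (Eventually.of_forall fun t ↦ ?_)
  exact (ev_pullback _ _ _ _ _ _).trans (a.ev_congr _ (fun _ ↦ rfl) rfl fun _ ↦ rfl)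

/-- The pull-back along the second projection. -/
def pullSnd (X : Type*) [DiffeologicalSpace X] : Forms Y →ₐ[ℝ] Forms (X × Y) :=
  pullback Prod.snd (smooth_snd X Y)

theorem ev_pullSnd (b : Forms Y) (p : Plot Y m) (z : Eu (n + m)) (v : Fin k → Eu (n + m)) :
    (pullSnd (Eu n) b).ev (prodPlot n p) z v = b.ev p (sndL n m z) fun i ↦ sndL n m (v i) := by
  rw [pullSnd, ev_pullback]
  exact b.ev_reparam_of_eq p (sndL n m).contDiff (hasFDerivAt_sndL n m z) (fun _ ↦ rfl) v

theorem pullSnd_val_eq_zero (b : Form Y l) (p : Plot Y m) (z : Eu (n + m)) (j : Fin n)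
    (u : Fin l → Eu (n + m)) (i : Fin l) (h : u i = join (EuclideanSpace.single j 1) 0) :
    (Form.pullback Prod.snd (smooth_snd (Eu n) Y) b).val (prodPlot n p) z u = 0 := by
  have h1 := ev_pullSnd (of l b) p z u
  rw [pullSnd, pullback_of, ev_of, ev_of] at h1
  rw [h1]
  refine (b.val p _).map_coord_zero i ?_
  rw [h, sndL_join]

/-- A form pulled back from `Y` contains no `dt` and vanishes on vectors tangent to the simplex. -/
theorem fibreInt_pullSnd (b : Forms Y) : fibreInt (n + 1) (pullSnd (Eu (n + 1)) b) = 0 := by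
  refine ext_ev fun k m p x w ↦ ?_
  rw [ev_fibreInt, ev_zero]
  refine integral_eq_zero_of_ae (Eventually.of_forall fun t ↦ ?_)
  beta_reduce
  rw [ev_pullSnd, ev]
  refine (Form.val _ _ _).map_coord_zero (Fin.castAdd k 0) ?_
  rw [frame_castAdd, sndL_join]

theorem integral_wedge_apply (β : Eu m [⋀^Fin l]→L[ℝ] ℝ) (a : Form (Eu n × Y) (n + i)) (p : Plot Y m)
    (x : Eu m) (w : Fin (l + i) → Eu m) :
    ∫ t in simplex n, wedge β (a.coefficient p (t, x)) w =
      wedge β ((Form.fibreInt n i a).val p x) w := by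
  have h := ((ContinuousAlternatingMap.apply ℝ (Eu m) ℝ w).comp (wedgeL (Eu m) l i β)).integral_comp_comm
    (integrableOn_simplex ((a.contDiff_coefficient p).continuous.comp
      (by fun_prop : Continuous fun t : Eu n ↦ (t, x))))
  exact h

/-- The projection formula. -/
theorem fibreInt_pullSnd_of_mul (b : Form Y l) (a : Forms (Eu n × Y)) :
    fibreInt n (pullSnd (Eu n) (of l b) * a) = (-1 : ℝ) ^ (l * n) • (of l b * fibreInt n a) := by
  induction a using induction with
  | zero => simp only [mul_zero, map_zero, smul_zero]
  | add x y hx hy => simp only [mul_add, map_add, hx, hy, smul_add]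
  | of j a =>
    have hz := fun (m : ℕ) (p : Plot Y m) z ↦ pullSnd_val_eq_zero (n := n) b p z
    refine ext_ev fun k m p x w ↦ ?_
    rw [ev_fibreInt, pullSnd, pullback_of, of_mul_of]
    by_cases hk : n + k = l + j
    · have h1 : ∀ t, (of (l + j) ((Form.pullback Prod.snd (smooth_snd (Eu n) Y) b).wedge a)).ev
          (prodPlot n p) (join t x) (frame n w) =
          wedge ((Form.pullback Prod.snd (smooth_snd (Eu n) Y) b).val (prodPlot n p) (join t x))
            (a.val (prodPlot n p) (join t x)) (frame n w ∘ Fin.cast hk.symm) := by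
        intro t
        rw [← Form.wedge_val, ← ev_of]
        exact ev_congr _ _ (fun _ ↦ rfl) hk fun _ ↦ rfl
      simp only [h1]
      by_cases hj : n ≤ j
      · obtain ⟨i, rfl⟩ := Nat.exists_eq_add_of_le hj
        obtain rfl : k = l + i := by omega
        rw [fibreInt_of, of_mul_of, ev_smul, ev_of, Form.wedge_val, ← integral_wedge_apply,
          ← integral_const_mul]
        refine integral_congr_ae (Eventually.of_forall fun t ↦ ?_)
        -- The vectors tangent to the simplex annihilate the factor from `Y`, so they all go into
        -- the second factor; passing the first one costs `(-1)^(l n)`.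
        refine (wedge_append rfl (a.val (prodPlot n p) (join t x)) _ (fun j ↦ join 0 (w j)) _
          (hz m p (join t x)) fun _ ↦ rfl).trans ?_
        congr 1
        have h2 := DFunLike.congr_fun (wedge_comp
          ((Form.pullback Prod.snd (smooth_snd (Eu n) Y) b).val (prodPlot n p) (join t x))
          (contract rfl (a.val (prodPlot n p) (join t x)) fun i ↦ join (EuclideanSpace.single i 1) 0)
          ((joinL n m).comp (ContinuousLinearMap.inr ℝ (Eu n) (Eu m)))) w
        refine h2.trans ?_
        congr 2
        ext u
        have h3 := ev_pullSnd (of l b) p (join t x) fun i ↦ join (0 : Eu n) (u i)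
        rw [pullSnd, pullback_of, ev_of, ev_of, sndL_join] at h3
        simp only [sndL_join] at h3
        exact h3
      · rw [fibreInt_of_lt (by omega), mul_zero, smul_zero, ev_zero]
        refine integral_eq_zero_of_ae (Eventually.of_forall fun t ↦ ?_)
        refine wedge_append_eq_zero (n := n) (by omega) _ (fun i ↦ join (EuclideanSpace.single i 1) 0) _
          (hz m p (join t x)) (fun i hi ↦ ?_) (by omega)
        exact frame_castAdd w i
    · simp only [ev_of_ne (Ne.symm hk)]
      rw [integral_zero]
      by_cases hj : n ≤ j
      · obtain ⟨i, rfl⟩ := Nat.exists_eq_add_of_le hj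
        rw [fibreInt_of, of_mul_of, ev_smul, ev_of_ne (by omega), mul_zero]
      · rw [fibreInt_of_lt (by omega), mul_zero, smul_zero, ev_zero]

theorem of_mul_of_comm (a : Form X k) (b : Form X l) :
    of k a * of l b = (-1 : ℝ) ^ (k * l) • (of l b * of k a) := by
  rw [of_mul_of, of_mul_of, Form.wedge_comm, map_smul, of_cast]

/-- The left version with graded commutativity applied before and after. The three signs have
exponents with sum `2 (n + i) l`, so none remains. -/
theorem fibreInt_mul_pullSnd (a : Forms (Eu n × Y)) (b : Forms Y) :
    fibreInt n (a * pullSnd (Eu n) b) = fibreInt n a * b := by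
  induction b using induction with
  | zero => simp only [mul_zero, map_zero]
  | add x y hx hy => simp only [mul_add, map_add, hx, hy]
  | of l b =>
    induction a using induction with
    | zero => simp only [zero_mul, map_zero]
    | add x y hx hy => simp only [add_mul, map_add, hx, hy]
    | of j a =>
      have h1 := fibreInt_pullSnd_of_mul (n := n) b (of j a)
      rw [pullSnd, pullback_of] at h1 ⊢
      rw [of_mul_of_comm, map_smul, h1, smul_smul]
      by_cases hj : n ≤ j
      · obtain ⟨i, rfl⟩ := Nat.exists_eq_add_of_le hj
        rw [fibreInt_of, of_mul_of_comm b, smul_smul, ← pow_add, ← pow_add]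
        have : Even ((n + i) * l + l * n + l * i) := ⟨(n + i) * l, by ring⟩
        rw [this.neg_one_pow, one_smul]
      · rw [fibreInt_of_lt (by omega), mul_zero, zero_mul, smul_zero]

end Forms
end ProjectionFormula

/-! ### Integration over the diagonal and over its Alexander–Whitney decomposition -/

section Homotopy
variable {X Y Z : Type*} [DiffeologicalSpace X] [DiffeologicalSpace Y] [DiffeologicalSpace Z]
  {k l m n p q r N M : ℕ}

theorem simplexMap_zero (f : Fin (m + 1) → Fin (n + 1)) : simplexMap f 0 = vert (f 0) := by
  rw [simplexMap, map_zero, add_zero]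

namespace Forms

variable (X) in
/-- The forms of degree less than `N`. -/
def degLT (N : ℕ) : Submodule ℝ (Forms X) where
  carrier := {a | ∀ k, N ≤ k → comp k a = 0}
  zero_mem' := fun _ _ ↦ map_zero _
  add_mem' := fun ha hb k hk ↦ by rw [map_add, ha k hk, hb k hk, add_zero]
  smul_mem' := fun c _ ha k hk ↦ by rw [map_smul, ha k hk, smul_zero]

theorem degLT_mono (h : M ≤ N) : degLT X M ≤ degLT X N := fun _ ha k hk ↦ ha k (h.trans hk)

theorem eq_zero_of_degLT {a : Forms X} (h : a ∈ degLT X 0) : a = 0 :=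
  ext_comp fun k ↦ (h k (Nat.zero_le k)).trans (map_zero _).symm

theorem pullback_mem_degLT (f : X → Y) (hf : DSmooth f) {a : Forms Y} (h : a ∈ degLT Y N) :
    pullback f hf a ∈ degLT X N := fun k hk ↦ by
  rw [comp_pullback, h k hk, map_zero]

theorem fibreInt_mem_degLT {a : Forms (Eu n × Y)} (h : a ∈ degLT _ (N + n)) :
    fibreInt n a ∈ degLT Y N := fun k hk ↦ by
  rw [comp_fibreInt, h (n + k) (by omega), map_zero]

theorem pullback_congr {f g : X → Y} (h : ∀ x, f x = g x) (hf : DSmooth f) (hg : DSmooth g)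
    (a : Forms Y) : pullback f hf a = pullback g hg a := by
  obtain rfl : f = g := funext h
  rfl

theorem smooth_const_prod (x : X) (Y : Type*) [DiffeologicalSpace Y] : DSmooth fun y : Y ↦ (x, y) :=
  fun _ _ hp ↦ ⟨isPlot_const, hp⟩

theorem pullback_zero_simplexPull {f : Fin 1 → Fin (n + 1)} {i : Fin (n + 1)} (h : f 0 = i)
    (a : Forms (Eu n × Y)) :
    pullback (fun y ↦ (0, y)) (smooth_zero_prod 0 Y) (simplexPull f a) =
      pullback (fun y ↦ (vert i, y)) (smooth_const_prod _ Y) a := by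
  subst h
  rw [simplexPull, pullback_pullback]
  refine pullback_congr (fun y ↦ ?_) _ _ a
  simp only [Function.comp, Prod.map, simplexMap_zero, id]

/-- Integration over an interval of the derivative of a form. -/
theorem fibreInt_one_d (a : Forms (Eu (0 + 1) × Y)) : fibreInt (0 + 1) (d a) =
    -d (fibreInt (0 + 1) a) + (pullback (fun y ↦ (vert (n := 0 + 1) 1, y)) (smooth_const_prod _ Y) a -
      pullback (fun y ↦ (vert (n := 0 + 1) 0, y)) (smooth_const_prod _ Y) a) := by
  rw [fibreInt_d, Fin.sum_univ_two, fibreInt_zero, fibreInt_zero,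
    pullback_zero_simplexPull (i := 1) rfl, pullback_zero_simplexPull (i := 0) rfl, Fin.val_zero,
    Fin.val_one, pow_zero, show (-1 : ℝ) ^ (0 + 1) = -1 by norm_num, one_smul, sub_eq_add_neg,
    neg_one_smul ℝ (d _), neg_one_smul ℝ (pullback _ _ a)]

theorem smooth_bisimplexMap (Y : Type*) [DiffeologicalSpace Y] (f : Fin (p + 1) → Fin (m + 1))
    (g : Fin (q + 1) → Fin (n + 1)) :
    DSmooth (Prod.map (simplexMap f) (Prod.map (simplexMap g) (id : Y → Y))) := fun _ _ hp ↦
  ⟨isPlot_iff_contDiff.2 ((contDiff_simplexMap f).comp (isPlot_iff_contDiff.1 hp.1)),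
    smooth_simplexMap Y g _ _ hp.2⟩

/-- The pull-back along a product of affine maps of simplices. -/
def bisimplexPull (f : Fin (p + 1) → Fin (m + 1)) (g : Fin (q + 1) → Fin (n + 1)) :
    Forms (Eu m × (Eu n × Y)) →ₐ[ℝ] Forms (Eu p × (Eu q × Y)) :=
  pullback _ (smooth_bisimplexMap Y f g)

theorem bisimplexPull_bisimplexPull {p' q' : ℕ} (f : Fin (p + 1) → Fin (m + 1))
    (g : Fin (q + 1) → Fin (n + 1)) (f' : Fin (p' + 1) → Fin (p + 1)) (g' : Fin (q' + 1) → Fin (q + 1))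
    (a : Forms (Eu m × (Eu n × Y))) :
    bisimplexPull f' g' (bisimplexPull f g a) = bisimplexPull (f ∘ f') (g ∘ g') a := by
  rw [bisimplexPull, bisimplexPull, pullback_pullback, bisimplexPull]
  refine pullback_congr (fun x ↦ ?_) _ _ a
  simp only [Function.comp, Prod.map, simplexMap_comp, id]

theorem simplexPull_eq_bisimplexPull (f : Fin (p + 1) → Fin (m + 1)) (a : Forms (Eu m × (Eu n × Y))) :
    simplexPull f a = bisimplexPull f id a := by
  refine pullback_congr (fun x ↦ ?_) _ _ a
  simp only [Prod.map, simplexMap_id, id]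

theorem simplexPull_fibreInt (g : Fin (q + 1) → Fin (n + 1)) (a : Forms (Eu p × (Eu n × Y))) :
    simplexPull g (fibreInt p a) = fibreInt p (bisimplexPull id g a) := by
  rw [simplexPull, ← fibreInt_pullback]
  congr 1
  refine pullback_congr (fun x ↦ ?_) _ _ a
  simp only [Prod.map, simplexMap_id, id]

/-- Integration over a product of simplices. -/
def biInt (f : Fin (p + 1) → Fin (m + 1)) (g : Fin (q + 1) → Fin (n + 1)) :
    Forms (Eu m × (Eu n × Y)) →ₗ[ℝ] Forms Y :=
  fibreInt q ∘ₗ fibreInt p ∘ₗ (bisimplexPull f g).toLinearMap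

theorem biInt_apply (f : Fin (p + 1) → Fin (m + 1)) (g : Fin (q + 1) → Fin (n + 1))
    (a : Forms (Eu m × (Eu n × Y))) : biInt f g a = fibreInt q (fibreInt p (bisimplexPull f g a)) := rfl

theorem biInt_congr {f f' : Fin (p + 1) → Fin (m + 1)} {g g' : Fin (q + 1) → Fin (n + 1)}
    (hf : ∀ i, (f i : ℕ) = f' i) (hg : ∀ i, (g i : ℕ) = g' i) (a : Forms (Eu m × (Eu n × Y))) :
    biInt f g a = biInt f' g' a := by
  obtain rfl : f = f' := funext fun i ↦ Fin.ext (hf i)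
  obtain rfl : g = g' := funext fun i ↦ Fin.ext (hg i)
  rfl

/-- The faces in the first factor. -/
def firstFaces : ∀ {p : ℕ} (_ : Fin (p + 1) → Fin (m + 1)) (_ : Fin (q + 1) → Fin (n + 1)),
    Forms (Eu m × (Eu n × Y)) →ₗ[ℝ] Forms Y
  | 0, _, _ => 0
  | p + 1, f, g => ∑ i : Fin (p + 2), (-1 : ℝ) ^ (i : ℕ) • biInt (f ∘ i.succAbove) g

/-- The faces in the second factor. -/
def secondFaces : ∀ {q : ℕ} (_ : Fin (p + 1) → Fin (m + 1)) (_ : Fin (q + 1) → Fin (n + 1)),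
    Forms (Eu m × (Eu n × Y)) →ₗ[ℝ] Forms Y
  | 0, _, _ => 0
  | q + 1, f, g => ∑ i : Fin (q + 2), (-1 : ℝ) ^ (p + (i : ℕ)) • biInt f (g ∘ i.succAbove)

theorem fibreInt_d_eq_firstFaces (f : Fin (p + 1) → Fin (m + 1)) (g : Fin (q + 1) → Fin (n + 1))
    (a : Forms (Eu m × (Eu n × Y))) : fibreInt q (fibreInt p (d (bisimplexPull f g a))) =
      (-1 : ℝ) ^ p • fibreInt q (d (fibreInt p (bisimplexPull f g a))) + firstFaces f g a := by
  cases p with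
  | zero => rw [fibreInt_zero_d, pow_zero, one_smul, firstFaces, LinearMap.zero_apply, add_zero]
  | succ p =>
    rw [fibreInt_d, map_add, map_smul, map_sum, firstFaces, LinearMap.sum_apply]
    congr 1
    refine Finset.sum_congr rfl fun i _ ↦ ?_
    rw [map_smul, LinearMap.smul_apply, biInt_apply, simplexPull_eq_bisimplexPull,
      bisimplexPull_bisimplexPull]
    rfl

theorem fibreInt_d_eq_secondFaces (f : Fin (p + 1) → Fin (m + 1)) (g : Fin (q + 1) → Fin (n + 1))
    (a : Forms (Eu m × (Eu n × Y))) : (-1 : ℝ) ^ p • fibreInt q (d (fibreInt p (bisimplexPull f g a))) =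
      (-1 : ℝ) ^ (p + q) • d (biInt f g a) + secondFaces f g a := by
  cases q with
  | zero => rw [fibreInt_zero_d, secondFaces, LinearMap.zero_apply, add_zero]; rfl
  | succ q =>
    rw [fibreInt_d, smul_add, smul_smul, ← pow_add, secondFaces, LinearMap.sum_apply, Finset.smul_sum]
    congr 1
    refine Finset.sum_congr rfl fun i _ ↦ ?_
    rw [LinearMap.smul_apply, biInt_apply, simplexPull_fibreInt, bisimplexPull_bisimplexPull, smul_smul,
      ← pow_add]
    rfl

/-- Stokes' theorem in the two factors in turn; the sign `(-1)^p` in `secondFaces` arises because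
the second application concerns a `d` that has already passed the integral over `Δ_p`. -/
theorem biInt_d (f : Fin (p + 1) → Fin (m + 1)) (g : Fin (q + 1) → Fin (n + 1))
    (a : Forms (Eu m × (Eu n × Y))) : biInt f g (d a) =
      (-1 : ℝ) ^ (p + q) • d (biInt f g a) + (firstFaces f g a + secondFaces f g a) := by
  rw [biInt_apply, bisimplexPull, ← d_pullback, ← bisimplexPull, fibreInt_d_eq_firstFaces,
    fibreInt_d_eq_secondFaces]
  abel

theorem smooth_diag (m : ℕ) (Y : Type*) [DiffeologicalSpace Y] :
    DSmooth fun x : Eu m × Y ↦ (x.1, x) := fun _ _ hp ↦ ⟨hp.1, hp⟩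

/-- Integration over the diagonal of a product of simplices. -/
def diagInt (m : ℕ) : Forms (Eu m × (Eu m × Y)) →ₗ[ℝ] Forms Y :=
  fibreInt m ∘ₗ (pullback (fun x : Eu m × Y ↦ (x.1, x)) (smooth_diag m Y)).toLinearMap

theorem diagInt_apply (a : Forms (Eu m × (Eu m × Y))) : diagInt m a =
    fibreInt m (pullback (fun x : Eu m × Y ↦ (x.1, x)) (smooth_diag m Y) a) := rfl

theorem diagInt_d (a : Forms (Eu (m + 1) × (Eu (m + 1) × Y))) : diagInt (m + 1) (d a) =
    (-1 : ℝ) ^ (m + 1) • d (diagInt (m + 1) a) +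
      ∑ i : Fin (m + 2), (-1 : ℝ) ^ (i : ℕ) • diagInt m (bisimplexPull i.succAbove i.succAbove a) := by
  rw [diagInt_apply, ← d_pullback, fibreInt_d]
  congr 1
  refine Finset.sum_congr rfl fun i _ ↦ ?_
  rw [diagInt_apply, simplexPull, bisimplexPull, pullback_pullback, pullback_pullback]
  congr 2

/-- A string of consecutive vertices. -/
def seg (p m s : ℕ) (i : Fin (p + 1)) : Fin (m + 1) := Fin.ofNat (m + 1) (s + i)

theorem val_seg {s : ℕ} (h : s + p ≤ m) (i : Fin (p + 1)) : (seg p m s i : ℕ) = s + i :=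
  Nat.mod_eq_of_lt (by omega)

/-- The integral over the Alexander–Whitney decomposition of the diagonal. -/
def awInt (m : ℕ) : Forms (Eu m × (Eu m × Y)) →ₗ[ℝ] Forms Y :=
  ∑ x ∈ Finset.HasAntidiagonal.antidiagonal m, biInt (seg x.1 m 0) (seg x.2 m x.1)

theorem awInt_apply (a : Forms (Eu m × (Eu m × Y))) :
    awInt m a = ∑ x ∈ Finset.HasAntidiagonal.antidiagonal m, biInt (seg x.1 m 0) (seg x.2 m x.1) a := by
  rw [awInt, LinearMap.sum_apply]

theorem val_succAbove (i : Fin (m + 1)) (j : Fin m) :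
    (i.succAbove j : ℕ) = if (j : ℕ) < i then (j : ℕ) else j + 1 := by
  rw [Fin.succAbove]
  simp only [Fin.lt_def, Fin.val_castSucc]
  split_ifs <;> rfl

/-- Let `c i` be the front and back segments of the string `0, …, p + q + 1` with vertex `i`
omitted. The faces of the first piece give `c i` for `i ≤ p`, those of the second piece give `c i`
for `i > p`. The last face of the first and the first face of the second are both the pair of
disjoint segments `0 … p` and `p + 1 … p + q + 1`, with opposite signs, and cancel. -/
theorem faces_seg (h : p + q = m) (a : Forms (Eu (m + 1) × (Eu (m + 1) × Y))) :
    (firstFaces (seg (p + 1) (m + 1) 0) (seg q (m + 1) (p + 1)) a +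
      secondFaces (seg p (m + 1) 0) (seg (q + 1) (m + 1) p) a) =
    ∑ i : Fin (m + 2), (-1 : ℝ) ^ (i : ℕ) • biInt (seg p m 0) (seg q m p)
      (bisimplexPull i.succAbove i.succAbove a) := by
  subst h
  obtain ⟨c, hc⟩ : ∃ c : ℕ → Forms Y, ∀ i, c i = biInt (fun j : Fin (p + 1) ↦ Fin.ofNat (p + q + 1 + 1)
    (if (j : ℕ) < i then (j : ℕ) else j + 1)) (fun j : Fin (q + 1) ↦ Fin.ofNat (p + q + 1 + 1)
      (if p + (j : ℕ) < i then p + (j : ℕ) else p + j + 1)) a := ⟨_, fun _ ↦ rfl⟩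
  have h1 : ∀ i : Fin (p + q + 2), biInt (seg p (p + q) 0) (seg q (p + q) p)
      (bisimplexPull i.succAbove i.succAbove a) = c i := by
    intro i
    rw [biInt_apply, bisimplexPull_bisimplexPull, hc, ← biInt_apply]
    refine biInt_congr (fun j ↦ ?_) (fun j ↦ ?_) a
    · rw [Function.comp, val_succAbove, val_seg (by omega), zero_add]
      exact (Nat.mod_eq_of_lt (by split_ifs <;> omega)).symm
    · rw [Function.comp, val_succAbove, val_seg (by omega)]
      exact (Nat.mod_eq_of_lt (by split_ifs <;> omega)).symm
  have h2 : firstFaces (seg (p + 1) (p + q + 1) 0) (seg q (p + q + 1) (p + 1)) a =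
      (∑ i ∈ Finset.range (p + 1), (-1 : ℝ) ^ i • c i) + (-1 : ℝ) ^ (p + 1) •
        biInt (seg p (p + q + 1) 0) (seg q (p + q + 1) (p + 1)) a := by
    rw [firstFaces, LinearMap.sum_apply, Fin.sum_univ_castSucc, Finset.sum_range]
    refine congrArg₂ (· + ·) ?_ ?_
    · refine Finset.sum_congr rfl fun i _ ↦ ?_
      rw [LinearMap.smul_apply, hc]
      refine congrArg _ (biInt_congr (fun j ↦ ?_) (fun j ↦ ?_) a)
      · rw [Function.comp, val_seg (by omega), val_succAbove, zero_add]
        exact (Nat.mod_eq_of_lt (by split_ifs <;> omega)).symm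
      · rw [val_seg (by omega), if_neg (by omega)]
        refine Eq.trans ?_ (Nat.mod_eq_of_lt (by omega)).symm
        omega
    · rw [LinearMap.smul_apply]
      refine congrArg _ (biInt_congr (fun j ↦ ?_) (fun _ ↦ rfl) a)
      rw [Function.comp, val_seg (by omega), val_succAbove, val_seg (by omega), if_pos (by simp; omega)]
  have h3 : secondFaces (seg p (p + q + 1) 0) (seg (q + 1) (p + q + 1) p) a =
      (-1 : ℝ) ^ p • biInt (seg p (p + q + 1) 0) (seg q (p + q + 1) (p + 1)) a +
      ∑ i ∈ Finset.range (q + 1), (-1 : ℝ) ^ (p + 1 + i) • c (p + 1 + i) := by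
    rw [secondFaces, LinearMap.sum_apply, Fin.sum_univ_succ, Finset.sum_range]
    refine congrArg₂ (· + ·) ?_ ?_
    · rw [LinearMap.smul_apply]
      refine congrArg _ (biInt_congr (fun _ ↦ rfl) (fun j ↦ ?_) a)
      rw [Function.comp, val_seg (by omega), val_succAbove, val_seg (by omega), if_neg (by simp)]
      omega
    · refine Finset.sum_congr rfl fun i _ ↦ ?_
      rw [LinearMap.smul_apply, hc, Fin.val_succ, add_assoc p 1, add_comm 1]
      refine congrArg _ (biInt_congr (fun j ↦ ?_) (fun j ↦ ?_) a)
      · rw [val_seg (by omega), if_pos (by omega), zero_add]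
        exact (Nat.mod_eq_of_lt (by omega)).symm
      · rw [Function.comp, val_seg (by omega), val_succAbove, Fin.val_succ]
        refine Eq.trans ?_ (Nat.mod_eq_of_lt (by split_ifs <;> omega)).symm
        split_ifs <;> omega
  simp only [h1]
  rw [h2, h3, ← Finset.sum_range fun i ↦ (-1 : ℝ) ^ i • c i,
    show p + q + 2 = (p + 1) + (q + 1) by omega, Finset.sum_range_add _ (p + 1),
    show (-1 : ℝ) ^ (p + 1) = -(-1) ^ p by ring, neg_smul]
  abel

/-- A decomposition of `m` into `p + q` collects the first faces of `(p + 1, q)` and the second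
faces of `(p, q + 1)`; the simplices `Δ_0` that are left over have no faces. Then `faces_seg`
applies termwise. -/
theorem awInt_d (a : Forms (Eu (m + 1) × (Eu (m + 1) × Y))) : awInt (m + 1) (d a) =
    (-1 : ℝ) ^ (m + 1) • d (awInt (m + 1) a) +
      ∑ i : Fin (m + 2), (-1 : ℝ) ^ (i : ℕ) • awInt m (bisimplexPull i.succAbove i.succAbove a) := by
  have h1 : awInt (m + 1) (d a) = (-1 : ℝ) ^ (m + 1) • d (awInt (m + 1) a) +
      ((∑ x ∈ Finset.HasAntidiagonal.antidiagonal (m + 1), firstFaces (seg x.1 (m + 1) 0) (seg x.2 (m + 1) x.1) a) +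
        ∑ x ∈ Finset.HasAntidiagonal.antidiagonal (m + 1), secondFaces (seg x.1 (m + 1) 0) (seg x.2 (m + 1) x.1) a) := by
    rw [awInt_apply, awInt_apply, map_sum, Finset.smul_sum, ← Finset.sum_add_distrib,
      ← Finset.sum_add_distrib]
    refine Finset.sum_congr rfl fun x hx ↦ ?_
    rw [biInt_d, Finset.HasAntidiagonal.mem_antidiagonal.1 hx]
  rw [h1, Finset.Nat.sum_antidiagonal_succ, Finset.Nat.sum_antidiagonal_succ' (n := m), firstFaces,
    secondFaces, LinearMap.zero_apply, zero_add, zero_add,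
    ← Finset.sum_add_distrib]
  congr 1
  simp only [awInt_apply, Finset.smul_sum]
  rw [Finset.sum_comm]
  refine Finset.sum_congr rfl fun x hx ↦ ?_
  exact faces_seg (Finset.HasAntidiagonal.mem_antidiagonal.1 hx) a

end Forms
end Homotopy

/-! ### The homotopy between the two integrals, by acyclic models -/

section Homotopy
variable {X Y Z : Type*} [DiffeologicalSpace X] [DiffeologicalSpace Y] [DiffeologicalSpace Z]
  {k l m n p q r N M : ℕ}

/-- Every composite of two faces arises from two pairs `(i, j)`, exchanged by an involution that
reverses the sign. -/
theorem sum_faces_faces {E : Type*} [AddCommGroup E] [Module ℝ E]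
    (c : (Fin (m + 1) → Fin (m + 3)) → E) :
    ∑ i : Fin (m + 3), (-1 : ℝ) ^ (i : ℕ) • ∑ j : Fin (m + 2), (-1 : ℝ) ^ (j : ℕ) •
      c (i.succAbove ∘ j.succAbove) = 0 := by
  simp only [Finset.smul_sum, smul_smul, ← pow_add]
  rw [← Finset.sum_product']
  refine Finset.sum_involution (fun x _ ↦ (x.1.succAbove x.2, x.2.predAbove x.1)) ?_ ?_ ?_ ?_
  · rintro ⟨i, j⟩ -
    have h : (i.succAbove j).succAbove ∘ (j.predAbove i).succAbove = i.succAbove ∘ j.succAbove :=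
      funext fun s ↦ Fin.succAbove_succAbove_succAbove_predAbove i j s
    rw [h, Fin.neg_one_pow_succAbove_add_predAbove, neg_smul]
    simp
  · rintro ⟨i, j⟩ - - h
    exact Fin.succAbove_ne i j (congrArg Prod.fst h)
  · intro x _
    exact Finset.mem_univ _
  · rintro ⟨i, j⟩ -
    exact Prod.ext (Fin.succAbove_succAbove_predAbove i j) (Fin.predAbove_predAbove_succAbove _ _)

namespace Forms

theorem pullback_id (a : Forms X) (h : DSmooth (id : X → X)) : pullback id h a = a := by
  refine ext_ev fun k m p x v ↦ ?_
  rw [ev_pullback]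
  rfl

theorem fibreInt_zero_pullSnd (b : Forms Y) : fibreInt 0 (pullSnd (Eu 0) b) = b := by
  rw [fibreInt_zero, pullSnd, pullback_pullback]
  exact pullback_id b _

/-- Pull-back of forms that do not involve the simplices. -/
def basic (m n : ℕ) : Forms Y →ₐ[ℝ] Forms (Eu m × (Eu n × Y)) :=
  (pullSnd (Eu m)).comp (pullSnd (Eu n))

theorem basic_apply (b : Forms Y) : basic m n b = pullSnd (Eu m) (pullSnd (Eu n) b) := rfl

theorem bisimplexPull_basic (f : Fin (p + 1) → Fin (m + 1)) (g : Fin (q + 1) → Fin (n + 1))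
    (b : Forms Y) : bisimplexPull f g (basic m n b) = basic p q b := by
  rw [basic_apply, basic_apply, bisimplexPull, pullSnd, pullSnd, pullSnd, pullSnd, pullback_pullback,
    pullback_pullback, pullback_pullback]
  rfl

theorem diagInt_basic (b : Forms Y) : diagInt (m + 1) (basic (m + 1) (m + 1) b) = 0 := by
  rw [diagInt_apply, basic_apply, pullSnd, pullSnd, pullback_pullback, pullback_pullback]
  exact fibreInt_pullSnd b

theorem biInt_basic (h : 0 < p + q) (f : Fin (p + 1) → Fin (m + 1)) (g : Fin (q + 1) → Fin (n + 1))
    (b : Forms Y) : biInt f g (basic m n b) = 0 := by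
  rw [biInt_apply, bisimplexPull_basic, basic_apply]
  cases p with
  | succ p => rw [fibreInt_pullSnd, map_zero]
  | zero =>
    rw [fibreInt_zero_pullSnd]
    cases q with
    | succ q => rw [fibreInt_pullSnd]
    | zero => omega

/-- The defect of the Alexander–Whitney decomposition. -/
def defect (m : ℕ) : Forms (Eu m × (Eu m × Y)) →ₗ[ℝ] Forms Y := diagInt m - awInt m

theorem defect_apply (a : Forms (Eu m × (Eu m × Y))) : defect m a = diagInt m a - awInt m a := rfl

theorem defect_zero : (defect 0 : Forms (Eu 0 × (Eu 0 × Y)) →ₗ[ℝ] Forms Y) = 0 := by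
  refine LinearMap.ext fun a ↦ ?_
  rw [defect_apply, awInt_apply, Finset.Nat.antidiagonal_zero, Finset.sum_singleton, diagInt_apply,
    biInt_apply, fibreInt_zero, fibreInt_zero, fibreInt_zero, bisimplexPull, pullback_pullback,
    pullback_pullback, pullback_pullback, LinearMap.zero_apply, sub_eq_zero]
  refine pullback_congr (fun y ↦ ?_) _ _ a
  exact Prod.ext (Subsingleton.elim _ _) (Prod.ext (Subsingleton.elim _ _) rfl)

/-- Forms from `Y` contain no `dt`: in positive dimension both integrals vanish, and in dimension 0
they coincide on all forms. -/
theorem defect_basic (b : Forms Y) : defect m (basic m m b) = 0 := by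
  cases m with
  | zero => rw [defect_zero, LinearMap.zero_apply]
  | succ m =>
    rw [defect_apply, diagInt_basic, awInt_apply, Finset.sum_eq_zero, sub_zero]
    intro x hx
    have := Finset.HasAntidiagonal.mem_antidiagonal.1 hx
    exact biInt_basic (by omega) _ _ b

theorem defect_d (a : Forms (Eu (m + 1) × (Eu (m + 1) × Y))) : defect (m + 1) (d a) =
    (-1 : ℝ) ^ (m + 1) • d (defect (m + 1) a) +
      ∑ i : Fin (m + 2), (-1 : ℝ) ^ (i : ℕ) • defect m (bisimplexPull i.succAbove i.succAbove a) := by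
  simp only [defect_apply, smul_sub, Finset.sum_sub_distrib, map_sub]
  rw [diagInt_d, awInt_d]
  abel

/-- The contraction of the product of two simplices to a vertex. -/
def coneMap (m : ℕ) (Y : Type*) (x : Eu (0 + 1) × (Eu m × (Eu m × Y))) : Eu m × (Eu m × Y) :=
  (x.1 0 • x.2.1, x.1 0 • x.2.2.1, x.2.2.2)

theorem smooth_coneMap (m : ℕ) (Y : Type*) [DiffeologicalSpace Y] : DSmooth (coneMap m Y) := by
  intro r c hc
  have h1 : ContDiff ℝ ∞ fun u ↦ (c u).1 0 :=
    (EuclideanSpace.proj (0 : Fin (0 + 1)) : Eu (0 + 1) →L[ℝ] ℝ).contDiff.comp (isPlot_iff_contDiff.1 hc.1)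
  exact ⟨isPlot_iff_contDiff.2 (h1.smul (isPlot_iff_contDiff.1 hc.2.1)),
    isPlot_iff_contDiff.2 (h1.smul (isPlot_iff_contDiff.1 hc.2.2.1)), hc.2.2.2⟩

/-- The homotopy operator of the contraction. -/
def coneInt (m : ℕ) : Forms (Eu m × (Eu m × Y)) →ₗ[ℝ] Forms (Eu m × (Eu m × Y)) :=
  fibreInt (0 + 1) ∘ₗ (pullback _ (smooth_coneMap m Y)).toLinearMap

theorem coneInt_apply (a : Forms (Eu m × (Eu m × Y))) :
    coneInt m a = fibreInt (0 + 1) (pullback _ (smooth_coneMap m Y) a) := rfl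

theorem smooth_id : DSmooth (id : X → X) := fun _ _ h ↦ h

/-- Scaling by `s` contracts both simplices to vertex 0, and integrating over `s` from 0 to 1 is the
homotopy of the Poincaré lemma. The value at `s = 1` is `a`; the value at `s = 0` comes from `Y`. -/
theorem coneInt_d (a : Forms (Eu m × (Eu m × Y))) : ∃ b : Forms Y,
    coneInt m (d a) = -d (coneInt m a) + (a - basic m m b) := by
  refine ⟨pullback (fun y ↦ (0, y)) (smooth_const_prod _ _)
    (pullback (fun y ↦ (0, y)) (smooth_const_prod _ _) a), ?_⟩
  rw [coneInt_apply, ← d_pullback, fibreInt_one_d, ← coneInt_apply, pullback_pullback, pullback_pullback,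
    basic_apply, pullSnd, pullSnd, pullback_pullback, pullback_pullback, pullback_pullback]
  have h1 : (vert (n := 0 + 1) 1) 0 = 1 := by
    rw [show (vert (n := 0 + 1) 1) = EuclideanSpace.single 0 1 from rfl]
    simp
  have h0 : (vert (n := 0 + 1) 0) 0 = 0 := rfl
  refine congrArg₂ (· + ·) rfl (congrArg₂ (· - ·) ?_ ?_)
  · refine (pullback_congr (fun x ↦ ?_) _ smooth_id a).trans (pullback_id a _)
    simp only [Function.comp, coneMap, h1, one_smul, id]
  · refine pullback_congr (fun x ↦ ?_) _ _ a
    simp only [Function.comp, coneMap, h0, zero_smul]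

theorem coneInt_basic (b : Forms Y) : coneInt m (basic m m b) = 0 := by
  refine Eq.trans ?_ (fibreInt_pullSnd (n := 0) (basic m m b))
  rw [coneInt_apply, basic_apply, pullSnd, pullSnd, pullSnd, pullback_pullback, pullback_pullback,
    pullback_pullback, pullback_pullback]
  congr 1

/-- The homotopy between the integral over the diagonal and the integral over its Alexander–Whitney
decomposition, constructed with the method of acyclic models. -/
def homotopyInt : ∀ m : ℕ, Forms (Eu m × (Eu m × Y)) →ₗ[ℝ] Forms Y
  | 0 => 0
  | m + 1 => (defect (m + 1) - ∑ i : Fin (m + 2), (-1 : ℝ) ^ (i : ℕ) •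
      homotopyInt m ∘ₗ (bisimplexPull i.succAbove i.succAbove).toLinearMap) ∘ₗ coneInt (m + 1)

/-- The remaining defect. -/
def remainder : ∀ m : ℕ, Forms (Eu m × (Eu m × Y)) →ₗ[ℝ] Forms Y
  | 0 => 0
  | m + 1 => defect (m + 1) - ∑ i : Fin (m + 2), (-1 : ℝ) ^ (i : ℕ) •
      homotopyInt m ∘ₗ (bisimplexPull i.succAbove i.succAbove).toLinearMap

theorem remainder_succ_apply (a : Forms (Eu (m + 1) × (Eu (m + 1) × Y))) : remainder (m + 1) a =
    defect (m + 1) a - ∑ i : Fin (m + 2), (-1 : ℝ) ^ (i : ℕ) •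
      homotopyInt m (bisimplexPull i.succAbove i.succAbove a) := by
  rw [remainder, LinearMap.sub_apply, LinearMap.sum_apply]
  rfl

theorem homotopyInt_apply (a : Forms (Eu m × (Eu m × Y))) :
    homotopyInt m a = remainder m (coneInt m a) := by
  cases m with
  | zero => rfl
  | succ m => rfl

theorem homotopyInt_basic (b : Forms Y) : homotopyInt m (basic m m b) = 0 := by
  rw [homotopyInt_apply, coneInt_basic, map_zero]

theorem remainder_basic (b : Forms Y) : remainder m (basic m m b) = 0 := by
  cases m with
  | zero => rfl
  | succ m =>
    rw [remainder_succ_apply, defect_basic, Finset.sum_eq_zero, sub_zero]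
    intro i _
    rw [bisimplexPull_basic, homotopyInt_basic, smul_zero]

/-- `remainder` differs from `defect` by a sum over faces. In the alternating sum this correction
becomes a sum over double faces and vanishes. -/
theorem sum_faces_defect (a : Forms (Eu (m + 1) × (Eu (m + 1) × Y))) :
    ∑ i : Fin (m + 2), (-1 : ℝ) ^ (i : ℕ) • defect m (bisimplexPull i.succAbove i.succAbove a) =
      ∑ i : Fin (m + 2), (-1 : ℝ) ^ (i : ℕ) • remainder m (bisimplexPull i.succAbove i.succAbove a) := by
  cases m with
  | zero => rw [defect_zero]; rfl
  | succ m =>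
    simp only [remainder_succ_apply, smul_sub, Finset.sum_sub_distrib]
    simp only [bisimplexPull_bisimplexPull]
    rw [sum_faces_faces fun f ↦ homotopyInt m (bisimplexPull f f a), sub_zero]

/-- The face terms in Stokes' formula for `defect` are, by `sum_faces_defect`, the remainders of the
faces. The homotopy formula one dimension lower produces the same terms, so `remainder` commutes
with `d` up to sign. -/
theorem remainder_d (ih : ∀ a : Forms (Eu m × (Eu m × Y)),
      homotopyInt m (d a) = (-1 : ℝ) ^ (m + 1) • d (homotopyInt m a) + remainder m a)
    (a : Forms (Eu (m + 1) × (Eu (m + 1) × Y))) :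
    remainder (m + 1) (d a) = (-1 : ℝ) ^ (m + 1) • d (remainder (m + 1) a) := by
  have h : ∀ i : Fin (m + 2), bisimplexPull i.succAbove i.succAbove (d a) =
    d (bisimplexPull i.succAbove i.succAbove a) := fun i ↦ (d_pullback _ _ a).symm
  rw [remainder_succ_apply, remainder_succ_apply, defect_d, sum_faces_defect]
  simp only [h, ih, smul_add, Finset.sum_add_distrib, map_sub, map_sum, map_smul, smul_sub,
    Finset.smul_sum]
  simp only [smul_comm ((-1 : ℝ) ^ (m + 1))]
  abel

/-- The step of acyclic models: `remainder` commutes with `d` up to sign and kills the forms from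
`Y`, whereas `coneInt` contracts all forms to those. Hence `remainder ∘ coneInt` is a null-homotopy
of `remainder`. -/
theorem homotopyInt_d (a : Forms (Eu m × (Eu m × Y))) :
    homotopyInt m (d a) = (-1 : ℝ) ^ (m + 1) • d (homotopyInt m a) + remainder m a := by
  induction m with
  | zero => simp [homotopyInt, remainder]
  | succ m ih =>
    obtain ⟨b, hb⟩ := coneInt_d a
    rw [homotopyInt_apply, hb, map_add, map_neg, remainder_d ih, map_sub, remainder_basic, sub_zero,
      homotopyInt_apply, pow_succ _ (m + 1), mul_neg_one, neg_smul]

theorem homotopyInt_defect (a : Forms (Eu (m + 1) × (Eu (m + 1) × Y))) :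
    homotopyInt (m + 1) (d a) = (-1 : ℝ) ^ m • d (homotopyInt (m + 1) a) + defect (m + 1) a -
      ∑ i : Fin (m + 2), (-1 : ℝ) ^ (i : ℕ) •
        homotopyInt m (bisimplexPull i.succAbove i.succAbove a) := by
  rw [homotopyInt_d, remainder_succ_apply, pow_add _ m 2]
  simp [add_sub_assoc]

theorem biInt_mem_degLT (f : Fin (p + 1) → Fin (m + 1)) (g : Fin (q + 1) → Fin (n + 1))
    {a : Forms (Eu m × (Eu n × Y))} (h : a ∈ degLT _ (N + (p + q))) : biInt f g a ∈ degLT Y N := by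
  refine fibreInt_mem_degLT (fibreInt_mem_degLT (pullback_mem_degLT _ _ ?_))
  rwa [add_assoc, add_comm q]

theorem defect_mem_degLT {a : Forms (Eu m × (Eu m × Y))} (h : a ∈ degLT _ (N + m)) :
    defect m a ∈ degLT Y N := by
  rw [defect_apply, awInt_apply]
  refine sub_mem (fibreInt_mem_degLT (pullback_mem_degLT _ _ h)) (sum_mem fun x hx ↦ ?_)
  refine biInt_mem_degLT _ _ ?_
  rwa [Finset.HasAntidiagonal.mem_antidiagonal.1 hx]

/-- The cone takes away one degree and the integrals over the simplices `m` more. Forms of bounded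
degree therefore contribute in finitely many dimensions only. -/
theorem homotopyInt_mem_degLT {a : Forms (Eu m × (Eu m × Y))} (h : a ∈ degLT _ (N + (m + 1))) :
    homotopyInt m a ∈ degLT Y N := by
  induction m generalizing N with
  | zero => exact zero_mem _
  | succ m ih =>
    rw [homotopyInt_apply, remainder_succ_apply]
    have h1 : coneInt (m + 1) a ∈ degLT _ (N + (m + 1)) :=
      fibreInt_mem_degLT (pullback_mem_degLT _ _ h)
    refine sub_mem (defect_mem_degLT h1) (sum_mem fun i _ ↦ Submodule.smul_mem _ _ (ih ?_))
    exact pullback_mem_degLT _ _ h1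

theorem smooth_parameter (m n : ℕ) {g : Z → Y} (hg : DSmooth g) :
    DSmooth (Prod.map id (Prod.map id g) : Eu m × (Eu n × Z) → Eu m × (Eu n × Y)) :=
  smooth_prodMap (smooth_prodMap hg)

theorem bisimplexPull_parameter {g : Z → Y} (hg : DSmooth g) (f : Fin (p + 1) → Fin (m + 1))
    (f' : Fin (q + 1) → Fin (n + 1)) (a : Forms (Eu m × (Eu n × Y))) :
    bisimplexPull f f' (pullback _ (smooth_parameter m n hg) a) =
      pullback _ (smooth_parameter p q hg) (bisimplexPull f f' a) := by
  rw [bisimplexPull, bisimplexPull, pullback_pullback, pullback_pullback]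
  rfl

theorem biInt_parameter {g : Z → Y} (hg : DSmooth g) (f : Fin (p + 1) → Fin (m + 1))
    (f' : Fin (q + 1) → Fin (n + 1)) (a : Forms (Eu m × (Eu n × Y))) :
    biInt f f' (pullback _ (smooth_parameter m n hg) a) = pullback g hg (biInt f f' a) := by
  rw [biInt_apply, bisimplexPull_parameter hg, biInt_apply, ← fibreInt_pullback _ hg,
    ← fibreInt_pullback _ (smooth_prodMap hg)]

theorem diagInt_parameter {g : Z → Y} (hg : DSmooth g) (a : Forms (Eu m × (Eu m × Y))) :
    diagInt m (pullback _ (smooth_parameter m m hg) a) = pullback g hg (diagInt m a) := by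
  rw [diagInt_apply, diagInt_apply, ← fibreInt_pullback, pullback_pullback, pullback_pullback]
  rfl

theorem defect_parameter {g : Z → Y} (hg : DSmooth g) (a : Forms (Eu m × (Eu m × Y))) :
    defect m (pullback _ (smooth_parameter m m hg) a) = pullback g hg (defect m a) := by
  simp only [defect_apply, awInt_apply, diagInt_parameter hg, biInt_parameter hg, map_sub, map_sum]

theorem coneInt_parameter {g : Z → Y} (hg : DSmooth g) (a : Forms (Eu m × (Eu m × Y))) :
    coneInt m (pullback _ (smooth_parameter m m hg) a) =
      pullback _ (smooth_parameter m m hg) (coneInt m a) := by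
  rw [coneInt_apply, coneInt_apply, ← fibreInt_pullback, pullback_pullback, pullback_pullback]
  rfl

/-- Naturality in the parameter space, by the naturality of every ingredient of the recursion. For
simplicial forms it turns the face terms of the homotopy into faces of the nerve. -/
theorem homotopyInt_parameter {g : Z → Y} (hg : DSmooth g) (a : Forms (Eu m × (Eu m × Y))) :
    homotopyInt m (pullback _ (smooth_parameter m m hg) a) = pullback g hg (homotopyInt m a) := by
  induction m with
  | zero => exact (map_zero _).symm
  | succ m ih =>
    rw [homotopyInt_apply, homotopyInt_apply, remainder_succ_apply, remainder_succ_apply,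
      coneInt_parameter hg, defect_parameter hg]
    simp only [bisimplexPull_parameter hg, ih, map_sub, map_sum, map_smul]

end Forms
end Homotopy

/-! ### The total complex in terms of forms on the single levels of the nerve -/

section SimplicialForms
variable {𝒢 : DiffGroupoid.{u}} {m n p q k l N M : ℕ}

namespace Total

/-- The inclusion of the forms on the `n`-simplices. -/
def incl (n : ℕ) : Forms (Nerve 𝒢 n) →ₗ[ℝ] Total 𝒢 := Forms.lift fun k ↦ Total.of n k

theorem incl_of (a : Form (Nerve 𝒢 n) k) : incl n (Forms.of k a) = Total.of n k a :=
  Forms.lift_of _ a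

theorem comp_of_same (a : Form (Nerve 𝒢 n) k) : comp n k (of n k a) = a :=
  DirectSum.component.lof_self ..

theorem comp_of_ne {n' k' : ℕ} (h : (n, k) ≠ (n', k')) (a : Form (Nerve 𝒢 n) k) :
    comp n' k' (of n k a) = 0 := (DirectSum.component.of ..).trans (dif_neg h)

theorem comp_incl (a : Forms (Nerve 𝒢 n)) : comp n k (incl n a) = Forms.comp k a := by
  induction a using Forms.induction with
  | zero => simp only [map_zero]
  | add x y hx hy => simp only [map_add, hx, hy]
  | of j a =>
    rw [incl_of]
    by_cases h : j = k
    · subst h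
      rw [comp_of_same, Forms.comp_of_same]
    · rw [comp_of_ne (by simpa using h), Forms.comp_of_ne h]

theorem comp_incl_of_ne (h : m ≠ n) (a : Forms (Nerve 𝒢 m)) : comp n k (incl m a) = 0 := by
  induction a using Forms.induction with
  | zero => simp only [map_zero]
  | add x y hx hy => simp only [map_add, hx, hy, add_zero]
  | of j a => rw [incl_of, comp_of_ne (by simp [h])]

theorem ext_comp {x y : Total 𝒢} (h : ∀ n k, comp n k x = comp n k y) : x = y :=
  DirectSum.ext_component ℝ fun i ↦ h i.1 i.2

/-- The alternating sum of the pull-backs along the faces. -/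
def faces (n : ℕ) : Forms (Nerve 𝒢 n) →ₗ[ℝ] Forms (Nerve 𝒢 (n + 1)) :=
  ∑ i : Fin (n + 2), (-1 : ℝ) ^ (i : ℕ) •
    (Forms.pullback (Nerve.reindex i.succAbove) (Nerve.smooth_reindex _)).toLinearMap

theorem faces_apply (a : Forms (Nerve 𝒢 n)) : faces n a = ∑ i : Fin (n + 2), (-1 : ℝ) ^ (i : ℕ) •
    Forms.pullback (Nerve.reindex i.succAbove) (Nerve.smooth_reindex _) a := by
  rw [faces, LinearMap.sum_apply]
  rfl

theorem faces_of (a : Form (Nerve 𝒢 n) k) :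
    faces n (Forms.of k a) = Forms.of k (Cochain.faceSum n k a) := by
  rw [faces_apply, Cochain.faceSum, LinearMap.sum_apply, map_sum, Finset.sum_range]
  refine Finset.sum_congr rfl fun i _ ↦ ?_
  rw [LinearMap.smul_apply, map_smul, Forms.pullback_of]
  refine congrArg _ (congrArg _ (Cochain.res_congr (fun j ↦ ?_) a))
  rw [Forms.val_succAbove]
  rcases val_face n i j with h | h <;> split_ifs <;> omega

theorem delta_incl (a : Forms (Nerve 𝒢 n)) :
    delta (incl n a) = (-1 : ℝ) ^ n • incl n (Forms.d a) + incl (n + 1) (faces n a) := by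
  induction a using Forms.induction with
  | zero => simp only [map_zero, smul_zero, add_zero]
  | add x y hx hy => simp only [map_add, hx, hy, smul_add]; abel
  | of j a => rw [incl_of, delta_of, Forms.d_of, incl_of, faces_of, incl_of]

/-- The sign `(-1)^(k q)` on `k`-forms. -/
def twist {X : Type*} [DiffeologicalSpace X] (q : ℕ) : Forms X →ₗ[ℝ] Forms X :=
  Forms.lift fun k ↦ (-1 : ℝ) ^ (k * q) • Forms.of k

theorem twist_of {X : Type*} [DiffeologicalSpace X] (a : Form X k) :
    twist q (Forms.of k a) = (-1 : ℝ) ^ (k * q) • Forms.of k a := Forms.lift_of _ a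

theorem pullback_twist {X Y : Type*} [DiffeologicalSpace X] [DiffeologicalSpace Y] (f : X → Y)
    (hf : DSmooth f) (a : Forms Y) :
    Forms.pullback f hf (twist q a) = twist q (Forms.pullback f hf a) := by
  induction a using Forms.induction with
  | zero => simp only [map_zero]
  | add x y hx hy => simp only [map_add, hx, hy]
  | of j a => rw [twist_of, map_smul, Forms.pullback_of, twist_of]

/-- The sign `(-1)^(k q)` of the cup product depends on the degree of the first factor only, so that
`twist q` absorbs it. -/
theorem incl_mul_incl (h : p + q = m) (a : Forms (Nerve 𝒢 p)) (b : Forms (Nerve 𝒢 q)) :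
    incl p a * incl q b = incl m (
      Forms.pullback (Nerve.reindex (Forms.seg p m 0)) (Nerve.smooth_reindex _) (twist q a) *
      Forms.pullback (Nerve.reindex (Forms.seg q m p)) (Nerve.smooth_reindex _) b) := by
  subst h
  induction a using Forms.induction with
  | zero => simp only [map_zero, zero_mul]
  | add x y hx hy => simp only [map_add, add_mul, hx, hy]
  | of j a =>
    induction b using Forms.induction with
    | zero => simp only [map_zero, mul_zero]
    | add x y hx hy => simp only [map_add, mul_add, hx, hy]
    | of l b =>
      rw [incl_of, incl_of, of_mul_of, twist_of, map_smul, Forms.pullback_of, Forms.pullback_of,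
        smul_mul_assoc, Forms.of_mul_of, map_smul, incl_of, Cochain.cup, map_smul]
      refine congrArg _ (congrArg _ (congrArg₂ Form.wedge ?_ ?_))
      · refine Cochain.res_congr (fun i ↦ ?_) a
        rw [Forms.val_seg (by omega), val_front, zero_add]
      · refine Cochain.res_congr (fun i ↦ ?_) b
        rw [Forms.val_seg (by omega), val_back]

/-- The element of the total complex with given components. -/
def assemble (a : ∀ n, Forms (Nerve 𝒢 n)) : Total 𝒢 := ∑ᶠ n, incl n (a n)

/-- `∑ᶠ` has its meaning only for finite support, which the bound `N` provides. -/
theorem assemble_eq_sum {a : ∀ n, Forms (Nerve 𝒢 n)} (h : ∀ n, N ≤ n → a n = 0) :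
    assemble a = ∑ n ∈ Finset.range N, incl n (a n) := by
  refine finsum_eq_sum_of_support_subset _ fun n hn ↦ ?_
  rw [Finset.coe_range, Set.mem_Iio]
  by_contra hc
  exact hn (by beta_reduce; rw [h n (not_lt.1 hc), map_zero])

theorem comp_assemble {a : ∀ n, Forms (Nerve 𝒢 n)} (h : ∀ n, N ≤ n → a n = 0) (n k : ℕ) :
    comp n k (assemble a) = Forms.comp k (a n) := by
  rw [assemble_eq_sum fun i (hi : max N (n + 1) ≤ i) ↦ h i ((le_max_left _ _).trans hi), map_sum,
    Finset.sum_eq_single n, comp_incl]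
  · intro m _ hm
    exact comp_incl_of_ne hm _
  · intro hn
    rw [Finset.mem_range] at hn
    omega

/-- The components of the differential. -/
def differential (a : ∀ n, Forms (Nerve 𝒢 n)) : ∀ n, Forms (Nerve 𝒢 n)
  | 0 => Forms.d (a 0)
  | n + 1 => (-1 : ℝ) ^ (n + 1) • Forms.d (a (n + 1)) + faces n (a n)

theorem delta_assemble {a : ∀ n, Forms (Nerve 𝒢 n)} (h : ∀ n, N ≤ n → a n = 0) :
    delta (assemble a) = assemble (differential a) := by
  have h1 : ∀ n, N + 1 ≤ n → differential a n = 0 := by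
    intro n hn
    obtain ⟨n, rfl⟩ := Nat.exists_eq_add_of_le' (Nat.one_le_of_lt hn)
    rw [differential, h _ (by omega), h _ (by omega), map_zero, map_zero, smul_zero, add_zero]
  rw [assemble_eq_sum h1, assemble_eq_sum (N := N + 1) fun n hn ↦ h n (by omega),
    Finset.sum_range_succ', map_add, map_sum]
  simp only [delta_incl, Finset.sum_add_distrib]
  rw [Finset.sum_range_succ' (fun n ↦ incl n (differential a n)), add_add_add_comm,
    add_comm (∑ i ∈ Finset.range N, incl (i + 1 + 1) _), add_comm (incl (0 + 1) _)]
  have h2 := Finset.sum_range_succ' (fun n ↦ incl (n + 1) (faces n (a n))) N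
  rw [Finset.sum_range_succ, h N le_rfl, map_zero, map_zero, add_zero] at h2
  simp only [differential, map_add, Finset.sum_add_distrib, map_smul]
  rw [h2, pow_zero, one_smul]
  abel

theorem assemble_sub {a b : ∀ n, Forms (Nerve 𝒢 n)} (ha : ∀ n, N ≤ n → a n = 0)
    (hb : ∀ n, N ≤ n → b n = 0) : assemble (fun n ↦ a n - b n) = assemble a - assemble b := by
  rw [assemble_eq_sum ha, assemble_eq_sum hb, assemble_eq_sum (N := N), ← Finset.sum_sub_distrib]
  · simp only [map_sub]
  · intro n hn
    rw [ha n hn, hb n hn, sub_zero]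

theorem assemble_mul {a b : ∀ n, Forms (Nerve 𝒢 n)} (ha : ∀ n, N ≤ n → a n = 0)
    (hb : ∀ n, M ≤ n → b n = 0) : assemble a * assemble b =
      assemble fun m ↦ ∑ x ∈ Finset.HasAntidiagonal.antidiagonal m,
        Forms.pullback (Nerve.reindex (Forms.seg x.1 m 0)) (Nerve.smooth_reindex _) (twist x.2 (a x.1)) *
        Forms.pullback (Nerve.reindex (Forms.seg x.2 m x.1)) (Nerve.smooth_reindex _) (b x.2) := by
  have h1 : ∀ m, N + M ≤ m → ∑ x ∈ Finset.HasAntidiagonal.antidiagonal m,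
        Forms.pullback (Nerve.reindex (Forms.seg x.1 m 0)) (Nerve.smooth_reindex _) (twist x.2 (a x.1)) *
        Forms.pullback (Nerve.reindex (Forms.seg x.2 m x.1)) (Nerve.smooth_reindex _) (b x.2) = 0 := by
    intro m hm
    refine Finset.sum_eq_zero fun x hx ↦ ?_
    have := Finset.HasAntidiagonal.mem_antidiagonal.1 hx
    by_cases h : N ≤ x.1
    · rw [ha _ h, map_zero, map_zero, zero_mul]
    · rw [hb _ (by omega), map_zero, mul_zero]
  rw [assemble_eq_sum h1, assemble_eq_sum (N := N + M) fun n hn ↦ ha n (by omega),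
    assemble_eq_sum (N := N + M) fun n hn ↦ hb n (by omega), Finset.sum_mul_sum, ← Finset.sum_product']
  have h2 : ∀ m, incl m (∑ x ∈ Finset.HasAntidiagonal.antidiagonal m,
        Forms.pullback (Nerve.reindex (Forms.seg x.1 m 0)) (Nerve.smooth_reindex _) (twist x.2 (a x.1)) *
        Forms.pullback (Nerve.reindex (Forms.seg x.2 m x.1)) (Nerve.smooth_reindex _) (b x.2)) =
      ∑ x ∈ Finset.HasAntidiagonal.antidiagonal m, incl x.1 (a x.1) * incl x.2 (b x.2) := by
    intro m
    rw [map_sum]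
    refine Finset.sum_congr rfl fun x hx ↦ ?_
    rw [incl_mul_incl (Finset.HasAntidiagonal.mem_antidiagonal.1 hx)]
  simp only [h2]
  rw [Finset.sum_sigma']
  symm
  -- Both sides run over pairs of levels. Pairs outside the common range contribute zero, since one
  -- of their factors is beyond its bound.
  refine Finset.sum_bij_ne_zero (fun x _ _ ↦ x.2) ?_ ?_ ?_ ?_
  · rintro ⟨m, x⟩ hx -
    simp only [Finset.mem_sigma, Finset.mem_range, Finset.HasAntidiagonal.mem_antidiagonal] at hx
    simp only [Finset.mem_product, Finset.mem_range]
    omega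
  · rintro ⟨m, x⟩ hx - ⟨m', x'⟩ hx' - h
    simp only [Finset.mem_sigma, Finset.mem_range, Finset.HasAntidiagonal.mem_antidiagonal] at hx hx'
    obtain rfl : x = x' := h
    obtain rfl : m = m' := by omega
    rfl
  · rintro x - h
    refine ⟨⟨x.1 + x.2, x⟩, ?_, h, rfl⟩
    simp only [Finset.mem_sigma, Finset.mem_range, Finset.HasAntidiagonal.mem_antidiagonal, and_true]
    by_contra hc
    by_cases h3 : N ≤ x.1
    · exact h (by rw [ha _ h3, map_zero, zero_mul])
    · exact h (by rw [hb _ (by omega), map_zero, mul_zero])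
  · rintro x - -
    rfl

end Total
end SimplicialForms

/-! ### Integration of simplicial forms -/

section Integral
variable {X Y : Type*} [DiffeologicalSpace X] [DiffeologicalSpace Y]
  {𝒢 : DiffGroupoid.{u}} {m n p q k l N M : ℕ}

namespace Forms

theorem of_mem_degLT (h : k < N) (a : Form X k) : of k a ∈ degLT X N := fun _ hj ↦
  comp_of_ne (by omega) a

theorem eq_sum_of_degLT {a : Forms X} (h : a ∈ degLT X N) :
    a = ∑ i ∈ Finset.range N, of i (comp i a) := by
  refine ext_comp fun k ↦ ?_
  rw [map_sum]
  by_cases hk : k < N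
  · rw [Finset.sum_eq_single k, comp_of_same]
    · intro i _ hi
      exact comp_of_ne hi _
    · intro hc
      exact absurd (Finset.mem_range.2 hk) hc
  · rw [h k (not_lt.1 hk), Finset.sum_eq_zero]
    intro i hi
    exact comp_of_ne (by rw [Finset.mem_range] at hi; omega) _

theorem mul_mem_degLT {a b : Forms X} (ha : a ∈ degLT X N) (hb : b ∈ degLT X M) :
    a * b ∈ degLT X (N + M) := by
  rw [eq_sum_of_degLT ha, eq_sum_of_degLT hb, Finset.sum_mul_sum]
  refine sum_mem fun i hi ↦ sum_mem fun j hj ↦ ?_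
  rw [of_mul_of]
  rw [Finset.mem_range] at hi hj
  exact of_mem_degLT (by omega) _

theorem d_mem_degLT {a : Forms X} (h : a ∈ degLT X N) : d a ∈ degLT X (N + 1) := by
  intro k hk
  obtain ⟨k, rfl⟩ := Nat.exists_eq_add_of_le' (Nat.one_le_of_lt hk)
  rw [comp_succ_d, h k (by omega), map_zero]

theorem fibreInt_eq_zero {a : Forms (Eu n × Y)} (h : a ∈ degLT _ N) (hn : N ≤ n) :
    fibreInt n a = 0 :=
  eq_zero_of_degLT (fibreInt_mem_degLT (degLT_mono (by omega) h))

end Forms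

open Forms

/-- Families of forms on the products of the simplices with the nerve of a groupoid. -/
abbrev Family (𝒢 : DiffGroupoid.{u}) := ∀ n, Forms (Eu n × Nerve 𝒢 n)

/-- Simplicial forms, of degree less than `N`. -/
structure Family.IsSimplicial (N : ℕ) (η : Family 𝒢) : Prop where
  compat : ∀ (m n : ℕ) (f : Fin (m + 1) → Fin (n + 1)), simplexPull f (η n) =
    Forms.pullback (Prod.map id (Nerve.reindex f)) (smooth_prodMap (Nerve.smooth_reindex f)) (η m)
  bounded : ∀ n, η n ∈ degLT _ N

namespace Family

/-- The integral of a simplicial form. -/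
def integral (η : Family 𝒢) : Total 𝒢 := Total.assemble fun n ↦ fibreInt n (η n)

variable {η η' : Family 𝒢}

theorem comp_integral (h : η.IsSimplicial N) (n k : ℕ) :
    Total.comp n k η.integral = Form.fibreInt n k (Forms.comp (n + k) (η n)) := by
  rw [← comp_fibreInt, integral, Total.comp_assemble fun n hn ↦ fibreInt_eq_zero (h.bounded n) hn]

theorem IsSimplicial.add (h : η.IsSimplicial N) (h' : η'.IsSimplicial M) :
    IsSimplicial (max N M) (η + η') := by
  refine ⟨fun m n f ↦ ?_, fun n ↦ add_mem (degLT_mono (le_max_left _ _) (h.bounded n))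
    (degLT_mono (le_max_right _ _) (h'.bounded n))⟩
  rw [Pi.add_apply, Pi.add_apply, map_add, map_add, h.compat, h'.compat]

theorem IsSimplicial.smul (h : η.IsSimplicial N) (c : ℝ) : IsSimplicial N (c • η) := by
  refine ⟨fun m n f ↦ ?_, fun n ↦ Submodule.smul_mem _ _ (h.bounded n)⟩
  rw [Pi.smul_apply, Pi.smul_apply, map_smul, map_smul, h.compat]

theorem integral_add (h : η.IsSimplicial N) (h' : η'.IsSimplicial M) :
    (η + η').integral = η.integral + η'.integral := by
  refine Total.ext_comp fun n k ↦ ?_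
  rw [map_add, comp_integral h, comp_integral h', comp_integral (h.add h'), Pi.add_apply, map_add,
    map_add]

theorem integral_smul (h : η.IsSimplicial N) (c : ℝ) : (c • η).integral = c • η.integral := by
  refine Total.ext_comp fun n k ↦ ?_
  rw [map_smul, comp_integral h, comp_integral (h.smul c), Pi.smul_apply, map_smul, map_smul]

theorem faces_fibreInt (h : η.IsSimplicial N) (n : ℕ) :
    Total.faces n (fibreInt n (η n)) =
      ∑ i : Fin (n + 2), (-1 : ℝ) ^ (i : ℕ) • fibreInt n (simplexPull i.succAbove (η (n + 1))) := by
  rw [Total.faces_apply]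
  refine Finset.sum_congr rfl fun i _ ↦ ?_
  rw [h.compat, fibreInt_pullback _ (Nerve.smooth_reindex _)]

/-- Stokes' theorem on each level. Compatibility with the faces rewrites the boundary terms as the
simplicial differential of the integral one level below, and the sign `(-1)^n` of Stokes is that of
the total differential. -/
theorem delta_integral (h : η.IsSimplicial N) :
    Total.delta η.integral = integral fun n ↦ Forms.d (η n) := by
  rw [integral, Total.delta_assemble fun n hn ↦ fibreInt_eq_zero (h.bounded n) hn, integral]
  congr 1
  funext n
  cases n with
  | zero => rw [Total.differential, fibreInt_zero_d]
  | succ n => rw [Total.differential, faces_fibreInt h, fibreInt_d]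

theorem delta_integral_eq_zero (h : η.IsSimplicial N) (hd : ∀ n, Forms.d (η n) = 0) :
    Total.delta η.integral = 0 := by
  rw [delta_integral h]
  simp only [hd, integral, map_zero]
  exact (Total.assemble_eq_sum (N := 0) fun _ _ ↦ rfl).trans (Finset.sum_range_zero _)

theorem smooth_forgetSnd (n m : ℕ) (Y : Type*) [DiffeologicalSpace Y] :
    DSmooth fun x : Eu n × (Eu m × Y) ↦ (x.1, x.2.2) := fun _ _ hp ↦ ⟨hp.1, hp.2.2⟩

/-- The external product of two simplicial forms. -/
def external (η η' : Family 𝒢) (m : ℕ) : Forms (Eu m × (Eu m × Nerve 𝒢 m)) :=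
  Forms.pullback (fun x ↦ (x.1, x.2.2)) (smooth_forgetSnd m m _) (η m) * pullSnd (Eu m) (η' m)

theorem external_mem_degLT (h : η.IsSimplicial N) (h' : η'.IsSimplicial M) (m : ℕ) :
    external η η' m ∈ degLT _ (N + M) :=
  mul_mem_degLT (pullback_mem_degLT _ _ (h.bounded m)) (pullback_mem_degLT _ _ (h'.bounded m))

theorem bisimplexPull_external (h : η.IsSimplicial N) (h' : η'.IsSimplicial M)
    (f : Fin (p + 1) → Fin (m + 1)) (g : Fin (q + 1) → Fin (m + 1)) :
    bisimplexPull f g (external η η' m) =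
      Forms.pullback (fun x ↦ (x.1, x.2.2)) (smooth_forgetSnd p q _)
        (Forms.pullback (Prod.map id (Nerve.reindex f)) (smooth_prodMap (Nerve.smooth_reindex f)) (η p)) *
      pullSnd (Eu p) (Forms.pullback (Prod.map id (Nerve.reindex g))
        (smooth_prodMap (Nerve.smooth_reindex g)) (η' q)) := by
  rw [external, map_mul, ← h.compat, ← h'.compat, bisimplexPull, pullback_pullback, pullSnd,
    pullback_pullback, simplexPull, pullback_pullback, pullSnd, simplexPull, pullback_pullback]
  rfl

theorem bisimplexPull_diag_external (h : η.IsSimplicial N) (h' : η'.IsSimplicial M)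
    (f : Fin (p + 1) → Fin (m + 1)) :
    bisimplexPull f f (external η η' m) =
      Forms.pullback _ (smooth_parameter p p (Nerve.smooth_reindex f)) (external η η' p) := by
  rw [bisimplexPull_external h h', external, map_mul, pullback_pullback, pullback_pullback, pullSnd,
    pullSnd, pullback_pullback, pullback_pullback]
  rfl

theorem d_external (hd : ∀ n, Forms.d (η n) = 0) (hd' : ∀ n, Forms.d (η' n) = 0) (m : ℕ) :
    Forms.d (external η η' m) = 0 := by
  rw [external, d_mul, d_pullback, hd, map_zero, zero_mul, zero_add, pullSnd, d_pullback, hd', map_zero,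
    mul_zero]

theorem diagInt_external (m : ℕ) : diagInt m (external η η' m) = fibreInt m (η m * η' m) := by
  rw [diagInt_apply, external, map_mul, pullback_pullback, pullSnd, pullback_pullback]
  congr 2
  · exact pullback_id _ smooth_id
  · exact pullback_id _ smooth_id

theorem fibreInt_pullSnd_mul (b : Forms Y) (a : Forms (Eu n × Y)) :
    fibreInt n (pullSnd (Eu n) b * a) = Total.twist n b * fibreInt n a := by
  induction b using Forms.induction with
  | zero => simp only [map_zero, zero_mul]
  | add x y hx hy => simp only [map_add, add_mul, hx, hy]
  | of j b => rw [fibreInt_pullSnd_of_mul, Total.twist_of, smul_mul_assoc]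

theorem fibreInt_forgetSnd (a : Forms (Eu p × Y)) :
    fibreInt p (Forms.pullback (fun x ↦ (x.1, x.2.2)) (smooth_forgetSnd p q Y) a) =
      pullSnd (Eu q) (fibreInt p a) :=
  fibreInt_pullback Prod.snd (smooth_snd (Eu q) Y) a

/-- The restriction to `Δ_p × Δ_q` is a product of forms on the separate factors, by compatibility.
The projection formula integrates each of them; moving the integral over `Δ_q` past the first one
gives the twist, which is the sign in the cup product. -/
theorem biInt_external (h : η.IsSimplicial N) (h' : η'.IsSimplicial M)
    (f : Fin (p + 1) → Fin (m + 1)) (g : Fin (q + 1) → Fin (m + 1)) :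
    biInt f g (external η η' m) =
      Forms.pullback (Nerve.reindex f) (Nerve.smooth_reindex f) (Total.twist q (fibreInt p (η p))) *
      Forms.pullback (Nerve.reindex g) (Nerve.smooth_reindex g) (fibreInt q (η' q)) := by
  rw [biInt_apply, bisimplexPull_external h h', fibreInt_mul_pullSnd, fibreInt_forgetSnd,
    fibreInt_pullSnd_mul, fibreInt_pullback _ (Nerve.smooth_reindex f),
    fibreInt_pullback _ (Nerve.smooth_reindex g), Total.pullback_twist]

theorem integral_mul (h : η.IsSimplicial N) (h' : η'.IsSimplicial M) : η.integral * η'.integral =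
    Total.assemble fun m ↦ awInt m (external η η' m) := by
  rw [integral, integral, Total.assemble_mul (fun n hn ↦ fibreInt_eq_zero (h.bounded n) hn)
    (fun n hn ↦ fibreInt_eq_zero (h'.bounded n) hn)]
  congr 1
  funext m
  rw [awInt_apply]
  exact Finset.sum_congr rfl fun x _ ↦ (biInt_external h h' _ _).symm

/-- Integration of closed simplicial forms is multiplicative up to coboundaries. -/
theorem exists_delta_eq_integral_mul (h : η.IsSimplicial N) (h' : η'.IsSimplicial M)
    (hd : ∀ n, Forms.d (η n) = 0) (hd' : ∀ n, Forms.d (η' n) = 0) :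
    ∃ x, Total.delta x = (η * η').integral - η.integral * η'.integral := by
  have h1 : ∀ m, N + M ≤ m → homotopyInt m (external η η' m) = 0 := fun m hm ↦
    eq_zero_of_degLT (homotopyInt_mem_degLT (degLT_mono (by omega) (external_mem_degLT h h' m)))
  have h2 : ∀ m, N + M ≤ m → diagInt m (external η η' m) = 0 := fun m hm ↦
    eq_zero_of_degLT (fibreInt_mem_degLT (pullback_mem_degLT _ _
      (degLT_mono (by omega) (external_mem_degLT h h' m))))
  have h3 : ∀ m, N + M ≤ m → awInt m (external η η' m) = 0 := fun m hm ↦ by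
    have h4 : defect m (external η η' m) = 0 :=
      eq_zero_of_degLT (defect_mem_degLT (degLT_mono (by omega) (external_mem_degLT h h' m)))
    rwa [defect_apply, h2 m hm, zero_sub, neg_eq_zero] at h4
  -- `diagInt` of the external product integrates `η * η'`, and `awInt` of it is the product of the
  -- integrals. The external product is closed and is compatible with simultaneous faces; by
  -- naturality `homotopyInt_defect` becomes the required identity for `δ`.
  refine ⟨Total.assemble fun m ↦ homotopyInt m (external η η' m), ?_⟩
  rw [Total.delta_assemble h1, integral_mul h h', integral]
  simp only [Pi.mul_apply, ← diagInt_external]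
  rw [← Total.assemble_sub h2 h3]
  congr 1
  funext m
  rw [← defect_apply]
  cases m with
  | zero => rw [Total.differential, homotopyInt, LinearMap.zero_apply, map_zero, defect_zero]; rfl
  | succ m =>
    have h5 := homotopyInt_defect (external η η' (m + 1))
    rw [d_external hd hd', map_zero] at h5
    simp only [bisimplexPull_diag_external h h', homotopyInt_parameter (Nerve.smooth_reindex _)] at h5
    rw [← Total.faces_apply] at h5
    rw [Total.differential, pow_succ, mul_neg_one, neg_smul, neg_add_eq_sub, sub_eq_iff_eq_add',
      ← sub_eq_zero, ← neg_eq_zero, neg_sub]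
    exact h5.symm

end Family
end Integral

/-! ### Descent of characteristic forms to the base -/

section Descent
variable {d : ℕ} {G : Type u} [TopologicalSpace G] [ChartedSpace (Eu d) G] [Group G]
  [LieGroup (𝓡 d) ∞ G] {X Y Z W : Type*} [DiffeologicalSpace X] [DiffeologicalSpace Y]
  [DiffeologicalSpace Z] [DiffeologicalSpace W] {k l m n N : ℕ}

theorem ext_pairing {L : Type*} [LieRing L] [LieAlgebra ℝ L] [Module.Finite ℝ L]
    {Θ Θ' : Form X k ⊗[ℝ] L} (h : ∀ ξ, pairing ξ Θ = pairing ξ Θ') : Θ = Θ' := by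
  rw [← sum_pairing_tmul (Module.finBasis ℝ L) Θ, ← sum_pairing_tmul (Module.finBasis ℝ L) Θ']
  exact Finset.sum_congr rfl fun i _ ↦ by rw [h]

theorem ext_conn {Θ Θ' : Form X 1 ⊗[ℝ] LieAlg d G}
    (h : ∀ (m : ℕ) (p : Plot X m) (x : Eu m), conn Θ p x = conn Θ' p x) : Θ = Θ' := by
  refine ext_pairing fun ξ ↦ Form.ext fun m p x ↦ ?_
  ext w
  have hw : w = fun _ ↦ w 0 := funext fun i ↦ by rw [Subsingleton.elim i 0]
  rw [hw, pairing_val, pairing_val]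
  exact congrArg ξ (DFunLike.congr_fun (h m p x) (w 0))

theorem LocalLift.forms_pullback_injective {π : X → Z} (h : LocalLift π) (hπ : DSmooth π) :
    Function.Injective (Forms.pullback π hπ) := fun a b hab ↦ Forms.ext_comp fun k ↦
  h.pullback_injective hπ (by rw [← Forms.comp_pullback, ← Forms.comp_pullback, hab])

theorem Forms.algebraMap_mem_degLT (r : ℝ) : algebraMap ℝ (Forms X) r ∈ degLT X 1 := by
  rw [Algebra.algebraMap_eq_smul_one]
  exact Submodule.smul_mem _ _ (of_mem_degLT zero_lt_one _)

/-- The degree of the value of a polynomial is bounded in terms of the polynomial. -/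
theorem exists_polyEval_mem_degLT {L : Type*} [LieRing L] [LieAlgebra ℝ L]
    (F : SymmetricAlgebra ℝ (Module.Dual ℝ L)) : ∃ N : ℕ, ∀ (X : Type u) [DiffeologicalSpace X]
      (Ω : Form X 2 ⊗[ℝ] L), polyEval Ω F ∈ Forms.degLT X N := by
  induction F using SymmetricAlgebra.induction with
  | algebraMap r =>
    refine ⟨1, fun X _ Ω ↦ ?_⟩
    rw [AlgHom.commutes]
    exact Forms.algebraMap_mem_degLT r
  | ι ξ =>
    refine ⟨3, fun X _ Ω ↦ ?_⟩
    rw [polyEval_ι]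
    exact Forms.of_mem_degLT (by norm_num) _
  | mul a b ha hb =>
    obtain ⟨N, hN⟩ := ha
    obtain ⟨M, hM⟩ := hb
    refine ⟨N + M, fun X _ Ω ↦ ?_⟩
    rw [map_mul]
    exact Forms.mul_mem_degLT (hN X Ω) (hM X Ω)
  | add a b ha hb =>
    obtain ⟨N, hN⟩ := ha
    obtain ⟨M, hM⟩ := hb
    refine ⟨max N M, fun X _ Ω ↦ ?_⟩
    rw [map_add]
    exact add_mem (Forms.degLT_mono (le_max_left _ _) (hN X Ω))
      (Forms.degLT_mono (le_max_right _ _) (hM X Ω))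

namespace IsGaugeForm
variable {π : X → Z} {Θ : Form X 1 ⊗[ℝ] LieAlg d G}

/-- Each component descends by `val_eq`; there are finitely many non-zero ones, so their descended
forms have a sum. -/
theorem exists_pullback_eq (h : IsGaugeForm π Θ) (hl : LocalLift π) (hπ : DSmooth π)
    (f : InvPoly d G) : ∃ b : Forms Z, Forms.pullback π hπ b = polyEval (curvature Θ) f.1 := by
  have h1 : ∀ k, ∃ b : Form Z k, Form.pullback π hπ b = Forms.comp k (polyEval (curvature Θ) f.1) :=
    fun k ↦ hl.exists_pullback_eq hπ _ fun m p p' u hp ↦ h.val_eq f p p' hp u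
  choose b hb using h1
  obtain ⟨N, hN⟩ : ∃ N, polyEval (curvature Θ) f.1 ∈ Forms.degLT X N := by
    classical
    refine ⟨(DFinsupp.support (polyEval (curvature Θ) f.1)).sup id + 1, fun k hk ↦ ?_⟩
    by_contra hc
    have := Finset.le_sup (f := id) (DFinsupp.mem_support_iff.2 hc)
    rw [id] at this
    omega
  refine ⟨∑ i ∈ Finset.range N, Forms.of i (b i), ?_⟩
  refine Eq.trans ?_ (Forms.eq_sum_of_degLT hN).symm
  rw [map_sum]
  refine Finset.sum_congr rfl fun i _ ↦ ?_
  rw [Forms.pullback_of, hb]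

/-- The characteristic forms on the base. -/
def descend (h : IsGaugeForm π Θ) (hl : LocalLift π) (hπ : DSmooth π) :
    InvPoly d G →ₐ[ℝ] Forms Z :=
  -- Pull-back is injective, hence an isomorphism onto its range; composing with the inverse makes
  -- the descended forms multiplicative in the polynomial without further work.
  (AlgEquiv.ofInjective _ (hl.forms_pullback_injective hπ)).symm.toAlgHom.comp
    (((polyEval (curvature Θ)).comp (InvPoly d G).val).codRestrict (Forms.pullback π hπ).range
      fun f ↦ h.exists_pullback_eq hl hπ f)

variable (h : IsGaugeForm π Θ) (hl : LocalLift π) (hπ : DSmooth π)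

theorem pullback_descend (f : InvPoly d G) :
    Forms.pullback π hπ (h.descend hl hπ f) = polyEval (curvature Θ) f.1 :=
  congrArg Subtype.val ((AlgEquiv.ofInjective _ (hl.forms_pullback_injective hπ)).apply_symm_apply
    ((((polyEval (curvature Θ)).comp (InvPoly d G).val).codRestrict (Forms.pullback π hπ).range
      fun f ↦ h.exists_pullback_eq hl hπ f) f))

theorem d_descend (f : InvPoly d G) : Forms.d (h.descend hl hπ f) = 0 := by
  refine hl.forms_pullback_injective hπ ?_
  rw [← Forms.d_pullback, pullback_descend, h.d_polyEval, map_zero]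

theorem descend_mem_degLT {f : InvPoly d G} (hN : polyEval (curvature Θ) f.1 ∈ Forms.degLT X N) :
    h.descend hl hπ f ∈ Forms.degLT Z N := fun k hk ↦ by
  refine hl.pullback_injective hπ ?_
  rw [map_zero, ← Forms.comp_pullback, pullback_descend, hN k hk]

theorem pullback_pullback_descend {π' : Y → W} (hπ' : DSmooth π') {g : W → Z} (hg : DSmooth g)
    {g' : Y → X} (hg' : DSmooth g') (e : ∀ y, π (g' y) = g (π' y)) (f : InvPoly d G) :
    Forms.pullback π' hπ' (Forms.pullback g hg (h.descend hl hπ f)) =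
      polyEval (curvature (vpull g' hg' Θ)) f.1 := by
  rw [← vpull_curvature, ← pullback_polyEval, ← h.pullback_descend hl hπ, Forms.pullback_pullback,
    Forms.pullback_pullback]
  exact Forms.pullback_congr (fun y ↦ (e y).symm) _ _ _

end IsGaugeForm
end Descent

/-! ### The simplicial characteristic form and the cochain map -/

section Characteristic
variable {d : ℕ} {G : Type u} [TopologicalSpace G] [ChartedSpace (Eu d) G] [Group G]
  [LieGroup (𝓡 d) ∞ G] {Γ : LieGroupoid.{u}} {B : PrincipalBundle d G Γ} {k m n N : ℕ}

/-- The coordinate `i` of the image point is the sum of the coordinates of all vertices that `f`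
sends to `i`. -/
theorem sum_bary_simplexMap_smul {E : Type*} [AddCommGroup E] [Module ℝ E]
    (f : Fin (m + 1) → Fin (n + 1)) (t : Eu m) (A : Fin (n + 1) → E) :
    ∑ i, bary i (simplexMap f t) • A i = ∑ j, bary j t • A (f j) := by
  simp only [bary_simplexMap, bary_vert, Finset.sum_smul]
  rw [Finset.sum_comm]
  refine Finset.sum_congr rfl fun j _ ↦ ?_
  rw [Finset.sum_eq_single (f j)]
  · rw [if_pos rfl, mul_one]
  · intro i _ hi
    rw [if_neg hi, mul_zero, zero_smul]
  · intro h
    exact absurd (Finset.mem_univ _) h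

theorem Total.comp_pull {𝒢 ℋ : DiffGroupoid.{u}} (φ : StrictHom 𝒢 ℋ) (x : Total ℋ) :
    Total.comp n k (φ.pull x) = Form.pullback (φ.nerve n) (φ.smooth_nerve n) (Total.comp n k x) := by
  induction x using Total.induction with
  | zero => simp only [map_zero]
  | add x y hx hy => simp only [map_add, hx, hy]
  | of m j a =>
    rw [StrictHom.pull_of]
    by_cases h : (m, j) = (n, k)
    · obtain ⟨rfl, rfl⟩ := Prod.mk.inj h
      rw [Total.comp_of_same, Total.comp_of_same]
    · rw [Total.comp_of_ne h, Total.comp_of_ne h, map_zero]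

theorem smooth_simplexNerve (B : PrincipalBundle d G Γ) (n : ℕ) :
    DSmooth (Prod.map (id : Eu n → Eu n) (B.toBase.nerve n)) := smooth_prodMap (B.toBase.smooth_nerve n)

theorem localLift_simplexNerve {T : Type*} [DiffeologicalSpace T] (B : PrincipalBundle d G Γ) (n : ℕ) :
    LocalLift (Prod.map (id : T → T) (B.toBase.nerve n)) := B.localLift_nerve.prodMap

open Forms

namespace PseudoConnection
variable (θ : PseudoConnection B)

theorem conn_extended (p : Plot (Eu n × Nerve B.transformation n) m) (x : Eu m) :
    conn (θ.extended n) p x = ∑ i, bary i (p.1 x).1 • conn θ.form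
      ⟨fun y ↦ Nerve.vertex i (p.1 y).2, p.2.2.1 i⟩ x :=
  conn_interpolate (c := fun i t ↦ bary i t) (v := fun i ↦ i) (θ := fun _ ↦ θ) p x

theorem isGaugeForm_extended (n : ℕ) :
    IsGaugeForm (Prod.map id (B.toBase.nerve n)) (θ.extended n) :=
  isGaugeForm_interpolate (c := fun i t ↦ bary i t) (v := fun i ↦ i) (θ := fun _ ↦ θ) sum_bary

/-- Both sides are `∑ t_j p_(f j)^* θ`. From this equality the characteristic forms inherit the
compatibility of simplicial forms. -/
theorem vpull_extended (f : Fin (m + 1) → Fin (n + 1)) :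
    vpull _ (smooth_simplexMap _ f) (θ.extended n) =
      vpull (Prod.map id (Nerve.reindex f)) (smooth_prodMap (Nerve.smooth_reindex f)) (θ.extended m) := by
  refine ext_conn fun r p x ↦ ?_
  rw [conn_vpull, conn_vpull, conn_extended, conn_extended]
  change ∑ i, bary i (simplexMap f (p.1 x).1) • conn θ.form
      ⟨fun y ↦ Nerve.vertex i (p.1 y).2, p.2.2.1 i⟩ x = ∑ i, bary i (p.1 x).1 • conn θ.form
      ⟨fun y ↦ Nerve.vertex (f i) (p.1 y).2, p.2.2.1 (f i)⟩ x
  exact sum_bary_simplexMap_smul f (p.1 x).1 fun i ↦ conn θ.form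
    ⟨fun y ↦ Nerve.vertex i (p.1 y).2, p.2.2.1 i⟩ x

/-- The characteristic forms, as simplicial forms. -/
def characteristic (n : ℕ) : InvPoly d G →ₐ[ℝ] Forms (Eu n × Nerve Γ.toDiff n) :=
  (θ.isGaugeForm_extended n).descend (localLift_simplexNerve B n) (smooth_simplexNerve B n)

/-- The family of characteristic forms of an invariant polynomial. -/
def family (f : InvPoly d G) : Family Γ.toDiff := fun n ↦ θ.characteristic n f

theorem pullback_pullback_family {Y W : Type*} [DiffeologicalSpace Y] [DiffeologicalSpace W]
    {π : Y → W} (hπ : DSmooth π) {g : W → Eu n × Nerve Γ.toDiff n} (hg : DSmooth g)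
    {g' : Y → Eu n × Nerve B.transformation n} (hg' : DSmooth g')
    (e : ∀ y, Prod.map id (B.toBase.nerve n) (g' y) = g (π y)) (f : InvPoly d G) :
    Forms.pullback π hπ (Forms.pullback g hg (θ.family f n)) =
      polyEval (curvature (vpull g' hg' (θ.extended n))) f.1 :=
  (θ.isGaugeForm_extended n).pullback_pullback_descend _ _ hπ hg hg' e f

/-- The equality is tested after pull-back to the nerve of the transformation groupoid, which is
injective on forms; there it is `vpull_extended`. -/
theorem simplexPull_family (f : InvPoly d G) (r : Fin (m + 1) → Fin (n + 1)) :
    simplexPull r (θ.family f n) = Forms.pullback (Prod.map id (Nerve.reindex r))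
      (smooth_prodMap (Nerve.smooth_reindex r)) (θ.family f m) := by
  refine (localLift_simplexNerve (T := Eu m) B n).forms_pullback_injective
    (smooth_prodMap (B.toBase.smooth_nerve n)) ?_
  have h1 := θ.pullback_pullback_family (smooth_prodMap (T := Eu m) (B.toBase.smooth_nerve n))
    (smooth_simplexMap (Nerve Γ.toDiff n) r) (smooth_simplexMap (Nerve B.transformation n) r)
    (fun y ↦ Prod.ext rfl rfl) f
  have h2 := θ.pullback_pullback_family (smooth_prodMap (T := Eu m) (B.toBase.smooth_nerve n))
    (smooth_prodMap (Nerve.smooth_reindex r)) (smooth_prodMap (Nerve.smooth_reindex r))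
    (fun y ↦ Prod.ext rfl rfl) f
  rw [← vpull_extended] at h2
  exact h1.trans h2.symm

theorem exists_isSimplicial_family (f : InvPoly d G) : ∃ N, (θ.family f).IsSimplicial N := by
  obtain ⟨N, hN⟩ := exists_polyEval_mem_degLT.{u} f.1
  exact ⟨N, fun m n r ↦ θ.simplexPull_family f r,
    fun n ↦ IsGaugeForm.descend_mem_degLT _ _ _ (hN _ _)⟩

theorem d_family (f : InvPoly d G) (n : ℕ) : Forms.d (θ.family f n) = 0 :=
  IsGaugeForm.d_descend _ _ _ f

theorem family_add (f g : InvPoly d G) : θ.family (f + g) = θ.family f + θ.family g :=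
  funext fun _ ↦ map_add _ f g

theorem family_smul (c : ℝ) (f : InvPoly d G) : θ.family (c • f) = c • θ.family f :=
  funext fun _ ↦ map_smul _ c f

theorem family_mul (f g : InvPoly d G) : θ.family (f * g) = θ.family f * θ.family g :=
  funext fun _ ↦ map_mul _ f g

theorem family_one : θ.family (1 : InvPoly d G) = 1 := funext fun _ ↦ map_one _

/-- The cochain map. -/
def cochainMap : InvPoly d G →ₗ[ℝ] Cocycle Γ.toDiff where
  toFun f := ⟨(θ.family f).integral, by
    obtain ⟨N, hN⟩ := θ.exists_isSimplicial_family f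
    exact Family.delta_integral_eq_zero hN (θ.d_family f)⟩
  map_add' f g := by
    obtain ⟨N, hN⟩ := θ.exists_isSimplicial_family f
    obtain ⟨M, hM⟩ := θ.exists_isSimplicial_family g
    refine Subtype.ext ?_
    dsimp only
    rw [family_add, Family.integral_add hN hM]
    rfl
  map_smul' c f := by
    obtain ⟨N, hN⟩ := θ.exists_isSimplicial_family f
    refine Subtype.ext ?_
    dsimp only
    rw [family_smul, Family.integral_smul hN]
    rfl

theorem coe_cochainMap (f : InvPoly d G) : (θ.cochainMap f).1 = (θ.family f).integral := rfl

theorem comp_pull_cochainMap (f : InvPoly d G) (n k : ℕ) :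
    Total.comp n k (B.toBase.pull (θ.cochainMap f).1) =
      Form.fibreInt n k (Forms.comp (n + k) (polyEval (curvature (θ.extended n)) f.1)) := by
  obtain ⟨N, hN⟩ := θ.exists_isSimplicial_family f
  rw [Total.comp_pull, coe_cochainMap, Family.comp_integral hN, ← comp_fibreInt, ← comp_fibreInt,
    ← Forms.comp_pullback, ← fibreInt_pullback _ (B.toBase.smooth_nerve n)]
  exact congrArg (fun a ↦ Forms.comp k (fibreInt n a)) (IsGaugeForm.pullback_descend _ _ _ f)

theorem isCochainMap_iff (z : InvPoly d G →ₗ[ℝ] Cocycle Γ.toDiff) : θ.IsCochainMap z ↔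
    ∀ f n k, Total.comp n k (B.toBase.pull (z f).1) =
      Form.fibreInt n k (Forms.comp (n + k) (polyEval (curvature (θ.extended n)) f.1)) := by
  refine ⟨fun h f n k ↦ Form.ext fun m p x ↦ ContinuousAlternatingMap.ext fun w ↦ ?_,
    fun h f n k m p x w ↦ ?_⟩
  · exact (h f n k m p x w).trans (Form.fibreInt_val _ _ _ _).symm
  · exact (congrArg (fun a : Form _ k ↦ a.val p x w) (h f n k)).trans (Form.fibreInt_val _ _ _ _)

theorem isCochainMap_cochainMap : θ.IsCochainMap θ.cochainMap :=
  (θ.isCochainMap_iff _).2 θ.comp_pull_cochainMap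

/-- The condition prescribes the pull-backs of all components, and pull-back to the nerve of the
transformation groupoid is injective because plots lift locally. -/
theorem IsCochainMap.eq {θ : PseudoConnection B} {z : InvPoly d G →ₗ[ℝ] Cocycle Γ.toDiff}
    (h : θ.IsCochainMap z) : z = θ.cochainMap := by
  refine LinearMap.ext fun f ↦ Subtype.ext (Total.ext_comp fun n k ↦ ?_)
  refine B.localLift_nerve.pullback_injective (B.toBase.smooth_nerve n) ?_
  rw [← Total.comp_pull, ← Total.comp_pull, (θ.isCochainMap_iff z).1 h, comp_pull_cochainMap]

end PseudoConnection
end Characteristic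

/-! ### Independence of the pseudo-connection; the algebra homomorphism -/

section Independence
variable {d : ℕ} {G : Type u} [TopologicalSpace G] [ChartedSpace (Eu d) G] [Group G]
  [LieGroup (𝓡 d) ∞ G] {Γ : LieGroupoid.{u}} {B : PrincipalBundle d G Γ} {k l m n N : ℕ}

open Forms

theorem Family.IsSimplicial.derivative {𝒢 : DiffGroupoid.{u}} {η : Family 𝒢} (h : η.IsSimplicial N) :
    Family.IsSimplicial (N + 1) fun n ↦ Forms.d (η n) :=
  ⟨fun m n f ↦ by rw [simplexPull, ← d_pullback, ← simplexPull, h.compat, d_pullback],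
    fun n ↦ d_mem_degLT (h.bounded n)⟩

/-- The constant 1 contains no `dt`, so only the level `n = 0` contributes. -/
theorem Family.integral_one {𝒢 : DiffGroupoid.{u}} : Family.integral (1 : Family 𝒢) = 1 := by
  have h : ∀ n, 1 ≤ n → fibreInt n ((1 : Family 𝒢) n) = 0 := by
    intro n hn
    obtain ⟨n, rfl⟩ := Nat.exists_eq_add_of_le' hn
    have h1 := fibreInt_pullSnd (n := n) (1 : Forms (Nerve 𝒢 (n + 1)))
    rwa [map_one] at h1
  rw [Family.integral, Total.assemble_eq_sum h, Finset.sum_range_one, Pi.one_apply, fibreInt_zero,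
    map_one]
  exact Total.incl_of _

theorem sum_bary_vert_smul {E : Type*} [AddCommGroup E] [Module ℝ E] (e : Fin (l + 1))
    (c : Fin (n + 1) → ℝ) (A : Fin (l + 1) × Fin (n + 1) → E) :
    ∑ x, (bary x.1 (vert e) * c x.2) • A x = ∑ i, c i • A (e, i) := by
  rw [Fintype.sum_prod_type, Finset.sum_eq_single e]
  · simp only [bary_vert, if_true, one_mul]
  · intro i _ hi
    simp only [bary_vert, if_neg hi, zero_mul, zero_smul, Finset.sum_const_zero]
  · intro h
    exact absurd (Finset.mem_univ _) h

theorem sum_bary_mul_simplexMap_smul {E : Type*} [AddCommGroup E] [Module ℝ E]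
    (f : Fin (m + 1) → Fin (n + 1)) (s : Eu l) (t : Eu m) (A : Fin (l + 1) × Fin (n + 1) → E) :
    ∑ x, (bary x.1 s * bary x.2 (simplexMap f t)) • A x =
      ∑ x : Fin (l + 1) × Fin (m + 1), (bary x.1 s * bary x.2 t) • A (x.1, f x.2) := by
  simp only [Fintype.sum_prod_type, mul_smul, ← Finset.smul_sum]
  simp only [sum_bary_simplexMap_smul f t fun i ↦ A (_, i)]

theorem contDiff_bary_mul_bary (Y : Type*) [DiffeologicalSpace Y] (i : Fin (l + 1) × Fin (n + 1)) (m : ℕ)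
    (p : Plot ((Eu l × Eu n) × Y) m) :
    ContDiff ℝ ∞ ((fun x ↦ bary i.1 x.1.1 * bary i.2 x.1.2) ∘ p.1) :=
  ((contDiff_bary i.1).comp (isPlot_iff_contDiff.1 p.2.1.1)).mul
    ((contDiff_bary i.2).comp (isPlot_iff_contDiff.1 p.2.1.2))

namespace PseudoConnection
variable (Θ : Fin (l + 1) → PseudoConnection B)

/-- Interpolation between several pseudo-connections over the simplices. -/
def interpolated (n : ℕ) : Form ((Eu l × Eu n) × Nerve B.transformation n) 1 ⊗[ℝ] LieAlg d G :=
  interpolate (fun (i : Fin (l + 1) × Fin (n + 1)) x ↦ bary i.1 x.1 * bary i.2 x.2)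
    (contDiff_bary_mul_bary _) (fun i ↦ i.2) fun i ↦ Θ i.1

theorem conn_interpolated (p : Plot ((Eu l × Eu n) × Nerve B.transformation n) m) (x : Eu m) :
    conn (interpolated Θ n) p x = ∑ i : Fin (l + 1) × Fin (n + 1),
      (bary i.1 (p.1 x).1.1 * bary i.2 (p.1 x).1.2) • conn (Θ i.1).form
        ⟨fun y ↦ Nerve.vertex i.2 (p.1 y).2, p.2.2.1 i.2⟩ x :=
  conn_interpolate p x

theorem isGaugeForm_interpolated (n : ℕ) :
    IsGaugeForm (Prod.map id (B.toBase.nerve n)) (interpolated Θ n) :=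
  isGaugeForm_interpolate fun t ↦ by
    rw [Fintype.sum_prod_type]
    simp only [← Finset.mul_sum, sum_bary, mul_one]

/-- The map `(s, (t, y)) ↦ ((s, t), y)`. -/
def regroup (l n : ℕ) (Y : Type*) (x : Eu l × (Eu n × Y)) : (Eu l × Eu n) × Y :=
  ((x.1, x.2.1), x.2.2)

theorem smooth_regroup (l n : ℕ) (Y : Type*) [DiffeologicalSpace Y] : DSmooth (regroup l n Y) :=
  fun _ _ hp ↦ ⟨⟨hp.1, hp.2.1⟩, hp.2.2⟩

/-- The characteristic forms of an interpolation. -/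
def interpolatedFamily (f : InvPoly d G) (n : ℕ) : Forms (Eu l × (Eu n × Nerve Γ.toDiff n)) :=
  Forms.pullback _ (smooth_regroup l n _) ((isGaugeForm_interpolated Θ n).descend
    (localLift_simplexNerve B n) (smooth_prodMap (B.toBase.smooth_nerve n)) f)

theorem pullback_pullback_interpolatedFamily {Y W : Type*} [DiffeologicalSpace Y] [DiffeologicalSpace W]
    {π : Y → W} (hπ : DSmooth π) {g : W → Eu l × (Eu n × Nerve Γ.toDiff n)} (hg : DSmooth g)
    {g' : Y → Eu l × (Eu n × Nerve B.transformation n)} (hg' : DSmooth g')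
    (e : ∀ y, Prod.map id (Prod.map id (B.toBase.nerve n)) (g' y) = g (π y)) (f : InvPoly d G) :
    Forms.pullback π hπ (Forms.pullback g hg (interpolatedFamily Θ f n)) =
      polyEval (curvature (vpull g' hg' (vpull _ (smooth_regroup l n _) (interpolated Θ n)))) f.1 := by
  rw [← vpull_curvature _ hg', ← pullback_polyEval]
  refine Eq.trans ?_ (congrArg (Forms.pullback g' hg')
    ((isGaugeForm_interpolated Θ n).pullback_pullback_descend (localLift_simplexNerve B n)
      (smooth_prodMap (B.toBase.smooth_nerve n))
      (smooth_prodMap (smooth_prodMap (B.toBase.smooth_nerve n))) (smooth_regroup l n _)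
      (smooth_regroup l n _) (fun _ ↦ rfl) f))
  rw [Forms.pullback_pullback, Forms.pullback_pullback]
  exact Forms.pullback_congr (fun y ↦ (e y).symm) _ _ _

theorem vpull_interpolated (f : Fin (m + 1) → Fin (n + 1)) :
    vpull _ (smooth_bisimplexMap _ id f) (vpull _ (smooth_regroup l n _) (interpolated Θ n)) =
      vpull _ (smooth_parameter l m (Nerve.smooth_reindex f))
        (vpull _ (smooth_regroup l m _) (interpolated Θ m)) := by
  refine ext_conn fun r p x ↦ ?_
  rw [conn_vpull, conn_vpull, conn_vpull, conn_vpull, conn_interpolated, conn_interpolated]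
  refine Eq.trans ?_ (sum_bary_mul_simplexMap_smul f (p.1 x).1 (p.1 x).2.1 fun i ↦ conn (Θ i.1).form
    ⟨fun y ↦ Nerve.vertex i.2 (p.1 y).2.2, p.2.2.2.1 i.2⟩ x)
  refine Finset.sum_congr rfl fun i _ ↦ congrArg₂ (· • ·) (congrArg₂ (· * ·) ?_ rfl) rfl
  exact congrArg (bary i.1) (simplexMap_id (p.1 x).1)

theorem vpull_vert_interpolated (e : Fin (l + 1)) (n : ℕ) :
    vpull _ (smooth_const_prod (vert e) _) (vpull _ (smooth_regroup l n _) (interpolated Θ n)) =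
      (Θ e).extended n := by
  refine ext_conn fun r p x ↦ ?_
  rw [conn_vpull, conn_vpull, conn_interpolated, conn_extended]
  exact sum_bary_vert_smul e (fun i ↦ bary i (p.1 x).1) fun i ↦ conn (Θ i.1).form
    ⟨fun y ↦ Nerve.vertex i.2 (p.1 y).2, p.2.2.1 i.2⟩ x

theorem d_interpolatedFamily (f : InvPoly d G) (n : ℕ) : Forms.d (interpolatedFamily Θ f n) = 0 := by
  rw [interpolatedFamily, d_pullback, IsGaugeForm.d_descend, map_zero]

theorem pullback_vert_interpolatedFamily (e : Fin (l + 1)) (f : InvPoly d G) (n : ℕ) :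
    Forms.pullback _ (smooth_const_prod (vert e) _) (interpolatedFamily Θ f n) = (Θ e).family f n := by
  refine (localLift_simplexNerve B n).forms_pullback_injective (smooth_simplexNerve B n) ?_
  have h := pullback_pullback_interpolatedFamily Θ (smooth_simplexNerve B n)
    (smooth_const_prod (vert e) (Eu n × Nerve Γ.toDiff n))
    (smooth_const_prod (vert e) (Eu n × Nerve B.transformation n)) (fun y ↦ Prod.ext rfl rfl) f
  rw [vpull_vert_interpolated] at h
  exact h.trans (((Θ e).isGaugeForm_extended n).pullback_descend _ _ f).symm

theorem bisimplexPull_interpolatedFamily (f : InvPoly d G) (r : Fin (m + 1) → Fin (n + 1)) :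
    bisimplexPull id r (interpolatedFamily Θ f n) =
      Forms.pullback _ (smooth_parameter l m (Nerve.smooth_reindex r)) (interpolatedFamily Θ f m) := by
  refine LocalLift.forms_pullback_injective (localLift_simplexNerve (T := Eu m) B n).prodMap
    (smooth_prodMap (smooth_prodMap (B.toBase.smooth_nerve n))) ?_
  have h1 := pullback_pullback_interpolatedFamily Θ
    (smooth_prodMap (T := Eu l) (smooth_prodMap (T := Eu m) (B.toBase.smooth_nerve n)))
    (smooth_bisimplexMap _ id r) (smooth_bisimplexMap _ id r)
    (fun y ↦ Prod.ext rfl (Prod.ext rfl rfl)) f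
  have h2 := pullback_pullback_interpolatedFamily Θ
    (smooth_prodMap (T := Eu l) (smooth_prodMap (T := Eu m) (B.toBase.smooth_nerve n)))
    (smooth_parameter l m (Nerve.smooth_reindex r)) (smooth_parameter l m (Nerve.smooth_reindex r))
    (fun y ↦ Prod.ext rfl (Prod.ext rfl rfl)) f
  rw [← vpull_interpolated] at h2
  exact h1.trans h2.symm

/-- The interpolation over `Δ_l` is compatible with the affine maps in the other simplex variable,
and integration over `Δ_l` commutes with these. -/
theorem exists_isSimplicial_fibreInt (f : InvPoly d G) : ∃ N,
    Family.IsSimplicial N fun n ↦ fibreInt l (interpolatedFamily Θ f n) := by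
  obtain ⟨N, hN⟩ := exists_polyEval_mem_degLT.{u} f.1
  refine ⟨N, fun m n r ↦ ?_, fun n ↦ fibreInt_mem_degLT (degLT_mono (Nat.le_add_right N l)
    (pullback_mem_degLT _ _ (IsGaugeForm.descend_mem_degLT _ _ _ (hN _ _))))⟩
  rw [simplexPull_fibreInt, bisimplexPull_interpolatedFamily]
  exact fibreInt_pullback _ (smooth_prodMap (Nerve.smooth_reindex r)) _

/-- The characteristic form of the interpolation over an interval is closed. By Stokes, the
differential of its integral over the interval is the difference of the two characteristic forms.
This integral is itself a simplicial form, and integrating it over the simplices gives the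
cobounding cochain. -/
theorem exists_delta_eq_sub (θ θ' : PseudoConnection B) (f : InvPoly d G) :
    ∃ x, Total.delta x = (θ'.cochainMap f).1 - (θ.cochainMap f).1 := by
  obtain ⟨Θ, h0, h1⟩ : ∃ Θ : Fin (0 + 1 + 1) → PseudoConnection B, Θ 0 = θ ∧ Θ 1 = θ' :=
    ⟨![θ, θ'], rfl, rfl⟩
  obtain ⟨N, hN⟩ := exists_isSimplicial_fibreInt Θ f
  obtain ⟨M, hM⟩ := θ.exists_isSimplicial_family f
  refine ⟨_, (Family.delta_integral hN).trans ?_⟩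
  rw [eq_sub_iff_add_eq, coe_cochainMap, coe_cochainMap, ← Family.integral_add hN.derivative hM]
  congr 1
  funext n
  have h2 := fibreInt_one_d (interpolatedFamily Θ f n)
  rw [d_interpolatedFamily, map_zero, pullback_vert_interpolatedFamily,
    pullback_vert_interpolatedFamily, h0, h1] at h2
  rw [Pi.add_apply, ← eq_sub_iff_add_eq]
  exact (neg_add_eq_zero.1 h2.symm)

end PseudoConnection

theorem cls_eq_cls {𝒢 : DiffGroupoid.{u}} {z z' : Cocycle 𝒢} (h : ∃ x, Total.delta x = z.1 - z'.1) :
    cls z = cls z' := Ideal.Quotient.eq.2 h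

namespace PseudoConnection

theorem cls_cochainMap_eq (θ θ' : PseudoConnection B) (f : InvPoly d G) :
    cls (θ.cochainMap f) = cls (θ'.cochainMap f) := cls_eq_cls (exists_delta_eq_sub θ' θ f)

/-- The Chern–Weil homomorphism. -/
def chernWeil (θ : PseudoConnection B) : InvPoly d G →ₐ[ℝ] Cohomology Γ.toDiff :=
  AlgHom.ofLinearMap ((Ideal.Quotient.mkₐ ℝ (coboundary Γ.toDiff)).toLinearMap ∘ₗ θ.cochainMap)
    (congrArg cls (Subtype.ext ((congrArg Family.integral θ.family_one).trans Family.integral_one)))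
    fun f g ↦ by
      obtain ⟨N, hN⟩ := θ.exists_isSimplicial_family f
      obtain ⟨M, hM⟩ := θ.exists_isSimplicial_family g
      -- The simplicial forms multiply strictly; only their integration costs a coboundary.
      refine cls_eq_cls (z' := θ.cochainMap f * θ.cochainMap g) ?_
      obtain ⟨x, hx⟩ := Family.exists_delta_eq_integral_mul hN hM (θ.d_family f) (θ.d_family g)
      refine ⟨x, hx.trans ?_⟩
      rw [coe_cochainMap, family_mul]
      rfl

theorem chernWeil_apply (θ : PseudoConnection B) (f : InvPoly d G) :
    θ.chernWeil f = cls (θ.cochainMap f) := rfl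

end PseudoConnection

theorem IsChernWeilMap.eq {w : InvPoly d G →ₐ[ℝ] Cohomology Γ.toDiff} (h : IsChernWeilMap B w)
    (θ : PseudoConnection B) : w = θ.chernWeil := by
  obtain ⟨θ', z, hz, hw⟩ := h
  refine AlgHom.ext fun f ↦ ?_
  rw [hw, hz.eq, PseudoConnection.chernWeil_apply]
  exact θ'.cls_cochainMap_eq θ f

end Independence

/-! ### Naturality under strict homomorphisms -/

section Naturality
variable {d : ℕ} {G : Type u} [TopologicalSpace G] [ChartedSpace (Eu d) G] [Group G]
  [LieGroup (𝓡 d) ∞ G] {Γ Γ' : LieGroupoid.{u}} (B : PrincipalBundle d G Γ)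
  (φ : LieGroupoid.Hom Γ' Γ) {k l m n N : ℕ}

open Forms

/-- The map of transformation groupoids over a homomorphism. -/
def PrincipalBundle.pullbackHom : StrictHom (B.pullback φ).transformation B.transformation where
  onOb := B.fromPullback φ
  onAr a := ⟨(φ.onAr a.1.1, B.fromPullback φ a.1.2),
    (φ.src_map a.1.1).trans ((congrArg φ.onOb a.2).trans a.1.2.2)⟩
  smooth_onOb := B.smooth_fromPullback φ
  smooth_onAr := fun _ _ hp ↦ ⟨φ.smooth_onAr.comp hp.1, hp.2.2⟩
  src_map _ := rfl
  tgt_map _ := rfl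
  unit_map x := Subtype.ext (Prod.ext ((φ.unit_map x.1.1).trans (congrArg _ x.2)) rfl)
  mul_map _ _ _ := Subtype.ext (Prod.ext (φ.mul_map _ _ _) rfl)

theorem nerve_pullbackHom (s : Nerve (B.pullback φ).transformation n) :
    φ.toStrict.nerve n ((B.pullback φ).toBase.nerve n s) =
      B.toBase.nerve n ((B.pullbackHom φ).nerve n s) :=
  Subtype.ext (Prod.ext (funext fun i ↦ (s.1.1 i).2) rfl)

variable {B} (θ : PseudoConnection B)

theorem PseudoConnection.vpull_pullbackHom_extended (n : ℕ) :
    vpull _ (smooth_prodMap ((B.pullbackHom φ).smooth_nerve n)) (θ.extended n) =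
      (θ.pullback φ).extended n := by
  refine ext_conn fun r p x ↦ ?_
  rw [conn_vpull, conn_extended, conn_extended]
  refine Finset.sum_congr rfl fun i _ ↦ congrArg₂ (· • ·) rfl ?_
  exact (congrFun (conn_vpull _ (B.smooth_fromPullback φ)
    ⟨fun y ↦ Nerve.vertex i (p.1 y).2, p.2.2.1 i⟩ θ.form) x).symm

/-- The functor `pullbackHom` lies over `φ` and pulls the form `∑ t_i p_i^* θ` back to the one of
the induced pseudo-connection. Curvature, evaluation of polynomials and integration over the simplex
all commute with pull-back along it. -/
theorem PseudoConnection.isCochainMap_pullback :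
    (θ.pullback φ).IsCochainMap (φ.toStrict.pullCocycle.toLinearMap ∘ₗ θ.cochainMap) := by
  rw [isCochainMap_iff]
  intro f n k
  have h1 : Total.comp n k ((B.pullback φ).toBase.pull
      ((φ.toStrict.pullCocycle.toLinearMap ∘ₗ θ.cochainMap) f).1) =
      Form.pullback _ ((B.pullbackHom φ).smooth_nerve n)
        (Total.comp n k (B.toBase.pull (θ.cochainMap f).1)) := by
    rw [Total.comp_pull, Total.comp_pull]
    refine (congrArg _ (Total.comp_pull φ.toStrict (θ.cochainMap f).1)).trans ?_
    refine (Form.pullback_pullback _ _ _).trans (Eq.trans ?_ (Form.pullback_pullback _ _ _).symm)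
    exact Form.pullback_congr (funext (nerve_pullbackHom B φ)) _ _ _
  rw [h1, comp_pull_cochainMap, ← comp_fibreInt, ← comp_fibreInt, ← Forms.comp_pullback,
    ← fibreInt_pullback _ ((B.pullbackHom φ).smooth_nerve n), pullback_polyEval, vpull_curvature,
    vpull_pullbackHom_extended]

end Naturality

/-! ### The curvature of a convex combination of connections -/

section CurvatureOfSum
variable {X Y : Type*} [DiffeologicalSpace X] [DiffeologicalSpace Y] {k l m n : ℕ}

namespace Forms

/-- The parity automorphism. -/
def parity : Forms X →ₐ[ℝ] Forms X :=
  algHom (fun k ↦ (-1 : ℝ) ^ k • LinearMap.id) (one_smul ℝ _) fun k l a b ↦ by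
    simp only [LinearMap.smul_apply, LinearMap.id_apply, Cochain.wedge_smul, Cochain.smul_wedge, smul_smul,
      pow_add]
    rw [mul_comm]

theorem parity_of (a : Form X k) : parity (of k a) = (-1 : ℝ) ^ k • of k a := by
  exact (algHom_of _ _ _ a).trans (map_smul (of k) _ a)

theorem parity_eq_twist (a : Forms X) : parity a = Total.twist 1 a := by
  induction a using induction with
  | zero => simp only [map_zero]
  | add x y hx hy => simp only [map_add, hx, hy]
  | of j a => rw [parity_of, Total.twist_of, mul_one]

theorem parity_parity (a : Forms X) : parity (parity a) = a := by
  induction a using induction with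
  | zero => simp only [map_zero]
  | add x y hx hy => simp only [map_add, hx, hy]
  | of j a => rw [parity_of, map_smul, parity_of, smul_smul, neg_one_pow_sq, one_smul]

theorem parity_pullback (f : X → Y) (hf : DSmooth f) (a : Forms Y) :
    parity (pullback f hf a) = pullback f hf (parity a) := by
  rw [parity_eq_twist, parity_eq_twist, Total.pullback_twist]

theorem twist_zero (a : Forms X) : Total.twist 0 a = a := by
  induction a using induction with
  | zero => simp only [map_zero]
  | add x y hx hy => simp only [map_add, hx, hy]
  | of j a => rw [Total.twist_of, mul_zero, pow_zero, one_smul]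

theorem of_mul_comm_of_even (h : Even k) (a : Form X k) (b : Forms X) : of k a * b = b * of k a := by
  induction b using induction with
  | zero => simp only [mul_zero, zero_mul]
  | add x y hx hy => simp only [mul_add, add_mul, hx, hy]
  | of j b => rw [of_mul_of_comm, (h.mul_right j).neg_one_pow, one_smul]

theorem of_one_mul (a : Form X 1) (b : Forms X) : of 1 a * b = parity b * of 1 a := by
  induction b using induction with
  | zero => simp only [mul_zero, map_zero, zero_mul]
  | add x y hx hy => simp only [mul_add, map_add, add_mul, hx, hy]
  | of j b => rw [of_mul_of_comm, parity_of, one_mul, smul_mul_assoc]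

theorem smooth_fst (X Y : Type*) [DiffeologicalSpace X] [DiffeologicalSpace Y] :
    DSmooth (Prod.fst : X × Y → X) := fun _ _ hp ↦ hp.1

/-- The pull-back along the first projection. -/
def pullFst (Y : Type*) [DiffeologicalSpace Y] : Forms X →ₐ[ℝ] Forms (X × Y) :=
  pullback Prod.fst (smooth_fst X Y)

/-- The integral of a form over a simplex. -/
def simplexIntegral (τ : Forms (Eu n)) : ℝ :=
  ∫ t in simplex n, τ.ev (⟨id, isPlot_id⟩ : Plot (Eu n) n) t fun i : Fin n ↦ EuclideanSpace.single i 1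

theorem ev_pullFst (τ : Forms (Eu n)) (p : Plot Y m) (z : Eu (n + m)) (v : Fin k → Eu (n + m)) :
    (pullFst Y τ).ev (prodPlot n p) z v =
      τ.ev (⟨id, isPlot_id⟩ : Plot (Eu n) n) (fstL n m z) fun i ↦ fstL n m (v i) := by
  rw [pullFst, ev_pullback]
  exact τ.ev_reparam_of_eq _ (fstL n m).contDiff (hasFDerivAt_fstL n m z) (fun _ ↦ rfl) v

/-- A form from the simplex vanishes on vectors tangent to `Y`, so only its top-degree part
contributes, and it contributes a constant. -/
theorem fibreInt_pullFst (τ : Forms (Eu n)) :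
    fibreInt n (pullFst Y τ) = algebraMap ℝ (Forms Y) τ.simplexIntegral := by
  refine ext_ev fun k m p x w ↦ ?_
  rw [ev_fibreInt, Algebra.algebraMap_eq_smul_one, ev_smul]
  simp only [ev_pullFst]
  have h1 : (1 : Forms Y) = of 0 (Form.const Y 1) := rfl
  cases k with
  | zero =>
    rw [h1, ev_of, simplexIntegral]
    refine Eq.trans ?_ (mul_one _).symm
    refine integral_congr_ae (Eventually.of_forall fun t ↦ ?_)
    beta_reduce
    rw [fstL_join]
    refine congrArg _ (funext fun i ↦ ?_)
    exact (congrArg (fstL n m) (frame_castAdd w i)).trans (fstL_join _ _)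
  | succ k =>
    rw [h1, ev_of_ne (by omega), mul_zero]
    refine integral_eq_zero_of_ae (Eventually.of_forall fun t ↦ ?_)
    refine (Form.val _ _ _).map_coord_zero (Fin.natAdd n 0) ?_
    rw [frame_natAdd, fstL_join]

end Forms

open Forms

section
variable {L : Type*} [LieRing L] [LieAlgebra ℝ L]

theorem pairing_rTensor (ξ : Module.Dual ℝ L) (g : Form X k →ₗ[ℝ] Form X l) (Θ : Form X k ⊗[ℝ] L) :
    pairing ξ (g.rTensor L Θ) = g (pairing ξ Θ) := by
  induction Θ with
  | zero => simp only [map_zero]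
  | tmul a l => rw [LinearMap.rTensor_tmul, pairing_tmul, pairing_tmul, map_smul]
  | add x y hx hy => simp only [map_add, hx, hy]

variable {ι κ : Type*} [Fintype ι] [Fintype κ] (T : ι → Form X 0) (Θ : ι → Form X 1 ⊗[ℝ] L)

theorem of_pairing_sum (ξ : Module.Dual ℝ L) :
    of 1 (pairing ξ (∑ i, ((Form.wedgeₗ X 1 0).flip (T i)).rTensor L (Θ i))) =
      ∑ i, of 1 (pairing ξ (Θ i)) * of 0 (T i) := by
  rw [map_sum, map_sum]
  refine Finset.sum_congr rfl fun i _ ↦ ?_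
  rw [pairing_rTensor, of_mul_of]
  rfl

/-- A covariance identity: for central weights of sum 1, the mean of the products minus the product
of the means is half the doubly weighted mean of the products of differences. -/
theorem sum_mul_sub_sum_sum_mul {A : Type*} [Ring A] [Algebra ℝ A] (t x y : ι → A)
    (ht : ∀ i a, t i * a = a * t i) (h1 : ∑ i, t i = 1) :
    ∑ i, x i * y i * t i - (∑ i, x i * t i) * ∑ i, y i * t i =
      (1 / 2 : ℝ) • ∑ i, ∑ j, (x i - x j) * (y i - y j) * (t i * t j) := by
  have h2 : ∀ i j, (x i - x j) * (y i - y j) * (t i * t j) =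
      (x i * y i * t i * t j - x i * t i * (y j * t j)) +
        (x j * y j * t j * t i - x j * t j * (y i * t i)) := by
    intro i j
    have e1 : x i * t i * (y j * t j) = x i * y j * (t i * t j) := by
      rw [mul_assoc, ← mul_assoc (t i), ht i (y j), mul_assoc, mul_assoc]
    have e2 : x j * t j * (y i * t i) = x j * y i * (t i * t j) := by
      rw [mul_assoc, ← mul_assoc (t j), ht j (y i), mul_assoc, mul_assoc, ht j (t i)]
    rw [e1, e2, mul_assoc _ (t i), mul_assoc _ (t j), ht j (t i)]
    simp only [sub_mul, mul_sub]
    abel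
  have h3 : ∑ i, ∑ j, (x i * y i * t i * t j - x i * t i * (y j * t j)) =
      ∑ i, x i * y i * t i - (∑ i, x i * t i) * ∑ i, y i * t i := by
    simp only [Finset.sum_sub_distrib, ← Finset.mul_sum, h1, mul_one, Finset.sum_mul]
  simp only [h2, Finset.sum_add_distrib]
  rw [Finset.sum_comm (f := fun i j ↦ x j * y j * t j * t i - x j * t j * (y i * t i)), h3, ← two_smul ℝ,
    smul_smul]
  norm_num

theorem of_pairing_curvature (b : Module.Basis κ ℝ L) (ξ : Module.Dual ℝ L) (Θ : Form X 1 ⊗[ℝ] L) :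
    of 2 (pairing ξ (curvature Θ)) = d (of 1 (pairing ξ Θ)) + (1 / 2 : ℝ) • ∑ r, ∑ s, ξ ⁅b r, b s⁆ •
      (of 1 (pairing (b.coord r) Θ) * of 1 (pairing (b.coord s) Θ)) := by
  rw [pairing_curvature b, map_add, map_smul, map_sum, d_of]
  simp only [map_sum, map_smul, of_wedgeOne]

/-- The curvature of a convex combination of connections in terms of their curvatures and their
differences. -/
theorem of_pairing_curvature_sum (b : Module.Basis κ ℝ L) (ξ : Module.Dual ℝ L)
    (h1 : ∑ i, of 0 (T i) = 1) (i₀ : ι) :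
    of 2 (pairing ξ (curvature (∑ i, ((Form.wedgeₗ X 1 0).flip (T i)).rTensor L (Θ i)))) =
      ∑ i, of 2 (pairing ξ (curvature (Θ i))) * of 0 (T i) -
      ∑ i, (of 1 (pairing ξ (Θ i)) - of 1 (pairing ξ (Θ i₀))) * d (of 0 (T i)) -
      (1 / 4 : ℝ) • ∑ r, ∑ s, ξ ⁅b r, b s⁆ • ∑ i, ∑ j,
        (of 1 (pairing (b.coord r) (Θ i)) - of 1 (pairing (b.coord r) (Θ j))) *
        (of 1 (pairing (b.coord s) (Θ i)) - of 1 (pairing (b.coord s) (Θ j))) *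
        (of 0 (T i) * of 0 (T j)) := by
  -- Since `∑ dt_i = 0`, a fixed connection form may be subtracted in all terms that contain a
  -- `dt_i`.
  have hd : ∑ i, d (of 0 (T i)) = 0 := by
    rw [← map_sum, h1]
    exact (d_of _).trans ((congrArg _ (Form.d_const 1)).trans (map_zero _))
  have hT : ∀ i (a : Forms X), of 0 (T i) * a = a * of 0 (T i) := fun i a ↦
    of_mul_comm_of_even (by decide) _ _
  -- The brackets in the curvatures of the single connections average to a mean of products, the
  -- bracket of the average is a product of means; the covariance identity leaves only differences.
  have h2 : ∀ r s, ∑ i, ∑ j,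
        (of 1 (pairing (b.coord r) (Θ i)) - of 1 (pairing (b.coord r) (Θ j))) *
        (of 1 (pairing (b.coord s) (Θ i)) - of 1 (pairing (b.coord s) (Θ j))) *
        (of 0 (T i) * of 0 (T j)) = (2 : ℝ) • (∑ i, of 1 (pairing (b.coord r) (Θ i)) *
          of 1 (pairing (b.coord s) (Θ i)) * of 0 (T i) -
        (∑ i, of 1 (pairing (b.coord r) (Θ i)) * of 0 (T i)) *
          ∑ i, of 1 (pairing (b.coord s) (Θ i)) * of 0 (T i)) := by
    intro r s
    rw [sum_mul_sub_sum_sum_mul _ _ _ hT h1, smul_smul]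
    norm_num
  have h3 : ∀ i, d (of 1 (pairing ξ (Θ i)) * of 0 (T i)) =
      d (of 1 (pairing ξ (Θ i))) * of 0 (T i) - of 1 (pairing ξ (Θ i)) * d (of 0 (T i)) := by
    intro i
    rw [d_mul, sgn_of, pow_one, neg_one_smul ℝ (of 1 (pairing ξ (Θ i))), neg_mul, sub_eq_add_neg]
  have h4 : ∑ i, ((1 / 2 : ℝ) • ∑ r, ∑ s, ξ ⁅b r, b s⁆ •
        (of 1 (pairing (b.coord r) (Θ i)) * of 1 (pairing (b.coord s) (Θ i)))) * of 0 (T i) =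
      (1 / 2 : ℝ) • ∑ r, ∑ s, ξ ⁅b r, b s⁆ • ∑ i, of 1 (pairing (b.coord r) (Θ i)) *
          of 1 (pairing (b.coord s) (Θ i)) * of 0 (T i) := by
    simp only [smul_mul_assoc, Finset.sum_mul, ← Finset.smul_sum]
    congr 1
    rw [Finset.sum_comm]
    refine Finset.sum_congr rfl fun r _ ↦ ?_
    rw [Finset.sum_comm]
    refine Finset.sum_congr rfl fun s _ ↦ ?_
    rw [Finset.smul_sum]
  have h5 : ∑ i, (of 1 (pairing ξ (Θ i)) - of 1 (pairing ξ (Θ i₀))) * d (of 0 (T i)) =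
      ∑ i, of 1 (pairing ξ (Θ i)) * d (of 0 (T i)) := by
    simp only [sub_mul, Finset.sum_sub_distrib, ← Finset.mul_sum, hd, mul_zero, sub_zero]
  simp only [h2]
  rw [of_pairing_curvature b, h5, of_pairing_sum]
  have h6 := fun r ↦ of_pairing_sum T Θ (b.coord r)
  simp only [h6]
  simp only [of_pairing_curvature b, add_mul, Finset.sum_add_distrib, h4, map_sum, h3,
    Finset.sum_sub_distrib, smul_comm _ (2 : ℝ), ← Finset.smul_sum]
  simp only [smul_sub, Finset.sum_sub_distrib]
  generalize ∑ r, ∑ s, ξ ⁅b r, b s⁆ • ∑ i, of 1 (pairing (b.coord r) (Θ i)) *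
          of 1 (pairing (b.coord s) (Θ i)) * of 0 (T i) = S₁
  generalize ∑ r, ∑ s, ξ ⁅b r, b s⁆ • ((∑ i, of 1 (pairing (b.coord r) (Θ i)) * of 0 (T i)) *
          ∑ i, of 1 (pairing (b.coord s) (Θ i)) * of 0 (T i)) = S₂
  rw [smul_smul, smul_smul, show 2 * (1 / 4 : ℝ) = 1 / 2 by norm_num]
  abel

end
end CurvatureOfSum

/-! ### Products ordered along the simplex as non-commutative polynomials, uniformly in all data -/

section Universal
variable (d : ℕ) (G : Type u) [TopologicalSpace G] [ChartedSpace (Eu d) G] [Group G]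
  [LieGroup (𝓡 d) ∞ G]

/-- A principal bundle over a Lie groupoid with a pseudo-connection. -/
structure Datum where
  base : LieGroupoid.{u}
  bundle : PrincipalBundle d G base
  conn : PseudoConnection bundle

/-- The forms on the nerves of the transformation groupoids of all principal bundles with
pseudo-connections. -/
abbrev NatForm (n : ℕ) := ∀ D : Datum d G, Forms (Nerve D.bundle.transformation n)

variable {d G} {m n k l i j : ℕ}

namespace NatForm
open Forms

/-- Re-indexing of vertices. -/
def res (f : Fin (m + 1) → Fin (n + 1)) : NatForm d G m →ₐ[ℝ] NatForm d G n :=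
  AlgHom.pi fun D ↦
    (Forms.pullback (Nerve.reindex f) (Nerve.smooth_reindex f)).comp (Pi.evalAlgHom ℝ _ D)

theorem res_apply (f : Fin (m + 1) → Fin (n + 1)) (a : NatForm d G m) (D : Datum d G) :
    res f a D = Forms.pullback (Nerve.reindex f) (Nerve.smooth_reindex f) (a D) := rfl

theorem res_res (f : Fin (m + 1) → Fin (n + 1)) (g : Fin (n + 1) → Fin (l + 1)) (a : NatForm d G m) :
    res g (res f a) = res (g ∘ f) a := funext fun D ↦ by
  rw [res_apply, res_apply, res_apply, pullback_pullback]
  rfl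

theorem res_congr {f f' : Fin (m + 1) → Fin (n + 1)} (h : ∀ i, (f i : ℕ) = f' i) (a : NatForm d G m) :
    res f a = res f' a := by
  obtain rfl : f = f' := funext fun i ↦ Fin.ext (h i)
  rfl

theorem res_eq_self {f : Fin (n + 1) → Fin (n + 1)} (h : ∀ i, (f i : ℕ) = i) (a : NatForm d G n) :
    res f a = a := by
  obtain rfl : f = id := funext fun i ↦ Fin.ext (h i)
  exact funext fun D ↦ pullback_id _ smooth_id

/-- The parity automorphism. -/
def parity : NatForm d G n →ₐ[ℝ] NatForm d G n :=
  AlgHom.pi fun D ↦ Forms.parity.comp (Pi.evalAlgHom ℝ _ D)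

theorem parity_apply (a : NatForm d G n) (D : Datum d G) : parity a D = Forms.parity (a D) := rfl

theorem parity_res (f : Fin (m + 1) → Fin (n + 1)) (a : NatForm d G m) :
    parity (res f a) = res f (parity a) := funext fun _ ↦ parity_pullback _ _ _

/-- The components of the pseudo-curvature. -/
def curv (ξ : Module.Dual ℝ (LieAlg d G)) : NatForm d G 0 := fun D ↦
  of 2 (pairing ξ D.conn.pseudoCurvature)

/-- The components of the difference of the pull-backs of a pseudo-connection. -/
def bdry (ξ : Module.Dual ℝ (LieAlg d G)) : NatForm d G 1 := fun D ↦ of 1 (pairing ξ D.conn.boundary)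

/-- Exterior products of components of the difference. -/
def bdryList (S : List (Module.Dual ℝ (LieAlg d G))) : NatForm d G 1 := fun D ↦
  of S.length (wedgeList D.conn.boundary S)

theorem bdryList_nil : bdryList [] = (1 : NatForm d G 1) := rfl

theorem bdryList_cons (ξ : Module.Dual ℝ (LieAlg d G)) (S : List (Module.Dual ℝ (LieAlg d G))) :
    bdryList (ξ :: S) = bdryList S * bdry ξ := funext fun _ ↦ (of_mul_of _ _).symm

theorem parity_bdryList (S : List (Module.Dual ℝ (LieAlg d G))) :
    parity (bdryList S) = (-1 : ℝ) ^ S.length • bdryList S := funext fun _ ↦ parity_of _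

theorem parity_curv (ξ : Module.Dual ℝ (LieAlg d G)) : parity (curv ξ) = curv ξ := funext fun _ ↦
  (parity_of _).trans (by rw [neg_one_sq, one_smul]; rfl)

theorem res_curv_mul (f : Fin 1 → Fin (n + 1)) (ξ : Module.Dual ℝ (LieAlg d G)) (a : NatForm d G n) :
    res f (curv ξ) * a = a * res f (curv ξ) := funext fun D ↦ by
  rw [Pi.mul_apply, Pi.mul_apply, res_apply, curv, pullback_of]
  exact of_mul_comm_of_even even_two _ _

theorem res_bdry_mul (f : Fin 2 → Fin (n + 1)) (ξ : Module.Dual ℝ (LieAlg d G)) (a : NatForm d G n) :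
    res f (bdry ξ) * a = parity a * res f (bdry ξ) := funext fun D ↦ by
  rw [Pi.mul_apply, Pi.mul_apply, res_apply, bdry, pullback_of, parity_apply]
  exact of_one_mul _ _

variable (d G) in
/-- The polynomials in the components of the pseudo-curvature. -/
def curvAlg : Subalgebra ℝ (NatForm d G 0) := Algebra.adjoin ℝ (Set.range curv)

variable (d G) in
/-- The span of the products of components of the pseudo-curvature and of the differences, ordered
along the vertices and edges of the simplices. -/
def ordered : ∀ n, Submodule ℝ (NatForm d G n)
  | 0 => Subalgebra.toSubmodule (curvAlg d G)
  | n + 1 => Submodule.span ℝ {z | ∃ x ∈ ordered n, ∃ S, ∃ y ∈ curvAlg d G,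
      z = res (seg n (n + 1) 0) x * res (seg 1 (n + 1) n) (bdryList S) * res (seg 0 (n + 1) (n + 1)) y}

theorem mem_ordered {x : NatForm d G n} (hx : x ∈ ordered d G n)
    (S : List (Module.Dual ℝ (LieAlg d G))) {y : NatForm d G 0} (hy : y ∈ curvAlg d G) :
    res (seg n (n + 1) 0) x * res (seg 1 (n + 1) n) (bdryList S) * res (seg 0 (n + 1) (n + 1)) y ∈
      ordered d G (n + 1) := Submodule.subset_span ⟨x, hx, S, y, hy, rfl⟩

theorem ordered_induction {P : Submodule ℝ (NatForm d G (n + 1))}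
    (h : ∀ x ∈ ordered d G n, ∀ S, ∀ y ∈ curvAlg d G, res (seg n (n + 1) 0) x *
      res (seg 1 (n + 1) n) (bdryList S) * res (seg 0 (n + 1) (n + 1)) y ∈ P) :
    ordered d G (n + 1) ≤ P := Submodule.span_le.2 fun z ⟨x, hx, S, y, hy, e⟩ ↦ by
  rw [e]
  exact h x hx S y hy

theorem one_mem_ordered : 1 ∈ ordered d G n := by
  induction n with
  | zero => exact one_mem (curvAlg d G)
  | succ n ih =>
    have := mem_ordered ih [] (one_mem (curvAlg d G))
    rwa [bdryList_nil, map_one, map_one, map_one, mul_one, mul_one] at this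

theorem parity_eq_of_mem_curvAlg {y : NatForm d G 0} (h : y ∈ curvAlg d G) : parity y = y := by
  induction h using Algebra.adjoin_induction with
  | mem x hx =>
    obtain ⟨ξ, rfl⟩ := hx
    exact parity_curv ξ
  | algebraMap r => exact AlgHom.commutes _ r
  | add x y _ _ hx hy => rw [map_add, hx, hy]
  | mul x y _ _ hx hy => rw [map_mul, hx, hy]

theorem parity_mem_ordered {x : NatForm d G n} (h : x ∈ ordered d G n) : parity x ∈ ordered d G n := by
  induction n with
  | zero => rwa [parity_eq_of_mem_curvAlg h]
  | succ n ih =>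
    refine ordered_induction (P := (ordered d G (n + 1)).comap parity.toLinearMap)
      (fun x hx S y hy ↦ ?_) h
    change parity _ ∈ ordered d G (n + 1)
    rw [map_mul, map_mul, parity_res, parity_res, parity_res, parity_bdryList,
      parity_eq_of_mem_curvAlg hy, map_smul, mul_smul_comm, smul_mul_assoc]
    exact Submodule.smul_mem _ _ (mem_ordered (ih hx) S hy)

/-- The components of the pseudo-curvature at a vertex. -/
def vertexCurv (n i : ℕ) (ξ : Module.Dual ℝ (LieAlg d G)) : NatForm d G n := res (seg 0 n i) (curv ξ)

/-- The components of the difference along an edge. -/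
def edgeBdry (n i : ℕ) (ξ : Module.Dual ℝ (LieAlg d G)) : NatForm d G n := res (seg 1 n i) (bdry ξ)

theorem res_front_res_seg (a : NatForm d G k) (h : i + k ≤ n) :
    res (seg n (n + 1) 0) (res (seg k n i) a) = res (seg k (n + 1) i) a := by
  rw [res_res]
  refine res_congr (fun j ↦ ?_) a
  rw [Function.comp, val_seg (by omega), val_seg h, val_seg (by omega), zero_add]

/-- Curvature components have even degree and are central, so the new factor moves to its own
vertex: either inside the front part, by induction, or next to the factor at the last vertex. -/
theorem vertexCurv_mul_mem_ordered (ξ : Module.Dual ℝ (LieAlg d G)) (h : i ≤ n) {x : NatForm d G n}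
    (hx : x ∈ ordered d G n) : vertexCurv n i ξ * x ∈ ordered d G n := by
  induction n with
  | zero =>
    obtain rfl : i = 0 := by omega
    rw [vertexCurv, res_eq_self fun j ↦ by rw [val_seg (by omega), zero_add]]
    exact (curvAlg d G).mul_mem (Algebra.subset_adjoin ⟨ξ, rfl⟩) hx
  | succ n ih =>
    refine ordered_induction (P := (ordered d G (n + 1)).comap (LinearMap.mulLeft ℝ _))
      (fun x hx S y hy ↦ ?_) hx
    change vertexCurv (n + 1) i ξ * _ ∈ ordered d G (n + 1)
    by_cases hi : i ≤ n
    · rw [vertexCurv, ← res_front_res_seg _ (by omega), ← mul_assoc, ← mul_assoc, ← map_mul]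
      exact mem_ordered (ih hi hx) S hy
    · obtain rfl : i = n + 1 := by omega
      rw [vertexCurv, ← mul_assoc, res_curv_mul, mul_assoc, ← map_mul]
      exact mem_ordered hx S (mul_mem (Algebra.subset_adjoin ⟨ξ, rfl⟩) hy)

theorem bdry_mul_bdryList (ξ : Module.Dual ℝ (LieAlg d G)) (S : List (Module.Dual ℝ (LieAlg d G))) :
    bdry ξ * bdryList S = (-1 : ℝ) ^ S.length • bdryList (ξ :: S) := by
  have h := res_bdry_mul id ξ (bdryList S)
  rw [res_eq_self (f := id) fun _ ↦ rfl] at h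
  rw [h, parity_bdryList, bdryList_cons, smul_mul_assoc]

/-- The component is odd: it passes the factors before its edge at the cost of a parity sign, under
which ordered products are stable, and then joins the list that belongs to its edge. -/
theorem edgeBdry_mul_mem_ordered (ξ : Module.Dual ℝ (LieAlg d G)) (h : i < n) {x : NatForm d G n}
    (hx : x ∈ ordered d G n) : edgeBdry n i ξ * x ∈ ordered d G n := by
  induction n with
  | zero => omega
  | succ n ih =>
    refine ordered_induction (P := (ordered d G (n + 1)).comap (LinearMap.mulLeft ℝ _))
      (fun x hx S y hy ↦ ?_) hx
    change edgeBdry (n + 1) i ξ * _ ∈ ordered d G (n + 1)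
    by_cases hi : i < n
    · rw [edgeBdry, ← res_front_res_seg _ (by omega), ← mul_assoc, ← mul_assoc, ← map_mul]
      exact mem_ordered (ih hi hx) S hy
    · obtain rfl : i = n := by omega
      rw [edgeBdry, ← mul_assoc, ← mul_assoc, res_bdry_mul, mul_assoc (parity _), ← map_mul,
        bdry_mul_bdryList, map_smul, mul_smul_comm, smul_mul_assoc, parity_res]
      exact Submodule.smul_mem _ _ (mem_ordered (parity_mem_ordered hx) _ hy)

variable (d G) in
/-- The forms which are values of non-commutative polynomials at the total pseudo-curvature. -/
def universal (n : ℕ) : Submodule ℝ (NatForm d G n) where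
  carrier := {a | ∃ p, ∀ D : Datum d G, D.conn.evalTotal p = Total.incl n (a D)}
  zero_mem' := ⟨0, fun D ↦ (map_zero _).trans (map_zero (Total.incl n)).symm⟩
  add_mem' := by
    rintro a b ⟨p, hp⟩ ⟨q, hq⟩
    exact ⟨p + q, fun D ↦ by rw [map_add, hp, hq, Pi.add_apply, map_add]⟩
  smul_mem' := by
    rintro c a ⟨p, hp⟩
    exact ⟨c • p, fun D ↦ by rw [map_smul, hp, Pi.smul_apply, map_smul]⟩

theorem curv_mem_universal (ξ : Module.Dual ℝ (LieAlg d G)) : curv ξ ∈ universal d G 0 :=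
  ⟨FreeAlgebra.ι ℝ (Sum.inr ξ), fun _ ↦
    (FreeAlgebra.lift_ι_apply _ _).trans (Total.incl_of _).symm⟩

theorem bdryList_mem_universal (S : List (Module.Dual ℝ (LieAlg d G))) :
    bdryList S ∈ universal d G 1 :=
  ⟨FreeAlgebra.ι ℝ (Sum.inl S), fun _ ↦
    (FreeAlgebra.lift_ι_apply _ _).trans (Total.incl_of _).symm⟩

theorem mul_res_last_mem_universal {a : NatForm d G n} (ha : a ∈ universal d G n) {b : NatForm d G 0}
    (hb : b ∈ universal d G 0) : a * res (seg 0 n n) b ∈ universal d G n := by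
  obtain ⟨p, hp⟩ := ha
  obtain ⟨q, hq⟩ := hb
  refine ⟨p * q, fun D ↦ ?_⟩
  rw [map_mul, hp, hq, Total.incl_mul_incl (add_zero n), twist_zero, Pi.mul_apply, ← res_apply,
    ← res_apply, res_eq_self fun i ↦ by rw [val_seg (by omega), zero_add]]

/-- The cup product with a cochain on `Q_1` introduces the sign `(-1)^k` on `k`-forms in the first
factor. The hypothesis concerns `parity a` in order to undo it. -/
theorem res_mul_res_mem_universal {a : NatForm d G n} (ha : parity a ∈ universal d G n)
    {b : NatForm d G 1} (hb : b ∈ universal d G 1) :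
    res (seg n (n + 1) 0) a * res (seg 1 (n + 1) n) b ∈ universal d G (n + 1) := by
  obtain ⟨p, hp⟩ := ha
  obtain ⟨q, hq⟩ := hb
  refine ⟨p * q, fun D ↦ ?_⟩
  rw [map_mul, hp, hq, Total.incl_mul_incl rfl, ← parity_eq_twist, parity_apply, Forms.parity_parity]
  rfl

theorem curvAlg_le_universal {y : NatForm d G 0} (h : y ∈ curvAlg d G) : y ∈ universal d G 0 := by
  induction h using Algebra.adjoin_induction with
  | mem x hx =>
    obtain ⟨ξ, rfl⟩ := hx
    exact curv_mem_universal ξ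
  | algebraMap r =>
    rw [Algebra.algebraMap_eq_smul_one]
    exact Submodule.smul_mem _ _ ⟨1, fun D ↦ (map_one _).trans (Total.incl_of _).symm⟩
  | add x y _ _ hx hy => exact add_mem hx hy
  | mul x y _ _ hx hy =>
    have := mul_res_last_mem_universal hx hy
    rwa [res_eq_self fun i ↦ by rw [val_seg (by omega), zero_add]] at this

/-- An ordered product is a cup product of the factors at vertex 0, edge 01, vertex 1, and so on,
each of which is a value of the generators. Only the edge factors produce signs, and the parity
automorphism accounts for them. -/
theorem ordered_le_universal : ordered d G n ≤ universal d G n := by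
  induction n with
  | zero => exact fun _ h ↦ curvAlg_le_universal h
  | succ n ih =>
    refine ordered_induction fun x hx S y hy ↦ ?_
    exact mul_res_last_mem_universal (res_mul_res_mem_universal (ih (parity_mem_ordered hx))
      (bdryList_mem_universal S)) (curvAlg_le_universal hy)

end NatForm
end Universal

/-! ### The cochain map as a polynomial in the total pseudo-curvature -/

section Polynomial
variable {d : ℕ} {G : Type u} [TopologicalSpace G] [ChartedSpace (Eu d) G] [Group G]
  [LieGroup (𝓡 d) ∞ G] {m n k l i j N : ℕ}

open Forms

variable (d G) in
/-- The forms on the products of a simplex with the nerves of the transformation groupoids. -/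
abbrev SimplexForm (n : ℕ) := ∀ D : Datum d G, Forms (Eu n × Nerve D.bundle.transformation n)

theorem vpull_vpull {X Y Z L : Type*} [DiffeologicalSpace X] [DiffeologicalSpace Y]
    [DiffeologicalSpace Z] [LieRing L] [LieAlgebra ℝ L] {f : X → Y} {f' : Y → Z} (hf : DSmooth f)
    (hf' : DSmooth f') (Θ : Form Z k ⊗[ℝ] L) :
    vpull f hf (vpull f' hf' Θ) = vpull (f' ∘ f) (hf'.comp' hf) Θ := by
  induction Θ with
  | zero => simp only [map_zero]
  | tmul a x => rfl
  | add a b ha hb => simp only [map_add, ha, hb]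

theorem vpull_reindex_vertex {𝒢 : DiffGroupoid.{u}} {L : Type*} [LieRing L] [LieAlgebra ℝ L]
    (f : Fin (m + 1) → Fin (n + 1)) {i : Fin (m + 1)} {j : Fin (n + 1)} (h : f i = j)
    (Θ : Form 𝒢.Ob k ⊗[ℝ] L) :
    vpull (Nerve.reindex f) (Nerve.smooth_reindex f)
      (vpull (Nerve.vertex i) (Nerve.smooth_vertex i) Θ) =
      vpull (Nerve.vertex j) (Nerve.smooth_vertex j) Θ := by
  subst h
  exact vpull_vpull _ _ Θ

namespace SimplexForm
open NatForm

/-- In the nerve the arrow of the edge from `i` to `i + 1` has source vertex `i + 1` and target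
vertex `i`; hence the order of the difference. -/
theorem vpull_reindex_boundary {Γ : LieGroupoid.{u}} {B : PrincipalBundle d G Γ}
    (θ : PseudoConnection B) (h : i < n) :
    vpull (Nerve.reindex (seg 1 n i)) (Nerve.smooth_reindex _) θ.boundary =
      θ.onVertex ⟨i + 1, by omega⟩ - θ.onVertex ⟨i, by omega⟩ := by
  have h1 : seg 1 n i 1 = ⟨i + 1, by omega⟩ := Fin.ext (val_seg (by omega) _)
  have h0 : seg 1 n i 0 = ⟨i, by omega⟩ := Fin.ext (val_seg (by omega) _)
  exact (map_sub _ _ _).trans (congrArg₂ _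
    (vpull_reindex_vertex (𝒢 := B.transformation) _ h1 θ.form)
    (vpull_reindex_vertex (𝒢 := B.transformation) _ h0 θ.form))

theorem vpull_reindex_pseudoCurvature {Γ : LieGroupoid.{u}} {B : PrincipalBundle d G Γ}
    (θ : PseudoConnection B) (i : Fin (n + 1)) :
    vpull (Nerve.reindex (seg 0 n i)) (Nerve.smooth_reindex _) θ.pseudoCurvature =
      curvature (θ.onVertex i) :=
  (vpull_reindex_vertex _ (Fin.ext (val_seg (by omega) _)) _).trans (vpull_curvature _ _ θ.form)

/-- Pull-back of forms on the simplex. -/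
def fst (τ : Forms (Eu n)) : SimplexForm d G n := fun _ ↦ pullFst _ τ

/-- Pull-back of forms on the nerve. -/
def snd : NatForm d G n →ₐ[ℝ] SimplexForm d G n :=
  AlgHom.pi fun D ↦ (pullSnd (Eu n)).comp (Pi.evalAlgHom ℝ _ D)

theorem fst_mul (τ τ' : Forms (Eu n)) : (fst (τ * τ') : SimplexForm d G n) = fst τ * fst τ' :=
  funext fun _ ↦ map_mul _ _ _

theorem snd_vertexCurv_mul (ξ : Module.Dual ℝ (LieAlg d G)) (a : SimplexForm d G n) :
    snd (vertexCurv n i ξ) * a = a * snd (vertexCurv n i ξ) := funext fun D ↦ by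
  refine Eq.trans ?_ (of_mul_comm_of_even even_two
    (Form.pullback _ (smooth_snd _ _) (Form.pullback (Nerve.reindex (seg 0 n i)) (Nerve.smooth_reindex _)
      (pairing ξ D.conn.pseudoCurvature))) (a D) |>.trans ?_)
  · rw [← pullback_of, ← pullback_of]; rfl
  · rw [← pullback_of, ← pullback_of]; rfl

theorem snd_edgeBdry_mul (ξ : Module.Dual ℝ (LieAlg d G)) (τ : Forms (Eu n)) :
    snd (edgeBdry n i ξ) * fst τ = fst (Forms.parity τ) * snd (edgeBdry n i ξ) := funext fun D ↦ by
  have h := of_one_mul (Form.pullback _ (smooth_snd (Eu n) _)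
    (Form.pullback (Nerve.reindex (seg 1 n i)) (Nerve.smooth_reindex _) (pairing ξ D.conn.boundary)))
      (pullFst _ τ)
  rw [← pullback_of, ← pullback_of, pullFst, parity_pullback] at h
  exact h

variable (d G) in
/-- The span of the products of forms on the simplex and ordered products. -/
def ordered (n : ℕ) : Submodule ℝ (SimplexForm d G n) :=
  Submodule.span ℝ {z | ∃ τ, ∃ b ∈ NatForm.ordered d G n, z = fst τ * snd b}

theorem mem_ordered (τ : Forms (Eu n)) {b : NatForm d G n} (hb : b ∈ NatForm.ordered d G n) :
    fst τ * snd b ∈ ordered d G n := Submodule.subset_span ⟨τ, b, hb, rfl⟩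

theorem ordered_induction {P : Submodule ℝ (SimplexForm d G n)}
    (h : ∀ τ, ∀ b ∈ NatForm.ordered d G n, fst τ * snd b ∈ P) : ordered d G n ≤ P :=
  Submodule.span_le.2 fun z ⟨τ, b, hb, e⟩ ↦ by
    rw [e]
    exact h τ b hb

variable (d G) in
/-- The forms that preserve the span of the ordered products. -/
def stabilizer (n : ℕ) : Subalgebra ℝ (SimplexForm d G n) where
  carrier := {a | ∀ s ∈ ordered d G n, a * s ∈ ordered d G n}
  mul_mem' ha hb s hs := by
    rw [mul_assoc]
    exact ha _ (hb s hs)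
  add_mem' ha hb s hs := by
    rw [add_mul]
    exact add_mem (ha s hs) (hb s hs)
  algebraMap_mem' r s hs := by
    rw [Algebra.algebraMap_eq_smul_one, smul_mul_assoc, one_mul]
    exact Submodule.smul_mem _ _ hs

theorem fst_mem_stabilizer (τ : Forms (Eu n)) : fst τ ∈ stabilizer d G n := fun _ hs ↦
  ordered_induction (P := (ordered d G n).comap (LinearMap.mulLeft ℝ (fst τ))) (fun τ' b hb ↦ by
    change fst τ * _ ∈ ordered d G n
    rw [← mul_assoc, ← fst_mul]
    exact mem_ordered _ hb) hs

theorem snd_vertexCurv_mem_stabilizer (ξ : Module.Dual ℝ (LieAlg d G)) (h : i ≤ n) :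
    snd (vertexCurv n i ξ) ∈ stabilizer d G n := fun _ hs ↦
  ordered_induction (P := (ordered d G n).comap (LinearMap.mulLeft ℝ (snd (vertexCurv n i ξ))))
    (fun τ b hb ↦ by
      change snd (vertexCurv n i ξ) * _ ∈ ordered d G n
      rw [← mul_assoc, snd_vertexCurv_mul, mul_assoc, ← map_mul]
      exact mem_ordered _ (vertexCurv_mul_mem_ordered ξ h hb)) hs

theorem snd_edgeBdry_mem_stabilizer (ξ : Module.Dual ℝ (LieAlg d G)) (h : i < n) :
    snd (edgeBdry n i ξ) ∈ stabilizer d G n := fun _ hs ↦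
  ordered_induction (P := (ordered d G n).comap (LinearMap.mulLeft ℝ (snd (edgeBdry n i ξ))))
    (fun τ b hb ↦ by
      change snd (edgeBdry n i ξ) * _ ∈ ordered d G n
      rw [← mul_assoc, snd_edgeBdry_mul, mul_assoc, ← map_mul]
      exact mem_ordered _ (edgeBdry_mul_mem_ordered ξ h hb)) hs

/-- Closure of the ordered products under multiplication is not apparent, but the elements that
preserve them form an algebra by construction. As 1 is ordered, membership in this algebra suffices,
and it can be checked on generators. -/
theorem mem_ordered_of_mem_stabilizer {a : SimplexForm d G n} (h : a ∈ stabilizer d G n) :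
    a ∈ ordered d G n := by
  have h1 : (1 : SimplexForm d G n) ∈ ordered d G n := by
    have := mem_ordered (1 : Forms (Eu n)) (one_mem_ordered (d := d) (G := G) (n := n))
    rwa [map_one, mul_one, show fst 1 = (1 : SimplexForm d G n) from funext fun _ ↦ map_one _] at this
  simpa using h 1 h1

/-- Integrating a simplex form times a form on the nerve multiplies the latter by the real number
`simplexIntegral`, the same for all data; this is why the coefficients of the polynomial do not
depend on the bundle. -/
theorem fibreInt_mem_ordered {a : SimplexForm d G n} (h : a ∈ ordered d G n) :
    (fun D ↦ fibreInt n (a D)) ∈ NatForm.ordered d G n := by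
  refine ordered_induction (P := (NatForm.ordered d G n).comap
    (LinearMap.pi fun D ↦ fibreInt n ∘ₗ LinearMap.proj D)) (fun τ b hb ↦ ?_) h
  have e : (fun D ↦ fibreInt n ((fst τ * snd b : SimplexForm d G n) D)) = τ.simplexIntegral • b :=
    funext fun D ↦ by
      refine (fibreInt_mul_pullSnd (pullFst _ τ) (b D)).trans ?_
      rw [fibreInt_pullFst, Algebra.algebraMap_eq_smul_one, smul_mul_assoc, one_mul]
      rfl
  change (fun D ↦ fibreInt n ((fst τ * snd b : SimplexForm d G n) D)) ∈ NatForm.ordered d G n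
  rw [e]
  exact Submodule.smul_mem _ _ hb

/-- The components of the pull-back of the pseudo-connection along a vertex. -/
def onVertex (i : Fin (n + 1)) (ξ : Module.Dual ℝ (LieAlg d G)) : SimplexForm d G n := fun D ↦
  of 1 (pairing ξ (vpull Prod.snd (smooth_snd _ _) (D.conn.onVertex i)))

theorem onVertex_succ_sub (ξ : Module.Dual ℝ (LieAlg d G)) (h : i < n) :
    onVertex ⟨i + 1, by omega⟩ ξ - onVertex ⟨i, by omega⟩ ξ = snd (edgeBdry n i ξ) := funext fun D ↦ by
  have h1 : snd (edgeBdry n i ξ) D = of 1 (Form.pullback _ (smooth_snd (Eu n) _)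
      (Form.pullback (Nerve.reindex (seg 1 n i)) (Nerve.smooth_reindex _)
        (pairing ξ D.conn.boundary))) := by
    rw [← pullback_of, ← pullback_of]
    rfl
  rw [h1, Pi.sub_apply, onVertex, onVertex, ← map_sub, ← map_sub, ← map_sub, pairing_vpull,
    ← pairing_vpull (f := Nerve.reindex (seg 1 n i))]
  exact congrArg (fun Θ ↦ of 1 (Form.pullback _ _ (pairing ξ Θ))) (vpull_reindex_boundary D.conn h).symm

/-- The difference between two vertices telescopes along the consecutive edges, where it is the
pull-back of `∂θ`. -/
theorem onVertex_sub_mem_stabilizer (ξ : Module.Dual ℝ (LieAlg d G)) (i j : Fin (n + 1)) :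
    onVertex i ξ - onVertex j ξ ∈ stabilizer d G n := by
  have h : ∀ i (hi : i < n + 1), onVertex ⟨i, hi⟩ ξ - onVertex 0 ξ ∈ stabilizer d G n := by
    intro i
    induction i with
    | zero =>
      intro hi
      rw [show (⟨0, hi⟩ : Fin (n + 1)) = 0 from rfl, sub_self]
      exact zero_mem _
    | succ i ih =>
      intro hi
      have h1 := add_mem (snd_edgeBdry_mem_stabilizer ξ (by omega : i < n)) (ih (by omega))
      rwa [← onVertex_succ_sub ξ (by omega), sub_add_sub_cancel] at h1
  have h1 := sub_mem (h i i.2) (h j j.2)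
  rwa [sub_sub_sub_cancel_right] at h1

theorem curvature_onVertex (ξ : Module.Dual ℝ (LieAlg d G)) (i : Fin (n + 1)) (D : Datum d G) :
    of 2 (pairing ξ (curvature (vpull Prod.snd (smooth_snd (Eu n) _) (D.conn.onVertex i)))) =
      snd (vertexCurv n i ξ) D := by
  have h1 : snd (vertexCurv n i ξ) D = of 2 (Form.pullback _ (smooth_snd (Eu n) _)
      (Form.pullback (Nerve.reindex (seg 0 n i)) (Nerve.smooth_reindex _)
        (pairing ξ D.conn.pseudoCurvature))) := by
    rw [← pullback_of, ← pullback_of]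
    rfl
  rw [h1, ← vpull_curvature, pairing_vpull, ← pairing_vpull (f := Nerve.reindex (seg 0 n i))]
  exact congrArg (fun Θ ↦ of 2 (Form.pullback _ _ (pairing ξ Θ)))
    (vpull_reindex_pseudoCurvature D.conn i).symm

/-- The form `t_i` on the simplex. -/
def coordinate (i : Fin (n + 1)) : Forms (Eu n) :=
  of 0 (Form.ofFun (bary i) fun _ p ↦ (contDiff_bary i).comp (isPlot_iff_contDiff.1 p.2))

theorem fst_coordinate (i : Fin (n + 1)) (D : Datum d G) :
    (fst (coordinate i) : SimplexForm d G n) D = of 0 (baryForm _ i) := pullback_of _ _ _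

theorem fst_d_coordinate (i : Fin (n + 1)) (D : Datum d G) :
    (fst (Forms.d (coordinate i)) : SimplexForm d G n) D = Forms.d (of 0 (baryForm _ i)) :=
  (d_pullback _ _ _).symm.trans (congrArg Forms.d (fst_coordinate i D))

theorem sum_baryForm (Y : Type*) [DiffeologicalSpace Y] :
    ∑ i : Fin (n + 1), of 0 (baryForm Y i) = 1 := by
  rw [← map_sum]
  refine congrArg (of 0) (Form.ext fun m p u ↦ ?_)
  ext v
  change (Form.eval p u v) (∑ i : Fin (n + 1), baryForm Y i) = 1
  rw [map_sum]
  exact sum_bary (p.1 u).1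

/-- By `of_pairing_curvature_sum` the curvature of `∑ t_i p_i^* θ` involves only pseudo-curvatures
at the vertices, differences of the connection forms, and the forms `t_i` and `dt_i` on the simplex.
All of these lie in the stabilizer. -/
theorem curvature_mem_stabilizer (ξ : Module.Dual ℝ (LieAlg d G)) :
    (fun D ↦ of 2 (pairing ξ (curvature (D.conn.extended n)))) ∈ stabilizer d G n := by
  let b := Module.finBasis ℝ (LieAlg d G)
  have h : (fun D ↦ of 2 (pairing ξ (curvature (D.conn.extended n)))) =
      ∑ i : Fin (n + 1), snd (vertexCurv n i ξ) * fst (coordinate i) -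
      ∑ i : Fin (n + 1), (onVertex i ξ - onVertex 0 ξ) * fst (Forms.d (coordinate i)) -
      (1 / 4 : ℝ) • ∑ r, ∑ s, ξ ⁅b r, b s⁆ • ∑ i : Fin (n + 1), ∑ j : Fin (n + 1),
        (onVertex i (b.coord r) - onVertex j (b.coord r)) *
        (onVertex i (b.coord s) - onVertex j (b.coord s)) *
        ((fst (coordinate i) : SimplexForm d G n) * fst (coordinate j)) := by
    funext D
    simp only [Pi.sub_apply, Finset.sum_apply, Pi.mul_apply, Pi.smul_apply, fst_coordinate,
      fst_d_coordinate, ← curvature_onVertex]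
    exact of_pairing_curvature_sum (fun i ↦ baryForm _ i)
      (fun i ↦ vpull Prod.snd (smooth_snd _ _) (D.conn.onVertex i)) b ξ (sum_baryForm _) 0
  rw [h]
  have h2 := onVertex_sub_mem_stabilizer (d := d) (G := G) (n := n)
  refine sub_mem (sub_mem (sum_mem fun i _ ↦ ?_) (sum_mem fun i _ ↦ ?_))
    (Subalgebra.smul_mem _ (sum_mem fun r _ ↦ sum_mem fun s _ ↦ Subalgebra.smul_mem _
      (sum_mem fun i _ ↦ sum_mem fun j _ ↦ ?_) _) _)
  · exact mul_mem (snd_vertexCurv_mem_stabilizer ξ (by omega)) (fst_mem_stabilizer _)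
  · exact mul_mem (h2 _ _ _) (fst_mem_stabilizer _)
  · exact mul_mem (mul_mem (h2 _ _ _) (h2 _ _ _))
      (mul_mem (fst_mem_stabilizer _) (fst_mem_stabilizer _))

theorem polyEval_mem_stabilizer (F : SymmetricAlgebra ℝ (Module.Dual ℝ (LieAlg d G))) :
    (fun D ↦ polyEval (curvature (D.conn.extended n)) F) ∈ stabilizer d G n := by
  induction F using SymmetricAlgebra.induction with
  | algebraMap r =>
    simp only [AlgHom.commutes]
    exact (stabilizer d G n).algebraMap_mem r
  | ι ξ =>
    simp only [polyEval_ι]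
    exact curvature_mem_stabilizer ξ
  | mul a b ha hb =>
    simp only [map_mul]
    exact mul_mem ha hb
  | add a b ha hb =>
    simp only [map_add]
    exact add_mem ha hb

end SimplexForm

/-- The cochain map is a non-commutative polynomial in the total pseudo-curvature. -/
theorem exists_evalTotal_eq (f : InvPoly d G) :
    ∃ p, ∀ D : Datum d G, D.bundle.toBase.pull (D.conn.cochainMap f).1 = D.conn.evalTotal p := by
  have h : ∀ n, ∃ p, ∀ D : Datum d G, D.conn.evalTotal p =
      Total.incl n (fibreInt n (polyEval (curvature (D.conn.extended n)) f.1)) := fun n ↦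
    NatForm.ordered_le_universal (SimplexForm.fibreInt_mem_ordered
      (SimplexForm.mem_ordered_of_mem_stabilizer (SimplexForm.polyEval_mem_stabilizer f.1)))
  choose p hp using h
  -- The bound `N` depends on `f` only. Levels from `N` on contribute nothing, so one finite sum of
  -- the polynomials `p n` serves for all data.
  obtain ⟨N, hN⟩ := exists_polyEval_mem_degLT.{u} f.1
  refine ⟨∑ n ∈ Finset.range N, p n, fun D ↦ ?_⟩
  have h0 : ∀ n, N ≤ n → fibreInt n (polyEval (curvature (D.conn.extended n)) f.1) = 0 := fun n hn ↦
    fibreInt_eq_zero (hN _ _) hn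
  rw [map_sum, Finset.sum_congr rfl fun n _ ↦ hp n D, ← Total.assemble_eq_sum h0]
  refine Total.ext_comp fun n k ↦ ?_
  rw [PseudoConnection.comp_pull_cochainMap, Total.comp_assemble h0, comp_fibreInt]

end Polynomial

end ChernWeil
end

theorem theoremA (d : ℕ) (G : Type u) [TopologicalSpace G] [ChartedSpace (Eu d) G] [Group G]
    [LieGroup (𝓡 d) ∞ G] :
    -- the cochain map exists, and induces an algebra homomorphism in cohomology
    -- that does not depend on the pseudo-connection
    (∀ (Γ : LieGroupoid.{u}) (B : PrincipalBundle d G Γ),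
      (∀ θ : PseudoConnection B, ∃! z : InvPoly d G →ₗ[ℝ] Cocycle Γ.toDiff, θ.IsCochainMap z) ∧
      (∀ (θ : PseudoConnection B) (z : InvPoly d G →ₗ[ℝ] Cocycle Γ.toDiff), θ.IsCochainMap z →
        ∃ w : InvPoly d G →ₐ[ℝ] Cohomology Γ.toDiff, ∀ f, w f = cls (z f)) ∧
      (∀ w w' : InvPoly d G →ₐ[ℝ] Cohomology Γ.toDiff,
        IsChernWeilMap B w → IsChernWeilMap B w' → w = w')) ∧
    -- the cochain map is determined by the total pseudo-curvature
    (∀ f : InvPoly d G,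
      ∃ p : FreeAlgebra ℝ (List (Module.Dual ℝ (LieAlg d G)) ⊕ Module.Dual ℝ (LieAlg d G)),
        ∀ (Γ : LieGroupoid.{u}) (B : PrincipalBundle d G Γ) (θ : PseudoConnection B)
          (z : InvPoly d G →ₗ[ℝ] Cocycle Γ.toDiff), θ.IsCochainMap z →
            B.toBase.pull (z f).1 = θ.evalTotal p) ∧
    -- naturality under strict homomorphisms
    (∀ (Γ Γ' : LieGroupoid.{u}) (φ : LieGroupoid.Hom Γ' Γ) (B : PrincipalBundle d G Γ),
      (∀ (θ : PseudoConnection B) (z : InvPoly d G →ₗ[ℝ] Cocycle Γ.toDiff), θ.IsCochainMap z →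
        (θ.pullback φ).IsCochainMap (φ.toStrict.pullCocycle.toLinearMap ∘ₗ z)) ∧
      (∀ (w : InvPoly d G →ₐ[ℝ] Cohomology Γ.toDiff) (w' : InvPoly d G →ₐ[ℝ] Cohomology Γ'.toDiff),
        IsChernWeilMap B w → IsChernWeilMap (B.pullback φ) w' →
          w' = φ.toStrict.pullCohomology.comp w)) := by
  refine ⟨fun Γ B ↦ ⟨fun θ ↦ ⟨θ.cochainMap, θ.isCochainMap_cochainMap, fun z hz ↦ hz.eq⟩,
    fun θ z hz ↦ ⟨θ.chernWeil, fun f ↦ by rw [hz.eq]; rfl⟩, fun w w' hw hw' ↦ ?_⟩, fun f ↦ ?_,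
    fun Γ Γ' φ B ↦ ⟨fun θ z hz ↦ ?_, fun w w' hw hw' ↦ ?_⟩⟩
  -- A pseudo-connection is supplied by the hypothesis on `w`; both maps are compared with the
  -- Chern–Weil homomorphism it defines.
  · obtain ⟨θ, z, hz, h⟩ := hw
    exact (IsChernWeilMap.eq ⟨θ, z, hz, h⟩ θ).trans (hw'.eq θ).symm
  · obtain ⟨p, hp⟩ := exists_evalTotal_eq f
    exact ⟨p, fun Γ B θ z hz ↦ by rw [hz.eq]; exact hp ⟨Γ, B, θ⟩⟩
  · rw [hz.eq]
    exact θ.isCochainMap_pullback φ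
  · obtain ⟨θ, z, hz, h⟩ := hw
    -- The map `w'` may come from any pseudo-connection on the pull-back bundle. By independence it
    -- can be computed with the pull-back of the one that defines `w`.
    have hz' := θ.isCochainMap_pullback φ
    rw [hw'.eq (θ.pullback φ)]
    refine AlgHom.ext fun f ↦ ?_
    rw [AlgHom.comp_apply, h, hz.eq, PseudoConnection.chernWeil_apply, ← hz'.eq]
    rfl
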